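/- **Setting.** Stabilizer gates are the Clifford gates $\mathrm S,\mathrm H,\mathrm{CX}$ and 0,1-measurements of single qubits, post-selected on a given outcome (acting as the linear, unnormalized projection on that outcome). A stabilizer circuit is a finite sequence of stabilizer gates. An implementation of a unitary gate $U$ on $n$ qubits consists of a number $a$ of ancillas, a stabilizer circuit $C_0$ on $n+a$ qubits, and a list $(c_1,C_1),\dots,(c_k,C_k)$ of complex numbers $c_i$ and stabilizer circuits $C_i$ on the $a$ ancillas, such that, with the magic state $|U\rangle=\sum_{i=1}^k c_iC_i|0^a\rangle$, there is a real $\theta$ with $C_0(|\psi\rangle\otimes|U\rangle)=e^{i\theta}(U|\psi\rangle)\otimes|0^a\rangle$ for all $|\psi\rangle$. An implementation strategy $f$ assigns such an implementation $f(U)$ to each gate $U$. Write $\chi_f(U)=k$, and $\mu_f(U)=|C_0|+\max_{i}|C_i|$ for its number of gates ($|\cdot|$ is the number of gates of a circuit). The machine is a random access machine with a fixed number of word registers, growable arrays of words, a fixed number of complex registers with exact arithmetic (the constants $0,1,i,1/\sqrt2$, addition, multiplication, conjugation, no tests), and pointers into a read-only input of linked records. Every instruction takes unit time, and words have $O(\log(\text{input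 size}))$ bits, respectively $O(\log(\text{input size}\cdot P))$ bits when $P$ threads are run. Space is the number of bits of the words in registers and arrays (plus one per array cell), apart from the fixed number of complex registers and input pointers. Threads have private memory, know their number and $P$, and are synchronized; in one communication step each thread may read one complex register of one other thread, and between communication steps the slowest thread determines the time. **Theorem.** There are a fixed program and a fixed parallel program with the following property. For every constant $A$ there is a constant $K$ (which the $O(\cdot)$ on word lengths also refers to) such that for all $n,m\ge1$, every circuit $C$ on $n$ qubits with $m$ gates in total, consisting of stabilizer gates and of further unitary gates $U_1,\dots,U_t$, every implementation strategy $f$ that uses at most $An$ ancillas for each $U_j$, and every $x\in\{0,1\}^n$, the following holds with $\chi=\prod_{j=1}^t\chi_f(U_j)$ and $\mu=\max_j\mu_f(U_j)$ (and $\mu=0$ if $t=0$). Given $n$, $x$, and $C$ with each $U_j$ described by $f(U_j)$: 1. The program computes $|\langle x|C|0^n\rangle|^2$ in time at most $K\chi n^2(m+t\mu)$ and in space at most $K(\log_2\chi+n^2)$ bits. 2. The parallel program, run on $\chi$ threads, computes $|\langle x|C|0^n\rangle|^2$ in parallel time at most $K(\log_2\chi+n^2(m+t\mu))$, which is at most $Kn^2(m+t\mu)$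 if $\chi_f(U_j)\le2^{An}$ for all $j$. If $C$ contains no measurements, $|\langle x|C|0^n\rangle|^2$ is the probability of observing $x$; otherwise it is the probability that the measurements in $C$ have their prescribed outcomes and that $x$ is then observed. -/

import Mathlib

namespace QSim

/-! # Quantum states, stabilizer circuits, implementations -/

/-- A (not necessarily normalized) vector on the qubits `ι`: amplitudes of the basis states. -/
abbrev State (ι : Type) : Type := (ι → Bool) → ℂ

/-- The all-zeros basis state. -/
noncomputable def ket0 (ι : Type) [Fintype ι] : State ι :=
  fun x => if x = (fun _ => false) then 1 else 0

/-- The product state `ψ ⊗ φ`. -/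
noncomputable def tensor {ι κ : Type} (ψ : State ι) (φ : State κ) : State (ι ⊕ κ) :=
  fun z => ψ (fun i => z (Sum.inl i)) * φ (fun j => z (Sum.inr j))

/-- Stabilizer gates on the qubits `ι`: the Clifford gates `S`, `H`, `CX` (control first), and the
measurement of a qubit in the 0,1-basis, post-selected on a given outcome. -/
inductive Gate (ι : Type) : Type
  | S (q : ι) : Gate ι
  | H (q : ι) : Gate ι
  | CX (c t : ι) (hne : c ≠ t) : Gate ι
  | meas (q : ι) (b : Bool) : Gate ι

/-- The action of a stabilizer gate. A post-selected measurement is the (linear) projection on the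
given outcome, so squared norms record the probability of the outcomes. -/
noncomputable def Gate.apply {ι : Type} [DecidableEq ι] : Gate ι → State ι → State ι
  | .S q, ψ => fun x => (if x q then Complex.I else 1) * ψ x
  | .H q, ψ => fun x => ((1 / Real.sqrt 2 : ℝ) : ℂ) *
      (ψ (Function.update x q false) + (if x q then -1 else 1) * ψ (Function.update x q true))
  | .CX c t _, ψ => fun x => ψ (Function.update x t (xor (x t) (x c)))
  | .meas q b, ψ => fun x => if x q = b then ψ x else 0

/-- A stabilizer circuit, first gate first. -/
abbrev StabCircuit (ι : Type) : Type := List (Gate ι)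

/-- The action of a stabilizer circuit. -/
noncomputable def StabCircuit.run {ι : Type} [DecidableEq ι] (C : StabCircuit ι) (ψ : State ι) :
    State ι :=
  C.foldl (fun φ g => g.apply φ) ψ

/-- A gate on `n` qubits: a unitary matrix of size `2 ^ n`. -/
abbrev Unitary (n : ℕ) : Type := Matrix.unitaryGroup (Fin n → Bool) ℂ

/-- What an implementation strategy assigns to a gate on `n` qubits: a number of ancillas, a
stabilizer circuit on the `n` qubits and the ancillas, and a stabilizer decomposition of a magic
state on the ancillas, as a list of coefficients and stabilizer circuits. -/
structure Impl (n : ℕ) : Type where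
  anc : ℕ
  circ : StabCircuit (Fin n ⊕ Fin anc)
  rank : ℕ
  coeff : Fin rank → ℂ
  prep : Fin rank → StabCircuit (Fin anc)

/-- The magic state `∑ j, c_j C_j |0…0⟩`. -/
noncomputable def Impl.magic {n : ℕ} (F : Impl n) : State (Fin F.anc) :=
  fun y => ∑ j, F.coeff j * (F.prep j).run (ket0 (Fin F.anc)) y

/-- The number of gates of an implementation: those of its stabilizer circuit, and those of the
longest of the circuits of its decomposition (one of them is run in each term). -/
def Impl.gates {n : ℕ} (F : Impl n) : ℕ :=
  F.circ.length + Finset.univ.sup (fun j => (F.prep j).length)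

/-- `C_0 (|ψ⟩ ⊗ |U⟩) = e^{iθ} (U |ψ⟩) ⊗ |0…0⟩` for all `ψ`, with a fixed real `θ`. -/
def Impl.Implements {n : ℕ} (F : Impl n) (U : Unitary n) : Prop :=
  ∃ θ : ℝ, ∀ ψ : State (Fin n),
    F.circ.run (tensor ψ F.magic) =
      fun z => Complex.exp (θ * Complex.I) * tensor (U.1.mulVec ψ) (ket0 (Fin F.anc)) z

/-- A gate of the circuit to be simulated: a stabilizer gate, or a further unitary gate. -/
inductive Item (n : ℕ) : Type
  | stab (g : Gate (Fin n)) : Item n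
  | high (U : Unitary n) : Item n

/-- The action of a gate of the circuit to be simulated. -/
noncomputable def Item.apply {n : ℕ} : Item n → State (Fin n) → State (Fin n)
  | .stab g, ψ => g.apply ψ
  | .high U, ψ => U.1.mulVec ψ

/-- A circuit on `n` qubits, first gate first. -/
abbrev Circuit (n : ℕ) : Type := List (Item n)

/-- The action of a circuit. -/
noncomputable def Circuit.run {n : ℕ} (C : Circuit n) (ψ : State (Fin n)) : State (Fin n) :=
  C.foldl (fun φ g => g.apply φ) ψ

/-- `|⟨x|C|0^n⟩|²`. -/
noncomputable def Circuit.prob {n : ℕ} (C : Circuit n) (x : Fin n → Bool) : ℝ :=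
  ‖C.run (ket0 (Fin n)) x‖ ^ 2

/-- The unitary of a gate that is not given as a stabilizer gate. -/
def Item.high? {n : ℕ} : Item n → Option (Unitary n)
  | .stab _ => none
  | .high U => some U

/-- The gates `U_1, …, U_t` of a circuit, with repetitions. -/
def Circuit.highGates {n : ℕ} (C : Circuit n) : List (Unitary n) := C.filterMap Item.high?

/-- `χ = ∏ j, χ_f(U_j)`. -/
def Circuit.chi {n : ℕ} (C : Circuit n) (f : Unitary n → Impl n) : ℕ :=
  (C.highGates.map (fun U => (f U).rank)).prod

/-- `μ = max_j μ_f(U_j)` (and `0` if there is no `U_j`). -/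
def Circuit.mu {n : ℕ} (C : Circuit n) (f : Unitary n → Impl n) : ℕ :=
  (C.highGates.map (fun U => (f U).gates)).foldr max 0

/-- `n² (m + t μ)`. -/
def Circuit.cost {n : ℕ} (C : Circuit n) (f : Unitary n → Impl n) : ℕ :=
  n ^ 2 * (C.length + C.highGates.length * C.mu f)

/-! # Inputs: rooted trees of records -/

/-- Read-only inputs: a record holds a word, a complex number, and an array of links to further
records. -/
inductive Tree : Type
  | node (word : ℕ) (coeff : ℂ) (arity : ℕ) (kids : Fin arity → Tree) : Tree

namespace Tree

def word : Tree → ℕ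
  | node a _ _ _ => a

def coeff : Tree → ℂ
  | node _ c _ _ => c

def arity : Tree → ℕ
  | node _ _ k _ => k

/-- The record at the end of link number `i`, if there is one. -/
def child : Tree → ℕ → Option Tree
  | node _ _ k kids, i => if h : i < k then some (kids ⟨i, h⟩) else none

/-- The number of records. -/
def size : Tree → ℕ
  | node _ _ _ kids => 1 + ∑ i, (kids i).size

/-- A record without links. -/
noncomputable def leaf (a : ℕ) : Tree := node a 0 0 Fin.elim0

/-- A linked list. -/
noncomputable def ofList : List Tree → Tree
  | [] => leaf 0
  | a :: l => node 1 0 2 ![a, ofList l]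

end Tree

/-- The record of a stabilizer gate, for a numbering of the qubits. -/
noncomputable def Gate.toTree {ι : Type} (num : ι → ℕ) : Gate ι → Tree
  | .S q => .node 0 0 1 ![.leaf (num q)]
  | .H q => .node 1 0 1 ![.leaf (num q)]
  | .CX c t _ => .node 2 0 2 ![.leaf (num c), .leaf (num t)]
  | .meas q b => .node 3 0 2 ![.leaf (num q), .leaf b.toNat]

/-- A stabilizer circuit as a linked list of gates. -/
noncomputable def StabCircuit.toTree {ι : Type} (num : ι → ℕ) (C : StabCircuit ι) : Tree :=
  Tree.ofList (C.map (Gate.toTree num))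

/-- The record of an implementation: its number of ancillas, its circuit, and the array of the
coefficients and circuits of its decomposition. Ancilla number `j` is qubit number `n + j`. -/
noncomputable def Impl.toTree {n : ℕ} (F : Impl n) : Tree :=
  .node F.anc 0 2
    ![StabCircuit.toTree (Sum.elim (fun i : Fin n => (i : ℕ)) (fun j : Fin F.anc => n + (j : ℕ))) F.circ,
      .node 0 0 F.rank (fun j =>
        .node 0 (F.coeff j) 1 ![StabCircuit.toTree (fun i : Fin F.anc => n + (i : ℕ)) (F.prep j)])]

/-- The record of a gate of the circuit to be simulated: a gate `U` is given by `f U`. -/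
noncomputable def Item.toTree {n : ℕ} (f : Unitary n → Impl n) : Item n → Tree
  | .stab g => g.toTree (fun i : Fin n => (i : ℕ))
  | .high U => .node 4 0 1 ![(f U).toTree]

/-- The whole input: `n`, the outcome `x`, and the circuit, as linked lists. -/
noncomputable def inputTree {n : ℕ} (f : Unitary n → Impl n) (C : Circuit n) (x : Fin n → Bool) :
    Tree :=
  .node n 0 2 ![Tree.ofList (List.ofFn (fun i => Tree.leaf (x i).toNat)),
    Tree.ofList (C.map (Item.toTree f))]

/-! # The machine

A random access machine with a fixed number of word registers, of growable work arrays of words, of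
complex registers with exact arithmetic, and of pointers into the read-only input. Every
instruction takes one unit of time. Words have `w` bits; an overflow, an access out of bounds or a
missing link is a fault, after which there is no execution. There is no test on complex numbers. -/

/-- The numbers of word registers, work arrays, pointers, and complex registers, the first two
word registers and the first complex register being always there. -/
structure Arch : Type where
  regs : ℕ
  arrs : ℕ
  ptrs : ℕ
  cregs : ℕ

/-- The contents of the memory. -/
structure Store (a : Arch) : Type where
  reg : Fin (a.regs + 2) → ℕ
  arr : Fin a.arrs → List ℕ
  ptr : Fin a.ptrs → Tree
  creg : Fin (a.cregs + 1) → ℂ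

/-- Work space in bits: the lengths of the words in registers and arrays, plus one per array cell.
The pointers into the input and the fixed number of complex registers are not counted. -/
def Store.space {a : Arch} (σ : Store a) : ℕ :=
  (∑ r, (σ.reg r).size) + ∑ s, ((σ.arr s).map (fun v => 1 + v.size)).sum

/-- The initial memory of thread number `id` of `P`. -/
def Store.init (a : Arch) (inp : Tree) (id P : ℕ) : Store a where
  reg := fun r => if r = 0 then id else if r = 1 then P else 0
  arr := fun _ => []
  ptr := fun _ => inp
  creg := fun _ => 0

/-- Operations on words. -/
inductive BinOp : Type
  | add | sub | mul | div | mod | lt | eq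

/-- Subtraction is truncated at `0`; comparisons give `1` or `0`. -/
def BinOp.eval : BinOp → ℕ → ℕ → ℕ
  | .add, u, v => u + v
  | .sub, u, v => u - v
  | .mul, u, v => u * v
  | .div, u, v => u / v
  | .mod, u, v => u % v
  | .lt, u, v => if u < v then 1 else 0
  | .eq, u, v => if u = v then 1 else 0

/-- Complex constants. -/
inductive CConst : Type
  | zero | one | i | invSqrtTwo

noncomputable def CConst.val : CConst → ℂ
  | .zero => 0
  | .one => 1
  | .i => Complex.I
  | .invSqrtTwo => ((1 / Real.sqrt 2 : ℝ) : ℂ)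

/-- Instructions; the destination comes first. -/
inductive Instr (a : Arch) : Type
  | const (d : Fin (a.regs + 2)) (k : ℕ)
  | op (o : BinOp) (d u v : Fin (a.regs + 2))
  | len (d : Fin (a.regs + 2)) (s : Fin a.arrs)
  | load (d : Fin (a.regs + 2)) (s : Fin a.arrs) (i : Fin (a.regs + 2))
  | store (s : Fin a.arrs) (i v : Fin (a.regs + 2))
  | push (s : Fin a.arrs) (v : Fin (a.regs + 2))
  | pop (s : Fin a.arrs)
  | root (p : Fin a.ptrs)
  | move (p q : Fin a.ptrs)
  | child (p q : Fin a.ptrs) (i : Fin (a.regs + 2))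
  | word (d : Fin (a.regs + 2)) (p : Fin a.ptrs)
  | arity (d : Fin (a.regs + 2)) (p : Fin a.ptrs)
  | coeff (z : Fin (a.cregs + 1)) (p : Fin a.ptrs)
  | cconst (z : Fin (a.cregs + 1)) (k : CConst)
  | cadd (z u v : Fin (a.cregs + 1))
  | cmul (z u v : Fin (a.cregs + 1))
  | cconj (z u : Fin (a.cregs + 1))

namespace Store

variable {a : Arch}

/-- Writing a word to a register; a fault if it has more than `w` bits. -/
def setReg (w : ℕ) (σ : Store a) (d : Fin (a.regs + 2)) (v : ℕ) : Option (Store a) :=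
  if v < 2 ^ w then some { σ with reg := Function.update σ.reg d v } else none

def setArr (σ : Store a) (s : Fin a.arrs) (l : List ℕ) : Store a :=
  { σ with arr := Function.update σ.arr s l }

def setPtr (σ : Store a) (p : Fin a.ptrs) (t : Tree) : Store a :=
  { σ with ptr := Function.update σ.ptr p t }

def setCreg (σ : Store a) (z : Fin (a.cregs + 1)) (c : ℂ) : Store a :=
  { σ with creg := Function.update σ.creg z c }

end Store

/-- The effect of an instruction on a machine with words of `w` bits and input `inp`. -/
noncomputable def Instr.exec {a : Arch} (w : ℕ) (inp : Tree) : Instr a → Store a → Option (Store a)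
  | .const d k, σ => σ.setReg w d k
  | .op o d u v, σ => σ.setReg w d (o.eval (σ.reg u) (σ.reg v))
  | .len d s, σ => σ.setReg w d (σ.arr s).length
  | .load d s i, σ => ((σ.arr s)[σ.reg i]?).bind (fun v => σ.setReg w d v)
  | .store s i v, σ =>
      if σ.reg i < (σ.arr s).length then
        some (σ.setArr s ((σ.arr s).set (σ.reg i) (σ.reg v))) else none
  | .push s v, σ => some (σ.setArr s (σ.arr s ++ [σ.reg v]))
  | .pop s, σ => some (σ.setArr s (σ.arr s).dropLast)
  | .root p, σ => some (σ.setPtr p inp)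
  | .move p q, σ => some (σ.setPtr p (σ.ptr q))
  | .child p q i, σ => ((σ.ptr q).child (σ.reg i)).map (fun t => σ.setPtr p t)
  | .word d p, σ => σ.setReg w d (σ.ptr p).word
  | .arity d p, σ => σ.setReg w d (σ.ptr p).arity
  | .coeff z p, σ => some (σ.setCreg z (σ.ptr p).coeff)
  | .cconst z k, σ => some (σ.setCreg z k.val)
  | .cadd z u v, σ => some (σ.setCreg z (σ.creg u + σ.creg v))
  | .cmul z u v, σ => some (σ.setCreg z (σ.creg u * σ.creg v))
  | .cconj z u, σ => some (σ.setCreg z (starRingEnd ℂ (σ.creg u)))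

/-- Programs of one thread; tests ask whether a register is nonzero. -/
inductive Code (a : Arch) : Type
  | skip : Code a
  | instr (i : Instr a) : Code a
  | seq (c₁ c₂ : Code a) : Code a
  | ite (r : Fin (a.regs + 2)) (c₁ c₂ : Code a) : Code a
  | loop (r : Fin (a.regs + 2)) (c : Code a) : Code a

/-- `Exec w inp c σ τ T S`: started in memory `σ`, the program `c` halts in memory `τ`, after `T`
steps, and `S` is the largest work space on the way. -/
inductive Exec {a : Arch} (w : ℕ) (inp : Tree) :
    Code a → Store a → Store a → ℕ → ℕ → Prop
  | skip (σ : Store a) : Exec w inp .skip σ σ 1 σ.space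
  | instr (i : Instr a) (σ τ : Store a) (h : i.exec w inp σ = some τ) :
      Exec w inp (.instr i) σ τ 1 (max σ.space τ.space)
  | seq (c₁ c₂ : Code a) (σ ρ τ : Store a) (T₁ T₂ S₁ S₂ : ℕ)
      (h₁ : Exec w inp c₁ σ ρ T₁ S₁) (h₂ : Exec w inp c₂ ρ τ T₂ S₂) :
      Exec w inp (.seq c₁ c₂) σ τ (T₁ + T₂) (max S₁ S₂)
  | iteTrue (r : Fin (a.regs + 2)) (c₁ c₂ : Code a) (σ τ : Store a) (T S : ℕ)
      (hr : σ.reg r ≠ 0) (h : Exec w inp c₁ σ τ T S) :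
      Exec w inp (.ite r c₁ c₂) σ τ (T + 1) S
  | iteFalse (r : Fin (a.regs + 2)) (c₁ c₂ : Code a) (σ τ : Store a) (T S : ℕ)
      (hr : σ.reg r = 0) (h : Exec w inp c₂ σ τ T S) :
      Exec w inp (.ite r c₁ c₂) σ τ (T + 1) S
  | loopStop (r : Fin (a.regs + 2)) (c : Code a) (σ : Store a) (hr : σ.reg r = 0) :
      Exec w inp (.loop r c) σ σ 1 σ.space
  | loopStep (r : Fin (a.regs + 2)) (c : Code a) (σ ρ τ : Store a) (T₁ T₂ S₁ S₂ : ℕ)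
      (hr : σ.reg r ≠ 0) (h₁ : Exec w inp c σ ρ T₁ S₁)
      (h₂ : Exec w inp (.loop r c) ρ τ T₂ S₂) :
      Exec w inp (.loop r c) σ τ (T₁ + T₂ + 1) (max S₁ S₂)

/-! # Parallel machine: synchronized threads with private memory -/

/-- Programs run by all threads. In `gather src d z`, every thread reads the complex register `z` of
the thread whose number is in its own register `src` into its own complex register `d` (nothing
happens in a thread for which there is no such thread). Loops are controlled by thread `0`. -/
inductive Par (a : Arch) : Type
  | compute (c : Code a) : Par a
  | gather (src : Fin (a.regs + 2)) (d z : Fin (a.cregs + 1)) : Par a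
  | seq (p₁ p₂ : Par a) : Par a
  | loop (r : Fin (a.regs + 2)) (p : Par a) : Par a

/-- The effect of `gather`. -/
def gatherStore {a : Arch} {P : ℕ} (src : Fin (a.regs + 2)) (d z : Fin (a.cregs + 1))
    (σ : Fin P → Store a) : Fin P → Store a :=
  fun i => if h : (σ i).reg src < P then (σ i).setCreg d ((σ ⟨(σ i).reg src, h⟩).creg z) else σ i

/-- `ParExec w inp p σ τ T`: `P` threads started in memories `σ` all halt in memories `τ`, after
parallel time `T`; between communications, the slowest thread determines the time. -/
inductive ParExec {a : Arch} {P : ℕ} (w : ℕ) (inp : Tree) :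
    Par a → (Fin P → Store a) → (Fin P → Store a) → ℕ → Prop
  | compute (c : Code a) (σ τ : Fin P → Store a) (T S : Fin P → ℕ)
      (h : ∀ i, Exec w inp c (σ i) (τ i) (T i) (S i)) :
      ParExec w inp (.compute c) σ τ (Finset.univ.sup T)
  | gather (src : Fin (a.regs + 2)) (d z : Fin (a.cregs + 1)) (σ : Fin P → Store a) :
      ParExec w inp (.gather src d z) σ (gatherStore src d z σ) 1
  | seq (p₁ p₂ : Par a) (σ ρ τ : Fin P → Store a) (T₁ T₂ : ℕ)
      (h₁ : ParExec w inp p₁ σ ρ T₁) (h₂ : ParExec w inp p₂ ρ τ T₂) :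
      ParExec w inp (.seq p₁ p₂) σ τ (T₁ + T₂)
  | loopStop (r : Fin (a.regs + 2)) (p : Par a) (σ : Fin P → Store a) (hP : 0 < P)
      (hr : (σ ⟨0, hP⟩).reg r = 0) :
      ParExec w inp (.loop r p) σ σ 1
  | loopStep (r : Fin (a.regs + 2)) (p : Par a) (σ ρ τ : Fin P → Store a) (T₁ T₂ : ℕ) (hP : 0 < P)
      (hr : (σ ⟨0, hP⟩).reg r ≠ 0) (h₁ : ParExec w inp p σ ρ T₁)
      (h₂ : ParExec w inp (.loop r p) ρ τ T₂) :
      ParExec w inp (.loop r p) σ τ (T₁ + T₂ + 1)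

/-- The program `c`, run by one thread, halts on input `inp` with output `y` in its first complex
register, after at most `T` steps and in work space at most `S` bits. -/
def Computes {a : Arch} (c : Code a) (w : ℕ) (inp : Tree) (y : ℂ) (T S : ℕ) : Prop :=
  ∃ (τ : Store a) (T' S' : ℕ), Exec w inp c (Store.init a inp 0 1) τ T' S' ∧
    τ.creg 0 = y ∧ T' ≤ T ∧ S' ≤ S

/-- The program `p`, run by `P` threads, halts on input `inp` with output `y` in the first complex
register of thread `0`, after parallel time at most `T`. -/
def ParComputes {a : Arch} (p : Par a) (P w : ℕ) (inp : Tree) (y : ℂ) (T : ℕ) : Prop :=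
  ∃ (hP : 0 < P) (τ : Fin P → Store a) (T' : ℕ),
    ParExec w inp p (fun i : Fin P => Store.init a inp i P) τ T' ∧
    (τ ⟨0, hP⟩).creg 0 = y ∧ T' ≤ T

end QSim

namespace QSim

/-! # Named registers, expressions, and a calculus of executions -/

/-! Replace every magic state by its decomposition and multiply out. By linearity, `C|0^n⟩` is up to
a global phase a sum of `χ` terms, each obtained from a basis state by stabilizer gates, projections
on ancilla values and scalar factors. Every term is a multiple of a stabilizer state, which can be
updated with its exact scalar in O(n²) steps per gate and read off at `x` in O(n²) steps. The sum of
these amplitudes has the required modulus. Four points make the bounds come out.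

Ancillas are reused. After a gate `U` the ancillas are back in the state 0 only in the sum of the
terms, not in each term. Projecting every term on ancillas 0 is linear and does not change a sum
that already has them at 0 (`sum_step`), so induction along the circuit works with one set of
ancillas (`sum_term`), and N ≤ (A+1)n qubits suffice. Only ancillas that occur in gates are
projected, the others having stayed 0 (`reset_terms`); hence the cost is proportional to the number
of gates and not to gates plus ancillas.

Tableaux. A state is stored as `amp * I ^ (xᵀ B x)` on the solutions of `x = M x` modulo 2, with an
extra coordinate that is constantly 1, and with every coordinate expressed by free ones
(`Tab.Valid`). Diagonal gates change entries of `B`. A measurement either eliminates a free variable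
(`meas_pivot`) or tests a constant (`meas_const`). CX is a controlled sign between two Hadamards
(`CX_eq`). For a Hadamard gate on `q`, a change of pivots first makes `q` bound, or free and absent
from all other rows (`H_swap`). If `q` is bound, one summand survives (`H_bound`). If it is free,
the sum over its value is `1 + I ^ (2 l + d)` with a linear form `l`, which is a constant times a
quadratic phase for odd `d` (`H_free_odd`), and 2 or 0 according to a linear equation for even `d`
(`H_free_even`).

Numbering of terms. There may be far more terms than a word can count. The number of the current
term is therefore kept as a list of mixed radix digits, one per gate of rank at least 2, which takes
O(log χ) bits (`radices_bounds`). While the circuit is traversed, each digit selects a term of its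
gate and is replaced by the digit of the successor; the final carry tells that all terms are done
(`itemCode_tri`, `termCode_tri`).

In parallel, each thread splits its own number into digits, computes one term, and the amplitudes
are added by doubling in O(log χ) rounds (`sumProg_exec`).

The statements about the machine come from a calculus of executions: `Den` describes the effect of a
program on an abstract memory, with time and space, and `Tri` hides the final memory behind a
property. Absence of overflow is checked against a bound on all words that is polynomial in the size
of the input (`wordBound_le`). -/

inductive Var : Type
  | id | P | n | L | LL | i | j | q | b | r | d | al | be | ga | e | s1 | s2 | acc | cc | k | carry
  | rank | dig | go | strd | src | u
  deriving DecidableEq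

inductive Arr : Type
  | M | B | Z | W | X | D
  deriving DecidableEq

inductive Ptr : Type
  | pc | it | pf | pe | pl | pg | pq | px
  deriving DecidableEq

inductive CReg : Type
  | out | amp | acc | tmp | aux
  deriving DecidableEq

/-- The architecture used: registers from number 32 on hold intermediate values. -/
abbrev arch : Arch := ⟨46, 6, 8, 7⟩

def Var.reg (x : Var) : Fin (arch.regs + 2) :=
  ⟨x.ctorIdx, by cases x <;> decide⟩

def Arr.idx (s : Arr) : Fin arch.arrs := ⟨s.ctorIdx, by cases s <;> decide⟩

def Ptr.idx (p : Ptr) : Fin arch.ptrs := ⟨p.ctorIdx, by cases p <;> decide⟩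

def CReg.idx (z : CReg) : Fin (arch.cregs + 1) := ⟨z.ctorIdx, by cases z <;> decide⟩

/-- The registers for intermediate values. -/
def scratch (d : ℕ) : Fin (arch.regs + 2) := ⟨(32 + d) % 48, Nat.mod_lt _ (by decide)⟩

theorem Var.reg_injective : Function.Injective Var.reg := by
  -- The list is a left inverse of the numbering, which avoids comparing all pairs of names.
  have h : ∀ x : Var, ([.id, .P, .n, .L, .LL, .i, .j, .q, .b, .r, .d, .al, .be, .ga, .e, .s1, .s2,
    .acc, .cc, .k, .carry, .rank, .dig, .go, .strd, .src, .u] : List Var)[x.reg.val]? = some x := by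
    intro x; cases x <;> rfl
  intro x y hxy
  have := h x
  rw [hxy, h y] at this
  exact (Option.some.inj this).symm

theorem Arr.idx_injective : Function.Injective Arr.idx := by
  intro x y h; cases x <;> cases y <;> first | rfl | (exact absurd h (by decide))

theorem Ptr.idx_injective : Function.Injective Ptr.idx := by
  intro x y h; cases x <;> cases y <;> first | rfl | (exact absurd h (by decide))

theorem CReg.idx_injective : Function.Injective CReg.idx := by
  intro x y h; cases x <;> cases y <;> first | rfl | (exact absurd h (by decide))

theorem Var.reg_lt (x : Var) : x.reg.val < 32 := by cases x <;> decide

theorem scratch_val {d : ℕ} (hd : d < 16) : (scratch d).val = 32 + d := by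
  simp only [scratch]; omega

theorem Var.reg_ne_scratch (x : Var) {d : ℕ} (hd : d < 16) : x.reg ≠ scratch d := by
  intro h
  have := congrArg Fin.val h
  rw [scratch_val hd] at this
  have := x.reg_lt
  omega

theorem scratch_ne {d d' : ℕ} (hd : d < 16) (hd' : d' < 16) (h : d' ≠ d) :
    scratch d' ≠ scratch d := by
  intro e
  have := congrArg Fin.val e
  rw [scratch_val hd, scratch_val hd'] at this
  omega

/-- The part of the memory that programs are specified by. -/
structure Mem : Type where
  v : Var → ℕ
  a : Arr → List ℕ
  p : Ptr → Tree
  c : CReg → ℂ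

/-- The parameters of an execution: word length, input, bounds for words, for the lengths of the
arrays other than `D`, and for the work space of the array `D`. -/
structure Env : Type where
  w : ℕ
  inp : Tree
  V : ℕ
  len : ℕ
  spD : ℕ
  hw : V < 2 ^ w
  hV : 100 ≤ V

def cells (l : List ℕ) : ℕ := (l.map (fun v => 1 + v.size)).sum

/-- There are 48 registers. Each of the five arrays other than `D` takes at most 3 bits per cell,
because its entries are at most 3. -/
def Env.space (E : Env) : ℕ := 48 * E.V.size + (15 * E.len + E.spD)

/-- The bounds on the arrays. -/
structure Mem.Good (E : Env) (h : Mem) : Prop where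
  v : ∀ x, h.v x ≤ E.V
  len : ∀ s, s ≠ .D → (h.a s).length ≤ E.len
  cell : ∀ s, s ≠ .D → ∀ v ∈ h.a s, v ≤ 3
  spD : cells (h.a .D) ≤ E.spD
  cellD : ∀ v ∈ h.a .D, v ≤ E.V

/-- Registers for intermediate values are only required to be bounded. Evaluating an expression thus
leads to a memory with the same description. -/
structure Rel (E : Env) (h : Mem) (σ : Store arch) : Prop where
  reg : ∀ x : Var, σ.reg x.reg = h.v x
  le : ∀ r, σ.reg r ≤ E.V
  arr : ∀ s : Arr, σ.arr s.idx = h.a s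
  ptr : ∀ p : Ptr, σ.ptr p.idx = h.p p
  creg : ∀ z : CReg, σ.creg z.idx = h.c z
  good : h.Good E

theorem cells_le_three {l : List ℕ} (h : ∀ v ∈ l, v ≤ 3) : cells l ≤ 3 * l.length := by
  induction l with
  | nil => simp [cells]
  | cons a l ih =>
    have h1 := ih (fun v hv => h v (List.mem_cons_of_mem _ hv))
    have h2 : a.size ≤ 2 := by
      rw [Nat.size_le]; have := h a (by simp); omega
    simp only [cells, List.map_cons, List.sum_cons, List.length_cons] at h1 ⊢
    omega

theorem Rel.space {E : Env} {h : Mem} {σ : Store arch} (H : Rel E h σ) : σ.space ≤ E.space := by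
  have h1 : ∑ r, (σ.reg r).size ≤ 48 * E.V.size := by
    have := Finset.sum_le_card_nsmul (Finset.univ : Finset (Fin (arch.regs + 2)))
      (fun r => (σ.reg r).size) E.V.size (fun r _ => Nat.size_le_size (H.le r))
    simpa using this
  have h2 : ∑ s, ((σ.arr s).map (fun v => 1 + v.size)).sum ≤ 15 * E.len + E.spD := by
    have hs : ∀ s : Arr, s ≠ .D → ((σ.arr s.idx).map (fun v => 1 + v.size)).sum ≤ 3 * E.len := by
      intro s hs
      rw [H.arr]
      exact (cells_le_three (H.good.cell s hs)).trans (by have := H.good.len s hs; omega)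
    have hD : ((σ.arr Arr.D.idx).map (fun v => 1 + v.size)).sum ≤ E.spD := by
      rw [H.arr]; exact H.good.spD
    have e : ∑ s, ((σ.arr s).map (fun v => 1 + v.size)).sum =
        ((σ.arr Arr.M.idx).map (fun v => 1 + v.size)).sum +
        ((σ.arr Arr.B.idx).map (fun v => 1 + v.size)).sum +
        ((σ.arr Arr.Z.idx).map (fun v => 1 + v.size)).sum +
        ((σ.arr Arr.W.idx).map (fun v => 1 + v.size)).sum +
        ((σ.arr Arr.X.idx).map (fun v => 1 + v.size)).sum +
        ((σ.arr Arr.D.idx).map (fun v => 1 + v.size)).sum := Fin.sum_univ_six _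
    rw [e]
    have := hs .M (by decide); have := hs .B (by decide); have := hs .Z (by decide)
    have := hs .W (by decide); have := hs .X (by decide)
    omega
  unfold Store.space Env.space
  omega

/-- Arithmetic expressions. -/
inductive AExp : Type
  | lit (k : ℕ)
  | var (x : Var)
  | op (o : BinOp) (a b : AExp)
  | get (s : Arr) (e : AExp)
  | word (p : Ptr)
  | arity (p : Ptr)

namespace AExp

def eval (h : Mem) : AExp → ℕ
  | lit k => k
  | var x => h.v x
  | op o a b => o.eval (a.eval h) (b.eval h)
  | get s e => (h.a s)[e.eval h]?.getD 0
  | word p => (h.p p).word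
  | arity p => (h.p p).arity

/-- Only sums and products can leave the range: the other operations give at most the first operand
or 1. -/
def OkOp (V : ℕ) : BinOp → ℕ → ℕ → Prop
  | .add, u, v => u + v ≤ V
  | .mul, u, v => u * v ≤ V
  | _, _, _ => True

/-- The evaluation causes no fault. -/
def Ok (V : ℕ) (h : Mem) : AExp → Prop
  | lit k => k ≤ V
  | var _ => True
  | op o a b => a.Ok V h ∧ b.Ok V h ∧ OkOp V o (a.eval h) (b.eval h)
  | get s e => e.Ok V h ∧ e.eval h < (h.a s).length
  | word p => (h.p p).word ≤ V
  | arity p => (h.p p).arity ≤ V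

/-- The number of consecutive scratch registers needed, when the second operand of an operation is
evaluated one register further up. -/
def depth : AExp → ℕ
  | op _ a b => max a.depth (b.depth + 1)
  | get _ e => e.depth
  | _ => 1

def cost : AExp → ℕ
  | lit _ => 1
  | var _ => 2
  | op _ a b => a.cost + (b.cost + 1)
  | get _ e => e.cost + 1
  | word _ => 1
  | arity _ => 1

/-- The value ends up in scratch register `d`. A register is copied by adding 0 to it. -/
def code : AExp → ℕ → Code arch
  | lit k, d => .instr (.const (scratch d) k)
  | var x, d => .seq (.instr (.const (scratch d) 0)) (.instr (.op .add (scratch d) x.reg (scratch d)))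
  | op o a b, d => .seq (a.code d) (.seq (b.code (d + 1))
      (.instr (.op o (scratch d) (scratch d) (scratch (d + 1)))))
  | get s e, d => .seq (e.code d) (.instr (.load (scratch d) s.idx (scratch d)))
  | word p, d => .instr (.word (scratch d) p.idx)
  | arity p, d => .instr (.arity (scratch d) p.idx)

end AExp

variable {E : Env} {h h' h₁ h₂ : Mem}

theorem AExp.eval_le (hg : h.Good E) : ∀ {e : AExp}, e.Ok E.V h → e.eval h ≤ E.V
  | .lit k, H => H
  | .var x, _ => hg.v x
  | .word p, H => H
  | .arity p, H => H
  | .get s e, H => by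
    simp only [AExp.eval, List.getElem?_eq_getElem H.2, Option.getD_some]
    by_cases hs : s = .D
    · subst hs; exact hg.cellD _ (List.getElem_mem _)
    · exact (hg.cell s hs _ (List.getElem_mem _)).trans (by have := E.hV; omega)
  | .op o a b, H => by
    have h1 := AExp.eval_le hg H.1
    have h2 := AExp.eval_le hg H.2.1
    have h3 := H.2.2
    have := E.hV
    cases o <;> simp only [AExp.eval, BinOp.eval, AExp.OkOp] at h3 ⊢
    · exact h3
    · omega
    · exact h3
    · exact (Nat.div_le_self _ _).trans h1
    · exact (Nat.mod_le _ _).trans h1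
    · split <;> omega
    · split <;> omega

theorem AExp.depth_pos : ∀ e : AExp, 0 < e.depth
  | lit _ => Nat.one_pos
  | var _ => Nat.one_pos
  | word _ => Nat.one_pos
  | arity _ => Nat.one_pos
  | get _ e => e.depth_pos
  | op _ a _ => lt_max_of_lt_left a.depth_pos

theorem Rel.setScratch {σ : Store arch} (H : Rel E h σ) {d v : ℕ} (hd : d < 16) (hv : v ≤ E.V) :
    Rel E h { σ with reg := Function.update σ.reg (scratch d) v } where
  reg x := by
    simp only [Function.update_of_ne (x.reg_ne_scratch hd)]; exact H.reg x
  le r := by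
    by_cases hr : r = scratch d
    · subst hr; simpa using hv
    · simp only [Function.update_of_ne hr]; exact H.le r
  arr := H.arr
  ptr := H.ptr
  creg := H.creg
  good := H.good

theorem setReg_eq {σ : Store arch} {d : Fin (arch.regs + 2)} {v : ℕ} (hv : v ≤ E.V) :
    σ.setReg E.w d v = some { σ with reg := Function.update σ.reg d v } := by
  have := E.hw
  simp only [Store.setReg, if_pos (lt_of_le_of_lt hv this)]

/-- The last clause, that scratch registers below `d` survive, is what keeps the first operand alive
while the second one is evaluated. The bound 16 is the number of scratch registers. -/
theorem AExp.exec : ∀ (e : AExp) {h : Mem} {σ : Store arch} {d : ℕ}, Rel E h σ → e.Ok E.V h →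
    d + e.depth ≤ 16 → ∃ τ S, Exec E.w E.inp (e.code d) σ τ e.cost S ∧ S ≤ E.space ∧ Rel E h τ ∧
      τ.reg (scratch d) = e.eval h ∧ ∀ d' < d, τ.reg (scratch d') = σ.reg (scratch d') := by
  have key : ∀ (i : Instr arch) {h : Mem} {σ : Store arch} {d v : ℕ}, Rel E h σ → v ≤ E.V →
      d < 16 → i.exec E.w E.inp σ = σ.setReg E.w (scratch d) v →
      ∃ τ S, Exec E.w E.inp (.instr i) σ τ 1 S ∧ S ≤ E.space ∧ Rel E h τ ∧
      τ.reg (scratch d) = v ∧ ∀ d' < d, τ.reg (scratch d') = σ.reg (scratch d') := by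
    intro i h σ d v H hv hd hi
    rw [setReg_eq hv] at hi
    refine ⟨_, _, .instr i _ _ hi, ?_, H.setScratch hd hv, by simp, ?_⟩
    · exact max_le H.space (H.setScratch hd hv).space
    · intro d' hd'
      simp only [Function.update_of_ne (scratch_ne hd (by omega) (by omega : d' ≠ d))]
  intro e
  induction e with
  | lit k => exact fun H hk hd => key _ H hk (by simp only [depth] at hd; omega) rfl
  | word p =>
    intro h σ d H hk hd
    refine key _ H hk (by simp only [depth] at hd; omega) ?_
    simp only [Instr.exec, H.ptr, eval]
  | arity p =>
    intro h σ d H hk hd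
    refine key _ H hk (by simp only [depth] at hd; omega) ?_
    simp only [Instr.exec, H.ptr, eval]
  | var x =>
    intro h σ d H _ hd
    have hd : d < 16 := by simp only [depth] at hd; omega
    obtain ⟨τ, S, h1, h2, h3, h4, h5⟩ := key (.const (scratch d) 0) H (Nat.zero_le _) hd rfl
    obtain ⟨τ', S', k1, k2, k3, k4, k5⟩ := key (.op .add (scratch d) x.reg (scratch d)) h3
      (H.good.v x) hd (by simp only [Instr.exec, BinOp.eval, h3.reg, h4, Nat.add_zero])
    exact ⟨τ', _, .seq _ _ _ _ _ _ _ _ _ h1 k1, max_le h2 k2, k3, k4,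
      fun d' hd' => (k5 d' hd').trans (h5 d' hd')⟩
  | get s e ih =>
    intro h σ d H hk hd
    have hd' : d < 16 := by
      have := e.depth_pos
      simp only [depth] at hd; omega
    obtain ⟨τ, S, h1, h2, h3, h4, h5⟩ := ih H hk.1 (d := d) (by simpa only [depth] using hd)
    obtain ⟨τ', S', k1, k2, k3, k4, k5⟩ := key (.load (scratch d) s.idx (scratch d)) h3
      (AExp.eval_le H.good hk) hd'
      (by simp only [Instr.exec, h3.arr, h4, eval, List.getElem?_eq_getElem hk.2, Option.bind_some,
        Option.getD_some])
    exact ⟨τ', _, .seq _ _ _ _ _ _ _ _ _ h1 k1, max_le h2 k2, k3, k4,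
      fun d' hd' => (k5 d' hd').trans (h5 d' hd')⟩
  | op o a b iha ihb =>
    intro h σ d H hk hd
    simp only [depth] at hd
    obtain ⟨τ, S, h1, h2, h3, h4, h5⟩ := iha H hk.1 (d := d) (by omega)
    obtain ⟨τ₁, S₁, i1, i2, i3, i4, i5⟩ := ihb h3 hk.2.1 (d := d + 1) (by omega)
    obtain ⟨τ', S', k1, k2, k3, k4, k5⟩ := key (.op o (scratch d) (scratch d) (scratch (d + 1))) i3
      (d := d) (AExp.eval_le H.good hk) (by omega)
      (by simp only [Instr.exec, i4, i5 d (by omega), h4, eval])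
    exact ⟨τ', _, .seq _ _ _ _ _ _ _ _ _ h1 (.seq _ _ _ _ _ _ _ _ _ i1 k1),
      max_le h2 (max_le i2 k2), k3, k4,
      fun d' hd' => (k5 d' hd').trans ((i5 d' (by omega)).trans (h5 d' hd'))⟩

/-- From any memory as described by `h`, the program halts in a memory as described by `h'`, in time
at most `T` and within the work space of `E`. -/
def Den (E : Env) (c : Code arch) (h : Mem) (T : ℕ) (h' : Mem) : Prop :=
  ∀ σ, Rel E h σ → ∃ τ T' S, Exec E.w E.inp c σ τ T' S ∧ T' ≤ T ∧ S ≤ E.space ∧ Rel E h' τ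

theorem Den.mono {c : Code arch} {T T' : ℕ} (H : Den E c h T h') (hT : T ≤ T') :
    Den E c h T' h' := fun σ hσ => by
  obtain ⟨τ, t, S, h1, h2, h3⟩ := H σ hσ
  exact ⟨τ, t, S, h1, h2.trans hT, h3⟩

theorem Den.skip : Den E .skip h 1 h :=
  fun σ hσ => ⟨σ, 1, _, .skip σ, le_rfl, hσ.space, hσ⟩

theorem Den.seq {c₁ c₂ : Code arch} {T₁ T₂ : ℕ} (H₁ : Den E c₁ h T₁ h₁) (H₂ : Den E c₂ h₁ T₂ h₂) :
    Den E (.seq c₁ c₂) h (T₁ + T₂) h₂ := fun σ hσ => by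
  obtain ⟨τ, t, S, a1, a2, a3, a4⟩ := H₁ σ hσ
  obtain ⟨τ', t', S', b1, b2, b3, b4⟩ := H₂ τ a4
  exact ⟨τ', _, _, .seq _ _ _ _ _ _ _ _ _ a1 b1, Nat.add_le_add a2 b2, max_le a3 b3, b4⟩

namespace Mem

def setV (h : Mem) (x : Var) (k : ℕ) : Mem := { h with v := Function.update h.v x k }
def setA (h : Mem) (s : Arr) (l : List ℕ) : Mem := { h with a := Function.update h.a s l }
def setP (h : Mem) (p : Ptr) (t : Tree) : Mem := { h with p := Function.update h.p p t }
def setC (h : Mem) (z : CReg) (k : ℂ) : Mem := { h with c := Function.update h.c z k }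

@[simp] theorem setV_v (h : Mem) (x : Var) (k : ℕ) (y : Var) :
    (h.setV x k).v y = if y = x then k else h.v y := by simp [setV, Function.update_apply]
@[simp] theorem setV_a (h : Mem) (x : Var) (k : ℕ) : (h.setV x k).a = h.a := rfl
@[simp] theorem setV_p (h : Mem) (x : Var) (k : ℕ) : (h.setV x k).p = h.p := rfl
@[simp] theorem setV_c (h : Mem) (x : Var) (k : ℕ) : (h.setV x k).c = h.c := rfl
@[simp] theorem setA_a (h : Mem) (x : Arr) (k : List ℕ) (y : Arr) :
    (h.setA x k).a y = if y = x then k else h.a y := by simp [setA, Function.update_apply]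
@[simp] theorem setA_v (h : Mem) (x : Arr) (k : List ℕ) : (h.setA x k).v = h.v := rfl
@[simp] theorem setA_p (h : Mem) (x : Arr) (k : List ℕ) : (h.setA x k).p = h.p := rfl
@[simp] theorem setA_c (h : Mem) (x : Arr) (k : List ℕ) : (h.setA x k).c = h.c := rfl
@[simp] theorem setP_p (h : Mem) (x : Ptr) (k : Tree) (y : Ptr) :
    (h.setP x k).p y = if y = x then k else h.p y := by simp [setP, Function.update_apply]
@[simp] theorem setP_v (h : Mem) (x : Ptr) (k : Tree) : (h.setP x k).v = h.v := rfl
@[simp] theorem setP_a (h : Mem) (x : Ptr) (k : Tree) : (h.setP x k).a = h.a := rfl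
@[simp] theorem setP_c (h : Mem) (x : Ptr) (k : Tree) : (h.setP x k).c = h.c := rfl
@[simp] theorem setC_c (h : Mem) (x : CReg) (k : ℂ) (y : CReg) :
    (h.setC x k).c y = if y = x then k else h.c y := by simp [setC, Function.update_apply]
@[simp] theorem setC_v (h : Mem) (x : CReg) (k : ℂ) : (h.setC x k).v = h.v := rfl
@[simp] theorem setC_a (h : Mem) (x : CReg) (k : ℂ) : (h.setC x k).a = h.a := rfl
@[simp] theorem setC_p (h : Mem) (x : CReg) (k : ℂ) : (h.setC x k).p = h.p := rfl

end Mem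

theorem Mem.Good.setV (hg : h.Good E) {x : Var} {k : ℕ} (hk : k ≤ E.V) : (h.setV x k).Good E where
  v y := by simp only [Mem.setV_v]; split <;> [exact hk; exact hg.v y]
  len := hg.len
  cell := hg.cell
  spD := hg.spD
  cellD := hg.cellD

theorem Mem.Good.setA (hg : h.Good E) {s : Arr} {l : List ℕ} (hs : s ≠ .D) (hl : l.length ≤ E.len)
    (hc : ∀ v ∈ l, v ≤ 3) : (h.setA s l).Good E where
  v := hg.v
  len t ht := by simp only [Mem.setA_a]; split <;> [exact hl; exact hg.len t ht]
  cell t ht := by simp only [Mem.setA_a]; split <;> [exact hc; exact hg.cell t ht]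
  spD := by simp only [Mem.setA_a, if_neg hs.symm]; exact hg.spD
  cellD := by simp only [Mem.setA_a, if_neg hs.symm]; exact hg.cellD

theorem Mem.Good.setD (hg : h.Good E) {l : List ℕ} (hl : cells l ≤ E.spD)
    (hc : ∀ v ∈ l, v ≤ E.V) : (h.setA .D l).Good E where
  v := hg.v
  len t ht := by simp only [Mem.setA_a, if_neg ht]; exact hg.len t ht
  cell t ht := by simp only [Mem.setA_a, if_neg ht]; exact hg.cell t ht
  spD := by simpa using hl
  cellD := by simpa using hc

/-! ## Statements -/

/-- `x := e` -/
def asg (x : Var) (e : AExp) : Code arch :=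
  .seq (e.code 0) (.seq (.instr (.const (scratch 1) 0))
    (.instr (.op .add x.reg (scratch 0) (scratch 1))))

/-- `s[e₁] := e₂` -/
def put (s : Arr) (e₁ e₂ : AExp) : Code arch :=
  .seq (e₁.code 0) (.seq (e₂.code 1) (.instr (.store s.idx (scratch 0) (scratch 1))))

def pushE (s : Arr) (e : AExp) : Code arch :=
  .seq (e.code 0) (.instr (.push s.idx (scratch 0)))

def link (p q : Ptr) (e : AExp) : Code arch :=
  .seq (e.code 0) (.instr (.child p.idx q.idx (scratch 0)))

def ifE (e : AExp) (c₁ c₂ : Code arch) : Code arch := .seq (e.code 0) (.ite (scratch 0) c₁ c₂)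

/-- A `loop` tests a register, so the test is evaluated once before the loop and again at the end of
each round. -/
def whileE (e : AExp) (c : Code arch) : Code arch :=
  .seq (e.code 0) (.loop (scratch 0) (.seq c (e.code 0)))

theorem Rel.setV {σ : Store arch} (H : Rel E h σ) {x : Var} {v : ℕ} (hv : v ≤ E.V) :
    Rel E (h.setV x v) { σ with reg := Function.update σ.reg x.reg v } where
  reg y := by
    simp only [Mem.setV_v, Function.update_apply, Var.reg_injective.eq_iff, H.reg]
  le r := by
    by_cases hr : r = x.reg
    · subst hr; simpa using hv
    · simp only [Function.update_of_ne hr]; exact H.le r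
  arr := H.arr
  ptr := H.ptr
  creg := H.creg
  good := H.good.setV hv

theorem Rel.setA {σ : Store arch} (H : Rel E h σ) {s : Arr} {l : List ℕ}
    (hg : (h.setA s l).Good E) : Rel E (h.setA s l) (σ.setArr s.idx l) where
  reg := H.reg
  le := H.le
  arr t := by
    simp only [Mem.setA_a, Store.setArr, Function.update_apply, Arr.idx_injective.eq_iff, H.arr]
  ptr := H.ptr
  creg := H.creg
  good := hg

theorem Rel.setP {σ : Store arch} (H : Rel E h σ) {p : Ptr} {t : Tree} :
    Rel E (h.setP p t) (σ.setPtr p.idx t) where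
  reg := H.reg
  le := H.le
  arr := H.arr
  ptr q := by
    simp only [Mem.setP_p, Store.setPtr, Function.update_apply, Ptr.idx_injective.eq_iff, H.ptr]
  creg := H.creg
  good := ⟨H.good.v, H.good.len, H.good.cell, H.good.spD, H.good.cellD⟩

theorem Rel.setC {σ : Store arch} (H : Rel E h σ) {z : CReg} {t : ℂ} :
    Rel E (h.setC z t) (σ.setCreg z.idx t) where
  reg := H.reg
  le := H.le
  arr := H.arr
  ptr := H.ptr
  creg q := by
    simp only [Mem.setC_c, Store.setCreg, Function.update_apply, CReg.idx_injective.eq_iff, H.creg]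
  good := ⟨H.good.v, H.good.len, H.good.cell, H.good.spD, H.good.cellD⟩

theorem Den.asg {x : Var} {e : AExp} {v : ℕ} (hd : e.depth ≤ 16) (hok : h.Good E → e.Ok E.V h)
    (hv : e.eval h = v) :
    Den E (asg x e) h (e.cost + 2) (h.setV x v) := fun σ hσ => by
  have hok := hok hσ.good
  obtain ⟨τ, S, h1, h2, h3, h4, -⟩ := e.exec hσ hok (d := 0) (by omega)
  have hv' : v ≤ E.V := hv ▸ AExp.eval_le hσ.good hok
  have r1 := h3.setScratch (d := 1) (v := 0) (by decide) (Nat.zero_le _)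
  have r2 := r1.setV (x := x) hv'
  refine ⟨_, _, _, .seq _ _ _ _ _ _ _ _ _ h1 (.seq _ _ _ _ _ _ _ _ _
    (.instr _ _ _ (setReg_eq (Nat.zero_le _)))
    (.instr _ _ _ ?_)), le_rfl,
    max_le h2 (max_le (max_le h3.space r1.space) (max_le r1.space r2.space)), r2⟩
  simp only [Instr.exec, BinOp.eval, Function.update_self]
  rw [Function.update_of_ne (scratch_ne (by decide) (by decide) (by decide)), h4, hv]
  exact setReg_eq hv'

theorem Den.put_of {s : Arr} {e₁ e₂ : AExp} {i v : ℕ} (hd₁ : e₁.depth ≤ 16) (hd₂ : e₂.depth ≤ 15)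
    (ok₁ : h.Good E → e₁.Ok E.V h) (ok₂ : h.Good E → e₂.Ok E.V h) (hi : e₁.eval h = i)
    (hv : e₂.eval h = v)
    (hl : i < (h.a s).length) (hg : h.Good E → (h.setA s ((h.a s).set i v)).Good E) :
    Den E (put s e₁ e₂) h (e₁.cost + (e₂.cost + 1)) (h.setA s ((h.a s).set i v)) := fun σ hσ => by
  have ok₁ := ok₁ hσ.good
  have ok₂ := ok₂ hσ.good
  obtain ⟨τ, S, h1, h2, h3, h4, -⟩ := e₁.exec hσ ok₁ (d := 0) (by omega)
  obtain ⟨τ', S', k1, k2, k3, k4, k5⟩ := e₂.exec h3 ok₂ (d := 1) (by omega)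
  have r := k3.setA (hg hσ.good)
  refine ⟨_, _, _, .seq _ _ _ _ _ _ _ _ _ h1 (.seq _ _ _ _ _ _ _ _ _ k1 (.instr _ _ _ ?_)), le_rfl,
    max_le h2 (max_le k2 (max_le k3.space r.space)), r⟩
  simp only [Instr.exec, k5 0 (by decide), h4, k4, k3.arr, hi, hv, if_pos hl]

theorem Den.put {s : Arr} {e₁ e₂ : AExp} {i v : ℕ} (hd₁ : e₁.depth ≤ 16) (hd₂ : e₂.depth ≤ 15)
    (ok₁ : h.Good E → e₁.Ok E.V h) (ok₂ : h.Good E → e₂.Ok E.V h) (hi : e₁.eval h = i)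
    (hv : e₂.eval h = v) (hs : s ≠ .D) (hv3 : v ≤ 3)
    (hl : i < (h.a s).length) :
    Den E (put s e₁ e₂) h (e₁.cost + (e₂.cost + 1)) (h.setA s ((h.a s).set i v)) :=
  Den.put_of hd₁ hd₂ ok₁ ok₂ hi hv hl fun hg => hg.setA hs (by simpa using hg.len s hs) (by
    intro v hv
    rcases List.mem_or_eq_of_mem_set hv with h | h
    · exact hg.cell s hs v h
    · omega)

theorem Den.pushE {s : Arr} {e : AExp} {v : ℕ} (hd : e.depth ≤ 16)
    (hok : h.Good E → e.Ok E.V h) (hv : e.eval h = v)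
    (hg : h.Good E → (h.setA s (h.a s ++ [v])).Good E) :
    Den E (pushE s e) h (e.cost + 1) (h.setA s (h.a s ++ [v])) := fun σ hσ => by
  have hok := hok hσ.good
  obtain ⟨τ, S, h1, h2, h3, h4, -⟩ := e.exec hσ hok (d := 0) (by omega)
  have r := h3.setA (hg hσ.good)
  refine ⟨_, _, _, .seq _ _ _ _ _ _ _ _ _ h1 (.instr _ _ _ ?_), le_rfl,
    max_le h2 (max_le h3.space r.space), r⟩
  simp only [Instr.exec, h4, h3.arr, hv]

theorem Den.link {p q : Ptr} {e : AExp} {i : ℕ} {t : Tree} (hd : e.depth ≤ 16)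
    (hok : h.Good E → e.Ok E.V h) (hi : e.eval h = i)
    (ht : (h.p q).child i = some t) :
    Den E (link p q e) h (e.cost + 1) (h.setP p t) := fun σ hσ => by
  have hok := hok hσ.good
  obtain ⟨τ, S, h1, h2, h3, h4, -⟩ := e.exec hσ hok (d := 0) (by omega)
  have r := h3.setP (p := p) (t := t)
  refine ⟨_, _, _, .seq _ _ _ _ _ _ _ _ _ h1 (.instr _ _ _ ?_), le_rfl,
    max_le h2 (max_le h3.space r.space), r⟩
  simp only [Instr.exec, h4, h3.ptr, hi, ht, Option.map_some]

theorem Den.move {p q : Ptr} : Den E (.instr (.move p.idx q.idx)) h 1 (h.setP p (h.p q)) :=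
  fun σ hσ => by
  have r := hσ.setP (p := p) (t := h.p q)
  refine ⟨_, _, _, .instr _ _ _ ?_, le_rfl, max_le hσ.space r.space, r⟩
  simp only [Instr.exec, hσ.ptr]

theorem Den.coeff {z : CReg} {p : Ptr} :
    Den E (.instr (.coeff z.idx p.idx)) h 1 (h.setC z (h.p p).coeff) := fun σ hσ => by
  have r := hσ.setC (z := z) (t := (h.p p).coeff)
  refine ⟨_, _, _, .instr _ _ _ ?_, le_rfl, max_le hσ.space r.space, r⟩
  simp only [Instr.exec, hσ.ptr]

theorem Den.cconst {z : CReg} {k : CConst} :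
    Den E (.instr (.cconst z.idx k)) h 1 (h.setC z k.val) := fun σ hσ => by
  have r := hσ.setC (z := z) (t := k.val)
  exact ⟨_, _, _, .instr _ _ _ rfl, le_rfl, max_le hσ.space r.space, r⟩

theorem Den.cadd {z u v : CReg} :
    Den E (.instr (.cadd z.idx u.idx v.idx)) h 1 (h.setC z (h.c u + h.c v)) := fun σ hσ => by
  have r := hσ.setC (z := z) (t := h.c u + h.c v)
  refine ⟨_, _, _, .instr _ _ _ ?_, le_rfl, max_le hσ.space r.space, r⟩
  simp only [Instr.exec, hσ.creg]

theorem Den.cmul {z u v : CReg} :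
    Den E (.instr (.cmul z.idx u.idx v.idx)) h 1 (h.setC z (h.c u * h.c v)) := fun σ hσ => by
  have r := hσ.setC (z := z) (t := h.c u * h.c v)
  refine ⟨_, _, _, .instr _ _ _ ?_, le_rfl, max_le hσ.space r.space, r⟩
  simp only [Instr.exec, hσ.creg]

theorem Den.cconj {z u : CReg} :
    Den E (.instr (.cconj z.idx u.idx)) h 1 (h.setC z (starRingEnd ℂ (h.c u))) := fun σ hσ => by
  have r := hσ.setC (z := z) (t := starRingEnd ℂ (h.c u))
  refine ⟨_, _, _, .instr _ _ _ ?_, le_rfl, max_le hσ.space r.space, r⟩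
  simp only [Instr.exec, hσ.creg]

theorem Den.ifE_pos {e : AExp} {c₁ c₂ : Code arch} {T : ℕ} (hd : e.depth ≤ 16)
    (hok : h.Good E → e.Ok E.V h)
    (he : e.eval h ≠ 0) (H : Den E c₁ h T h') : Den E (ifE e c₁ c₂) h (e.cost + (T + 1)) h' :=
  fun σ hσ => by
  obtain ⟨τ, S, h1, h2, h3, h4, -⟩ := e.exec hσ (hok hσ.good) (d := 0) (by omega)
  obtain ⟨τ', T', S', k1, k2, k3, k4⟩ := H τ h3
  exact ⟨τ', _, _, .seq _ _ _ _ _ _ _ _ _ h1 (.iteTrue _ _ _ _ _ _ _ (by rwa [h4]) k1), by omega,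
    max_le h2 k3, k4⟩

theorem Den.ifE_neg {e : AExp} {c₁ c₂ : Code arch} {T : ℕ} (hd : e.depth ≤ 16)
    (hok : h.Good E → e.Ok E.V h)
    (he : e.eval h = 0) (H : Den E c₂ h T h') : Den E (ifE e c₁ c₂) h (e.cost + (T + 1)) h' :=
  fun σ hσ => by
  obtain ⟨τ, S, h1, h2, h3, h4, -⟩ := e.exec hσ (hok hσ.good) (d := 0) (by omega)
  obtain ⟨τ', T', S', k1, k2, k3, k4⟩ := H τ h3
  exact ⟨τ', _, _, .seq _ _ _ _ _ _ _ _ _ h1 (.iteFalse _ _ _ _ _ _ _ (by rwa [h4]) k1), by omega,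
    max_le h2 k3, k4⟩

theorem Den.while_stop {e : AExp} {c : Code arch} (hd : e.depth ≤ 16)
    (hok : h.Good E → e.Ok E.V h)
    (he : e.eval h = 0) : Den E (whileE e c) h (e.cost + 1) h := fun σ hσ => by
  obtain ⟨τ, S, h1, h2, h3, h4, -⟩ := e.exec hσ (hok hσ.good) (d := 0) (by omega)
  exact ⟨_, _, _, .seq _ _ _ _ _ _ _ _ _ h1 (.loopStop _ _ _ (by rwa [h4])), le_rfl,
    max_le h2 h3.space, h3⟩

theorem Den.while_step {e : AExp} {c : Code arch} {T₁ T₂ : ℕ} (hd : e.depth ≤ 16)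
    (hok : h.Good E → e.Ok E.V h) (he : e.eval h ≠ 0) (H₁ : Den E c h T₁ h₁)
    (H₂ : Den E (whileE e c) h₁ T₂ h₂) :
    Den E (whileE e c) h (e.cost + 1 + T₁ + T₂) h₂ := fun σ hσ => by
  obtain ⟨τ, S, a1, a2, a3, a4, -⟩ := e.exec hσ (hok hσ.good) (d := 0) (by omega)
  obtain ⟨ρ, t, S', b1, b2, b3, b4⟩ := H₁ τ a3
  obtain ⟨ω, t', S'', c1, c2, c3, c4⟩ := H₂ ρ b4
  -- The remaining execution begins with an evaluation of the test. It is cut off there and attached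
  -- to the first round, where the loop expects it.
  cases c1 with
  | seq _ _ _ κ _ t1 t2 s1 s2 x y =>
  refine ⟨ω, _, _, .seq _ _ _ _ _ _ _ _ _ a1 (.loopStep _ _ _ _ _ _ _ _ _ (by rwa [a4])
    (.seq _ _ _ _ _ _ _ _ _ b1 x) y), by omega, ?_, c4⟩
  have := max_le_iff.1 c3
  exact max_le a2 (max_le (max_le b3 this.1) this.2)

theorem Den.while_iter {e : AExp} {c : Code arch} {T : ℕ} (st : ℕ → Mem) (m : ℕ)
    (hd : e.depth ≤ 16) (hok : ∀ i ≤ m, (st i).Good E → e.Ok E.V (st i))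
    (he : ∀ i < m, e.eval (st i) ≠ 0) (hm : e.eval (st m) = 0)
    (H : ∀ i < m, Den E c (st i) T (st (i + 1))) :
    Den E (whileE e c) (st 0) (m * (e.cost + 1 + T) + (e.cost + 1)) (st m) := by
  induction m generalizing st with
  | zero => exact (Den.while_stop hd (hok 0 le_rfl) hm).mono (by omega)
  | succ m ih =>
    have := ih (fun i => st (i + 1)) (fun i hi => hok _ (by omega)) (fun i hi => he _ (by omega)) hm
      (fun i hi => H _ (by omega))
    refine (Den.while_step hd (hok 0 (by omega)) (he 0 (by omega)) (H 0 (by omega)) this).mono ?_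
    rw [Nat.add_mul]; omega

end QSim

namespace QSim

/-! ## Notation for expressions, loops -/

namespace AExp

instance : Add AExp := ⟨.op .add⟩
instance : Sub AExp := ⟨.op .sub⟩
instance : Mul AExp := ⟨.op .mul⟩
instance : Div AExp := ⟨.op .div⟩
instance : Mod AExp := ⟨.op .mod⟩
instance (k : ℕ) : OfNat AExp k := ⟨.lit k⟩
instance : Coe Var AExp := ⟨.var⟩

/-- The test `a < b`. -/
def ltE (a b : AExp) : AExp := .op .lt a b
/-- The test `a = b`. -/
def eqE (a b : AExp) : AExp := .op .eq a b

variable {h : Mem} {V : ℕ} {a b : AExp}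

theorem eval_add : (a + b).eval h = a.eval h + b.eval h := rfl
theorem eval_sub : (a - b).eval h = a.eval h - b.eval h := rfl
theorem eval_mul : (a * b).eval h = a.eval h * b.eval h := rfl
theorem eval_div : (a / b).eval h = a.eval h / b.eval h := rfl
theorem eval_mod : (a % b).eval h = a.eval h % b.eval h := rfl
theorem eval_lt : (ltE a b).eval h = if a.eval h < b.eval h then 1 else 0 := rfl
theorem eval_eq : (eqE a b).eval h = if a.eval h = b.eval h then 1 else 0 := rfl
theorem eval_two : (2 : AExp).eval h = 2 := rfl
theorem eval_three : (3 : AExp).eval h = 3 := rfl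
theorem eval_four : (4 : AExp).eval h = 4 := rfl
theorem eval_zero : (0 : AExp).eval h = 0 := rfl
theorem eval_one : (1 : AExp).eval h = 1 := rfl
theorem eval_var (x : Var) : (AExp.var x).eval h = h.v x := rfl
theorem eval_get (s : Arr) (e : AExp) : (get s e).eval h = (h.a s)[e.eval h]?.getD 0 := rfl
theorem eval_word (p : Ptr) : (word p).eval h = (h.p p).word := rfl
theorem eval_arity (p : Ptr) : (arity p).eval h = (h.p p).arity := rfl

theorem ok_add : (a + b).Ok V h ↔ a.Ok V h ∧ b.Ok V h ∧ a.eval h + b.eval h ≤ V := Iff.rfl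
theorem ok_sub : (a - b).Ok V h ↔ a.Ok V h ∧ b.Ok V h :=
  and_congr_right fun _ => and_iff_left trivial
theorem ok_mul : (a * b).Ok V h ↔ a.Ok V h ∧ b.Ok V h ∧ a.eval h * b.eval h ≤ V := Iff.rfl
theorem ok_div : (a / b).Ok V h ↔ a.Ok V h ∧ b.Ok V h :=
  and_congr_right fun _ => and_iff_left trivial
theorem ok_mod : (a % b).Ok V h ↔ a.Ok V h ∧ b.Ok V h :=
  and_congr_right fun _ => and_iff_left trivial
theorem ok_lt : (ltE a b).Ok V h ↔ a.Ok V h ∧ b.Ok V h :=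
  and_congr_right fun _ => and_iff_left trivial
theorem ok_eq : (eqE a b).Ok V h ↔ a.Ok V h ∧ b.Ok V h :=
  and_congr_right fun _ => and_iff_left trivial
theorem ok_two : (2 : AExp).Ok V h ↔ 2 ≤ V := Iff.rfl
theorem ok_four : (4 : AExp).Ok V h ↔ 4 ≤ V := Iff.rfl
theorem ok_zero : (0 : AExp).Ok V h ↔ 0 ≤ V := Iff.rfl
theorem ok_one : (1 : AExp).Ok V h ↔ 1 ≤ V := Iff.rfl
theorem ok_var (x : Var) : (AExp.var x).Ok V h ↔ True := Iff.rfl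
theorem ok_get (s : Arr) (e : AExp) :
    (get s e).Ok V h ↔ e.Ok V h ∧ e.eval h < (h.a s).length := Iff.rfl
theorem ok_word (p : Ptr) : (word p).Ok V h ↔ (h.p p).word ≤ V := Iff.rfl
theorem ok_arity (p : Ptr) : (arity p).Ok V h ↔ (h.p p).arity ≤ V := Iff.rfl

end AExp

variable {E : Env} {h h' h₁ h₂ : Mem}

@[simp] theorem Mem.setV_setV (h : Mem) (x : Var) (a b : ℕ) :
    (h.setV x a).setV x b = h.setV x b := by
  simp [Mem.setV]

theorem Mem.setV_self {x : Var} {k : ℕ} (hk : h.v x = k) : h.setV x k = h := by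
  subst hk; simp [Mem.setV]

theorem Mem.setV_comm (h : Mem) {x y : Var} (hxy : x ≠ y) (a b : ℕ) :
    (h.setV x a).setV y b = (h.setV y b).setV x a := by
  simp only [Mem.setV]; rw [Function.update_comm hxy.symm]

theorem Mem.setV_setA (h : Mem) (x : Var) (s : Arr) (a : ℕ) (l : List ℕ) :
    (h.setV x a).setA s l = (h.setA s l).setV x a := rfl

theorem Mem.setA_setA (h : Mem) (s : Arr) (l l' : List ℕ) :
    (h.setA s l).setA s l' = h.setA s l' := by
  simp [Mem.setA]

theorem Mem.setA_self (h : Mem) (s : Arr) : h.setA s (h.a s) = h := by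
  simp [Mem.setA]

/-- `for x < e do c`, for a counter `x` that is `0` before and after. -/
def forE (x : Var) (e : AExp) (c : Code arch) : Code arch :=
  .seq (whileE (.ltE x e) (.seq c (asg x (x + 1)))) (asg x 0)

/-- The memories `st i` are described with the counter at 0, and the actual counter value is laid
over them. In this way a finished loop leaves the counter at 0, as the layout of the memory requires
between statements. -/
theorem Den.forE {x : Var} {e : AExp} {c : Code arch} {T : ℕ} (st : ℕ → Mem) (m : ℕ)
    (hd : e.depth ≤ 15) (hm : m ≤ E.V)
    (hok : ∀ i ≤ m, ((st i).setV x i).Good E → e.Ok E.V ((st i).setV x i))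
    (he : ∀ i ≤ m, e.eval ((st i).setV x i) = m)
    (h0 : (st 0).v x = 0) (hm0 : (st m).v x = 0)
    (H : ∀ i < m, Den E c ((st i).setV x i) T ((st (i + 1)).setV x i)) :
    Den E (forE x e c) (st 0) (m * (T + e.cost + 10) + (e.cost + 7)) (st m) := by
  have h1 := Den.while_iter (E := E) (e := .ltE x e) (c := .seq c (QSim.asg x (.var x + 1))) (T := T + 6)
    (fun i => (st i).setV x i) m (by simp only [AExp.ltE, AExp.depth]; omega)
    (fun i hi hg => (AExp.ok_lt).2 ⟨trivial, hok i hi hg⟩)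
    (fun i hi => by simp [AExp.eval_lt, AExp.eval_var, he i hi.le, hi])
    (by simp [AExp.eval_lt, AExp.eval_var, he m le_rfl])
    (fun i hi => by
      have h2 := Den.asg (E := E) (h := (st (i + 1)).setV x i) (x := x) (e := .var x + 1) (v := i + 1)
        (show (AExp.op .add (AExp.var x) (AExp.lit 1)).depth ≤ 16 by simp [AExp.depth])
        (fun _ => (AExp.ok_add).2 ⟨trivial, by have := E.hV; exact (by omega : 1 ≤ E.V), by
          simp [AExp.eval_var, AExp.eval_one]; omega⟩)
        (by simp [AExp.eval_add, AExp.eval_var, AExp.eval_one])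
      rw [Mem.setV_setV] at h2
      exact (H i hi).seq h2)
  have h3 := Den.asg (E := E) (h := (st m).setV x m) (x := x) (e := 0) (v := 0) (by decide : AExp.depth (AExp.lit 0) ≤ 16)
    (fun _ => Nat.zero_le _) rfl
  rw [Mem.setV_setV, Mem.setV_self hm0] at h3
  have h4 := h1.seq h3
  rw [Mem.setV_self h0] at h4
  refine h4.mono ?_
  have : (AExp.ltE x e).cost = e.cost + 3 := by simp only [AExp.ltE, AExp.cost]; omega
  rw [this, show (0 : AExp).cost = 1 from rfl,
    show e.cost + 3 + 1 + (T + 6) = T + e.cost + 10 by omega]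
  omega

/-- `l` with its first `m` cells replaced by the values of `f`. -/
def fillL (l : List ℕ) (f : ℕ → ℕ) : ℕ → List ℕ
  | 0 => l
  | k + 1 => (fillL l f k).set k (f k)

@[simp] theorem length_fillL (l : List ℕ) (f : ℕ → ℕ) (m : ℕ) :
    (fillL l f m).length = l.length := by
  induction m with
  | zero => rfl
  | succ m ih => simp [fillL, ih]

theorem getElem?_fillL_ge (l : List ℕ) (f : ℕ → ℕ) {m k : ℕ} (h : m ≤ k) :
    (fillL l f m)[k]? = l[k]? := by
  induction m with
  | zero => rfl
  | succ m ih => rw [fillL, List.getElem?_set_ne (by omega), ih (by omega)]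

theorem getElem?_fillL (l : List ℕ) (f : ℕ → ℕ) {m k : ℕ} (h : k < m) (hl : k < l.length) :
    (fillL l f m)[k]? = some (f k) := by
  induction m with
  | zero => omega
  | succ m ih =>
    rw [fillL]
    by_cases hk : k = m
    · subst hk; rw [List.getElem?_set_self (by simpa using hl)]
    · rw [List.getElem?_set_ne (by omega), ih (by omega)]

/-- `for i < len do s[i] := e` -/
def fill (s : Arr) (len e : AExp) : Code arch := forE .i len (put s (.var .i) e)

/-- The factor 300 is generous: a round costs the expression (at most 200), the bound of the loop
(at most 10) and a small overhead. The parameter `S` lets vectors and matrices be charged to the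
same quantity. -/
theorem Den.fill {s : Arr} {len e : AExp} {m S : ℕ} (f : ℕ → ℕ) (hs : s ≠ .D)
    (hdl : len.depth ≤ 15) (hde : e.depth ≤ 15) (hcl : len.cost ≤ 10) (hce : e.cost ≤ 200)
    (hmS : m ≤ S) (hS : 1 ≤ S)
    (h0 : h.v .i = 0) (hm : m ≤ (h.a s).length) (hmV : m ≤ E.V)
    (hokl : ∀ k ≤ m, len.Ok E.V ((h.setA s (fillL (h.a s) f k)).setV .i k))
    (hl : ∀ k ≤ m, len.eval ((h.setA s (fillL (h.a s) f k)).setV .i k) = m)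
    (hok : ∀ k < m, ((h.setA s (fillL (h.a s) f k)).setV .i k).Good E →
      e.Ok E.V ((h.setA s (fillL (h.a s) f k)).setV .i k))
    (he : ∀ k < m, e.eval ((h.setA s (fillL (h.a s) f k)).setV .i k) = f k)
    (hf : ∀ k < m, f k ≤ 3) :
    Den E (fill s len e) h (300 * S) (h.setA s (fillL (h.a s) f m)) := by
  have h1 := Den.forE (E := E) (x := .i) (e := len) (c := QSim.put s (.var .i) e) (T := e.cost + 3)
    (fun k => h.setA s (fillL (h.a s) f k)) m hdl hmV (fun k hk _ => hokl k hk) hl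
    (by simpa using h0) (by simpa using h0) (fun k hk => by
      have h2 := Den.put (E := E) (h := (h.setA s (fillL (h.a s) f k)).setV .i k) (s := s)
        (e₁ := .var .i) (e₂ := e) (i := k) (v := f k) (by simp [AExp.depth]) hde
        (fun _ => trivial) (hok k hk)
        (by simp [AExp.eval_var]) (he k hk) hs (hf k hk) (by simp; omega)
      rw [Mem.setV_setA, Mem.setA_setA] at h2
      simp only [Mem.setV_a, Mem.setA_a, if_true] at h2
      exact h2.mono (by simp only [AExp.cost]; omega))
  simp only [fillL, Mem.setA_self] at h1
  refine h1.mono ?_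
  have : m * (e.cost + 3 + len.cost + 10) ≤ S * 223 := Nat.mul_le_mul hmS (by omega)
  omega

/-- `x := 0; for y < len do x := e` -/
def fold (y x : Var) (len e : AExp) : Code arch := .seq (asg x 0) (forE y len (asg x e))

theorem Den.fold {x y : Var} {len e : AExp} {m S : ℕ} (g : ℕ → ℕ) (hx : x ≠ y)
    (hdl : len.depth ≤ 15) (hde : e.depth ≤ 16) (hcl : len.cost ≤ 10) (hce : e.cost ≤ 200)
    (hmS : m ≤ S) (hS : 1 ≤ S)
    (h0 : h.v y = 0) (hmV : m ≤ E.V)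
    (hokl : ∀ k ≤ m, len.Ok E.V ((h.setV x (g k)).setV y k))
    (hl : ∀ k ≤ m, len.eval ((h.setV x (g k)).setV y k) = m)
    (hok : ∀ k < m, ((h.setV x (g k)).setV y k).Good E → e.Ok E.V ((h.setV x (g k)).setV y k))
    (hg : g 0 = 0)
    (he : ∀ k < m, e.eval ((h.setV x (g k)).setV y k) = g (k + 1)) :
    Den E (fold y x len e) h (300 * S) (h.setV x (g m)) := by
  have h3 := Den.asg (E := E) (h := h) (x := x) (e := 0) (v := 0)
    (by decide : AExp.depth (AExp.lit 0) ≤ 16) (fun _ => Nat.zero_le _) rfl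
  have h1 := Den.forE (E := E) (x := y) (e := len) (c := QSim.asg x e) (T := e.cost + 2)
    (fun k => h.setV x (g k)) m hdl hmV (fun k hk _ => hokl k hk) hl
    (by simp [hx.symm, h0]) (by simp [hx.symm, h0]) (fun k hk => by
      have h2 := Den.asg (E := E) (h := (h.setV x (g k)).setV y k) (x := x) (e := e)
        hde (hok k hk) (he k hk)
      rw [← Mem.setV_comm _ hx, Mem.setV_setV] at h2
      exact h2)
  simp only [hg] at h1
  refine (h3.seq h1).mono ?_
  have : m * (e.cost + 2 + len.cost + 10) ≤ S * 222 := Nat.mul_le_mul hmS (by omega)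
  rw [show (0 : AExp).cost = 1 from rfl]
  omega

/-- The program has an execution as described that ends in a memory with the property `Q`. -/
def Tri (E : Env) (c : Code arch) (h : Mem) (T : ℕ) (Q : Mem → Prop) : Prop :=
  ∃ h', Den E c h T h' ∧ Q h'

theorem Den.tri {c : Code arch} {T : ℕ} {Q : Mem → Prop} (H : Den E c h T h') (hQ : Q h') :
    Tri E c h T Q := ⟨h', H, hQ⟩

theorem Tri.seq {c₁ c₂ : Code arch} {T₁ T₂ : ℕ} {Q₁ Q : Mem → Prop} (H₁ : Tri E c₁ h T₁ Q₁)
    (H₂ : ∀ h₁, Q₁ h₁ → Tri E c₂ h₁ T₂ Q) : Tri E (.seq c₁ c₂) h (T₁ + T₂) Q := by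
  obtain ⟨h₁, a, b⟩ := H₁
  obtain ⟨h₂, a', b'⟩ := H₂ h₁ b
  exact ⟨h₂, a.seq a', b'⟩

theorem Den.seq_tri {c₁ c₂ : Code arch} {T₁ T₂ : ℕ} {Q : Mem → Prop} (H₁ : Den E c₁ h T₁ h₁)
    (H₂ : Tri E c₂ h₁ T₂ Q) : Tri E (.seq c₁ c₂) h (T₁ + T₂) Q := by
  obtain ⟨h₂, a', b'⟩ := H₂
  exact ⟨h₂, H₁.seq a', b'⟩

theorem Tri.mono {c : Code arch} {T T' : ℕ} {Q Q' : Mem → Prop} (H : Tri E c h T Q) (hT : T ≤ T')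
    (hQ : ∀ h', Q h' → Q' h') : Tri E c h T' Q' := by
  obtain ⟨h₁, a, b⟩ := H
  exact ⟨h₁, a.mono hT, hQ _ b⟩

theorem Tri.ifE {e : AExp} {c₁ c₂ : Code arch} {T : ℕ} {Q : Mem → Prop} (hd : e.depth ≤ 16)
    (hok : h.Good E → e.Ok E.V h) (H₁ : e.eval h ≠ 0 → Tri E c₁ h T Q)
    (H₂ : e.eval h = 0 → Tri E c₂ h T Q) : Tri E (ifE e c₁ c₂) h (e.cost + (T + 1)) Q := by
  by_cases he : e.eval h = 0
  · obtain ⟨h', a, b⟩ := H₂ he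
    exact ⟨h', Den.ifE_neg hd hok he a, b⟩
  · obtain ⟨h', a, b⟩ := H₁ he
    exact ⟨h', Den.ifE_pos hd hok he a, b⟩

end QSim

namespace QSim

/-! # Stabilizer states as quadratic forms on affine subspaces -/

/-- The bits of `x`, followed by the constant `1` as number `N`. -/
def ext (N : ℕ) (x : ℕ → Bool) (i : ℕ) : ℕ := if i < N then (x i).toNat else 1

def lin (N : ℕ) (u : ℕ → ℕ) (x : ℕ → Bool) : ℕ := ∑ j ∈ Finset.range (N + 1), u j * ext N x j

def qf (N : ℕ) (B : ℕ → ℕ → ℕ) (x : ℕ → Bool) : ℕ :=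
  ∑ i ∈ Finset.range (N + 1), ∑ j ∈ Finset.range (N + 1), B i j * ext N x i * ext N x j

/-- The affine equations `x = M x` modulo `2`. -/
def Sat (N : ℕ) (M : ℕ → ℕ → ℕ) (x : ℕ → Bool) : Prop :=
  ∀ i ≤ N, lin N (M i) x ≡ ext N x i [MOD 2]

structure Tab : Type where
  M : ℕ → ℕ → ℕ
  B : ℕ → ℕ → ℕ
  amp : ℂ

open Classical in
/-- The state with amplitude `amp * I ^ (xᵀ B x)` at the solutions `x` of `x = M x`. -/
noncomputable def Tab.den (N : ℕ) (T : Tab) : State ℕ :=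
  fun x => if Sat N T.M x then T.amp * Complex.I ^ qf N T.B x else 0

open Classical in
theorem Tab.den_mk {N : ℕ} {x : ℕ → Bool} (M B : ℕ → ℕ → ℕ) (a : ℂ) :
    Tab.den N ⟨M, B, a⟩ x = if Sat N M x then a * Complex.I ^ qf N B x else 0 := rfl

open Classical in
theorem Tab.den_apply {N : ℕ} (x : ℕ → Bool) (T : Tab) :
    T.den N x = if Sat N T.M x then T.amp * Complex.I ^ qf N T.B x else 0 := rfl

def unitRow (q j : ℕ) : ℕ := if j = q then 1 else 0

/-- By `free`, a variable that occurs on the right-hand side of any equation has the trivial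
equation itself. So `M` is idempotent, and its rows parametrize the affine subspace by the free
variables: `q` is free if `M q q = 1`, otherwise its column vanishes. The constant coordinate `N`
counts as free. -/
structure Tab.Valid (N : ℕ) (T : Tab) : Prop where
  M_le : ∀ i ≤ N, ∀ j ≤ N, T.M i j ≤ 1
  B_le : ∀ i ≤ N, ∀ j ≤ N, T.B i j ≤ 3
  symm : ∀ i ≤ N, ∀ j ≤ N, T.B i j = T.B j i
  free : ∀ i ≤ N, ∀ j ≤ N, T.M i j = 1 → ∀ k ≤ N, T.M j k = unitRow j k
  last : ∀ k ≤ N, T.M N k = unitRow N k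

variable {N q : ℕ} {x : ℕ → Bool} {T : Tab}

theorem ext_last : ext N x N = 1 := by simp [ext]

theorem ext_lt (hq : q < N) : ext N x q = (x q).toNat := by simp [ext, hq]

theorem ext_update (hq : q < N) (v : Bool) (j : ℕ) :
    ext N (Function.update x q v) j = if j = q then v.toNat else ext N x j := by
  unfold ext
  by_cases h : j = q
  · subst h; simp [hq]
  · simp [h]

theorem lin_congr {u v : ℕ → ℕ} {m : ℕ} (h : ∀ j ≤ N, u j ≡ v j [MOD m]) :
    lin N u x ≡ lin N v x [MOD m] := by
  unfold lin
  rw [← ZMod.natCast_eq_natCast_iff]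
  push_cast
  refine Finset.sum_congr rfl fun j hj => ?_
  rw [(ZMod.natCast_eq_natCast_iff _ _ _).2 (h j (by simp at hj; omega))]

theorem lin_add (u v : ℕ → ℕ) : lin N (fun j => u j + v j) x = lin N u x + lin N v x := by
  simp only [lin, add_mul, Finset.sum_add_distrib]

theorem lin_smul (c : ℕ) (u : ℕ → ℕ) : lin N (fun j => c * u j) x = c * lin N u x := by
  simp only [lin, mul_assoc, Finset.mul_sum]

theorem lin_unit (hq : q ≤ N) : lin N (unitRow q) x = ext N x q := by
  unfold lin
  rw [Finset.sum_eq_single q]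
  · simp [unitRow]
  · intro j _ hj; simp [unitRow, hj]
  · intro h; simp at h; omega

theorem lin_eq_of {u v : ℕ → ℕ} (h : ∀ j ≤ N, u j = v j) : lin N u x = lin N v x :=
  Finset.sum_congr rfl fun j hj => by rw [h j (by simp at hj; omega)]

theorem lin_sum (W : ℕ → ℕ) (M : ℕ → ℕ → ℕ) :
    lin N (fun k => ∑ j ∈ Finset.range (N + 1), W j * M j k) x =
      ∑ j ∈ Finset.range (N + 1), W j * lin N (M j) x := by
  simp only [lin, Finset.sum_mul, Finset.mul_sum, mul_assoc]
  exact Finset.sum_comm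

theorem lin_update {u : ℕ → ℕ} (hq : q < N) (hu : u q = 0) (v : Bool) :
    lin N u (Function.update x q v) = lin N u x := by
  refine Finset.sum_congr rfl fun j _ => ?_
  rw [ext_update hq]
  split
  · rename_i h; subst h; simp [hu]
  · rfl

/-- Eliminating the pivot `p` of an equation `z`. -/
def elim (M : ℕ → ℕ → ℕ) (p : ℕ) (z : ℕ → ℕ) (i j : ℕ) : ℕ := (M i j + M i p * z j) % 2

/-- Row `p` was trivial and becomes `x_p = x_p + z · x`, which says exactly that `z · x` is even.
Given this, the other rows have changed by even numbers only. -/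
theorem sat_elim {M : ℕ → ℕ → ℕ} {p : ℕ} {z : ℕ → ℕ} (hp : p ≤ N)
    (hM : ∀ k ≤ N, M p k = unitRow p k) :
    Sat N (elim M p z) x ↔ Sat N M x ∧ lin N z x ≡ 0 [MOD 2] := by
  have key : ∀ i, lin N (elim M p z i) x ≡ lin N (M i) x + M i p * lin N z x [MOD 2] := by
    intro i
    rw [← lin_smul, ← lin_add]
    exact lin_congr fun j _ => Nat.mod_modEq _ _
  constructor
  · intro h
    have hzero : lin N z x ≡ 0 [MOD 2] := by
      have h1 := (key p).symm.trans (h p hp)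
      rw [lin_eq_of hM, lin_unit hp, hM p hp] at h1
      simp only [unitRow, if_true, one_mul] at h1
      exact Nat.ModEq.add_left_cancel' (ext N x p) (by simpa using h1)
    refine ⟨fun i hi => ?_, hzero⟩
    have h1 := (key i).symm.trans (h i hi)
    refine Nat.ModEq.trans ?_ h1
    simpa using (hzero.symm.mul_left (M i p)).add_left (lin N (M i) x)
  · rintro ⟨h, hzero⟩ i hi
    refine (key i).trans (Nat.ModEq.trans ?_ (h i hi))
    simpa using (hzero.mul_left (M i p)).add_left (lin N (M i) x)

/-- Substituting for `p` brings the variables of `z` into other rows, so these must be free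
afterwards. The second alternative in `hf` is for a variable that was bound before and is set free
by the elimination, as in `H_swap`. -/
theorem valid_elim (hT : T.Valid N) {p : ℕ} {z : ℕ → ℕ} (hp : p < N) (hz : z p = 1)
    (hM : ∀ k ≤ N, T.M p k = unitRow p k)
    (hf : ∀ j ≤ N, j ≠ p → z j % 2 = 1 → T.M j j = 1 ∨ ∀ k ≤ N, elim T.M p z j k = unitRow j k) :
    Tab.Valid N { T with M := elim T.M p z } := by
  have row : ∀ j ≤ N, j ≠ p → T.M j j = 1 → ∀ k ≤ N, elim T.M p z j k = unitRow j k := by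
    intro j hj hjp h k hk
    have h1 := hT.free j hj j hj h
    simp only [elim, h1 k hk, h1 p hp.le, unitRow, if_neg (Ne.symm hjp)]
    split <;> simp
  refine ⟨fun i _ j _ => ?_, hT.B_le, hT.symm, ?_, row N le_rfl hp.ne' ?_⟩
  · simp only [elim]; omega
  · intro i hi j hj hij
    have hjp : j ≠ p := by
      rintro rfl
      simp only [elim, hz] at hij
      omega
    by_cases h1 : T.M i j = 1
    · refine row j hj hjp ?_
      rw [hT.free i hi j hj h1 j hj]; simp [unitRow]
    · have h0 : T.M i j = 0 := by have := hT.M_le i hi j hj; omega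
      have hzj : z j % 2 = 1 := by
        simp only [elim, h0, zero_add] at hij
        have := hT.M_le i hi p hp.le
        interval_cases T.M i p <;> simp_all
      rcases hf j hj hjp hzj with h | h
      · exact row j hj hjp h
      · exact h
  · rw [hT.last N le_rfl]; simp [unitRow]

/-! ## Measurements -/

/-- The equation `x_q = b`, with `x_q` replaced by row `q`. -/
def measRow (N : ℕ) (M : ℕ → ℕ → ℕ) (q : ℕ) (b : Bool) (j : ℕ) : ℕ :=
  (M q j + b.toNat * unitRow N j) % 2

theorem lin_measRow (hq : q < N) (b : Bool) (h : Sat N T.M x) :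
    lin N (measRow N T.M q b) x ≡ (x q).toNat + b.toNat [MOD 2] := by
  have h1 : lin N (measRow N T.M q b) x ≡
      lin N (fun j => T.M q j + b.toNat * unitRow N j) x [MOD 2] :=
    lin_congr fun j _ => Nat.mod_modEq _ _
  refine h1.trans ?_
  rw [lin_add, lin_smul, lin_unit le_rfl, ext_last, mul_one, ← ext_lt hq]
  exact (h q hq.le).add_right _

theorem toNat_add_modEq (a b : Bool) : a.toNat + b.toNat ≡ 0 [MOD 2] ↔ a = b := by
  cases a <;> cases b <;> simp [Nat.ModEq]

/-- Row `q` contains a free variable `p`, so the outcome is not determined. The equation `x_q = b`,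
written in free variables, is solved for `p`, which becomes bound. -/
theorem meas_pivot (hT : T.Valid N) (hq : q < N) (b : Bool) {p : ℕ} (hp : p < N)
    (hz : measRow N T.M q b p = 1) :
    Tab.Valid N { T with M := elim T.M p (measRow N T.M q b) } ∧
    Tab.den N { T with M := elim T.M p (measRow N T.M q b) } =
      (Gate.meas q b).apply (T.den N) := by
  have hqp : T.M q p = 1 := by
    simp only [measRow, unitRow, if_neg hp.ne, mul_zero, add_zero] at hz
    have := hT.M_le q hq.le p hp.le
    omega
  have hrow := hT.free q hq.le p hp.le hqp
  refine ⟨valid_elim hT hp hz hrow ?_, ?_⟩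
  · intro j hj _ h
    left
    by_cases hjN : j = N
    · subst hjN; rw [hT.last j le_rfl]; simp [unitRow]
    · simp only [measRow, unitRow, if_neg hjN, mul_zero, add_zero] at h
      have := hT.M_le q hq.le j hj
      rw [hT.free q hq.le j hj (by omega) j hj]; simp [unitRow]
  · classical
    funext x
    have h0 := sat_elim (M := T.M) (x := x) (z := measRow N T.M q b) hp.le hrow
    simp only [Gate.apply]
    rw [Tab.den_mk, Tab.den_apply x T]
    simp only [h0]
    by_cases h : Sat N T.M x
    · have h1 : lin N (measRow N T.M q b) x ≡ 0 [MOD 2] ↔ x q = b := by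
        rw [← toNat_add_modEq]
        exact ⟨(lin_measRow hq b h).symm.trans, (lin_measRow hq b h).trans⟩
      simp only [h, true_and, if_true, h1]
    · simp [h]

/-- Without a free variable in row `q`, the bit `x_q` is constant on the support. The projection
keeps the state or kills it, according to the remaining constant. -/
theorem meas_const (hq : q < N) (b : Bool)
    (hz : ∀ p < N, measRow N T.M q b p = 0) :
    Tab.den N { T with amp := if measRow N T.M q b N = 0 then T.amp else 0 } =
      (Gate.meas q b).apply (T.den N) := by
  funext x
  simp only [Tab.den, Gate.apply]
  by_cases h : Sat N T.M x
  · have h1 := lin_measRow hq b h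
    have h2 : lin N (measRow N T.M q b) x = measRow N T.M q b N := by
      unfold lin
      rw [Finset.sum_range_succ, Finset.sum_eq_zero, zero_add, ext_last, mul_one]
      intro j hj
      rw [hz j (by simpa using hj), zero_mul]
    have h3 : measRow N T.M q b N = 0 ↔ x q = b := by
      rw [← toNat_add_modEq, ← h2]
      have : measRow N T.M q b N < 2 := Nat.mod_lt _ (by decide)
      rw [← h2] at this
      unfold Nat.ModEq at *
      omega
    simp only [h, if_true, h3]
    split <;> simp
  · simp [h]

/-! ## Diagonal gates -/

theorem qf_congr {B B' : ℕ → ℕ → ℕ} (h : ∀ i ≤ N, ∀ j ≤ N, B i j ≡ B' i j [MOD 4]) :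
    qf N B x ≡ qf N B' x [MOD 4] := by
  unfold qf
  rw [← ZMod.natCast_eq_natCast_iff]
  push_cast
  refine Finset.sum_congr rfl fun i hi => Finset.sum_congr rfl fun j hj => ?_
  rw [(ZMod.natCast_eq_natCast_iff _ _ _).2
    (h i (by simp at hi; omega) j (by simp at hj; omega))]

theorem qf_add (B B' : ℕ → ℕ → ℕ) :
    qf N (fun i j => B i j + B' i j) x = qf N B x + qf N B' x := by
  simp only [qf, add_mul, Finset.sum_add_distrib]

theorem qf_mul (c : ℕ) (u v : ℕ → ℕ) :
    qf N (fun i j => c * (u i * v j)) x = c * (lin N u x * lin N v x) := by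
  simp only [qf, lin]
  rw [Finset.sum_mul_sum, Finset.mul_sum]
  simp only [Finset.mul_sum]
  exact Finset.sum_congr rfl fun i _ => Finset.sum_congr rfl fun j _ => by ring

theorem I_pow_congr {a b : ℕ} (h : a ≡ b [MOD 4]) : Complex.I ^ a = Complex.I ^ b := by
  rw [← Nat.div_add_mod a 4, ← Nat.div_add_mod b 4, h]
  simp [pow_add, pow_mul]

/-- Adding `1` to the entry `(c, t)`, modulo `4`. -/
def bump (B : ℕ → ℕ → ℕ) (c t i j : ℕ) : ℕ := (B i j + unitRow c i * unitRow t j) % 4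

theorem qf_bump {c t : ℕ} (hc : c ≤ N) (ht : t ≤ N) (B : ℕ → ℕ → ℕ) :
    qf N (bump B c t) x ≡ qf N B x + ext N x c * ext N x t [MOD 4] := by
  have h1 : qf N (bump B c t) x ≡
      qf N (fun i j => B i j + 1 * (unitRow c i * unitRow t j)) x [MOD 4] :=
    qf_congr fun i _ j _ => by rw [one_mul]; exact Nat.mod_modEq _ _
  rw [qf_add, qf_mul, lin_unit hc, lin_unit ht, one_mul] at h1
  exact h1

theorem S_valid (hT : T.Valid N) : Tab.Valid N { T with B := bump T.B q q } :=
  ⟨hT.M_le, fun i _ j _ => by simp only [bump]; omega,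
    fun i hi j hj => by simp only [bump, hT.symm i hi j hj, mul_comm], hT.free, hT.last⟩

theorem S_den (hq : q < N) :
    Tab.den N { T with B := bump T.B q q } = (Gate.S q).apply (T.den N) := by
  funext x
  simp only [Tab.den, Gate.apply]
  by_cases h : Sat N T.M x
  · simp only [h, if_true, I_pow_congr (qf_bump hq.le hq.le T.B), pow_add, ext_lt hq]
    cases x q <;> simp
    ring
  · simp [h]

/-- Both entries `(c, q)` and `(q, c)` are increased. This preserves symmetry and adds `2 x_c x_q`
to the exponent of `I`, which is the controlled sign. -/
theorem CZ_valid (hT : T.Valid N) {c : ℕ} :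
    Tab.Valid N { T with B := bump (bump T.B c q) q c } :=
  ⟨hT.M_le, fun i _ j _ => by simp only [bump]; omega,
    fun i hi j hj => by
      simp only [bump, hT.symm i hi j hj, Nat.mod_add_mod]
      congr 1
      ring, hT.free, hT.last⟩

theorem CZ_den {c : ℕ} (hq : q < N) (hc : c < N) :
    Tab.den N { T with B := bump (bump T.B c q) q c } =
      fun x => (if x c && x q then -1 else 1) * T.den N x := by
  funext x
  simp only [Tab.den]
  by_cases h : Sat N T.M x
  · have h1 := (qf_bump (x := x) hq.le hc.le (bump T.B c q)).trans
      ((qf_bump (x := x) hc.le hq.le T.B).add_right _)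
    simp only [h, if_true, I_pow_congr h1, pow_add, ext_lt hq, ext_lt hc]
    cases x q <;> cases x c <;> simp
    linear_combination (T.amp * Complex.I ^ qf N T.B x) * Complex.I_mul_I
  · simp [h]

theorem sqrt_half_mul_self : ((1 / Real.sqrt 2 : ℝ) : ℂ) * ((1 / Real.sqrt 2 : ℝ) : ℂ) = 1 / 2 := by
  rw [← Complex.ofReal_mul, div_mul_div_comm, Real.mul_self_sqrt (by norm_num)]
  norm_num

/-- Conjugation by a Hadamard gate on the target turns the controlled sign into a controlled flip,
so only diagonal gates and Hadamard gates have to be treated on tableaux. -/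
theorem CX_eq {c : ℕ} (h : c ≠ q) (ψ : State ℕ) :
    (Gate.CX c q h).apply ψ = (Gate.H q).apply
      (fun x => (if x c && x q then -1 else 1) * (Gate.H q).apply ψ x) := by
  have hs := sqrt_half_mul_self
  funext x
  simp only [Gate.apply, Function.update_self, Function.update_idem, Function.update_of_ne h]
  cases hc : x c <;> cases hq : x q <;> simp only [Bool.false_eq_true,
    if_true, if_false, Bool.and_true, Bool.and_false, Bool.xor_false, Bool.xor_true,
    Bool.not_false, Bool.not_true]
  · linear_combination -2 * ψ (Function.update x q false) * hs
  · linear_combination -2 * ψ (Function.update x q true) * hs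
  · linear_combination -2 * ψ (Function.update x q true) * hs
  · linear_combination -2 * ψ (Function.update x q false) * hs

/-! ## The Hadamard gate -/

theorem H_apply (ψ : State ℕ) : (Gate.H q).apply ψ x = ((1 / Real.sqrt 2 : ℝ) : ℂ) *
    (ψ (Function.update x q false) + Complex.I ^ (2 * (x q).toNat) *
      ψ (Function.update x q true)) := by
  simp only [Gate.apply]
  cases x q <;> simp

/-- Row `q` of `B`, with the diagonal entry replaced by `1`. -/
def hadRow (B : ℕ → ℕ → ℕ) (q j : ℕ) : ℕ := if j = q then 1 else B q j

/-- `B` without its row and column `q`. -/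
def minor (B : ℕ → ℕ → ℕ) (q i j : ℕ) : ℕ := if i = q ∨ j = q then 0 else B i j

/-- One formula for all cases of the Hadamard gate. With `w = hadRow B q`, it adds `2α (z·x)(w·x) +
β (z·x)² + γ (w·x)²` to the form without `x_q`, in a symmetric way. The triples used are `(1, B q q,
0)` for a bound qubit, and `(0, 0, 4 - B q q)` and `(0, 0, 0)` for a free one. -/
def hadB (B : ℕ → ℕ → ℕ) (q : ℕ) (z : ℕ → ℕ) (α β γ : ℕ) (i j : ℕ) : ℕ :=
  (minor B q i j + α * (z i * hadRow B q j + hadRow B q i * z j) + β * (z i * z j) +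
    γ * (hadRow B q i * hadRow B q j)) % 4

def setRow (M : ℕ → ℕ → ℕ) (q : ℕ) (z : ℕ → ℕ) (i j : ℕ) : ℕ := if i = q then z j else M i j

theorem qf_hadB (B : ℕ → ℕ → ℕ) (z : ℕ → ℕ) (α β γ : ℕ) :
    qf N (hadB B q z α β γ) x ≡ qf N (minor B q) x +
      2 * α * (lin N z x * lin N (hadRow B q) x) + β * (lin N z x * lin N z x) +
      γ * (lin N (hadRow B q) x * lin N (hadRow B q) x) [MOD 4] := by
  have h1 : qf N (hadB B q z α β γ) x ≡ qf N (fun i j => minor B q i j +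
      (α * (z i * hadRow B q j) + α * (hadRow B q i * z j)) + β * (z i * z j) +
        γ * (hadRow B q i * hadRow B q j)) x [MOD 4] :=
    qf_congr fun i _ j _ => by
      simp only [hadB, mul_add]; exact Nat.mod_modEq _ _
  simp only [qf_add, qf_mul] at h1
  refine h1.trans (congrArg (· % 4) ?_)
  ring

/-- Splits off the terms that contain the summation variable `v`. The term `2 v x_q` on the left is
the sign of the Hadamard gate; it is absorbed on the right by the diagonal entry 1 of `hadRow`, so
that one linear form collects everything that is multiplied by `2 v`. -/
theorem qf_update (hq : q < N) (B : ℕ → ℕ → ℕ) (hB : ∀ i ≤ N, ∀ j ≤ N, B i j = B j i) (v : Bool) :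
    qf N B (Function.update x q v) + 2 * v.toNat * (x q).toNat =
      qf N (minor B q) x + 2 * v.toNat * lin N (hadRow B q) x + B q q * v.toNat ^ 2 := by
  set g : ℕ → ℕ := fun i => if i = q then 0 else ext N x i with hg
  have hqr : q ∈ Finset.range (N + 1) := by simp; omega
  have e1 : ∀ i, ext N (Function.update x q v) i = g i + v.toNat * unitRow q i := by
    intro i; rw [ext_update hq]; simp only [hg, unitRow]; split <;> simp
  have e2 : qf N (minor B q) x = ∑ i ∈ Finset.range (N + 1), ∑ j ∈ Finset.range (N + 1),
      B i j * g i * g j := by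
    refine Finset.sum_congr rfl fun i _ => Finset.sum_congr rfl fun j _ => ?_
    by_cases h1 : i = q <;> by_cases h2 : j = q <;> simp [minor, hg, h1, h2]
  have e3 : lin N (hadRow B q) x = (∑ j ∈ Finset.range (N + 1), B q j * g j) + (x q).toNat := by
    rw [← ext_lt hq, ← lin_unit hq.le, lin, lin, ← Finset.sum_add_distrib]
    refine Finset.sum_congr rfl fun j _ => ?_
    by_cases h : j = q <;> simp [hadRow, hg, unitRow, h]
  have e4 : qf N B (Function.update x q v) =
      (∑ i ∈ Finset.range (N + 1), ∑ j ∈ Finset.range (N + 1), B i j * g i * g j) +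
      v.toNat * (∑ j ∈ Finset.range (N + 1), B q j * g j) +
      v.toNat * (∑ i ∈ Finset.range (N + 1), B i q * g i) + v.toNat ^ 2 * B q q := by
    have : ∀ i j, B i j * (g i + v.toNat * unitRow q i) * (g j + v.toNat * unitRow q j) =
        B i j * g i * g j + v.toNat * (unitRow q i * (B i j * g j)) +
        v.toNat * (unitRow q j * (B i j * g i)) +
        v.toNat ^ 2 * (unitRow q i * (unitRow q j * B i j)) := by intros; ring
    simp only [qf, e1, this, Finset.sum_add_distrib, ← Finset.mul_sum]
    simp only [unitRow, ite_mul, one_mul, zero_mul, Finset.sum_ite_eq', hqr, if_true]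
  have e5 : ∑ i ∈ Finset.range (N + 1), B i q * g i = ∑ j ∈ Finset.range (N + 1), B q j * g j :=
    Finset.sum_congr rfl fun i hi => by rw [hB i (by simp at hi; omega) q hq.le]
  rw [e4, e5, ← e2, e3]
  ring

theorem hadB_le (B : ℕ → ℕ → ℕ) (z : ℕ → ℕ) (α β γ i j : ℕ) : hadB B q z α β γ i j ≤ 3 := by
  simp only [hadB]; omega

theorem hadB_symm {B : ℕ → ℕ → ℕ} {z : ℕ → ℕ} {α β γ i j : ℕ} (h : B i j = B j i) :
    hadB B q z α β γ i j = hadB B q z α β γ j i := by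
  simp only [hadB, minor, h, or_comm]
  congr 1
  ring

/-- The equations other than number `q`. -/
def SatNe (N : ℕ) (M : ℕ → ℕ → ℕ) (q : ℕ) (x : ℕ → Bool) : Prop :=
  ∀ i ≤ N, i ≠ q → lin N (M i) x ≡ ext N x i [MOD 2]

theorem sat_iff {M : ℕ → ℕ → ℕ} (hq : q ≤ N) :
    Sat N M x ↔ SatNe N M q x ∧ lin N (M q) x ≡ ext N x q [MOD 2] := by
  constructor
  · exact fun h => ⟨fun i hi _ => h i hi, h q hq⟩
  · rintro ⟨h, h'⟩ i hi
    by_cases hiq : i = q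
    · exact hiq ▸ h'
    · exact h i hi hiq

theorem satNe_update {M : ℕ → ℕ → ℕ} (hq : q < N) (hM : ∀ i ≤ N, i ≠ q → M i q = 0) (v : Bool) :
    SatNe N M q (Function.update x q v) ↔ SatNe N M q x := by
  refine forall₃_congr fun i hi hiq => ?_
  rw [lin_update hq (hM i hi hiq), ext_update hq, if_neg hiq]

theorem satNe_setRow {M : ℕ → ℕ → ℕ} {z : ℕ → ℕ} : SatNe N (setRow M q z) q x ↔ SatNe N M q x := by
  refine forall₃_congr fun i hi hiq => ?_
  have : setRow M q z i = M i := by funext j; simp [setRow, hiq]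
  rw [this]

theorem setRow_self (M : ℕ → ℕ → ℕ) (z : ℕ → ℕ) : setRow M q z q = z := by
  funext j; simp [setRow]

/-- The equation `z`, which says that `x_r` equals its row, holds on the whole support. Eliminating
it changes only the description of the state. As row `r` contains `q`, it can be solved for `q`, and
the two variables exchange roles: `q` becomes bound and `r` free. -/
theorem H_swap (hT : T.Valid N) (hq : q < N) (hqq : T.M q q = 1) {r : ℕ} (hr : r < N) (hrq : r ≠ q)
    (hM : T.M r q = 1) {z : ℕ → ℕ} (hz : ∀ j ≤ N, z j = (T.M r j + unitRow r j) % 2) :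
    Tab.Valid N { T with M := elim T.M q z } ∧
      Tab.den N { T with M := elim T.M q z } = T.den N ∧ elim T.M q z q q = 0 := by
  have hrow := hT.free q hq.le q hq.le hqq
  have hz1 : z q = 1 := by rw [hz q hq.le]; simp [hM, unitRow, hrq.symm]
  refine ⟨valid_elim hT hq hz1 hrow ?_, ?_, ?_⟩
  · intro j hj hjq h
    rw [hz j hj] at h
    by_cases hjr : j = r
    · subst hjr
      right
      intro k hk
      simp only [elim, hM, one_mul, hz k hk]
      have := hT.M_le j hj k hk
      have : unitRow j k ≤ 1 := by unfold unitRow; split <;> omega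
      omega
    · left
      simp only [unitRow, if_neg hjr, add_zero] at h
      have := hT.M_le r hr.le j hj
      rw [hT.free r hr.le j hj (by omega) j hj]; simp [unitRow]
  · classical
    funext x
    have h0 := sat_elim (M := T.M) (x := x) (z := z) hq.le hrow
    have h1 : Sat N T.M x → lin N z x ≡ 0 [MOD 2] := by
      intro h
      have h2 : lin N z x ≡ lin N (fun j => T.M r j + unitRow r j) x [MOD 2] :=
        lin_congr fun j hj => by rw [hz j hj]; exact Nat.mod_modEq _ _
      refine h2.trans ?_
      rw [lin_add, lin_unit hr.le]
      refine ((h r hr.le).add_right _).trans ?_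
      rw [← two_mul]
      exact (Nat.modEq_zero_iff_dvd).2 (dvd_mul_right _ _)
    have h2 : Sat N (elim T.M q z) x ↔ Sat N T.M x := h0.trans (and_iff_left_of_imp h1)
    rw [Tab.den_mk, Tab.den_apply x T]
    simp only [h2]
  · simp [elim, hqq, hz1]

theorem col_zero_of_bound (hT : T.Valid N) (hq : q < N) (hqq : T.M q q = 0) :
    ∀ i ≤ N, T.M i q = 0 := by
  intro i hi
  by_contra h
  have := hT.M_le i hi q hq.le
  have h1 := hT.free i hi q hq.le (by omega) q hq.le
  simp [unitRow, hqq] at h1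

theorem parity_bool (m : ℕ) : ∃ v : Bool, m ≡ v.toNat [MOD 2] ∧ ¬ m ≡ (!v).toNat [MOD 2] := by
  rcases Nat.mod_two_eq_zero_or_one m with h | h
  · exact ⟨false, by simp [Nat.ModEq, h], by simp [Nat.ModEq, h]⟩
  · exact ⟨true, by simp [Nat.ModEq, h], by simp [Nat.ModEq, h]⟩

/-- The old value of qubit `q` is forced to be the parity of `lin (M q)`, so exactly one of the two
summands survives. The new `x_q` is unconstrained and enters through the sign; hence `q` becomes
free, and the old value is replaced in the exponent by its linear form. -/
theorem H_bound (hT : T.Valid N) (hq : q < N) (hqq : T.M q q = 0) :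
    Tab.Valid N ⟨setRow T.M q (unitRow q), hadB T.B q (T.M q) 1 (T.B q q) 0,
      T.amp * ((1 / Real.sqrt 2 : ℝ) : ℂ)⟩ ∧
    Tab.den N ⟨setRow T.M q (unitRow q), hadB T.B q (T.M q) 1 (T.B q q) 0,
      T.amp * ((1 / Real.sqrt 2 : ℝ) : ℂ)⟩ = (Gate.H q).apply (T.den N) := by
  have hcol := col_zero_of_bound hT hq hqq
  refine ⟨⟨?_, fun i _ j _ => hadB_le _ _ _ _ _ _ _,
    fun i hi j hj => hadB_symm (hT.symm i hi j hj), ?_, ?_⟩, ?_⟩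
  · intro i hi j hj
    simp only [setRow, unitRow]
    have := hT.M_le i hi j hj
    split_ifs <;> omega
  · intro i hi j hj hij k hk
    by_cases hjq : j = q
    · simp [setRow, hjq]
    · simp only [setRow, if_neg hjq]
      by_cases hiq : i = q
      · simp [setRow, hiq, unitRow, hjq] at hij
      · simp only [setRow, if_neg hiq] at hij
        exact hT.free i hi j hj hij k hk
  · intro k hk
    simp only [setRow, if_neg hq.ne', hT.last k hk]
  · classical
    funext x
    have hs : ∀ v : Bool, Sat N T.M (Function.update x q v) ↔
        SatNe N T.M q x ∧ lin N (T.M q) x ≡ v.toNat [MOD 2] := by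
      intro v
      rw [sat_iff hq.le, satNe_update hq (fun i hi _ => hcol i hi), lin_update hq hqq,
        ext_update hq, if_pos rfl]
    have hs' : Sat N (setRow T.M q (unitRow q)) x ↔ SatNe N T.M q x := by
      rw [sat_iff hq.le, satNe_setRow, setRow_self, lin_unit hq.le]
      exact and_iff_left rfl
    rw [H_apply, Tab.den_mk]
    simp only [Tab.den_apply _ T, hs, hs']
    by_cases h : SatNe N T.M q x
    · obtain ⟨v, hv, hv'⟩ := parity_bool (lin N (T.M q) x)
      have h1 : qf N (hadB T.B q (T.M q) 1 (T.B q q) 0) x ≡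
          qf N T.B (Function.update x q v) + 2 * v.toNat * (x q).toNat [MOD 4] := by
        refine (qf_hadB _ _ _ _ _).trans ?_
        rw [qf_update hq _ hT.symm]
        rw [← ZMod.natCast_eq_natCast_iff] at hv ⊢
        -- The linear form is an integer `v + 2k` and not reduced modulo 2. This does no harm: it
        -- enters the exponent doubled or squared, and both are determined modulo 4 by the parity.
        obtain ⟨k, hk⟩ : ∃ k : ℤ, (lin N (T.M q) x : ℤ) = v.toNat + 2 * k := by
          have := (ZMod.natCast_eq_natCast_iff _ _ _).1 hv
          obtain ⟨k, hk⟩ := (Nat.modEq_iff_dvd.1 this)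
          exact ⟨-k, by push_cast at hk; linarith⟩
        have hk4 : ((lin N (T.M q) x : ℕ) : ZMod 4) = v.toNat + 2 * (k : ZMod 4) := by
          have := congrArg (Int.cast : ℤ → ZMod 4) hk
          push_cast at this
          exact this
        have h4 : (4 : ZMod 4) = 0 := by decide
        push_cast
        rw [hk4]
        linear_combination ((k : ZMod 4) * lin N (hadRow T.B q) x + T.B q q * v.toNat * k +
          T.B q q * k ^ 2) * h4
      rw [I_pow_congr h1]
      cases v
      · simp only [Bool.not_false] at hv'
        simp only [h, hv, hv', and_true, and_false, if_true, if_false, pow_add]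
        simp
        ring
      · simp only [Bool.not_true] at hv'
        simp only [h, hv, hv', and_self, and_false, if_true, if_false, pow_add]
        simp only [Bool.toNat_true]
        ring
    · simp [h]

/-- What the two terms of the Hadamard gate on a free qubit add up to. -/
theorem H_free_apply (hT : T.Valid N) (hq : q < N) (hqq : T.M q q = 1)
    (hcol : ∀ i ≤ N, i ≠ q → T.M i q = 0) [Decidable (SatNe N T.M q x)] :
    (Gate.H q).apply (T.den N) x = if SatNe N T.M q x then
      T.amp * ((1 / Real.sqrt 2 : ℝ) : ℂ) * Complex.I ^ qf N (minor T.B q) x *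
        (1 + Complex.I ^ (2 * lin N (hadRow T.B q) x + T.B q q)) else 0 := by
  have hrow := hT.free q hq.le q hq.le hqq
  have hs : ∀ v : Bool, Sat N T.M (Function.update x q v) ↔ SatNe N T.M q x := by
    intro v
    rw [sat_iff hq.le, satNe_update hq hcol, lin_eq_of hrow, lin_unit hq.le]
    exact and_iff_left rfl
  rw [H_apply]
  simp only [Tab.den_apply _ T, hs]
  split
  · have h0 := qf_update (x := x) hq T.B hT.symm false
    have h1 := qf_update (x := x) hq T.B hT.symm true
    simp only [Bool.toNat_false, Bool.toNat_true, mul_zero, zero_mul, add_zero, mul_one, one_pow,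
      Nat.zero_pow (show 0 < 2 by decide)] at h0 h1
    have h2 : Complex.I ^ (2 * (x q).toNat) * Complex.I ^ qf N T.B (Function.update x q true) =
        Complex.I ^ qf N (minor T.B q) x * Complex.I ^ (2 * lin N (hadRow T.B q) x + T.B q q) := by
      rw [← pow_add, ← pow_add, add_comm, h1, add_assoc]
    rw [h0]
    linear_combination ((1 / Real.sqrt 2 : ℝ) : ℂ) * T.amp * h2
  · simp

/-- With `d = B q q` odd, `1 + I ^ (2 l + d) = (I ^ d + 1) * I ^ ((4 - d) l²)`: for even `l` both
sides are `1 + I ^ d`, and for odd `l` this is `-I ^ d = I ^ (-d)`. Since `l²` is 0 or 1 modulo 4,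
the phase is a quadratic form. The vector `z` has coefficients 0 and stands for whatever the work
array contains. -/
theorem H_free_odd (hT : T.Valid N) (hq : q < N) (hqq : T.M q q = 1)
    (hcol : ∀ i ≤ N, i ≠ q → T.M i q = 0) (hd : T.B q q % 2 = 1) (z : ℕ → ℕ) :
    Tab.Valid N ⟨T.M, hadB T.B q z 0 0 (4 - T.B q q),
      T.amp * (Complex.I ^ T.B q q + 1) * ((1 / Real.sqrt 2 : ℝ) : ℂ)⟩ ∧
    Tab.den N ⟨T.M, hadB T.B q z 0 0 (4 - T.B q q),
      T.amp * (Complex.I ^ T.B q q + 1) * ((1 / Real.sqrt 2 : ℝ) : ℂ)⟩ =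
        (Gate.H q).apply (T.den N) := by
  refine ⟨⟨hT.M_le, fun i _ j _ => hadB_le _ _ _ _ _ _ _,
    fun i hi j hj => hadB_symm (hT.symm i hi j hj), hT.free, hT.last⟩, ?_⟩
  classical
  funext x
  rw [H_free_apply hT hq hqq hcol]
  have hs : Sat N T.M x ↔ SatNe N T.M q x := by
    rw [sat_iff hq.le, lin_eq_of (hT.free q hq.le q hq.le hqq), lin_unit hq.le]
    exact and_iff_left rfl
  rw [Tab.den_mk]
  simp only [hs]
  split
  · have h1 := qf_hadB (N := N) (q := q) (x := x) T.B z 0 0 (4 - T.B q q)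
    simp only [mul_zero, zero_mul, add_zero] at h1
    rw [I_pow_congr h1, pow_add]
    set l := lin N (hadRow T.B q) x
    have h2 : (1 + Complex.I ^ (2 * l + T.B q q)) =
        (Complex.I ^ T.B q q + 1) * Complex.I ^ ((4 - T.B q q) * (l * l)) := by
      have hB := hT.B_le q hq.le q hq.le
      have h3 : T.B q q = 1 ∨ T.B q q = 3 := by omega
      have hl : (l % 2 = 0 ∧ l * l ≡ 0 [MOD 4] ∧ 2 * l ≡ 0 [MOD 4]) ∨
          (l % 2 = 1 ∧ l * l ≡ 1 [MOD 4] ∧ 2 * l ≡ 2 [MOD 4]) := by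
        rcases Nat.even_or_odd' l with ⟨k, hk | hk⟩
        · left
          refine ⟨by omega, ?_, by unfold Nat.ModEq; omega⟩
          rw [hk, show 2 * k * (2 * k) = 4 * (k * k) by ring]; simp [Nat.ModEq]
        · right
          refine ⟨by omega, ?_, by unfold Nat.ModEq; omega⟩
          rw [hk, show (2 * k + 1) * (2 * k + 1) = 1 + 4 * (k * k + k) by ring]; simp [Nat.ModEq]
      have hI3 : Complex.I ^ 3 = -Complex.I := by rw [pow_succ, Complex.I_sq]; ring
      have hI4 : Complex.I * Complex.I = -1 := Complex.I_mul_I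
      rcases h3 with h3 | h3 <;> rcases hl with ⟨-, a, b⟩ | ⟨-, a, b⟩ <;>
        rw [I_pow_congr (a.mul_left _), I_pow_congr (b.add_right _)] <;> simp [h3, hI3, pow_succ]
      all_goals first | ring1 | linear_combination hI4
    rw [h2]
    ring
  · rfl

/-- With `d = B q q` even, `1 + I ^ (2 l + d)` is 2 or 0, according to whether `l + d/2` is even. As
`l` contains `x_q` with coefficient 1, this condition is an equation for `x_q`; `y` is its
right-hand side with all variables expressed by free ones. The coefficient of `q` in it cancels
modulo 2, so `q` becomes bound. -/
theorem H_free_even (hT : T.Valid N) (hq : q < N) (hqq : T.M q q = 1)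
    (hcol : ∀ i ≤ N, i ≠ q → T.M i q = 0) (hd : T.B q q % 2 = 0) (z : ℕ → ℕ) {y : ℕ → ℕ}
    (hy : ∀ k ≤ N, y k = ((∑ j ∈ Finset.range (N + 1), hadRow T.B q j * T.M j k) + unitRow q k +
      T.B q q / 2 * unitRow N k) % 2) :
    Tab.Valid N ⟨setRow T.M q y, hadB T.B q z 0 0 0,
      T.amp * (1 + 1) * ((1 / Real.sqrt 2 : ℝ) : ℂ)⟩ ∧
    Tab.den N ⟨setRow T.M q y, hadB T.B q z 0 0 0,
      T.amp * (1 + 1) * ((1 / Real.sqrt 2 : ℝ) : ℂ)⟩ = (Gate.H q).apply (T.den N) := by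
  have hrow := hT.free q hq.le q hq.le hqq
  have hqr : q ∈ Finset.range (N + 1) := by simp; omega
  have hyq : y q = 0 := by
    rw [hy q hq.le, Finset.sum_eq_single_of_mem q hqr]
    · simp [hadRow, hqq, unitRow, hq.ne]
    · intro j hj hjq
      rw [hcol j (by simp at hj; omega) hjq, mul_zero]
  refine ⟨⟨?_, fun i _ j _ => hadB_le _ _ _ _ _ _ _,
    fun i hi j hj => hadB_symm (hT.symm i hi j hj), ?_, ?_⟩, ?_⟩
  · intro i hi j hj
    simp only [setRow]
    split
    · rw [hy j hj]; omega
    · exact hT.M_le i hi j hj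
  · have key : ∀ j ≤ N, j ≠ q → T.M j j = 1 → ∀ k ≤ N, setRow T.M q y j k = unitRow j k := by
      intro j hj hjq h k hk
      simp only [setRow, if_neg hjq]
      exact hT.free j hj j hj h k hk
    intro i hi j hj hij
    by_cases hiq : i = q
    · simp only [setRow, hiq, if_true] at hij
      have hjq : j ≠ q := by rintro rfl; omega
      refine key j hj hjq ?_
      by_cases hjN : j = N
      · subst hjN; rw [hT.last j le_rfl]; simp [unitRow]
      -- A variable that is not free has a zero column, so it cannot enter `y` through the sum.
      · by_contra hne
        have : ∀ l ∈ Finset.range (N + 1), hadRow T.B q l * T.M l j = 0 := by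
          intro l hl
          have hl : l ≤ N := by simp at hl; omega
          have h1 := hT.M_le l hl j hj
          by_cases h2 : T.M l j = 1
          · exact absurd (by rw [hT.free l hl j hj h2 j hj]; simp [unitRow]) hne
          · rw [show T.M l j = 0 by omega, mul_zero]
        rw [hy j hj, Finset.sum_eq_zero this] at hij
        simp [unitRow, hjq, hjN] at hij
    · simp only [setRow, if_neg hiq] at hij
      have hjq : j ≠ q := by rintro rfl; rw [hcol i hi hiq] at hij; omega
      exact key j hj hjq (by rw [hT.free i hi j hj hij j hj]; simp [unitRow])
  · intro k hk
    simp only [setRow, if_neg hq.ne', hT.last k hk]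
  classical
  funext x
  rw [H_free_apply hT hq hqq hcol]
  have hs : Sat N (setRow T.M q y) x ↔
      SatNe N T.M q x ∧ lin N (hadRow T.B q) x + T.B q q / 2 ≡ 0 [MOD 2] := by
    rw [sat_iff hq.le, satNe_setRow, setRow_self]
    refine and_congr_right fun hne => ?_
    have h1 : lin N y x ≡ lin N (hadRow T.B q) x + ext N x q + T.B q q / 2 [MOD 2] := by
      have h2 : lin N y x ≡ lin N (fun k => (∑ j ∈ Finset.range (N + 1),
          hadRow T.B q j * T.M j k) + unitRow q k + T.B q q / 2 * unitRow N k) x [MOD 2] :=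
        lin_congr fun k hk => by rw [hy k hk]; exact Nat.mod_modEq _ _
      refine h2.trans ?_
      rw [lin_add, lin_add, lin_smul, lin_unit hq.le, lin_unit le_rfl, ext_last, mul_one, lin_sum]
      refine Nat.ModEq.add_right _ (Nat.ModEq.add_right _ ?_)
      unfold lin
      rw [← ZMod.natCast_eq_natCast_iff]
      push_cast
      refine Finset.sum_congr rfl fun j hj => ?_
      have hj : j ≤ N := by simp at hj; omega
      congr 1
      have : lin N (T.M j) x ≡ ext N x j [MOD 2] := by
        by_cases hjq : j = q
        · subst hjq; rw [lin_eq_of hrow, lin_unit hj]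
        · exact hne j hj hjq
      have := (ZMod.natCast_eq_natCast_iff _ _ _).2 this
      unfold lin at this
      push_cast at this
      exact this
    have h3 : lin N y x ≡ ext N x q [MOD 2] ↔
        lin N (hadRow T.B q) x + ext N x q + T.B q q / 2 ≡ ext N x q [MOD 2] :=
      ⟨h1.symm.trans, h1.trans⟩
    rw [h3]
    unfold Nat.ModEq
    omega
  rw [Tab.den_mk]
  simp only [hs]
  by_cases h : SatNe N T.M q x
  · have h1 := qf_hadB (N := N) (q := q) (x := x) T.B z 0 0 0
    simp only [mul_zero, zero_mul, add_zero] at h1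
    rw [I_pow_congr h1]
    simp only [h, true_and, if_true]
    split
    · rename_i h2
      have : 2 * lin N (hadRow T.B q) x + T.B q q ≡ 0 [MOD 4] := by
        unfold Nat.ModEq at *; omega
      rw [I_pow_congr this]
      ring
    · rename_i h2
      have : 2 * lin N (hadRow T.B q) x + T.B q q ≡ 2 [MOD 4] := by
        unfold Nat.ModEq at *; omega
      rw [I_pow_congr this, Complex.I_sq]
      ring
  · simp [h]

end QSim

namespace QSim

open AExp (var get ltE eqE)

attribute [simp] AExp.eval_add AExp.eval_sub AExp.eval_mul AExp.eval_div AExp.eval_mod AExp.eval_lt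
  AExp.eval_eq AExp.eval_two AExp.eval_three AExp.eval_four AExp.eval_zero AExp.eval_one AExp.eval_var AExp.eval_get
  AExp.eval_word AExp.eval_arity AExp.ok_add AExp.ok_sub AExp.ok_mul AExp.ok_div AExp.ok_mod
  AExp.ok_lt AExp.ok_eq AExp.ok_two AExp.ok_four AExp.ok_zero AExp.ok_one AExp.ok_var AExp.ok_get
  AExp.ok_word AExp.ok_arity

variable {E : Env} {h h' h₁ h₂ : Mem} {N : ℕ}

/-! ## Stabilizer states in memory -/

/-- The memory is laid out for matrices of size `N + 1`. -/
structure Base (N : ℕ) (h : Mem) : Prop where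
  L : h.v .L = N + 1
  LL : h.v .LL = (N + 1) * (N + 1)
  i : h.v .i = 0
  j : h.v .j = 0
  len : ∀ s, s ≠ .D → (h.a s).length = (N + 1) * (N + 1)

def VecIs (N : ℕ) (l : List ℕ) (f : ℕ → ℕ) : Prop := ∀ k ≤ N, l[k]? = some (f k)

def MatIs (N : ℕ) (l : List ℕ) (F : ℕ → ℕ → ℕ) : Prop :=
  ∀ i ≤ N, ∀ j ≤ N, l[i * (N + 1) + j]? = some (F i j)

theorem Base.setA (hb : Base N h) {s : Arr} {l : List ℕ} (hl : l.length = (N + 1) * (N + 1)) :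
    Base N (h.setA s l) :=
  ⟨hb.L, hb.LL, hb.i, hb.j, fun t ht => by
    simp only [Mem.setA_a]; split <;> [exact hl; exact hb.len t ht]⟩

theorem Base.setV (hb : Base N h) {x : Var} {k : ℕ}
    (hx : x ≠ .L ∧ x ≠ .LL ∧ x ≠ .i ∧ x ≠ .j) : Base N (h.setV x k) :=
  ⟨by simp [hx.1.symm, hb.L], by simp [hx.2.1.symm, hb.LL], by simp [hx.2.2.1.symm, hb.i],
    by simp [hx.2.2.2.symm, hb.j], hb.len⟩

theorem Base.setP (hb : Base N h) {p : Ptr} {t : Tree} : Base N (h.setP p t) :=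
  ⟨hb.L, hb.LL, hb.i, hb.j, hb.len⟩

theorem Base.setC (hb : Base N h) {z : CReg} {t : ℂ} : Base N (h.setC z t) :=
  ⟨hb.L, hb.LL, hb.i, hb.j, hb.len⟩

theorem flat_lt {i j : ℕ} (hi : i ≤ N) (hj : j ≤ N) : i * (N + 1) + j < (N + 1) * (N + 1) := by
  have : i * (N + 1) ≤ N * (N + 1) := Nat.mul_le_mul_right _ hi
  rw [Nat.add_mul N 1]; omega

theorem le_sq : N + 1 ≤ (N + 1) * (N + 1) := Nat.le_mul_self _

/-- The expression may read the cell that is about to be overwritten: it still has its old content,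
and `he` may assume this, but nothing about other cells of the same array. This is what allows
updates in place. -/
theorem fill_vec {s : Arr} {e : AExp} (hb : Base N h) (hE : (N + 1) * (N + 1) + 100 ≤ E.V)
    (f : ℕ → ℕ) (hs : s ≠ .D) (hde : e.depth ≤ 15) (hce : e.cost ≤ 200)
    (he : ∀ l k, l.length = (N + 1) * (N + 1) → k ≤ N → l[k]? = (h.a s)[k]? →
      e.Ok E.V ((h.setA s l).setV .i k) ∧ e.eval ((h.setA s l).setV .i k) = f k)
    (hf : ∀ k ≤ N, f k ≤ 3) :
    ∃ l, Den E (fill s (var .L) e) h (300 * ((N + 1) * (N + 1))) (h.setA s l) ∧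
      l.length = (N + 1) * (N + 1) ∧ VecIs N l f := by
  have hl := hb.len s hs
  have hN := le_sq (N := N)
  have key : ∀ k < N + 1, (fillL (h.a s) f k)[k]? = (h.a s)[k]? :=
    fun k _ => getElem?_fillL_ge _ _ le_rfl
  refine ⟨fillL (h.a s) f (N + 1), Den.fill f hs (by simp [AExp.depth]) hde (by simp [AExp.cost]) hce
    hN (by omega) hb.i (by omega) (by omega) (fun _ _ => trivial) (fun k _ => by simp [hb.L])
    (fun k hk _ => (he _ k (by simp [hl]) (by omega) (key k hk)).1)
    (fun k hk => (he _ k (by simp [hl]) (by omega) (key k hk)).2) (fun k hk => hf k (by omega)),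
    by simp [hl], fun k hk => getElem?_fillL _ _ (by omega) (by omega)⟩

theorem fill_mat {s : Arr} {e : AExp} (hb : Base N h) (hE : (N + 1) * (N + 1) + 100 ≤ E.V)
    (F : ℕ → ℕ → ℕ) (hs : s ≠ .D) (hde : e.depth ≤ 15) (hce : e.cost ≤ 200)
    (he : ∀ l k i j, l.length = (N + 1) * (N + 1) → i ≤ N → j ≤ N → k = i * (N + 1) + j →
      k / (N + 1) = i → k % (N + 1) = j → k < (N + 1) * (N + 1) → l[k]? = (h.a s)[k]? →
      e.Ok E.V ((h.setA s l).setV .i k) ∧ e.eval ((h.setA s l).setV .i k) = F i j)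
    (hf : ∀ i ≤ N, ∀ j ≤ N, F i j ≤ 3) :
    ∃ l, Den E (fill s (var .LL) e) h (300 * ((N + 1) * (N + 1))) (h.setA s l) ∧
      l.length = (N + 1) * (N + 1) ∧ MatIs N l F := by
  have hl := hb.len s hs
  have hN := le_sq (N := N)
  set f : ℕ → ℕ := fun k => F (k / (N + 1)) (k % (N + 1)) with hfdef
  have hdiv : ∀ k < (N + 1) * (N + 1), k / (N + 1) ≤ N ∧ k % (N + 1) ≤ N := fun k hk =>
    ⟨Nat.lt_succ_iff.1 (Nat.div_lt_of_lt_mul hk), Nat.lt_succ_iff.1 (Nat.mod_lt _ (Nat.succ_pos _))⟩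
  have key : ∀ k < (N + 1) * (N + 1),
      e.Ok E.V ((h.setA s (fillL (h.a s) f k)).setV .i k) ∧
      e.eval ((h.setA s (fillL (h.a s) f k)).setV .i k) = f k := fun k hk =>
    he _ k _ _ (by simp [hl]) (hdiv k hk).1 (hdiv k hk).2
      (by rw [Nat.mul_comm]; exact (Nat.div_add_mod k (N + 1)).symm) rfl rfl hk
      (getElem?_fillL_ge _ _ le_rfl)
  refine ⟨fillL (h.a s) f ((N + 1) * (N + 1)), Den.fill f hs (by simp [AExp.depth]) hde
    (by simp [AExp.cost]) hce le_rfl (by omega) hb.i (by omega) (by omega) (fun _ _ => trivial)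
    (fun k _ => by simp [hb.LL]) (fun k hk _ => (key k hk).1) (fun k hk => (key k hk).2)
    (fun k hk => hf _ (hdiv k hk).1 _ (hdiv k hk).2),
    by simp [hl], fun i hi j hj => ?_⟩
  have := flat_lt hi hj
  rw [getElem?_fillL _ _ this (by omega)]
  have h1 : (i * (N + 1) + j) / (N + 1) = i := by
    rw [Nat.mul_comm, Nat.mul_add_div (Nat.succ_pos _), Nat.div_eq_of_lt (by omega)]; rfl
  have h2 : (i * (N + 1) + j) % (N + 1) = j := by
    rw [Nat.mul_comm, Nat.mul_add_mod, Nat.mod_eq_of_lt (by omega)]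
  simp only [hfdef, h1, h2]

/-- The memory holds the stabilizer state `T`. -/
structure Rep (N : ℕ) (T : Tab) (h : Mem) : Prop where
  base : Base N h
  M : MatIs N (h.a .M) T.M
  B : MatIs N (h.a .B) T.B
  amp : h.c .amp = T.amp
  valid : T.Valid N

/-- The memory holds the stabilizer state `ψ`. -/
def Holds (N : ℕ) (ψ : State ℕ) (h : Mem) : Prop := ∃ T, Rep N T h ∧ T.den N = ψ

/-- What does not change, when the registers `xs` and the pointers `ps` may change. -/
structure Frame (xs : List Var) (ps : List Ptr) (h h' : Mem) : Prop where
  v : ∀ x, x ∉ xs → h'.v x = h.v x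
  p : ∀ p, p ∉ ps → h'.p p = h.p p
  X : h'.a .X = h.a .X
  D : h'.a .D = h.a .D
  acc : h'.c .acc = h.c .acc

theorem Frame.refl (xs : List Var) (ps : List Ptr) (h : Mem) : Frame xs ps h h :=
  ⟨fun _ _ => rfl, fun _ _ => rfl, rfl, rfl, rfl⟩

theorem Frame.trans {xs : List Var} {ps : List Ptr} (a : Frame xs ps h h₁) (b : Frame xs ps h₁ h₂) :
    Frame xs ps h h₂ :=
  ⟨fun x hx => (b.v x hx).trans (a.v x hx), fun x hx => (b.p x hx).trans (a.p x hx),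
    b.X.trans a.X, b.D.trans a.D, b.acc.trans a.acc⟩

theorem Frame.mono {xs xs' : List Var} {ps ps' : List Ptr} (a : Frame xs ps h h')
    (hx : xs ⊆ xs') (hp : ps ⊆ ps') : Frame xs' ps' h h' :=
  ⟨fun x h => a.v x (fun h' => h (hx h')), fun x h => a.p x (fun h' => h (hp h')), a.X, a.D, a.acc⟩

theorem Frame.setV (xs : List Var) (ps : List Ptr) (h : Mem) {x : Var} (hx : x ∈ xs) (k : ℕ) :
    Frame xs ps h (h.setV x k) :=
  ⟨fun y hy => by simp [show y ≠ x from fun e => hy (e ▸ hx)], fun _ _ => rfl, rfl, rfl, rfl⟩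

theorem Frame.setP (xs : List Var) (ps : List Ptr) (h : Mem) {p : Ptr} (hp : p ∈ ps) (t : Tree) :
    Frame xs ps h (h.setP p t) :=
  ⟨fun _ _ => rfl, fun y hy => by simp [show y ≠ p from fun e => hy (e ▸ hp)], rfl, rfl, rfl⟩

theorem Frame.setA (xs : List Var) (ps : List Ptr) (h : Mem) {s : Arr} (hs : s ≠ .X ∧ s ≠ .D)
    (l : List ℕ) : Frame xs ps h (h.setA s l) :=
  ⟨fun _ _ => rfl, fun _ _ => rfl, by simp [hs.1.symm], by simp [hs.2.symm], rfl⟩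

theorem Frame.setC (xs : List Var) (ps : List Ptr) (h : Mem) {z : CReg} (hz : z ≠ .acc) (t : ℂ) :
    Frame xs ps h (h.setC z t) :=
  ⟨fun _ _ => rfl, fun _ _ => rfl, rfl, rfl, by simp [hz.symm]⟩

/-! ## Elimination of a pivot -/

/-- `M := M + W Zᵀ` modulo `2`. -/
def elimCode : Code arch :=
  fill .M (var .LL) ((get .M (var .i) + get .W (var .i / var .L) * get .Z (var .i % var .L)) % 2)

theorem elimCode_den (hb : Base N h) (hE : (N + 1) * (N + 1) + 100 ≤ E.V) {M : ℕ → ℕ → ℕ}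
    {w z : ℕ → ℕ} (hM : MatIs N (h.a .M) M) (hW : VecIs N (h.a .W) w) (hZ : VecIs N (h.a .Z) z)
    (M1 : ∀ i ≤ N, ∀ j ≤ N, M i j ≤ 1) (w1 : ∀ i ≤ N, w i ≤ 1) (z1 : ∀ i ≤ N, z i ≤ 1) :
    ∃ l, Den E elimCode h (300 * ((N + 1) * (N + 1))) (h.setA .M l) ∧
      l.length = (N + 1) * (N + 1) ∧ MatIs N l (fun i j => (M i j + w i * z j) % 2) := by
  refine fill_mat hb hE _ (by decide) (by decide) (by decide) ?_ (fun i _ j _ => by omega)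
  intro l k i j hl hi hj hk hd hm hkl hlk
  have a1 := M1 i hi j hj
  have a2 : w i * z j ≤ 1 := Nat.mul_le_mul (w1 i hi) (z1 j hj)
  have hN := le_sq (N := N)
  have e1 : l[k]? = some (M i j) := by rw [hlk, hk]; exact hM i hi j hj
  have e2 : (h.a .W)[i]? = some (w i) := hW i hi
  have e3 : (h.a .Z)[j]? = some (z j) := hZ j hj
  constructor
  · simp [hb.L, hd, hm, e1, e2, e3, hl, hb.len]
    omega
  · simp [hb.L, hd, hm, e1, e2, e3]

/-- The last `k < m` with `c k = 1`, plus one, or `0`. -/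
def pivot (c : ℕ → ℕ) : ℕ → ℕ
  | 0 => 0
  | k + 1 => if c k = 1 then k + 1 else pivot c k

theorem pivot_le (c : ℕ → ℕ) (m : ℕ) : pivot c m ≤ m := by
  induction m with
  | zero => exact le_rfl
  | succ m ih => simp only [pivot]; split <;> omega

theorem pivot_zero {c : ℕ → ℕ} {m : ℕ} (h : pivot c m = 0) : ∀ k < m, c k ≠ 1 := by
  induction m with
  | zero => intro k hk; omega
  | succ m ih =>
    simp only [pivot] at h
    split at h
    · omega
    · intro k hk
      by_cases hkm : k = m
      · subst hkm; assumption
      · exact ih h k (by omega)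

theorem pivot_pos {c : ℕ → ℕ} {m : ℕ} (h : pivot c m ≠ 0) :
    pivot c m - 1 < m ∧ c (pivot c m - 1) = 1 := by
  induction m with
  | zero => exact absurd rfl h
  | succ m ih =>
    simp only [pivot] at h ⊢
    split
    · rename_i hc; exact ⟨by omega, hc⟩
    · rename_i hc
      rw [if_neg hc] at h
      exact ⟨by have := (ih h).1; omega, (ih h).2⟩

/-! ## Measurements -/

/-- `Z` receives the equation, and `r` the pivot plus one, or 0 if there is none. The pivot column
is copied to `W` first, because `M` is overwritten while it is updated. -/
def measCode : Code arch :=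
  .seq (fill .Z (var .L)
    ((get .M (var .q * var .L + var .i) + var .b * eqE (var .i) (var .L - 1)) % 2))
  (.seq (fold .i .r (var .L - 1)
    (get .Z (var .i) * (var .i + 1) + (1 - get .Z (var .i)) * var .r))
  (ifE (var .r)
    (.seq (fill .W (var .L) (get .M (var .i * var .L + (var .r - 1)))) elimCode)
    (ifE (get .Z (var .L - 1)) (.instr (.cconst CReg.amp.idx .zero)) .skip)))

theorem measCode_tri {ψ : State ℕ} (hE : (N + 1) * (N + 1) + 100 ≤ E.V) (H : Holds N ψ h) {q : ℕ}
    {b : Bool} (hq : q < N) (hvq : h.v .q = q) (hvb : h.v .b = b.toNat) :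
    Tri E measCode h (2000 * ((N + 1) * (N + 1)))
      (fun h' => Holds N ((Gate.meas q b).apply ψ) h' ∧ Frame [.r] [] h h') := by
  obtain ⟨T, R, rfl⟩ := H
  have hb := R.base
  have hN := le_sq (N := N)
  have hb1 : b.toNat ≤ 1 := by cases b <;> simp
  set z := measRow N T.M q b with hz
  have hz1 : ∀ j, z j ≤ 1 := fun j => by simp only [hz, measRow]; omega
  obtain ⟨lZ, d1, lZlen, lZis⟩ := fill_vec (E := E) (s := .Z) (e := (get .M (var .q * var .L + var .i) +
      var .b * eqE (var .i) (var .L - 1)) % 2) hb hE z (by decide) (by decide) (by decide) (by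
    intro l k hl hk _
    have a1 := R.valid.M_le q hq.le k hk
    have a2 := flat_lt hq.le hk
    have e1 := R.M q hq.le k hk
    have a3 : (if k = N then b.toNat else 0) ≤ 1 := by split <;> omega
    constructor
    · simp [hvq, hvb, hb.L, e1, hb.len]
      omega
    · simp [hvq, hvb, hb.L, e1, hz, measRow, unitRow]) (fun k _ => by have := hz1 k; omega)
  set h1 := h.setA .Z lZ with hh1
  have hb1' : Base N h1 := hb.setA lZlen
  have d2 := Den.fold (E := E) (h := h1) (x := .r) (y := .i) (len := var .L - 1)
    (e := get .Z (var .i) * (var .i + 1) + (1 - get .Z (var .i)) * var .r) (m := N)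
    (S := (N + 1) * (N + 1)) (pivot z) (by decide) (by decide) (by decide) (by decide) (by decide)
    (by omega) (by omega) hb1'.i (by omega)
    (fun k _ => by simp; omega)
    (fun k _ => by simp [hb1'.L])
    (fun k hk _ => by
      have e1 : lZ[k]? = some (z k) := lZis k (by omega)
      have a1 := hz1 k
      have a2 := pivot_le z k
      have : z k = 0 ∨ z k = 1 := by omega
      simp [hh1, e1, lZlen]
      rcases this with e | e <;> simp [e] <;> omega)
    rfl
    (fun k hk => by
      have e1 : lZ[k]? = some (z k) := lZis k (by omega)
      have : z k = 0 ∨ z k = 1 := by have := hz1 k; omega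
      simp only [hh1, pivot]
      rcases this with e | e <;> simp [e1, e])
  set h2 := h1.setV .r (pivot z N) with hh2
  have hb2 : Base N h2 := hb1'.setV (by decide)
  have fr2 : Frame [.r] [] h h2 :=
    (Frame.setA _ _ h (by decide) lZ).trans (Frame.setV _ _ _ (by simp) _)
  have d3 : Tri E (ifE (var .r)
    (.seq (fill .W (var .L) (get .M (var .i * var .L + (var .r - 1)))) elimCode)
    (ifE (get .Z (var .L - 1)) (.instr (.cconst CReg.amp.idx .zero)) .skip)) h2
    ((var .r).cost + (1000 * ((N + 1) * (N + 1)) + 1))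
    (fun h' => Holds N ((Gate.meas q b).apply (T.den N)) h' ∧ Frame [.r] [] h h') := by
    refine Tri.ifE (by decide) (fun _ => trivial) (fun hr => ?_) (fun hr => ?_)
    · simp only [AExp.eval_var, hh2, Mem.setV_v, if_true] at hr
      obtain ⟨hp, hzp⟩ := pivot_pos hr
      set p := pivot z N - 1 with hpdef
      obtain ⟨lW, d3, lWlen, lWis⟩ := fill_vec (E := E) (h := h2) (s := .W)
        (e := get .M (var .i * var .L + (var .r - 1))) hb2 hE (fun i => T.M i p) (by decide)
        (by decide) (by decide) (by
          intro l k hl hk _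
          have a2 := flat_lt hk hp.le
          have e1 := R.M k hk p hp.le
          have e2 : h2.v .r - 1 = p := by simp [hh2, hpdef]
          have e3 : h2.a .M = h.a .M := by simp [hh2, hh1]
          constructor
          · simp [hb2.L, hb2.len, a2, e2]
            omega
          · simp [hb2.L, e2, e3, e1]) (fun k hk => by have := R.valid.M_le k hk p hp.le; omega)
      have hb3 : Base N (h2.setA .W lW) := hb2.setA lWlen
      obtain ⟨lM, d4, lMlen, lMis⟩ := elimCode_den (E := E) (h := h2.setA .W lW) hb3 hE (M := T.M)
        (w := fun i => T.M i p) (z := z) (by simpa [hh2, hh1] using R.M) (by simpa using lWis)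
        (by simpa [hh2, hh1] using lZis) R.valid.M_le (fun i hi => R.valid.M_le i hi p hp.le)
        (fun i _ => hz1 i)
      obtain ⟨v1, v2⟩ := meas_pivot R.valid hq b hp hzp
      refine ⟨_, (d3.seq d4).mono (by omega), ⟨_, ⟨hb3.setA lMlen, ?_, ?_, ?_, v1⟩, v2⟩, ?_⟩
      · simp only [Mem.setA_a, if_true]; exact lMis
      · simpa [hh2, hh1] using R.B
      · simpa [hh2, hh1] using R.amp
      · exact (fr2.trans (Frame.setA _ _ _ (by decide) _)).trans (Frame.setA _ _ _ (by decide) _)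
    · simp only [AExp.eval_var, hh2, Mem.setV_v, if_true] at hr
      have hz0 : ∀ p < N, z p = 0 := fun p hp => by
        have := pivot_zero hr p hp; have := hz1 p; omega
      have hsem := meas_const (T := T) hq b hz0
      have e1 : lZ[N]? = some (z N) := lZis N le_rfl
      have ev : (get .Z (var .L - 1)).eval h2 = z N := by
        simp [hh2, hh1, hb.L, e1]
      have ok : h2.Good E → (get .Z (var .L - 1)).Ok E.V h2 := fun _ => by
        simp [hb2.L, hb2.len]
        constructor <;> omega
      refine Tri.mono (T := (get .Z (var .L - 1)).cost + (1 + 1)) (Tri.ifE (by decide) ok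
        (Q := fun h' => Holds N ((Gate.meas q b).apply (T.den N)) h' ∧ Frame [.r] [] h h')
        (fun hne => ?_) (fun he => ?_)) ?_ (fun _ a => a)
      · refine Den.cconst.tri ⟨⟨_, ⟨hb2.setC, ?_, ?_, ?_, ?_⟩, hsem⟩,
          fr2.trans (Frame.setC _ _ _ (by decide) _)⟩
        · simpa [hh2, hh1] using R.M
        · simpa [hh2, hh1] using R.B
        · rw [ev] at hne
          simp only [Mem.setC_c, if_true, CConst.val]
          exact (if_neg hne).symm
        · exact ⟨R.valid.M_le, R.valid.B_le, R.valid.symm, R.valid.free, R.valid.last⟩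
      · refine Den.skip.tri ⟨⟨_, ⟨hb2, ?_, ?_, ?_, ?_⟩, hsem⟩, fr2⟩
        · simpa [hh2, hh1] using R.M
        · simpa [hh2, hh1] using R.B
        · rw [ev] at he
          have e2 : measRow N T.M q b N = 0 := he
          simpa [e2, hh2, hh1] using R.amp
        · exact ⟨R.valid.M_le, R.valid.B_le, R.valid.symm, R.valid.free, R.valid.last⟩
      · rw [show (get .Z (var .L - 1)).cost = 5 from rfl]; omega
  exact (d1.seq_tri (d2.seq_tri d3)).mono (by
    rw [show (var .r).cost = 2 from rfl]; omega) (fun _ a => a)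

end QSim

namespace QSim

open AExp (var get ltE eqE)

variable {E : Env} {h h' h₁ h₂ : Mem} {N : ℕ}

/-! ## The Hadamard gate -/

def hadBCode : Code arch :=
  fill .B (var .LL) (((1 - eqE (var .i / var .L) (var .q)) * ((1 - eqE (var .i % var .L) (var .q)) *
      get .B (var .i)) +
    var .al * (get .Z (var .i / var .L) * get .W (var .i % var .L) +
      get .W (var .i / var .L) * get .Z (var .i % var .L)) +
    var .be * (get .Z (var .i / var .L) * get .Z (var .i % var .L)) +
    var .ga * (get .W (var .i / var .L) * get .W (var .i % var .L))) % 4)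

theorem hadBCode_den (hb : Base N h) (hE : (N + 1) * (N + 1) + 100 ≤ E.V) {B : ℕ → ℕ → ℕ}
    {q α β γ : ℕ} {z : ℕ → ℕ} (hB : MatIs N (h.a .B) B) (hW : VecIs N (h.a .W) (hadRow B q))
    (hZ : VecIs N (h.a .Z) z) (B3 : ∀ i ≤ N, ∀ j ≤ N, B i j ≤ 3) (hqN : q < N)
    (z1 : ∀ i ≤ N, z i ≤ 1) (hq : h.v .q = q) (hα : h.v .al = α) (hβ : h.v .be = β)
    (hγ : h.v .ga = γ) (α1 : α ≤ 1) (β3 : β ≤ 3) (γ3 : γ ≤ 3) :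
    ∃ l, Den E hadBCode h (300 * ((N + 1) * (N + 1))) (h.setA .B l) ∧
      l.length = (N + 1) * (N + 1) ∧ MatIs N l (hadB B q z α β γ) := by
  refine fill_mat hb hE _ (by decide) (by decide) (by decide) ?_ (fun i _ j _ => hadB_le _ _ _ _ _ _ _)
  intro l k i j hl hi hj hk hd hm hkl hlk
  have b1 := B3 i hi j hj
  have w3 : ∀ i ≤ N, hadRow B q i ≤ 3 := fun i hi => by
    simp only [hadRow]; split <;> [omega; exact B3 q hqN.le i hi]
  have c1 : z i * hadRow B q j ≤ 3 := Nat.mul_le_mul (z1 i hi) (w3 j hj)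
  have c2 : hadRow B q i * z j ≤ 3 := Nat.mul_le_mul (w3 i hi) (z1 j hj)
  have c3 : z i * z j ≤ 1 := Nat.mul_le_mul (z1 i hi) (z1 j hj)
  have c4 : hadRow B q i * hadRow B q j ≤ 9 := Nat.mul_le_mul (w3 i hi) (w3 j hj)
  have c5 : α * (z i * hadRow B q j + hadRow B q i * z j) ≤ 1 * 6 := Nat.mul_le_mul α1 (by omega)
  have c6 : β * (z i * z j) ≤ 3 * 1 := Nat.mul_le_mul β3 c3
  have c7 : γ * (hadRow B q i * hadRow B q j) ≤ 3 * 9 := Nat.mul_le_mul γ3 c4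
  have c8 : (1 - if j = q then 1 else 0) * B i j ≤ 1 * 3 := Nat.mul_le_mul (by omega) b1
  have c9 : (1 - if i = q then 1 else 0) * ((1 - if j = q then 1 else 0) * B i j) ≤ 1 * 3 :=
    Nat.mul_le_mul (by omega) (by omega)
  have hN := le_sq (N := N)
  have e1 : l[k]? = some (B i j) := by rw [hlk, hk]; exact hB i hi j hj
  have e2 : (h.a .W)[i]? = some (hadRow B q i) := hW i hi
  have e2' : (h.a .W)[j]? = some (hadRow B q j) := hW j hj
  have e3 : (h.a .Z)[j]? = some (z j) := hZ j hj
  have e3' : (h.a .Z)[i]? = some (z i) := hZ i hi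
  have em : (1 - if i = q then 1 else 0) * ((1 - if j = q then 1 else 0) * B i j) =
      minor B q i j := by
    by_cases h1 : i = q <;> by_cases h2 : j = q <;> simp [minor, h1, h2]
  constructor
  · simp [hb.L, hd, hm, e1, e2, e3, e2', e3', hl, hb.len, hq, hα, hβ, hγ]
    omega
  · simp [hb.L, hd, hm, e1, e2, e3, e2', e3', hq, hα, hβ, hγ, em, hadB]

def setRowCode : Code arch :=
  fill .M (var .LL) (eqE (var .i / var .L) (var .q) * get .Z (var .i % var .L) +
    (1 - eqE (var .i / var .L) (var .q)) * get .M (var .i))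

theorem setRowCode_den (hb : Base N h) (hE : (N + 1) * (N + 1) + 100 ≤ E.V) {M : ℕ → ℕ → ℕ}
    {q : ℕ} {z : ℕ → ℕ} (hM : MatIs N (h.a .M) M) (hZ : VecIs N (h.a .Z) z)
    (M1 : ∀ i ≤ N, ∀ j ≤ N, M i j ≤ 1) (z1 : ∀ i ≤ N, z i ≤ 1) (hq : h.v .q = q) :
    ∃ l, Den E setRowCode h (300 * ((N + 1) * (N + 1))) (h.setA .M l) ∧
      l.length = (N + 1) * (N + 1) ∧ MatIs N l (setRow M q z) := by
  refine fill_mat hb hE _ (by decide) (by decide) (by decide) ?_ (fun i hi j hj => by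
    simp only [setRow]; have := M1 i hi j hj; have := z1 j hj; split <;> omega)
  intro l k i j hl hi hj hk hd hm hkl hlk
  have a1 := M1 i hi j hj
  have a2 := z1 j hj
  have hN := le_sq (N := N)
  have e1 : l[k]? = some (M i j) := by rw [hlk, hk]; exact hM i hi j hj
  have e3 : (h.a .Z)[j]? = some (z j) := hZ j hj
  by_cases hiq : i = q
  · constructor
    · simp [hb.L, hd, hm, e1, e3, hl, hb.len, hq, hiq]
      omega
    · simp [hb.L, hd, hm, e1, e3, hq, hiq, setRow]
  · constructor
    · simp [hb.L, hd, hm, e1, e3, hl, hb.len, hq, hiq]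
      omega
    · simp [hb.L, hd, hm, e1, e3, hq, hiq, setRow]

/-- `Z[i] := ∑ j, W[j] M[s1 i + s2 j]` modulo `2`. -/
def matvecCode : Code arch :=
  forE .i (var .L) (.seq (fold .j .acc (var .L)
    ((var .acc + get .W (var .j) * get .M (var .i * var .s1 + var .j * var .s2)) % 2))
    (put .Z (var .i) (var .acc)))

/-- The two strides make one program serve for `M` (strides `N + 1` and `1`) and for its transpose
(`1` and `N + 1`); `F` is the matrix actually read. -/
theorem matvecCode_den (hb : Base N h) (hE : (N + 1) * (N + 1) + 100 ≤ E.V) {F : ℕ → ℕ → ℕ}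
    {w : ℕ → ℕ} {s₁ s₂ : ℕ} (h₁ : h.v .s1 = s₁) (h₂ : h.v .s2 = s₂) (hW : VecIs N (h.a .W) w)
    (hM : ∀ i ≤ N, ∀ j ≤ N, i * s₁ + j * s₂ < (N + 1) * (N + 1) ∧
      (h.a .M)[i * s₁ + j * s₂]? = some (F i j))
    (F1 : ∀ i ≤ N, ∀ j ≤ N, F i j ≤ 1) (w3 : ∀ i ≤ N, w i ≤ 3) :
    ∃ l k, Den E matvecCode h (400 * ((N + 1) * (N + 1))) ((h.setV .acc k).setA .Z l) ∧
      l.length = (N + 1) * (N + 1) ∧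
      VecIs N l (fun i => (∑ j ∈ Finset.range (N + 1), w j * F i j) % 2) := by
  have hN := le_sq (N := N)
  set f : ℕ → ℕ := fun i => (∑ j ∈ Finset.range (N + 1), w j * F i j) % 2 with hf
  -- The accumulator keeps the last computed entry, number `i - 1`, except before the first round,
  -- when it is untouched.
  set st : ℕ → Mem := fun i =>
    (h.setV .acc (if i = 0 then h.v .acc else f (i - 1))).setA .Z (fillL (h.a .Z) f i) with hst
  have hbst : ∀ i, Base N (st i) := fun i =>
    (hb.setV (by decide)).setA (by simp [hb.len])
  have h0 : st 0 = h := by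
    simp only [hst, if_true, fillL, Mem.setV_self rfl, Mem.setA_self]
  have h1 := Den.forE (E := E) (x := .i) (e := var .L) (c := .seq (fold .j .acc (var .L)
    ((var .acc + get .W (var .j) * get .M (var .i * var .s1 + var .j * var .s2)) % 2))
    (put .Z (var .i) (var .acc))) (T := 300 * (N + 1) + 5) st (N + 1) (by decide) (by omega)
    (fun _ _ _ => trivial) (fun i _ => by simp [(hbst i).L]) (hbst 0).i (hbst _).i (fun i hi => by
      have hiN : i ≤ N := by omega
      have d1 := Den.fold (E := E) (h := (st i).setV .i i) (x := .acc) (y := .j) (len := var .L)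
        (e := (var .acc + get .W (var .j) * get .M (var .i * var .s1 + var .j * var .s2)) % 2)
        (m := N + 1) (S := N + 1) (fun m => (∑ j ∈ Finset.range m, w j * F i j) % 2) (by decide)
        (by decide) (by decide) (by decide) (by decide) le_rfl (by omega) (by simp [(hbst i).j])
        (by omega) (fun _ _ => trivial) (fun k _ => by simp [(hbst i).L])
        (fun k hk _ => by
          have e1 : (h.a .W)[k]? = some (w k) := hW k (by omega)
          obtain ⟨a1, e2⟩ := hM i hiN k (by omega)
          have a2 : w k * F i k ≤ 3 * 1 :=
            Nat.mul_le_mul (w3 k (by omega)) (F1 i hiN k (by omega))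
          have a3 : (∑ j ∈ Finset.range k, w j * F i j) % 2 < 2 := Nat.mod_lt _ (by decide)
          simp [hst, e1, e2, h₁, h₂, hb.len]
          omega)
        (by simp)
        (fun k hk => by
          have e1 : (h.a .W)[k]? = some (w k) := hW k (by omega)
          obtain ⟨a1, e2⟩ := hM i hiN k (by omega)
          simp [hst, e1, e2, h₁, h₂, Finset.sum_range_succ])
      have hfl : f i < 2 := Nat.mod_lt _ (by decide)
      have d2 := Den.put (E := E) (h := ((st i).setV .i i).setV .acc (f i)) (s := .Z)
        (e₁ := var .i) (e₂ := var .acc) (i := i) (v := f i) (by decide) (by decide)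
        (fun _ => trivial) (fun _ => trivial) (by simp) (by simp) (by decide) (by omega)
        (by simp [hst, hb.len]; omega)
      have e : (((st i).setV .i i).setV .acc (f i)).setA .Z
          (((((st i).setV .i i).setV .acc (f i)).a .Z).set i (f i)) = (st (i + 1)).setV .i i := by
        simp only [hst, Mem.setV_a, Mem.setA_a, if_true]
        simp only [Mem.setV_comm _ (show Var.i ≠ Var.acc by decide), Mem.setV_setA, Mem.setV_setV,
          Mem.setA_setA, Nat.add_sub_cancel, if_neg (Nat.succ_ne_zero i), fillL]
      rw [e] at d2
      exact (d1.seq d2).mono (by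
        rw [show (var .i).cost = 2 from rfl, show (var .acc).cost = 2 from rfl]))
  rw [h0] at h1
  refine ⟨_, _, h1.mono ?_, by simp [hb.len],
    fun k hk => getElem?_fillL _ _ (by omega) (by simp [hb.len]; omega)⟩
  rw [show (var .L).cost = 2 from rfl]
  have : (N + 1) * (300 * (N + 1) + 5 + 2 + 10) = 300 * ((N + 1) * (N + 1)) + 17 * (N + 1) := by ring
  omega

/-- `tmp := I ^ e` -/
def powCode : Code arch :=
  .seq (.instr (.cconst CReg.tmp.idx .one)) (.seq (.instr (.cconst CReg.aux.idx .i))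
    (forE .i (var .e) (.instr (.cmul CReg.tmp.idx CReg.tmp.idx CReg.aux.idx))))

theorem powCode_den (hb : Base N h) {e : ℕ} (he : h.v .e = e) (he3 : e ≤ 3) :
    Den E powCode h 60 ((h.setC .aux Complex.I).setC .tmp (Complex.I ^ e)) := by
  have hEV := E.hV
  set st : ℕ → Mem := fun k => (h.setC .aux Complex.I).setC .tmp (Complex.I ^ k) with hst
  have hbst : ∀ i, Base N (st i) := fun i => hb.setC.setC
  have h1 := Den.forE (E := E) (x := .i) (e := var .e)
    (c := .instr (.cmul CReg.tmp.idx CReg.tmp.idx CReg.aux.idx)) (T := 1) st e (by decide) (by omega)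
    (fun _ _ _ => trivial) (fun i _ => by simp [hst, he]) (hbst 0).i (hbst _).i (fun k _ => by
      have := Den.cmul (E := E) (h := (st k).setV .i k) (z := .tmp) (u := .tmp) (v := .aux)
      convert this using 1
      simp only [hst, Mem.setC, Mem.setV, Function.update_idem, pow_succ, Function.update_self]
      simp)
  have h0 : st 0 = (h.setC .tmp 1).setC .aux Complex.I := by
    simp only [hst, Mem.setC, pow_zero]
    rw [Function.update_comm (by decide)]
  rw [h0] at h1
  refine ((Den.cconst (k := .one)).seq ((Den.cconst (k := .i)).seq h1)).mono ?_
  rw [show (var .e).cost = 2 from rfl]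
  omega

/-- A row `r ≠ q` that contains `q` is searched for. The factor `d = M q q` lets the search fail if
`q` is bound, and the other factor excludes row `q` itself. -/
def swapCode : Code arch :=
  .seq (asg .d (get .M (var .q * var .L + var .q)))
  (.seq (fold .i .r (var .L - 1)
    ((var .d * (get .M (var .i * var .L + var .q) * (1 - eqE (var .i) (var .q)))) * (var .i + 1) +
    (1 - var .d * (get .M (var .i * var .L + var .q) * (1 - eqE (var .i) (var .q)))) * var .r))
  (ifE (var .r)
    (.seq (fill .Z (var .L) ((get .M ((var .r - 1) * var .L + var .i) +
      eqE (var .i) (var .r - 1)) % 2))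
    (.seq (fill .W (var .L) (get .M (var .i * var .L + var .q))) elimCode))
    .skip))

theorem swapCode_tri {T : Tab} (hE : (N + 1) * (N + 1) + 100 ≤ E.V) (R : Rep N T h) {q : ℕ}
    (hq : q < N) (hvq : h.v .q = q) :
    Tri E swapCode h (2000 * ((N + 1) * (N + 1)))
      (fun h' => (∃ T', Rep N T' h' ∧ T'.den N = T.den N ∧
        (T'.M q q = 1 → ∀ i ≤ N, i ≠ q → T'.M i q = 0)) ∧ Frame [.r, .d] [] h h') := by
  have hb := R.base
  have hN := le_sq (N := N)
  have eqq := R.M q hq.le q hq.le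
  have a1 := flat_lt (N := N) hq.le hq.le
  have mqq := R.valid.M_le q hq.le q hq.le
  have d1 := Den.asg (E := E) (h := h) (x := .d) (e := get .M (var .q * var .L + var .q))
    (v := T.M q q) (by decide)
    (fun _ => by simp [hvq, hb.L, hb.len]; omega) (by simp [hvq, hb.L, eqq])
  set h1 := h.setV .d (T.M q q) with hh1
  have hb1 : Base N h1 := hb.setV (by decide)
  set c : ℕ → ℕ := fun i => T.M q q * (T.M i q * (1 - if i = q then 1 else 0)) with hc
  have hc1 : ∀ i ≤ N, c i ≤ 1 := fun i hi => by
    have := R.valid.M_le i hi q hq.le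
    calc c i ≤ 1 * (1 * 1) := Nat.mul_le_mul mqq (Nat.mul_le_mul this (by omega))
      _ = 1 := rfl
  have d2 := Den.fold (E := E) (h := h1) (x := .r) (y := .i) (len := var .L - 1)
    (e := (var .d * (get .M (var .i * var .L + var .q) * (1 - eqE (var .i) (var .q)))) *
      (var .i + 1) + (1 - var .d * (get .M (var .i * var .L + var .q) *
        (1 - eqE (var .i) (var .q)))) * var .r) (m := N)
    (S := (N + 1) * (N + 1)) (pivot c) (by decide) (by decide) (by decide) (by decide) (by decide)
    (by omega) (by omega) hb1.i (by omega)
    (fun k _ => by simp; omega)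
    (fun k _ => by simp [hb1.L])
    (fun k hk _ => by
      have e1 := R.M k hk.le q hq.le
      have b1 := flat_lt (N := N) hk.le hq.le
      have b2 := pivot_le c k
      have b3 := hc1 k hk.le
      have b4 : T.M k q * (1 - if k = q then 1 else 0) ≤ 1 * 1 :=
        Nat.mul_le_mul (R.valid.M_le k hk.le q hq.le) (by omega)
      have b5 : c k * (k + 1) ≤ k + 1 := by nlinarith
      have b6 : c k * (k + 1) + (1 - c k) * pivot c k ≤ N + 1 := by
        have : c k = 0 ∨ c k = 1 := by omega
        rcases this with e | e <;> simp [e] <;> omega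
      simp [hh1, hvq, hb.L, hb.len, e1]
      simp only [hc] at b3 b5 b6 ⊢
      omega)
    rfl
    (fun k hk => by
      have e1 := R.M k hk.le q hq.le
      have : c k = 0 ∨ c k = 1 := by have := hc1 k hk.le; omega
      have e2 : T.M q q * (T.M k q * (1 - if k = q then 1 else 0)) = c k := rfl
      simp only [hh1, pivot]
      simp only [AExp.eval_add, AExp.eval_mul, AExp.eval_sub, AExp.eval_var, AExp.eval_get,
        AExp.eval_eq, AExp.eval_one, Mem.setV_v, Mem.setV_a, reduceCtorEq, if_false, if_true, hvq,
        hb.L, e1, Option.getD_some, e2]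
      rcases this with e | e <;> simp [e])
  set h2 := h1.setV .r (pivot c N) with hh2
  have hb2 : Base N h2 := hb1.setV (by decide)
  have fr2 : Frame [.r, .d] [] h h2 :=
    (Frame.setV _ _ h (by simp) _).trans (Frame.setV _ _ _ (by simp) _)
  have R2 : Rep N T h2 :=
    ⟨hb2, by simpa [hh2, hh1] using R.M, by simpa [hh2, hh1] using R.B,
      by simpa [hh2, hh1] using R.amp, R.valid⟩
  have hvq2 : h2.v .q = q := by simp [hh2, hh1, hvq]
  have d3 : Tri E (ifE (var .r)
    (.seq (fill .Z (var .L) ((get .M ((var .r - 1) * var .L + var .i) +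
      eqE (var .i) (var .r - 1)) % 2))
    (.seq (fill .W (var .L) (get .M (var .i * var .L + var .q))) elimCode))
    .skip) h2
    ((var .r).cost + (1000 * ((N + 1) * (N + 1)) + 1))
    (fun h' => (∃ T', Rep N T' h' ∧ T'.den N = T.den N ∧
        (T'.M q q = 1 → ∀ i ≤ N, i ≠ q → T'.M i q = 0)) ∧ Frame [.r, .d] [] h h') := by
    refine Tri.ifE (by decide) (fun _ => trivial) (fun hr => ?_) (fun hr => ?_)
    · simp only [AExp.eval_var, hh2, Mem.setV_v, if_true] at hr
      obtain ⟨hp, hcp⟩ := pivot_pos hr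
      have er : h2.v .r - 1 = pivot c N - 1 := by simp [hh2]
      set r := pivot c N - 1 with hrdef
      have hrow := hc1
      have hMqq : T.M q q = 1 := by
        by_contra hne
        have : T.M q q = 0 := by omega
        simp [hc, this] at hcp
      have hrq : r ≠ q := by
        intro e; simp [hc, e] at hcp
      have hMrq : T.M r q = 1 := by
        simpa [hc, hMqq, hrq] using hcp
      set z : ℕ → ℕ := fun j => (T.M r j + unitRow r j) % 2 with hz
      obtain ⟨lZ, d3, lZlen, lZis⟩ := fill_vec (E := E) (h := h2) (s := .Z)
        (e := (get .M ((var .r - 1) * var .L + var .i) + eqE (var .i) (var .r - 1)) % 2) hb2 hE z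
        (by decide) (by decide) (by decide) (by
          intro l k hl hk _
          have a2 := flat_lt (N := N) hp.le hk
          have e1 := R2.M r hp.le k hk
          have a3 := R.valid.M_le r hp.le k hk
          constructor
          · simp [hb2.L, hb2.len, er, e1]
            split <;> omega
          · simp [hb2.L, er, e1, hz, unitRow]) (fun k _ => by simp only [hz]; omega)
      have hb3 : Base N (h2.setA .Z lZ) := hb2.setA lZlen
      obtain ⟨lW, d4, lWlen, lWis⟩ := fill_vec (E := E) (h := h2.setA .Z lZ) (s := .W)
        (e := get .M (var .i * var .L + var .q)) hb3 hE (fun i => T.M i q)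
        (by decide) (by decide) (by decide) (by
          intro l k hl hk _
          have a2 := flat_lt (N := N) hk hq.le
          have e1 := R2.M k hk q hq.le
          constructor
          · simp [hb2.L, hb2.len, hvq2]
            omega
          · simp [hb2.L, hvq2, e1]) (fun k hk => by have := R.valid.M_le k hk q hq.le; omega)
      have hb4 : Base N ((h2.setA .Z lZ).setA .W lW) := hb3.setA lWlen
      obtain ⟨lM, d5, lMlen, lMis⟩ := elimCode_den (E := E) hb4 hE (M := T.M)
        (w := fun i => T.M i q) (z := z) (by simpa using R2.M) (by simpa using lWis)
        (by simpa using lZis) R.valid.M_le (fun i hi => R.valid.M_le i hi q hq.le)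
        (fun i _ => by simp only [hz]; omega)
      obtain ⟨v1, v2, v3⟩ := H_swap R.valid hq hMqq hp hrq hMrq (z := z) (fun _ _ => rfl)
      refine ⟨_, (d3.seq (d4.seq d5)).mono (by omega), ⟨_, ⟨hb4.setA lMlen, ?_, ?_, ?_, v1⟩, v2, ?_⟩, ?_⟩
      · simp only [Mem.setA_a, if_true]; exact lMis
      · simpa using R2.B
      · simpa using R2.amp
      · intro h1
        have v3' : elim T.M q z q q = 0 := v3
        simp only at h1
        omega
      · exact ((fr2.trans (Frame.setA _ _ _ (by decide) _)).trans
          (Frame.setA _ _ _ (by decide) _)).trans (Frame.setA _ _ _ (by decide) _)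
    · simp only [AExp.eval_var, hh2, Mem.setV_v, if_true] at hr
      refine ⟨_, Den.skip.mono (by omega), ⟨T, R2, rfl, ?_⟩, fr2⟩
      intro hMqq i hi hiq
      -- The search covers only rows below `N`; row `N` is that of the constant and does not contain
      -- `q`.
      by_cases hiN : i = N
      · rw [hiN, R.valid.last q hq.le, unitRow, if_neg hq.ne]
      · have h1 := pivot_zero hr i (by omega)
        simp only [hc, hMqq, if_neg hiq, one_mul, mul_one, Nat.sub_zero] at h1
        have := R.valid.M_le i hi q hq.le
        omega
  exact (d1.seq_tri (d2.seq_tri d3)).mono (by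
    rw [show (get .M (var .q * var .L + var .q)).cost = 9 from rfl,
      show (var .r).cost = 2 from rfl]; omega) (fun _ a => a)

end QSim

namespace QSim

open AExp (var get ltE eqE)

variable {E : Env} {h h' h₁ h₂ : Mem} {N : ℕ}

/-! ### The cases of the Hadamard gate as programs -/

def boundCode : Code arch :=
  .seq (fill .Z (var .L) (get .M (var .q * var .L + var .i)))
  (.seq (asg .al 1) (.seq (asg .be (var .d)) (.seq (asg .ga 0) (.seq hadBCode
  (.seq (fill .Z (var .L) (eqE (var .i) (var .q))) setRowCode)))))

def freeOddCode : Code arch :=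
  .seq (asg .al 0) (.seq (asg .be 0) (.seq (asg .ga (4 - var .d)) (.seq hadBCode
  (asg .e (var .d)))))

/-- The matrix-vector product takes the transpose of `M`, as the coefficients of `hadRow` are pushed
through the rows of `M`. Setting `e` to 0 makes the common factor `I ^ e + 1` equal to 2. -/
def freeEvenCode : Code arch :=
  .seq (asg .al 0) (.seq (asg .be 0) (.seq (asg .ga 0) (.seq hadBCode
  (.seq (asg .s1 1) (.seq (asg .s2 (var .L)) (.seq matvecCode
  (.seq (fill .Z (var .L) (((get .Z (var .i) + eqE (var .i) (var .q)) +
    (var .d / 2) * eqE (var .i) (var .L - 1)) % 2))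
  (.seq setRowCode (asg .e 0)))))))))

/-- `amp := amp * (I ^ e + 1)` -/
def onePowCode : Code arch :=
  .seq powCode (.seq (.instr (.cconst CReg.aux.idx .one))
    (.seq (.instr (.cadd CReg.tmp.idx CReg.tmp.idx CReg.aux.idx))
      (.instr (.cmul CReg.amp.idx CReg.amp.idx CReg.tmp.idx))))

def hadCoreCode : Code arch :=
  .seq (asg .d (get .B (var .q * var .L + var .q)))
  (.seq (fill .W (var .L) (eqE (var .i) (var .q) +
    (1 - eqE (var .i) (var .q)) * get .B (var .q * var .L + var .i)))
  (.seq (ifE (get .M (var .q * var .L + var .q))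
    (.seq (ifE (var .d % 2) freeOddCode freeEvenCode) onePowCode) boundCode)
  (.seq (.instr (.cconst CReg.tmp.idx .invSqrtTwo))
    (.instr (.cmul CReg.amp.idx CReg.amp.idx CReg.tmp.idx)))))

def hadVars : List Var := [.r, .d, .al, .be, .ga, .e, .s1, .s2, .acc]

/-- What the branches of the Hadamard gate achieve: all but a scalar factor. -/
structure Pre (N : ℕ) (ψ : State ℕ) (κ : ℂ) (h : Mem) : Prop where
  base : Base N h
  ex : ∃ M B, MatIs N (h.a .M) M ∧ MatIs N (h.a .B) B ∧ Tab.Valid N ⟨M, B, h.c .amp * κ⟩ ∧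
    Tab.den N ⟨M, B, h.c .amp * κ⟩ = ψ

section branches

variable {T : Tab} {q : ℕ}

theorem boundCode_tri (hE : (N + 1) * (N + 1) + 100 ≤ E.V) (R : Rep N T h)
    (hq : q < N) (hvq : h.v .q = q) (hd : h.v .d = T.B q q) (hW : VecIs N (h.a .W) (hadRow T.B q))
    (hqq : T.M q q = 0) :
    Tri E boundCode h (2000 * ((N + 1) * (N + 1)))
      (fun h' => Pre N ((Gate.H q).apply (T.den N)) ((1 / Real.sqrt 2 : ℝ) : ℂ) h' ∧
        Frame hadVars [] h h') := by
  have hb := R.base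
  have hN := le_sq (N := N)
  have hV := E.hV
  obtain ⟨lZ, d1, lZlen, lZis⟩ := fill_vec (E := E) (h := h) (s := .Z)
    (e := get .M (var .q * var .L + var .i)) hb hE (T.M q)
    (by decide) (by decide) (by decide) (by
      intro l k hl hk _
      have a2 := flat_lt (N := N) hq.le hk
      have e1 := R.M q hq.le k hk
      constructor
      · simp [hb.L, hb.len, hvq]
        omega
      · simp [hb.L, hvq, e1]) (fun k hk => by have := R.valid.M_le q hq.le k hk; omega)
  have d2 := Den.asg (E := E) (h := h.setA .Z lZ) (x := .al) (e := 1) (v := 1) (by decide)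
    (fun _ => by simp; omega) rfl
  have d3 := Den.asg (E := E) (h := (h.setA .Z lZ).setV .al 1) (x := .be) (e := var .d)
    (v := T.B q q) (by decide) (fun _ => trivial) (by simp [hd])
  have d4 := Den.asg (E := E) (h := ((h.setA .Z lZ).setV .al 1).setV .be (T.B q q)) (x := .ga)
    (e := 0) (v := 0) (by decide) (fun _ => by simp) rfl
  set h4 := (((h.setA .Z lZ).setV .al 1).setV .be (T.B q q)).setV .ga 0 with hh4
  have hb4 : Base N h4 := (((hb.setA lZlen).setV (by decide)).setV (by decide)).setV (by decide)
  obtain ⟨lB, d5, lBlen, lBis⟩ := hadBCode_den (E := E) (h := h4) (α := 1) (β := T.B q q) (γ := 0)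
    (z := T.M q) hb4 hE (by simpa [hh4] using R.B) (by simpa [hh4] using hW)
    (by simpa [hh4] using lZis) R.valid.B_le hq (R.valid.M_le q hq.le)
    (by simp [hh4, hvq]) (by simp [hh4]) (by simp [hh4]) (by simp [hh4]) le_rfl
    (R.valid.B_le q hq.le q hq.le) (by omega)
  have hb5 : Base N (h4.setA .B lB) := hb4.setA lBlen
  obtain ⟨lZ', d6, lZlen', lZis'⟩ := fill_vec (E := E) (h := h4.setA .B lB) (s := .Z)
    (e := eqE (var .i) (var .q)) hb5 hE (unitRow q)
    (by decide) (by decide) (by decide) (by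
      intro l k hl hk _
      constructor
      · simp
      · simp [hh4, hvq, unitRow]) (fun k hk => by simp only [unitRow]; split <;> omega)
  have hb6 : Base N ((h4.setA .B lB).setA .Z lZ') := hb5.setA lZlen'
  obtain ⟨lM, d7, lMlen, lMis⟩ := setRowCode_den (E := E) hb6 hE (M := T.M) (q := q)
    (z := unitRow q) (by simpa [hh4] using R.M) (by simpa using lZis') R.valid.M_le
    (fun k hk => by simp only [unitRow]; split <;> omega) (by simp [hh4, hvq])
  obtain ⟨v1, v2⟩ := H_bound R.valid hq hqq
  refine ⟨_, (d1.seq (d2.seq (d3.seq (d4.seq (d5.seq (d6.seq d7)))))).mono (by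
    rw [show (1 : AExp).cost = 1 from rfl, show (0 : AExp).cost = 1 from rfl,
      show (var .d).cost = 2 from rfl]; omega), ⟨hb6.setA lMlen, setRow T.M q (unitRow q),
      hadB T.B q (T.M q) 1 (T.B q q) 0, ?_, ?_, ?_, ?_⟩, ?_⟩
  · simpa using lMis
  · simpa using lBis
  · simpa [hh4, R.amp] using v1
  · simpa [hh4, R.amp] using v2
  · refine Frame.trans (Frame.trans (Frame.trans (Frame.trans (Frame.trans (Frame.trans
      (Frame.setA _ _ _ (by decide) _) (Frame.setV _ _ _ ?_ _)) (Frame.setV _ _ _ ?_ _))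
      (Frame.setV _ _ _ ?_ _)) (Frame.setA _ _ _ (by decide) _)) (Frame.setA _ _ _ (by decide) _))
      (Frame.setA _ _ _ (by decide) _) <;> decide

theorem freeOddCode_tri (hE : (N + 1) * (N + 1) + 100 ≤ E.V) (R : Rep N T h)
    (hq : q < N) (hvq : h.v .q = q) (hd : h.v .d = T.B q q) (hW : VecIs N (h.a .W) (hadRow T.B q))
    (hqq : T.M q q = 1) (hcol : ∀ i ≤ N, i ≠ q → T.M i q = 0) (hodd : T.B q q % 2 = 1)
    {z : ℕ → ℕ} (hZ : VecIs N (h.a .Z) z) (z1 : ∀ i ≤ N, z i ≤ 1) :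
    Tri E freeOddCode h (1000 * ((N + 1) * (N + 1)))
      (fun h' => (Pre N ((Gate.H q).apply (T.den N))
        ((Complex.I ^ (h'.v .e) + 1) * ((1 / Real.sqrt 2 : ℝ) : ℂ)) h' ∧ h'.v .e ≤ 3) ∧
        Frame hadVars [] h h') := by
  have hb := R.base
  have hN := le_sq (N := N)
  have hV := E.hV
  have d2 := Den.asg (E := E) (h := h) (x := .al) (e := 0) (v := 0) (by decide)
    (fun _ => by simp) rfl
  have d3 := Den.asg (E := E) (h := h.setV .al 0) (x := .be) (e := 0) (v := 0) (by decide)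
    (fun _ => by simp) rfl
  have d4 := Den.asg (E := E) (h := (h.setV .al 0).setV .be 0) (x := .ga)
    (e := 4 - var .d) (v := 4 - T.B q q) (by decide) (fun _ => by simp; omega) (by simp [hd])
  set h4 := ((h.setV .al 0).setV .be 0).setV .ga (4 - T.B q q) with hh4
  have hb4 : Base N h4 := ((hb.setV (by decide)).setV (by decide)).setV (by decide)
  obtain ⟨lB, d5, lBlen, lBis⟩ := hadBCode_den (E := E) (h := h4) (α := 0) (β := 0)
    (γ := 4 - T.B q q)
    (z := z) hb4 hE (by simpa [hh4] using R.B) (by simpa [hh4] using hW)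
    (by simpa [hh4] using hZ) R.valid.B_le hq z1
    (by simp [hh4, hvq]) (by simp [hh4]) (by simp [hh4]) (by simp [hh4]) (by omega)
    (by omega) (by omega)
  have hb5 : Base N (h4.setA .B lB) := hb4.setA lBlen
  have d6 := Den.asg (E := E) (h := h4.setA .B lB) (x := .e)
    (e := var .d) (v := T.B q q) (by decide) (fun _ => by simp) (by simp [hh4, hd])
  obtain ⟨v1, v2⟩ := H_free_odd R.valid hq hqq hcol hodd z
  rw [mul_assoc] at v1 v2
  refine ⟨_, (d2.seq (d3.seq (d4.seq (d5.seq d6)))).mono (by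
    rw [show (0 : AExp).cost = 1 from rfl, show (4 - var .d).cost = 4 from rfl,
      show (var .d).cost = 2 from rfl]; omega), ⟨⟨hb5.setV (by decide), T.M,
      hadB T.B q z 0 0 (4 - T.B q q), ?_, ?_, ?_, ?_⟩, ?_⟩, ?_⟩
  · simpa [hh4] using R.M
  · simpa using lBis
  · simpa [hh4, R.amp] using v1
  · simpa [hh4, R.amp] using v2
  · simpa using R.valid.B_le q hq.le q hq.le
  · refine Frame.trans (Frame.trans (Frame.trans (Frame.trans (Frame.setV _ _ _ ?_ _)
      (Frame.setV _ _ _ ?_ _)) (Frame.setV _ _ _ ?_ _)) (Frame.setA _ _ _ (by decide) _))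
      (Frame.setV _ _ _ ?_ _) <;> decide

theorem freeEvenCode_tri (hE : (N + 1) * (N + 1) + 100 ≤ E.V) (R : Rep N T h)
    (hq : q < N) (hvq : h.v .q = q) (hd : h.v .d = T.B q q) (hW : VecIs N (h.a .W) (hadRow T.B q))
    (hqq : T.M q q = 1) (hcol : ∀ i ≤ N, i ≠ q → T.M i q = 0) (heven : T.B q q % 2 = 0)
    {z : ℕ → ℕ} (hZ : VecIs N (h.a .Z) z) (z1 : ∀ i ≤ N, z i ≤ 1) :
    Tri E freeEvenCode h (2000 * ((N + 1) * (N + 1)))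
      (fun h' => (Pre N ((Gate.H q).apply (T.den N))
        ((Complex.I ^ (h'.v .e) + 1) * ((1 / Real.sqrt 2 : ℝ) : ℂ)) h' ∧ h'.v .e ≤ 3) ∧
        Frame hadVars [] h h') := by
  have hb := R.base
  have hN := le_sq (N := N)
  have hV := E.hV
  have d2 := Den.asg (E := E) (h := h) (x := .al) (e := 0) (v := 0) (by decide)
    (fun _ => by simp) rfl
  have d3 := Den.asg (E := E) (h := h.setV .al 0) (x := .be) (e := 0) (v := 0) (by decide)
    (fun _ => by simp) rfl
  have d4 := Den.asg (E := E) (h := (h.setV .al 0).setV .be 0) (x := .ga)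
    (e := 0) (v := 0) (by decide) (fun _ => by simp) rfl
  set h4 := ((h.setV .al 0).setV .be 0).setV .ga 0 with hh4
  have hb4 : Base N h4 := ((hb.setV (by decide)).setV (by decide)).setV (by decide)
  obtain ⟨lB, d5, lBlen, lBis⟩ := hadBCode_den (E := E) (h := h4) (α := 0) (β := 0)
    (γ := 0)
    (z := z) hb4 hE (by simpa [hh4] using R.B) (by simpa [hh4] using hW)
    (by simpa [hh4] using hZ) R.valid.B_le hq z1
    (by simp [hh4, hvq]) (by simp [hh4]) (by simp [hh4]) (by simp [hh4]) (by omega)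
    (by omega) (by omega)
  have hb5 : Base N (h4.setA .B lB) := hb4.setA lBlen
  have d6 := Den.asg (E := E) (h := h4.setA .B lB) (x := .s1)
    (e := 1) (v := 1) (by decide) (fun _ => by simp; omega) rfl
  have d7 := Den.asg (E := E) (h := (h4.setA .B lB).setV .s1 1) (x := .s2)
    (e := var .L) (v := N + 1) (by decide) (fun _ => by simp) (by simp [hb4.L])
  set h7 := ((h4.setA .B lB).setV .s1 1).setV .s2 (N + 1) with hh7
  have hb7 : Base N h7 := (hb5.setV (by decide)).setV (by decide)
  have w3 : ∀ i ≤ N, hadRow T.B q i ≤ 3 := fun i hi => by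
    simp only [hadRow]; split <;> [omega; exact R.valid.B_le q hq.le i hi]
  obtain ⟨lZ, k, d8, lZlen, lZis⟩ := matvecCode_den (E := E) (h := h7) hb7 hE
    (F := fun i j => T.M j i) (w := hadRow T.B q) (s₁ := 1) (s₂ := N + 1) (by simp [hh7])
    (by simp [hh7]) (by simpa [hh7, hh4] using hW) (fun i hi j hj => by
      have := flat_lt (N := N) hj hi
      have := R.M j hj i hi
      rw [mul_one, Nat.add_comm]
      exact ⟨by assumption, by simpa [hh7, hh4] using this⟩)
    (fun i hi j hj => R.valid.M_le j hj i hi) w3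
  set h8 := (h7.setV .acc k).setA .Z lZ with hh8
  have hb8 : Base N h8 := (hb7.setV (by decide)).setA lZlen
  set sm : ℕ → ℕ := fun i => ∑ j ∈ Finset.range (N + 1), hadRow T.B q j * T.M j i with hsm
  set y : ℕ → ℕ := fun i => (sm i + unitRow q i + T.B q q / 2 * unitRow N i) % 2 with hy
  have B3 := R.valid.B_le q hq.le q hq.le
  obtain ⟨lY, d9, lYlen, lYis⟩ := fill_vec (E := E) (h := h8) (s := .Z)
    (e := ((get .Z (var .i) + eqE (var .i) (var .q)) +
    (var .d / 2) * eqE (var .i) (var .L - 1)) % 2) hb8 hE y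
    (by decide) (by decide) (by decide) (by
      intro l k hl hk hlk
      have e1 : lZ[k]? = some (sm k % 2) := lZis k hk
      rw [hh8] at hlk
      simp only [Mem.setA_a, if_true] at hlk
      rw [e1] at hlk
      have e2 : h8.v .d = T.B q q := by simp [hh8, hh7, hh4, hd]
      have e3 : h8.v .q = q := by simp [hh8, hh7, hh4, hvq]
      have a2 : T.B q q / 2 * (if k = N then 1 else 0) ≤ 1 * 1 :=
        Nat.mul_le_mul (by omega) (by split <;> omega)
      have a3 : sm k % 2 < 2 := Nat.mod_lt _ (by decide)
      have hlk' : k < l.length := by omega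
      constructor
      · simp only [AExp.ok_add, AExp.ok_mul, AExp.ok_mod, AExp.ok_get, AExp.ok_eq, AExp.ok_sub,
          AExp.ok_div, AExp.ok_var, AExp.ok_one, AExp.ok_two, AExp.eval_add, AExp.eval_mul,
          AExp.eval_var, AExp.eval_get, AExp.eval_eq, AExp.eval_sub, AExp.eval_div, AExp.eval_one,
          AExp.eval_two, Mem.setV_v, Mem.setV_a, Mem.setA_a, Mem.setA_v, if_true, reduceCtorEq,
          if_false, hlk, Option.getD_some, hl, e2, e3, hb8.L, Nat.add_sub_cancel, true_and,
          and_true]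
        have : (if k = q then 1 else 0) ≤ 1 := by split <;> omega
        omega
      · simp only [AExp.eval_add, AExp.eval_mul, AExp.eval_mod,
          AExp.eval_var, AExp.eval_get, AExp.eval_eq, AExp.eval_sub, AExp.eval_div, AExp.eval_one,
          AExp.eval_two, Mem.setV_v, Mem.setV_a, Mem.setA_a, Mem.setA_v, if_true, reduceCtorEq,
          if_false, hlk, Option.getD_some, e2, e3, hb8.L, Nat.add_sub_cancel, hy, unitRow]
        omega) (fun k hk => by simp only [hy]; omega)
  have hb9 : Base N (h8.setA .Z lY) := hb8.setA lYlen
  obtain ⟨lM, d10, lMlen, lMis⟩ := setRowCode_den (E := E) hb9 hE (M := T.M) (q := q)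
    (z := y) (by simpa [hh8, hh7, hh4] using R.M) (by simpa using lYis) R.valid.M_le
    (fun k hk => by simp only [hy]; omega) (by simp [hh8, hh7, hh4, hvq])
  have hb10 : Base N ((h8.setA .Z lY).setA .M lM) := hb9.setA lMlen
  have d11 := Den.asg (E := E) (h := (h8.setA .Z lY).setA .M lM) (x := .e)
    (e := 0) (v := 0) (by decide) (fun _ => by simp) rfl
  obtain ⟨v1, v2⟩ := H_free_even R.valid hq hqq hcol heven z (y := y) (fun k _ => rfl)
  rw [mul_assoc] at v1 v2
  refine ⟨_, (d2.seq (d3.seq (d4.seq (d5.seq (d6.seq (d7.seq (d8.seq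
    (d9.seq (d10.seq d11))))))))).mono (by
    rw [show (0 : AExp).cost = 1 from rfl, show (1 : AExp).cost = 1 from rfl,
      show (var .L).cost = 2 from rfl]; omega),
    ⟨⟨hb10.setV (by decide), setRow T.M q y, hadB T.B q z 0 0 0, ?_, ?_, ?_, ?_⟩, ?_⟩, ?_⟩
  · simpa using lMis
  · simpa [hh8, hh7] using lBis
  · simpa [hh8, hh7, hh4, R.amp] using v1
  · simpa [hh8, hh7, hh4, R.amp] using v2
  · simp
  · refine Frame.trans (Frame.trans (Frame.trans (Frame.trans (Frame.trans (Frame.trans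
      (Frame.trans (Frame.trans (Frame.trans (Frame.trans (Frame.setV _ _ _ ?_ _)
      (Frame.setV _ _ _ ?_ _)) (Frame.setV _ _ _ ?_ _)) (Frame.setA _ _ _ (by decide) _))
      (Frame.setV _ _ _ ?_ _)) (Frame.setV _ _ _ ?_ _)) (Frame.setV _ _ _ ?_ _))
      (Frame.setA _ _ _ (by decide) _)) (Frame.setA _ _ _ (by decide) _))
      (Frame.setA _ _ _ (by decide) _))
      (Frame.setV _ _ _ ?_ _) <;> decide

end branches

theorem onePowCode_tri {ψ : State ℕ} {κ : ℂ}
    (H : Pre N ψ ((Complex.I ^ (h.v .e) + 1) * κ) h) (he : h.v .e ≤ 3) :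
    Tri E onePowCode h 63 (fun h' => Pre N ψ κ h' ∧ Frame hadVars [] h h') := by
  obtain ⟨hb, M, B, hM, hB, v1, v2⟩ := H
  have d1 := powCode_den (E := E) hb rfl he
  set h1 := (h.setC .aux Complex.I).setC .tmp (Complex.I ^ h.v .e) with hh1
  have d2 := Den.cconst (E := E) (h := h1) (z := .aux) (k := .one)
  have d3 := Den.cadd (E := E) (h := h1.setC .aux CConst.one.val) (z := .tmp) (u := .tmp) (v := .aux)
  have d4 := Den.cmul (E := E) (h := (h1.setC .aux CConst.one.val).setC .tmp
    ((h1.setC .aux CConst.one.val).c .tmp + (h1.setC .aux CConst.one.val).c .aux))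
    (z := .amp) (u := .amp) (v := .tmp)
  refine ⟨_, (d1.seq (d2.seq (d3.seq d4))).mono (by omega), ⟨hb.setC.setC.setC.setC.setC, M, B,
    hM, hB, ?_, ?_⟩, ?_⟩
  · simpa [hh1, CConst.val, mul_assoc] using v1
  · simpa [hh1, CConst.val, mul_assoc] using v2
  · exact ((((Frame.setC _ _ _ (by decide) _).trans (Frame.setC _ _ _ (by decide) _)).trans
      (Frame.setC _ _ _ (by decide) _)).trans (Frame.setC _ _ _ (by decide) _)).trans
      (Frame.setC _ _ _ (by decide) _)

theorem hadCoreCode_tri {T : Tab} {q : ℕ} (hE : (N + 1) * (N + 1) + 100 ≤ E.V) (R : Rep N T h)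
    (hq : q < N) (hvq : h.v .q = q) (hcol : T.M q q = 1 → ∀ i ≤ N, i ≠ q → T.M i q = 0)
    {z : ℕ → ℕ} (hZ : VecIs N (h.a .Z) z) (z1 : ∀ i ≤ N, z i ≤ 1) :
    Tri E hadCoreCode h (4000 * ((N + 1) * (N + 1)))
      (fun h' => Holds N ((Gate.H q).apply (T.den N)) h' ∧ Frame hadVars [] h h') := by
  have hb := R.base
  have hN := le_sq (N := N)
  have hV := E.hV
  have fqq := flat_lt (N := N) hq.le hq.le
  have eB := R.B q hq.le q hq.le
  have eM := R.M q hq.le q hq.le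
  have d1 := Den.asg (E := E) (h := h) (x := .d) (e := get .B (var .q * var .L + var .q))
    (v := T.B q q) (by decide)
    (fun _ => by simp [hvq, hb.L, hb.len]; omega) (by simp [hvq, hb.L, eB])
  have hb1 : Base N (h.setV .d (T.B q q)) := hb.setV (by decide)
  have w3 : ∀ i ≤ N, hadRow T.B q i ≤ 3 := fun i hi => by
    simp only [hadRow]; split <;> [omega; exact R.valid.B_le q hq.le i hi]
  obtain ⟨lW, d2, lWlen, lWis⟩ := fill_vec (E := E) (h := h.setV .d (T.B q q)) (s := .W)
    (e := eqE (var .i) (var .q) + (1 - eqE (var .i) (var .q)) * get .B (var .q * var .L + var .i))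
    hb1 hE (hadRow T.B q)
    (by decide) (by decide) (by decide) (by
      intro l k hl hk _
      have a2 := flat_lt (N := N) hq.le hk
      have e1 := R.B q hq.le k hk
      have := R.valid.B_le q hq.le k hk
      by_cases hkq : k = q
      · constructor
        · simp [hb.L, hb.len, hvq, hkq]
          omega
        · simp [hvq, hkq, hadRow]
      · constructor
        · simp [hb.L, hb.len, hvq, hkq, e1]
          omega
        · simp [hb.L, hvq, e1, hkq, hadRow]) w3
  set h2 := (h.setV .d (T.B q q)).setA .W lW with hh2
  have hb2 : Base N h2 := hb1.setA lWlen
  have R2 : Rep N T h2 := ⟨hb2, by simpa [hh2] using R.M, by simpa [hh2] using R.B,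
    by simpa [hh2] using R.amp, R.valid⟩
  have hq2 : h2.v .q = q := by simp [hh2, hvq]
  have hd2 : h2.v .d = T.B q q := by simp [hh2]
  have hW2 : VecIs N (h2.a .W) (hadRow T.B q) := by simpa [hh2] using lWis
  have hZ2 : VecIs N (h2.a .Z) z := by simpa [hh2] using hZ
  have fr2 : Frame hadVars [] h h2 :=
    (Frame.setV _ _ h (by decide) _).trans (Frame.setA _ _ _ (by decide) _)
  have evM : (get .M (var .q * var .L + var .q)).eval h2 = T.M q q := by
    have := R2.M q hq.le q hq.le
    simp [hq2, hb2.L, this]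
  have d3 : Tri E (ifE (get .M (var .q * var .L + var .q))
      (.seq (ifE (var .d % 2) freeOddCode freeEvenCode) onePowCode) boundCode) h2
      ((get .M (var .q * var .L + var .q)).cost + (3000 * ((N + 1) * (N + 1)) + 1))
      (fun h' => Pre N ((Gate.H q).apply (T.den N)) ((1 / Real.sqrt 2 : ℝ) : ℂ) h' ∧
        Frame hadVars [] h h') := by
    refine Tri.ifE (by decide) (fun _ => by simp [hq2, hb2.L, hb2.len]; omega) (fun hne => ?_)
      (fun he => ?_)
    · rw [evM] at hne
      have hqq : T.M q q = 1 := by have := R.valid.M_le q hq.le q hq.le; omega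
      have ev : (var .d % 2).eval h2 = T.B q q % 2 := by simp [hd2]
      refine Tri.mono (Tri.seq (Q₁ := fun h' => (Pre N ((Gate.H q).apply (T.den N))
        ((Complex.I ^ (h'.v .e) + 1) * ((1 / Real.sqrt 2 : ℝ) : ℂ)) h' ∧ h'.v .e ≤ 3) ∧
        Frame hadVars [] h2 h') (Tri.ifE (T := 2000 * ((N + 1) * (N + 1))) (by decide)
          (fun _ => by simp; omega) (fun hne => ?_) (fun he => ?_))
        (fun h' hh => (onePowCode_tri (E := E) hh.1.1 hh.1.2).mono le_rfl
          (Q' := fun h'' => Pre N ((Gate.H q).apply (T.den N)) ((1 / Real.sqrt 2 : ℝ) : ℂ) h'' ∧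
            Frame hadVars [] h h'') (fun h'' hh' => ⟨hh'.1, (fr2.trans hh.2).trans hh'.2⟩)))
        ?_ (fun _ a => a)
      · rw [ev] at hne
        exact (freeOddCode_tri hE R2 hq hq2 hd2 hW2 hqq (hcol hqq) (by omega) hZ2 z1).mono
          (by omega) (fun _ a => a)
      · rw [ev] at he
        exact freeEvenCode_tri hE R2 hq hq2 hd2 hW2 hqq (hcol hqq) he hZ2 z1
      · rw [show (var .d % 2).cost = 4 from rfl]; omega
    · rw [evM] at he
      exact (boundCode_tri hE R2 hq hq2 hd2 hW2 he).mono (by omega)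
        (fun h' a => ⟨a.1, fr2.trans a.2⟩)
  refine (d1.seq_tri (d2.seq_tri (d3.seq (T₂ := 2)
    (Q := fun h' => Holds N ((Gate.H q).apply (T.den N)) h' ∧ Frame hadVars [] h h')
    fun h3 hh3 => ?_))).mono (by
    rw [show (get .M (var .q * var .L + var .q)).cost = 9 from rfl,
      show (get .B (var .q * var .L + var .q)).cost = 9 from rfl]; omega) (fun _ a => a)
  obtain ⟨⟨hb3, M, B, hM, hB, v1, v2⟩, fr3⟩ := hh3
  refine ⟨_, (Den.cconst (E := E) (h := h3) (z := .tmp) (k := .invSqrtTwo)).seq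
    (Den.cmul (z := .amp) (u := .amp) (v := .tmp)), ⟨⟨M, B, _⟩, ⟨hb3.setC.setC, hM, hB, ?_, v1⟩, v2⟩, ?_⟩
  · simp [CConst.val]
  · exact (fr3.trans (Frame.setC _ _ _ (by decide) _)).trans (Frame.setC _ _ _ (by decide) _)

/-- `Z` is cleared because the update of `B` for a free qubit still multiplies its entries by 0, and
they must be known to be small for the evaluation to stay within the word bound. -/
def hadCode : Code arch := .seq swapCode (.seq (fill .Z (var .L) 0) hadCoreCode)

theorem hadCode_tri {ψ : State ℕ} {q : ℕ} (hE : (N + 1) * (N + 1) + 100 ≤ E.V) (H : Holds N ψ h)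
    (hq : q < N) (hvq : h.v .q = q) :
    Tri E hadCode h (7000 * ((N + 1) * (N + 1)))
      (fun h' => Holds N ((Gate.H q).apply ψ) h' ∧ Frame hadVars [] h h') := by
  obtain ⟨T, R, rfl⟩ := H
  refine ((swapCode_tri hE R hq hvq).seq (T₂ := 5000 * ((N + 1) * (N + 1)))
    fun h1 ⟨⟨T', R', hden, hcol⟩, fr⟩ => ?_).mono (by omega) (fun _ a => a)
  have fr1 : Frame hadVars [] h h1 := fr.mono (by decide) (by decide)
  obtain ⟨lZ, d1, lZlen, lZis⟩ := fill_vec (E := E) (h := h1) (s := .Z) (e := 0) R'.base hE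
    (fun _ => 0) (by decide) (by decide) (by decide) (fun l k _ _ _ => by simp) (by simp)
  have R2 : Rep N T' (h1.setA .Z lZ) := ⟨R'.base.setA lZlen, by simpa using R'.M,
    by simpa using R'.B, R'.amp, R'.valid⟩
  have fr2 := fr1.trans (Frame.setA hadVars [] h1 (s := .Z) (by decide) lZ)
  refine (d1.seq_tri (hadCoreCode_tri hE R2 hq ?_ hcol (z := fun _ => 0) ?_ (by simp))).mono
    (by omega) (fun h' a => ⟨hden ▸ a.1, fr2.trans a.2⟩)
  · rw [Mem.setA_v, fr.v .q (by decide), hvq]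
  · simpa using lZis

/-! ## All gates -/

/-- `B[e₁, e₂] := B[e₁, e₂] + 1` modulo `4` -/
def bumpCode (x y : Var) : Code arch :=
  put .B (var x * var .L + var y) ((get .B (var x * var .L + var y) + 1) % 4)

theorem bumpCode_den {x y : Var} {c t : ℕ} {B : ℕ → ℕ → ℕ} (hb : Base N h)
    (hE : (N + 1) * (N + 1) + 100 ≤ E.V) (hB : MatIs N (h.a .B) B)
    (B3 : ∀ i ≤ N, ∀ j ≤ N, B i j ≤ 3) (hc : c ≤ N) (ht : t ≤ N) (hx : h.v x = c) (hy : h.v y = t) :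
    ∃ l, Den E (bumpCode x y) h 30 (h.setA .B l) ∧ l.length = (N + 1) * (N + 1) ∧
      MatIs N l (bump B c t) := by
  have a1 := flat_lt hc ht
  have e1 := hB c hc t ht
  have b3 := B3 c hc t ht
  have hN := le_sq (N := N)
  refine ⟨(h.a .B).set (c * (N + 1) + t) ((B c t + 1) % 4), (Den.put (E := E) (h := h)
    (i := c * (N + 1) + t) (v := (B c t + 1) % 4) (Nat.le_of_ble_eq_true rfl)
    (Nat.le_of_ble_eq_true rfl)
    (fun _ => ?_) (fun _ => ?_) ?_ ?_ (by decide) (by omega) (by rw [hb.len _ (by decide)]; omega)).mono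
      (Nat.le_of_ble_eq_true rfl), by simp [hb.len], ?_⟩
  · simp [hx, hy, hb.L]
    omega
  · simp [hx, hy, hb.L, hb.len, e1]
    omega
  · simp [hx, hy, hb.L]
  · simp [hx, hy, hb.L, e1]
  · intro i hi j hj
    rw [List.getElem?_set]
    by_cases hcij : c = i ∧ t = j
    · obtain ⟨rfl, rfl⟩ := hcij
      simp [hb.len, a1, bump, unitRow]
    · rw [if_neg, hB i hi j hj]
      · have := B3 i hi j hj
        have h0 : unitRow c i * unitRow t j = 0 := by
          simp only [unitRow]
          by_cases h1 : i = c
          · have : j ≠ t := fun e => hcij ⟨h1.symm, e.symm⟩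
            simp [this]
          · simp [h1]
        simp only [bump, h0, add_zero]
        rw [Nat.mod_eq_of_lt (by omega)]
      · intro e
        apply hcij
        have h1 := congrArg (· / (N + 1)) e
        have h2 := congrArg (· % (N + 1)) e
        simp only [Nat.mul_comm _ (N + 1), Nat.mul_add_div (Nat.succ_pos _),
          Nat.div_eq_of_lt (show t < N + 1 by omega), Nat.div_eq_of_lt (show j < N + 1 by omega),
          Nat.mul_add_mod, Nat.mod_eq_of_lt (show t < N + 1 by omega),
          Nat.mod_eq_of_lt (show j < N + 1 by omega)] at h1 h2
        exact ⟨by omega, h2⟩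

def gateVars : List Var := .q :: .b :: .cc :: hadVars

def cxCode : Code arch :=
  .seq hadCode (.seq (bumpCode .cc .q) (.seq (bumpCode .q .cc) hadCode))

theorem cxCode_tri {ψ : State ℕ} {c q : ℕ} (hE : (N + 1) * (N + 1) + 100 ≤ E.V) (H : Holds N ψ h)
    (hc : c < N) (hq : q < N) (hne : c ≠ q) (hvc : h.v .cc = c) (hvq : h.v .q = q) :
    Tri E cxCode h (15000 * ((N + 1) * (N + 1)))
      (fun h' => Holds N ((Gate.CX c q hne).apply ψ) h' ∧ Frame hadVars [] h h') := by
  have hN := le_sq (N := N)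
  refine ((hadCode_tri hE H hq hvq).seq (T₂ := 8000 * ((N + 1) * (N + 1)))
    fun h1 ⟨⟨T, R, hden⟩, fr⟩ => ?_).mono (by omega) (fun _ a => a)
  have v1 : h1.v .q = q := by rw [fr.v .q (by decide), hvq]
  have v2 : h1.v .cc = c := by rw [fr.v .cc (by decide), hvc]
  obtain ⟨l, d1, l1, l2⟩ := bumpCode_den (E := E) R.base hE R.B R.valid.B_le hc.le hq.le v2 v1
  obtain ⟨l', d2, l1', l2'⟩ := bumpCode_den (E := E) (x := .q) (y := .cc) (h := h1.setA .B l)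
    (B := bump T.B c q) (R.base.setA l1) hE
    (by simpa using l2) (fun i _ j _ => by simp only [bump]; omega) hq.le hc.le v1 v2
  have R2 : Rep N { T with B := bump (bump T.B c q) q c } ((h1.setA .B l).setA .B l') :=
    ⟨(R.base.setA l1).setA l1', by simpa using R.M, by simpa using l2', R.amp, CZ_valid R.valid⟩
  refine (d1.seq_tri (d2.seq_tri (hadCode_tri hE ⟨_, R2, rfl⟩ hq v1))).mono
    (by omega) (fun h' a => ⟨?_, ((fr.trans (Frame.setA _ _ _ (by decide) _)).trans
      (Frame.setA _ _ _ (by decide) _)).trans a.2⟩)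
  rw [CX_eq hne, ← hden, ← CZ_den hq hc]
  exact a.1

end QSim

namespace QSim

/-! # Terms of the simulation, as maps of states on the qubits `ℕ` -/

/-! ### Circuits on subsets of the qubits, and linearity -/

section relabel

variable {ι κ : Type}

def Gate.map (e : ι → κ) (he : Function.Injective e) : Gate ι → Gate κ
  | .S q => .S (e q)
  | .H q => .H (e q)
  | .CX c t h => .CX (e c) (e t) (he.ne h)
  | .meas q b => .meas (e q) b

theorem Gate.toTree_map (e : ι → κ) (he : Function.Injective e) (num : κ → ℕ) (g : Gate ι) :
    (g.map e he).toTree num = g.toTree (fun i => num (e i)) := by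
  cases g <;> rfl

def Gate.qubits : Gate ι → List ι
  | .S q => [q]
  | .H q => [q]
  | .CX c t _ => [c, t]
  | .meas q _ => [q]

theorem Gate.qubits_map (e : ι → κ) (he : Function.Injective e) (g : Gate ι) :
    (g.map e he).qubits = g.qubits.map e := by
  cases g <;> rfl

variable [DecidableEq ι] [DecidableEq κ]

/-- The amplitudes on the qubits `e i`, with the other qubits fixed to the values in `z`. -/
noncomputable def slice (e : ι → κ) (z : κ → Bool) (Ψ : State κ) : State ι := fun y => Ψ (Function.extend e y z)

theorem extend_update {e : ι → κ} (he : Function.Injective e) (y : ι → Bool) (z : κ → Bool) (q : ι)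
    (v : Bool) : Function.extend e (Function.update y q v) z =
      Function.update (Function.extend e y z) (e q) v := by
  funext k
  by_cases hk : ∃ i, e i = k
  · obtain ⟨i, rfl⟩ := hk
    simp only [he.extend_apply, Function.update_apply, he.eq_iff]
  · have : k ≠ e q := fun h => hk ⟨q, h.symm⟩
    rw [Function.update_of_ne this, Function.extend_apply' _ _ _ hk, Function.extend_apply' _ _ _ hk]

/-- A gate on qubits in the image of `e` leaves all others alone, so for fixed values of the others
it acts as the gate on `ι`. -/
theorem slice_apply {e : ι → κ} (he : Function.Injective e) (z : κ → Bool) (g : Gate ι)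
    (Ψ : State κ) : slice e z ((g.map e he).apply Ψ) = g.apply (slice e z Ψ) := by
  funext y
  cases g <;> simp [slice, Gate.map, Gate.apply, he.extend_apply, extend_update he]

theorem slice_run {e : ι → κ} (he : Function.Injective e) (z : κ → Bool) (C : StabCircuit ι)
    (Ψ : State κ) :
    slice e z (StabCircuit.run (C.map (Gate.map e he)) Ψ) = C.run (slice e z Ψ) := by
  induction C generalizing Ψ with
  | nil => rfl
  | cons g C ih =>
    have := ih ((g.map e he).apply Ψ)
    rw [slice_apply] at this
    exact this

theorem Gate.apply_add (g : Gate ι) (ψ φ : State ι) : g.apply (ψ + φ) = g.apply ψ + g.apply φ := by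
  funext x
  cases g <;> simp only [Gate.apply, Pi.add_apply]
  · ring
  · ring
  · split <;> simp

theorem Gate.apply_smul (g : Gate ι) (c : ℂ) (ψ : State ι) : g.apply (c • ψ) = c • g.apply ψ := by
  funext x
  cases g <;> simp only [Gate.apply, Pi.smul_apply, smul_eq_mul]
  · ring
  · ring
  · split <;> simp

theorem StabCircuit.run_add (C : StabCircuit ι) (ψ φ : State ι) :
    C.run (ψ + φ) = C.run ψ + C.run φ := by
  induction C generalizing ψ φ with
  | nil => rfl
  | cons g C ih =>
    have := ih (g.apply ψ) (g.apply φ)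
    rw [← Gate.apply_add] at this
    exact this

theorem StabCircuit.run_smul (C : StabCircuit ι) (c : ℂ) (ψ : State ι) :
    C.run (c • ψ) = c • C.run ψ := by
  induction C generalizing ψ with
  | nil => rfl
  | cons g C ih =>
    have := ih (g.apply ψ)
    rw [← Gate.apply_smul] at this
    exact this

noncomputable def StabCircuit.linear (C : StabCircuit ι) : State ι →ₗ[ℂ] State ι where
  toFun := C.run
  map_add' := C.run_add
  map_smul' := C.run_smul

/-- A qubit that is not touched remains in the state `0`. -/
theorem Gate.apply_support {g : Gate ι} {q : ι} (hq : q ∉ g.qubits) {Ψ : State ι}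
    (h : ∀ x, x q = true → Ψ x = 0) : ∀ x, x q = true → g.apply Ψ x = 0 := by
  intro x hx
  cases g with
  | S p => simp [Gate.apply, h x hx]
  | H p =>
    have : q ≠ p := by simpa [Gate.qubits] using hq
    have h0 := h (Function.update x p false) (by rw [Function.update_of_ne this, hx])
    have h1 := h (Function.update x p true) (by rw [Function.update_of_ne this, hx])
    simp [Gate.apply, h0, h1]
  | CX c t hne =>
    have : q ≠ t := fun e => hq (by simp [Gate.qubits, e])
    simp only [Gate.apply]
    exact h _ (by rw [Function.update_of_ne this, hx])
  | meas p b => simp [Gate.apply, h x hx]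

theorem StabCircuit.run_support {C : StabCircuit ι} {q : ι} (hq : ∀ g ∈ C, q ∉ g.qubits)
    {Ψ : State ι} (h : ∀ x, x q = true → Ψ x = 0) : ∀ x, x q = true → C.run Ψ x = 0 := by
  induction C generalizing Ψ with
  | nil => exact h
  | cons g C ih =>
    exact ih (fun g' hg' => hq g' (List.mem_cons_of_mem _ hg'))
      (Gate.apply_support (hq g List.mem_cons_self) h)

end relabel

/-! ## Resetting ancillas -/

noncomputable def resetQubit (n : ℕ) (Ψ : State ℕ) (q : ℕ) : State ℕ :=
  if q < n then Ψ else (Gate.meas q false).apply Ψ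

/-- Projects the ancillas that the gates of a circuit act on to the state `0`. -/
noncomputable def reset (n : ℕ) (C : List (Gate ℕ)) (Ψ : State ℕ) : State ℕ :=
  C.foldl (fun Φ g => g.qubits.foldl (resetQubit n) Φ) Ψ

theorem foldl_resetQubit (n : ℕ) (l : List ℕ) (Ψ : State ℕ) (x : ℕ → Bool) :
    l.foldl (resetQubit n) Ψ x = if ∀ q ∈ l, n ≤ q → x q = false then Ψ x else 0 := by
  induction l generalizing Ψ with
  | nil => simp
  | cons q l ih =>
    simp only [List.foldl_cons, ih, List.forall_mem_cons, resetQubit]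
    by_cases hq : q < n
    · simp [hq]
    · by_cases hx : x q = false <;> simp [hq, hx, Gate.apply, Nat.le_of_not_lt hq]

theorem reset_apply (n : ℕ) (C : List (Gate ℕ)) (Ψ : State ℕ) (x : ℕ → Bool) :
    reset n C Ψ x = if ∀ g ∈ C, ∀ q ∈ g.qubits, n ≤ q → x q = false then Ψ x else 0 := by
  induction C generalizing Ψ with
  | nil => simp [reset]
  | cons g C ih =>
    have := ih (g.qubits.foldl (resetQubit n) Ψ)
    rw [show reset n (g :: C) Ψ = reset n C (g.qubits.foldl (resetQubit n) Ψ) from rfl, this]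
    rw [foldl_resetQubit]
    by_cases h1 : ∀ q ∈ g.qubits, n ≤ q → x q = false
    · rw [if_pos h1]
      refine if_congr ?_ rfl rfl
      rw [List.forall_mem_cons]
      exact ⟨fun h => ⟨h1, h⟩, fun h => h.2⟩
    · rw [if_neg h1, ite_self, if_neg]
      exact fun h => h1 (h g List.mem_cons_self)

/-- The state `ψ` on the first `n` qubits, with the other ones up to number `N` in the state `0`. -/
noncomputable def emb (n N : ℕ) (ψ : State (Fin n)) : State ℕ :=
  fun x => if ∀ i < N, n ≤ i → x i = false then ψ (fun i => x i) else 0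

/-! ### The terms of one gate, and their sum -/

section impl

variable {n : ℕ}

def numC (n a : ℕ) : Fin n ⊕ Fin a → ℕ :=
  Sum.elim (fun i : Fin n => (i : ℕ)) (fun j : Fin a => n + (j : ℕ))

def numA (n a : ℕ) (j : Fin a) : ℕ := n + (j : ℕ)

theorem numC_injective (n a : ℕ) : Function.Injective (numC n a) := by
  rintro (i | i) (j | j) h <;> simp only [numC, Sum.elim_inl, Sum.elim_inr] at h
  · rw [Fin.ext h]
  · omega
  · omega
  · rw [Fin.ext (Nat.add_left_cancel h)]

theorem numA_injective (n a : ℕ) : Function.Injective (numA n a) :=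
  fun _ _ h => Fin.ext (Nat.add_left_cancel h)

def Impl.circN (F : Impl n) : List (Gate ℕ) :=
  F.circ.map (Gate.map (numC n F.anc) (numC_injective n F.anc))

def Impl.prepN (F : Impl n) (j : Fin F.rank) : List (Gate ℕ) :=
  (F.prep j).map (Gate.map (numA n F.anc) (numA_injective n F.anc))

/-- The term number `j` of a gate. -/
noncomputable def Impl.step (F : Impl n) (j : ℕ) (Ψ : State ℕ) : State ℕ :=
  if h : j < F.rank then
    F.coeff ⟨j, h⟩ • reset n F.circN (reset n (F.prepN ⟨j, h⟩)
      (StabCircuit.run F.circN (StabCircuit.run (F.prepN ⟨j, h⟩) Ψ)))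
  else 0

variable {F : Impl n} {N : ℕ}

theorem circN_lt (hN : n + F.anc ≤ N) : ∀ g ∈ F.circN, ∀ q ∈ g.qubits, q < N := by
  intro g hg q hq
  simp only [Impl.circN, List.mem_map] at hg
  obtain ⟨g, -, rfl⟩ := hg
  rw [Gate.qubits_map, List.mem_map] at hq
  obtain ⟨i, -, rfl⟩ := hq
  rcases i with i | i <;> simp only [numC, Sum.elim_inl, Sum.elim_inr] <;> omega

theorem prepN_lt (hN : n + F.anc ≤ N) (j : Fin F.rank) :
    ∀ g ∈ F.prepN j, ∀ q ∈ g.qubits, q < N := by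
  intro g hg q hq
  simp only [Impl.prepN, List.mem_map] at hg
  obtain ⟨g, -, rfl⟩ := hg
  rw [Gate.qubits_map, List.mem_map] at hq
  obtain ⟨i, -, rfl⟩ := hq
  simp only [numA]; omega

/-- An ancilla that no gate acts on is still 0 in the term by `StabCircuit.run_support`. Projecting
the ancillas that occur in either circuit is therefore the same as projecting all of them. -/
theorem reset_terms (hN : n + F.anc ≤ N) (j : Fin F.rank) (ψ : State (Fin n)) (x : ℕ → Bool) :
    reset n F.circN (reset n (F.prepN j) (StabCircuit.run F.circN
      (StabCircuit.run (F.prepN j) (emb n N ψ)))) x =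
    if ∀ i < N, n ≤ i → x i = false then StabCircuit.run F.circN
      (StabCircuit.run (F.prepN j) (emb n N ψ)) x else 0 := by
  rw [reset_apply, reset_apply]
  by_cases h : ∀ i < N, n ≤ i → x i = false
  · rw [if_pos h, if_pos fun g hg q hq => h q (circN_lt hN g hg q hq),
      if_pos fun g hg q hq => h q (prepN_lt hN j g hg q hq)]
  · rw [if_neg h]
    push Not at h
    obtain ⟨i, hi, hni, hx⟩ := h
    simp only [ne_eq, Bool.not_eq_false] at hx
    by_cases hc : ∃ g ∈ F.circN, i ∈ g.qubits
    · obtain ⟨g, hg, hq⟩ := hc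
      rw [if_neg fun h => by simpa [hx] using h g hg i hq hni]
    by_cases hp : ∃ g ∈ F.prepN j, i ∈ g.qubits
    · obtain ⟨g, hg, hq⟩ := hp
      rw [if_neg (c := ∀ g ∈ F.prepN j, _) fun h => by simpa [hx] using h g hg i hq hni, ite_self]
    push Not at hc hp
    rw [StabCircuit.run_support hc (StabCircuit.run_support hp ?_) x hx]
    · simp
    · intro y hy
      simp only [emb]
      exact if_neg fun h => by simpa [hy] using h i hi hni

/-- The preparation acts on ancillas only, and these start in 0. So the state of the first `n +
F.anc` qubits is a product, and the scalar records that the remaining qubits below `N` have to be 0.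
-/
theorem slice_prep (j : Fin F.rank) (hN : n + F.anc ≤ N)
    (ψ : State (Fin n)) (x : ℕ → Bool) :
    slice (numC n F.anc) x (StabCircuit.run (F.prepN j) (emb n N ψ)) =
      (if ∀ i < N, n + F.anc ≤ i → x i = false then (1 : ℂ) else 0) •
        tensor ψ ((F.prep j).run (ket0 (Fin F.anc))) := by
  funext y
  set w := Function.extend (numC n F.anc) y x with hw
  have hw1 : ∀ i : Fin n, w i = y (.inl i) := fun i =>
    (numC_injective n F.anc).extend_apply y x (.inl i)
  have hw2 : ∀ i, n + F.anc ≤ i → w i = x i := by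
    intro i hi
    refine Function.extend_apply' _ _ _ ?_
    rintro ⟨k | k, hk⟩ <;> simp only [numC, Sum.elim_inl, Sum.elim_inr] at hk <;> omega
  have h1 : slice (numA n F.anc) w (emb n N ψ) =
      ((if ∀ i < N, n + F.anc ≤ i → x i = false then (1 : ℂ) else 0) *
        ψ (fun i => y (.inl i))) • ket0 (Fin F.anc) := by
    funext u
    have e1 : ∀ i : Fin F.anc, Function.extend (numA n F.anc) u w (n + i) = u i := fun i =>
      (numA_injective n F.anc).extend_apply u w i
    have e2 : ∀ i, (i < n ∨ n + F.anc ≤ i) → Function.extend (numA n F.anc) u w i = w i := by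
      intro i hi
      refine Function.extend_apply' _ _ _ ?_
      rintro ⟨k, hk⟩
      simp only [numA] at hk
      omega
    have e3 : (∀ i < N, n ≤ i → Function.extend (numA n F.anc) u w i = false) ↔
        (∀ i < N, n + F.anc ≤ i → x i = false) ∧ u = fun _ => false := by
      constructor
      · intro h
        refine ⟨fun i hi hni => ?_, funext fun i => ?_⟩
        · rw [← hw2 i hni, ← e2 i (.inr hni)]; exact h i hi (by omega)
        · rw [← e1 i]; exact h _ (by omega) (by omega)
      · rintro ⟨h, rfl⟩ i hi hni
        by_cases hia : n + F.anc ≤ i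
        · rw [e2 i (.inr hia), hw2 i hia]; exact h i hi hia
        · have := e1 ⟨i - n, by omega⟩
          simpa only [show n + (i - n) = i by omega] using this
    have e4 : (fun i : Fin n => Function.extend (numA n F.anc) u w i) = fun i => y (.inl i) :=
      funext fun i => by rw [e2 i (.inl i.2), hw1]
    simp only [slice, emb, e3, e4, Pi.smul_apply, smul_eq_mul, ket0]
    by_cases a : ∀ i < N, n + F.anc ≤ i → x i = false
    · by_cases b : u = fun _ => false <;> simp [b]
    · simp [a]
  have h2 : Function.extend (numA n F.anc) (fun i => y (.inr i)) w = w := by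
    funext k
    by_cases hk : ∃ i, numA n F.anc i = k
    · obtain ⟨i, rfl⟩ := hk
      rw [(numA_injective n F.anc).extend_apply]
      exact ((numC_injective n F.anc).extend_apply y x (.inr i)).symm
    · rw [Function.extend_apply' _ _ _ hk]
  have h3 := congrFun (slice_run (numA_injective n F.anc) w (F.prep j) (emb n N ψ))
    (fun i => y (.inr i))
  rw [h1, StabCircuit.run_smul] at h3
  have h4 : slice (numC n F.anc) x (StabCircuit.run (F.prepN j) (emb n N ψ)) y =
      slice (numA n F.anc) w (StabCircuit.run (F.prepN j) (emb n N ψ)) (fun i => y (.inr i)) := by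
    change _ = StabCircuit.run (F.prepN j) (emb n N ψ)
      (Function.extend (numA n F.anc) (fun i => y (.inr i)) w)
    rw [h2]
    rfl
  rw [h4]
  refine h3.trans ?_
  simp only [tensor, Pi.smul_apply, smul_eq_mul, mul_assoc]

/-- For fixed values outside the first `n + F.anc` qubits, every term is the circuit applied to `ψ`
tensor a prepared state. By linearity the sum has the magic state in the second factor, and the
implementation property applies. -/
theorem sum_terms {U : Unitary n} {θ : ℝ} (hN : n + F.anc ≤ N)
    (hU : ∀ ψ : State (Fin n), F.circ.run (tensor ψ F.magic) =
      fun z => Complex.exp (θ * Complex.I) * tensor (U.1.mulVec ψ) (ket0 (Fin F.anc)) z)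
    (ψ : State (Fin n)) :
    ∑ j, F.coeff j • StabCircuit.run F.circN (StabCircuit.run (F.prepN j) (emb n N ψ)) =
      Complex.exp (θ * Complex.I) • emb n N (U.1.mulVec ψ) := by
  funext x
  set y : Fin n ⊕ Fin F.anc → Bool := fun i => x (numC n F.anc i) with hy
  have hx : Function.extend (numC n F.anc) y x = x := by
    funext k
    by_cases hk : ∃ i, numC n F.anc i = k
    · obtain ⟨i, rfl⟩ := hk
      rw [(numC_injective n F.anc).extend_apply]
    · rw [Function.extend_apply' _ _ _ hk]
  set s : ℂ := if ∀ i < N, n + F.anc ≤ i → x i = false then (1 : ℂ) else 0 with hs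
  have h1 : ∀ j, StabCircuit.run F.circN (StabCircuit.run (F.prepN j) (emb n N ψ)) x =
      s * F.circ.run (tensor ψ ((F.prep j).run (ket0 (Fin F.anc)))) y := by
    intro j
    have h2 := congrFun (slice_run (numC_injective n F.anc) x F.circ
      (StabCircuit.run (F.prepN j) (emb n N ψ))) y
    rw [slice_prep j hN, StabCircuit.run_smul] at h2
    simp only [slice, hx] at h2
    exact h2
  have h3 : tensor ψ F.magic =
      ∑ j, F.coeff j • tensor ψ ((F.prep j).run (ket0 (Fin F.anc))) := by
    funext z
    simp only [tensor, Impl.magic, Finset.sum_apply, Pi.smul_apply, smul_eq_mul, Finset.mul_sum]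
    exact Finset.sum_congr rfl fun j _ => by ring
  have h4 := hU ψ
  rw [h3] at h4
  have h5 : F.circ.run (∑ j, F.coeff j • tensor ψ ((F.prep j).run (ket0 (Fin F.anc)))) =
      ∑ j, F.coeff j • F.circ.run (tensor ψ ((F.prep j).run (ket0 (Fin F.anc)))) := by
    have := map_sum (StabCircuit.linear F.circ)
      (fun j => F.coeff j • tensor ψ ((F.prep j).run (ket0 (Fin F.anc)))) Finset.univ
    refine this.trans (Finset.sum_congr rfl fun j _ => ?_)
    exact StabCircuit.run_smul _ _ _
  rw [h5] at h4
  have h6 := congrFun h4 y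
  simp only [Finset.sum_apply, Pi.smul_apply, smul_eq_mul] at h6 ⊢
  have h7 : s * tensor (U.1.mulVec ψ) (ket0 (Fin F.anc)) y = emb n N (U.1.mulVec ψ) x := by
    simp only [tensor, ket0, emb, hs, hy, numC, Sum.elim_inl, Sum.elim_inr]
    by_cases h : ∀ i < N, n ≤ i → x i = false
    · rw [if_pos h, if_pos (fun i hi hni => h i hi (by omega)),
        if_pos (funext fun j => h _ (by omega) (by omega))]
      ring
    · rw [if_neg h]
      by_cases h' : ∀ i < N, n + F.anc ≤ i → x i = false
      · rw [if_neg (c := _ = _), mul_zero, mul_zero]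
        intro h''
        apply h
        intro i hi hni
        by_cases hia : n + F.anc ≤ i
        · exact h' i hi hia
        · have := congrFun h'' ⟨i - n, by omega⟩
          simpa only [show n + (i - n) = i by omega] using this
      · rw [if_neg h', zero_mul]
  simp only [h1]
  calc ∑ j, F.coeff j * (s * F.circ.run (tensor ψ ((F.prep j).run (ket0 (Fin F.anc)))) y)
      = s * ∑ j, F.coeff j * F.circ.run (tensor ψ ((F.prep j).run (ket0 (Fin F.anc)))) y := by
        rw [Finset.mul_sum]; exact Finset.sum_congr rfl fun j _ => by ring
    _ = Complex.exp (θ * Complex.I) * (s * tensor (U.1.mulVec ψ) (ket0 (Fin F.anc)) y) := by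
        rw [h6]; ring
    _ = _ := by rw [h7]

/-- The sum of the unprojected terms vanishes unless the ancillas are 0, and projection is linear.
Hence the projected terms have the same sum, although the single terms differ. -/
theorem sum_step {U : Unitary n} {θ : ℝ} (hN : n + F.anc ≤ N)
    (hU : ∀ ψ : State (Fin n), F.circ.run (tensor ψ F.magic) =
      fun z => Complex.exp (θ * Complex.I) * tensor (U.1.mulVec ψ) (ket0 (Fin F.anc)) z)
    (ψ : State (Fin n)) :
    ∑ j ∈ Finset.range F.rank, F.step j (emb n N ψ) =
      Complex.exp (θ * Complex.I) • emb n N (U.1.mulVec ψ) := by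
  rw [Finset.sum_range]
  funext x
  have h := congrFun (sum_terms hN hU ψ) x
  simp only [Finset.sum_apply, Pi.smul_apply, smul_eq_mul, Impl.step, Fin.is_lt, dif_pos,
    reset_terms hN] at h ⊢
  by_cases hx : ∀ i < N, n ≤ i → x i = false
  · simpa only [if_pos hx] using h
  · simp only [if_neg hx, mul_zero, Finset.sum_const_zero, emb]

/-- With no terms the magic state would be 0, and so would be the image of every `ψ`; but `U` maps
`U†|0…0⟩` to a nonzero vector. Without this, `χ` could be 0 and there would be no thread to run. -/
theorem rank_pos {U : Unitary n} (hU : F.Implements U) : 0 < F.rank := by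
  by_contra h0
  obtain ⟨θ, hθ⟩ := hU
  have hr : F.rank = 0 := by omega
  have hm : F.magic = 0 := by
    funext y
    have : IsEmpty (Fin F.rank) := by rw [hr]; infer_instance
    simp [Impl.magic]
  have h1 := hθ (U.1.conjTranspose.mulVec (ket0 (Fin n)))
  have h2 : U.1.mulVec (U.1.conjTranspose.mulVec (ket0 (Fin n))) = ket0 (Fin n) := by
    rw [Matrix.mulVec_mulVec, ← Matrix.star_eq_conjTranspose, Matrix.mem_unitaryGroup_iff.1 U.2,
      Matrix.one_mulVec]
  rw [hm, h2] at h1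
  have h3 : tensor (U.1.conjTranspose.mulVec (ket0 (Fin n))) (0 : State (Fin F.anc)) =
      (0 : ℂ) • 0 := by
    funext z; simp [tensor]
  rw [h3, StabCircuit.run_smul, zero_smul] at h1
  have h4 := congrFun h1 (fun _ => false)
  simp only [Pi.zero_apply, tensor, ket0, if_true, mul_one] at h4
  exact Complex.exp_ne_zero _ h4.symm

end impl

/-! ## The sum of all terms -/

section terms

variable {n : ℕ}

/-- The term number `id`, whose digits in the mixed radix system of the ranks number the terms of
the single gates. -/
noncomputable def term (f : Unitary n → Impl n) : Circuit n → ℕ → State ℕ → State ℕ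
  | [], _, Ψ => Ψ
  | .stab g :: l, id, Ψ => term f l id ((g.map (fun i : Fin n => (i : ℕ)) Fin.val_injective).apply Ψ)
  | .high U :: l, id, Ψ => term f l (id / (f U).rank) ((f U).step (id % (f U).rank) Ψ)

theorem reset_add (m : ℕ) (C : List (Gate ℕ)) (Ψ Φ : State ℕ) :
    reset m C (Ψ + Φ) = reset m C Ψ + reset m C Φ := by
  funext x
  simp only [reset_apply, Pi.add_apply]; split <;> simp

theorem reset_smul (m : ℕ) (C : List (Gate ℕ)) (c : ℂ) (Ψ : State ℕ) :
    reset m C (c • Ψ) = c • reset m C Ψ := by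
  funext x
  simp only [reset_apply, Pi.smul_apply]; split <;> simp

theorem step_add (F : Impl n) (j : ℕ) (Ψ Φ : State ℕ) :
    F.step j (Ψ + Φ) = F.step j Ψ + F.step j Φ := by
  unfold Impl.step
  split
  · simp only [StabCircuit.run_add, reset_add, smul_add]
  · simp

theorem step_smul (F : Impl n) (j : ℕ) (c : ℂ) (Ψ : State ℕ) :
    F.step j (c • Ψ) = c • F.step j Ψ := by
  unfold Impl.step
  split
  · simp only [StabCircuit.run_smul, reset_smul, smul_comm c]
  · simp

theorem term_add (f : Unitary n → Impl n) (C : Circuit n) (id : ℕ) (Ψ Φ : State ℕ) :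
    term f C id (Ψ + Φ) = term f C id Ψ + term f C id Φ := by
  induction C generalizing id Ψ Φ with
  | nil => rfl
  | cons a C ih => cases a <;> simp only [term, Gate.apply_add, step_add, ih]

theorem term_smul (f : Unitary n → Impl n) (C : Circuit n) (id : ℕ) (c : ℂ) (Ψ : State ℕ) :
    term f C id (c • Ψ) = c • term f C id Ψ := by
  induction C generalizing id Ψ with
  | nil => rfl
  | cons a C ih => cases a <;> simp only [term, Gate.apply_smul, step_smul, ih]

theorem term_sum (f : Unitary n → Impl n) (C : Circuit n) (id m : ℕ) (Ψ : ℕ → State ℕ) :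
    term f C id (∑ j ∈ Finset.range m, Ψ j) = ∑ j ∈ Finset.range m, term f C id (Ψ j) :=
  map_sum (⟨⟨term f C id, term_add f C id⟩, term_smul f C id⟩ : State ℕ →ₗ[ℂ] State ℕ) _ _

theorem sum_range_mul_div_mod {M : Type*} [AddCommMonoid M] (r m : ℕ) (g : ℕ → ℕ → M) :
    ∑ i ∈ Finset.range (r * m), g (i / r) (i % r) =
      ∑ a ∈ Finset.range m, ∑ b ∈ Finset.range r, g a b := by
  rcases Nat.eq_zero_or_pos r with rfl | hr
  · simp
  induction m with
  | zero => simp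
  | succ m ih =>
    rw [Nat.mul_succ, Finset.sum_range_add, ih, Finset.sum_range_succ]
    congr 1
    refine Finset.sum_congr rfl fun b hb => ?_
    have hb : b < r := by simpa using hb
    rw [Nat.mul_add_div hr, Nat.div_eq_of_lt hb, Nat.mul_add_mod, Nat.mod_eq_of_lt hb, add_zero]

theorem emb_gate {N : ℕ} (g : Gate (Fin n)) (ψ : State (Fin n)) :
    (g.map (fun i : Fin n => (i : ℕ)) Fin.val_injective).apply (emb n N ψ) =
      emb n N (g.apply ψ) := by
  funext x
  have upd : ∀ (q : Fin n) (v : Bool), (∀ i < N, n ≤ i → Function.update x (q : ℕ) v i = false) ↔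
      ∀ i < N, n ≤ i → x i = false := fun q v => by
    refine forall₃_congr fun i _ hi => ?_
    rw [Function.update_of_ne (by omega)]
  have upd' : ∀ (q : Fin n) (v : Bool), (fun i : Fin n => Function.update x (q : ℕ) v i) =
      Function.update (fun i : Fin n => x i) q v := fun q v => by
    funext i
    simp only [Function.update_apply, Fin.ext_iff]
  by_cases hx : ∀ i < N, n ≤ i → x i = false
  · cases g <;> simp only [Gate.map, Gate.apply, emb, upd, upd', if_pos hx]
  · cases g <;> simp [Gate.map, Gate.apply, emb, upd, hx]

/-- The least significant digit belongs to the first gate that is not a stabilizer gate. Since the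
rest of a term is linear in the state, summing over this digit puts the true `U` in place of its
terms; the phases of the gates add up. -/
theorem sum_term (f : Unitary n → Impl n) {N : ℕ} (C : Circuit n)
    (hC : ∀ U ∈ C.highGates, (f U).Implements U ∧ n + (f U).anc ≤ N) :
    ∃ θ : ℝ, ∀ ψ : State (Fin n), ∑ id ∈ Finset.range (C.chi f), term f C id (emb n N ψ) =
      Complex.exp (θ * Complex.I) • emb n N (C.run ψ) := by
  induction C with
  | nil => exact ⟨0, fun ψ => by simp [Circuit.chi, Circuit.highGates, term, Circuit.run]⟩
  | cons a C ih =>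
    cases a with
    | stab g =>
      obtain ⟨θ, hθ⟩ := ih hC
      refine ⟨θ, fun ψ => ?_⟩
      have := hθ (g.apply ψ)
      simp only [term, emb_gate]
      exact this
    | high U =>
      have hC' : ∀ V ∈ Circuit.highGates C, (f V).Implements V ∧ n + (f V).anc ≤ N :=
        fun V hV => hC V (List.mem_cons_of_mem _ hV)
      obtain ⟨θ, hθ⟩ := ih hC'
      obtain ⟨⟨θ', hθ'⟩, hN⟩ := hC U (List.mem_cons_self)
      refine ⟨θ + θ', fun ψ => ?_⟩
      have e1 : Circuit.chi (.high U :: C) f = (f U).rank * Circuit.chi C f := by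
        simp [Circuit.chi, Circuit.highGates, Item.high?]
      rw [e1]
      simp only [term]
      rw [sum_range_mul_div_mod (f U).rank (Circuit.chi C f)
        (fun a b => term f C a ((f U).step b (emb n N ψ)))]
      simp only [← term_sum, sum_step hN hθ', term_smul, ← Finset.smul_sum]
      rw [hθ, smul_smul]
      have e2 : Complex.exp (↑(θ + θ') * Complex.I) =
          Complex.exp (θ' * Complex.I) * Complex.exp (θ * Complex.I) := by
        rw [← Complex.exp_add]; congr 1; push_cast; ring
      rw [e2]
      rfl

end terms

end QSim

namespace QSim

open AExp (var get ltE eqE word arity)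

variable {E : Env} {h h' h₁ h₂ : Mem} {N : ℕ}

theorem Holds.setV {ψ : State ℕ} (H : Holds N ψ h) {x : Var} {k : ℕ}
    (hx : x ≠ .L ∧ x ≠ .LL ∧ x ≠ .i ∧ x ≠ .j) : Holds N ψ (h.setV x k) := by
  obtain ⟨T, R, hT⟩ := H
  exact ⟨T, ⟨R.base.setV hx, R.M, R.B, R.amp, R.valid⟩, hT⟩

theorem Holds.setP {ψ : State ℕ} (H : Holds N ψ h) {p : Ptr} {t : Tree} :
    Holds N ψ (h.setP p t) := by
  obtain ⟨T, R, hT⟩ := H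
  exact ⟨T, ⟨R.base.setP, R.M, R.B, R.amp, R.valid⟩, hT⟩

theorem Holds.setD {ψ : State ℕ} (H : Holds N ψ h) {l : List ℕ} :
    Holds N ψ (h.setA .D l) := by
  obtain ⟨T, R, hT⟩ := H
  exact ⟨T, ⟨⟨R.base.L, R.base.LL, R.base.i, R.base.j, fun s hs => by
    simpa [hs] using R.base.len s hs⟩, by simpa using R.M, by simpa using R.B, R.amp, R.valid⟩, hT⟩

/-! ## Gates given as records -/

/-- The tags are those of `Gate.toTree`. The first operand goes to `q`; for CX it is the control and
is moved on to `cc`, before `q` receives the target. -/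
def gateCode : Code arch :=
  .seq (link .pq .pg 0) (.seq (asg .q (word .pq))
  (ifE (word .pg)
    (ifE (eqE (word .pg) 1) hadCode
      (.seq (link .pq .pg 1)
      (ifE (eqE (word .pg) 2)
        (.seq (asg .cc (var .q)) (.seq (asg .q (word .pq)) cxCode))
        (.seq (asg .b (word .pq)) measCode))))
    (bumpCode .q .q)))

theorem gateCode_tri {ψ : State ℕ} {g : Gate ℕ} (hE : (N + 1) * (N + 1) + 100 ≤ E.V)
    (H : Holds N ψ h) (hg : ∀ q ∈ g.qubits, q < N) (hpg : h.p .pg = g.toTree (fun i => i)) :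
    Tri E gateCode h (16000 * ((N + 1) * (N + 1)))
      (fun h' => Holds N (g.apply ψ) h' ∧ Frame gateVars [.pq] h h') := by
  have hN := le_sq (N := N)
  have hV := E.hV
  cases g with
  | S q =>
    have hq : q < N := hg q (by simp [Gate.qubits])
    have d1 := Den.link (E := E) (h := h) (p := .pq) (q := .pg) (e := 0) (i := 0) (t := .leaf q)
      (by decide) (fun _ => by simp) rfl (by rw [hpg]; rfl)
    have d2 := Den.asg (E := E) (h := h.setP .pq (.leaf q)) (x := .q) (e := word .pq) (v := q)
      (by decide) (fun _ => by simp [Tree.leaf, Tree.word]; omega) (by simp [Tree.leaf, Tree.word])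
    obtain ⟨T, R, rfl⟩ := H
    have R1 : Rep N T ((h.setP .pq (.leaf q)).setV .q q) :=
      ⟨R.base.setP.setV (by decide), R.M, R.B, R.amp, R.valid⟩
    obtain ⟨l, d3, l1, l2⟩ := bumpCode_den (E := E) (x := .q) (y := .q) R1.base hE R1.B
      R1.valid.B_le hq.le hq.le (by simp) (by simp)
    have d4 := Den.ifE_neg (E := E) (e := word .pg) (c₁ := ifE (eqE (word .pg) 1) hadCode
      (.seq (link .pq .pg 1)
      (ifE (eqE (word .pg) 2)
        (.seq (asg .cc (var .q)) (.seq (asg .q (word .pq)) cxCode))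
        (.seq (asg .b (word .pq)) measCode)))) (by decide)
        (fun _ => by simp [hpg, Gate.toTree, Tree.word]) (by simp [hpg, Gate.toTree, Tree.word]) d3
    refine ((d1.seq (d2.seq d4)).mono ?_).tri ⟨⟨{ T with B := bump T.B q q },
      ⟨R1.base.setA l1, by simpa using R.M, by simpa using l2, R.amp, S_valid R.valid⟩, ?_⟩, ?_⟩
    · simp only [AExp.cost]; omega
    · exact S_den hq
    · exact ((Frame.setP _ _ h (by decide) _).trans (Frame.setV _ _ _ (by decide) _)).trans
        (Frame.setA _ _ _ (by decide) _)
  | H q =>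
    have hq : q < N := hg q (by simp [Gate.qubits])
    have d1 := Den.link (E := E) (h := h) (p := .pq) (q := .pg) (e := 0) (i := 0) (t := .leaf q)
      (by decide) (fun _ => by simp) rfl (by rw [hpg]; rfl)
    have d2 := Den.asg (E := E) (h := h.setP .pq (.leaf q)) (x := .q) (e := word .pq) (v := q)
      (by decide) (fun _ => by simp [Tree.leaf, Tree.word]; omega) (by simp [Tree.leaf, Tree.word])
    have fr : Frame gateVars [.pq] h ((h.setP .pq (.leaf q)).setV .q q) :=
      (Frame.setP _ _ h (by decide) _).trans (Frame.setV _ _ _ (by decide) _)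
    obtain ⟨h3, d3, a3, fr3⟩ := hadCode_tri (E := E) hE (H.setP.setV (x := .q) (by decide)) hq
      (show ((h.setP .pq (.leaf q)).setV .q q).v .q = q by simp)
    refine ((d1.seq (d2.seq (Den.ifE_pos (by decide)
        (fun _ => by simp [hpg, Gate.toTree, Tree.word]; omega)
        (by simp [hpg, Gate.toTree, Tree.word])
        (Den.ifE_pos (by decide) (fun _ => by simp [hpg, Gate.toTree, Tree.word]; omega)
        (by simp [hpg, Gate.toTree, Tree.word]) d3)))).mono ?_).tri
      ⟨a3, fr.trans (fr3.mono (by decide) (by decide))⟩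
    simp only [AExp.cost,
      show (eqE (word .pg) 1).cost = 3 from rfl]; omega
  | CX c q hne =>
    have hc : c < N := hg c (by simp [Gate.qubits])
    have hq : q < N := hg q (by simp [Gate.qubits])
    have d1 := Den.link (E := E) (h := h) (p := .pq) (q := .pg) (e := 0) (i := 0) (t := .leaf c)
      (by decide) (fun _ => by simp) rfl (by rw [hpg]; rfl)
    have d2 := Den.asg (E := E) (h := h.setP .pq (.leaf c)) (x := .q) (e := word .pq) (v := c)
      (by decide) (fun _ => by simp [Tree.leaf, Tree.word]; omega) (by simp [Tree.leaf, Tree.word])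
    set h2 := (h.setP .pq (.leaf c)).setV .q c with hh2
    have e2 : h2.p .pg = (Gate.CX c q hne).toTree (fun i => i) := by simp [hh2, hpg]
    have d3 := Den.link (E := E) (h := h2) (p := .pq) (q := .pg) (e := 1) (i := 1) (t := .leaf q)
      (by decide) (fun _ => by simp; omega) rfl (by rw [e2]; rfl)
    have d4 := Den.asg (E := E) (h := h2.setP .pq (.leaf q)) (x := .cc) (e := var .q) (v := c)
      (by decide) (fun _ => trivial) (by simp [hh2])
    have d5 := Den.asg (E := E) (h := (h2.setP .pq (.leaf q)).setV .cc c) (x := .q)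
      (e := word .pq) (v := q)
      (by decide) (fun _ => by simp [Tree.leaf, Tree.word]; omega) (by simp [Tree.leaf, Tree.word])
    set h5 := ((h2.setP .pq (.leaf q)).setV .cc c).setV .q q with hh5
    have fr : Frame gateVars [.pq] h h5 :=
      ((((Frame.setP _ _ h (by decide) _).trans (Frame.setV _ _ _ (by decide) _)).trans
        (Frame.setP _ _ _ (by decide) _)).trans (Frame.setV _ _ _ (by decide) _)).trans
        (Frame.setV _ _ _ (by decide) _)
    have H5 : Holds N ψ h5 :=
      ((((H.setP).setV (by decide)).setP).setV (by decide)).setV (by decide)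
    obtain ⟨h6, d6, a6, fr6⟩ := cxCode_tri (E := E) hE H5 hc hq hne (by simp [hh5]) (by simp [hh5])
    refine ((d1.seq (d2.seq (Den.ifE_pos (by decide)
        (fun _ => by simp [hh2, hpg, Gate.toTree, Tree.word]; omega)
        (by simp [hh2, hpg, Gate.toTree, Tree.word])
        (Den.ifE_neg (by decide) (fun _ => by simp [hh2, hpg, Gate.toTree, Tree.word]; omega)
        (by simp [hh2, hpg, Gate.toTree, Tree.word])
        (d3.seq (Den.ifE_pos (by decide) (fun _ => by simp [hh2, hpg, Gate.toTree, Tree.word]; omega)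
        (by simp [hh2, hpg, Gate.toTree, Tree.word]) (d4.seq (d5.seq d6)))))))).mono ?_).tri
      ⟨a6, fr.trans (fr6.mono (by decide) (by decide))⟩
    simp only [AExp.cost,
      show (eqE (word .pg) 1).cost = 3 from rfl, show (eqE (word .pg) 2).cost = 3 from rfl]; omega
  | meas q b =>
    have hq : q < N := hg q (by simp [Gate.qubits])
    have hb1 : b.toNat ≤ 1 := by cases b <;> simp
    have d1 := Den.link (E := E) (h := h) (p := .pq) (q := .pg) (e := 0) (i := 0) (t := .leaf q)
      (by decide) (fun _ => by simp) rfl (by rw [hpg]; rfl)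
    have d2 := Den.asg (E := E) (h := h.setP .pq (.leaf q)) (x := .q) (e := word .pq) (v := q)
      (by decide) (fun _ => by simp [Tree.leaf, Tree.word]; omega) (by simp [Tree.leaf, Tree.word])
    set h2 := (h.setP .pq (.leaf q)).setV .q q with hh2
    have e2 : h2.p .pg = (Gate.meas q b).toTree (fun i => i) := by simp [hh2, hpg]
    have d3 := Den.link (E := E) (h := h2) (p := .pq) (q := .pg) (e := 1) (i := 1)
      (t := .leaf b.toNat)
      (by decide) (fun _ => by simp; omega) rfl (by rw [e2]; rfl)
    have d5 := Den.asg (E := E) (h := h2.setP .pq (.leaf b.toNat)) (x := .b)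
      (e := word .pq) (v := b.toNat)
      (by decide) (fun _ => by simp [Tree.leaf, Tree.word]; omega) (by simp [Tree.leaf, Tree.word])
    set h5 := (h2.setP .pq (.leaf b.toNat)).setV .b b.toNat with hh5
    have fr : Frame gateVars [.pq] h h5 :=
      (((Frame.setP _ _ h (by decide) _).trans (Frame.setV _ _ _ (by decide) _)).trans
        (Frame.setP _ _ _ (by decide) _)).trans (Frame.setV _ _ _ (by decide) _)
    have H5 : Holds N ψ h5 := (((H.setP).setV (by decide)).setP).setV (by decide)
    obtain ⟨h6, d6, a6, fr6⟩ := measCode_tri (E := E) hE H5 (b := b) hq (by simp [hh5, hh2])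
      (by simp [hh5])
    refine ((d1.seq (d2.seq (Den.ifE_pos (by decide)
        (fun _ => by simp [hh2, hpg, Gate.toTree, Tree.word]; omega)
        (by simp [hh2, hpg, Gate.toTree, Tree.word])
        (Den.ifE_neg (by decide) (fun _ => by simp [hh2, hpg, Gate.toTree, Tree.word]; omega)
        (by simp [hh2, hpg, Gate.toTree, Tree.word])
        (d3.seq (Den.ifE_neg (by decide) (fun _ => by simp [hh2, hpg, Gate.toTree, Tree.word]; omega)
        (by simp [hh2, hpg, Gate.toTree, Tree.word]) (d5.seq d6))))))).mono ?_).tri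
      ⟨a6, fr.trans (fr6.mono (by decide) (by decide))⟩
    simp only [AExp.cost,
      show (eqE (word .pg) 1).cost = 3 from rfl, show (eqE (word .pg) 2).cost = 3 from rfl]; omega

/-! ## Resetting the operands of a gate -/

/-- Projects the qubit that `pq` points to on the state `0`, if it is an ancilla. -/
def zeroCode : Code arch :=
  .seq (asg .q (word .pq)) (.seq (asg .b 0) (ifE (ltE (var .q) (var .n)) .skip measCode))

theorem zeroCode_tri {ψ : State ℕ} {n q : ℕ} (hE : (N + 1) * (N + 1) + 100 ≤ E.V)
    (H : Holds N ψ h) (hq : q < N) (hn : h.v .n = n) (hpq : h.p .pq = .leaf q) :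
    Tri E zeroCode h (2100 * ((N + 1) * (N + 1)))
      (fun h' => Holds N (resetQubit n ψ q) h' ∧ Frame gateVars [.pq] h h') := by
  have hN := le_sq (N := N)
  have d2 := Den.asg (E := E) (h := h) (x := .q) (e := word .pq) (v := q)
    (by decide) (fun _ => by simp [hpq, Tree.leaf, Tree.word]; omega)
    (by simp [hpq, Tree.leaf, Tree.word])
  have d3 := Den.asg (E := E) (h := h.setV .q q) (x := .b) (e := 0) (v := 0)
    (by decide) (fun _ => by simp) rfl
  set h3 := (h.setV .q q).setV .b 0 with hh3
  have fr : Frame gateVars [.pq] h h3 :=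
    (Frame.setV _ _ h (by decide) _).trans (Frame.setV _ _ _ (by decide) _)
  have H3 : Holds N ψ h3 := (H.setV (by decide)).setV (by decide)
  refine (d2.seq_tri (d3.seq_tri (Tri.ifE (T := 2000 * ((N + 1) * (N + 1)))
    (by decide) (fun _ => by simp) (fun he => ?_) (fun he => ?_)))).mono ?_ (fun _ a => a)
  · have hqn : q < n := by simpa [hh3, hn] using he
    refine ⟨h3, Den.skip.mono (by omega), ?_, fr⟩
    rw [resetQubit, if_pos hqn]; exact H3
  · have hqn : ¬ q < n := by simpa [hh3, hn] using he
    rw [resetQubit, if_neg hqn]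
    exact (measCode_tri (E := E) hE H3 (b := false) hq (by simp [hh3]) (by simp [hh3])).mono le_rfl
      fun h' a => ⟨a.1, fr.trans (a.2.mono (by decide) (by decide))⟩
  · simp only [AExp.cost,
      show (ltE (var .q) (var .n)).cost = 5 from rfl]; omega

/-- Tag 2 is CX, the only gate with a second qubit; the second link of a measurement is its outcome.
-/
def cleanCode : Code arch :=
  .seq (link .pq .pg 0) (.seq zeroCode
    (ifE (eqE (word .pg) 2) (.seq (link .pq .pg 1) zeroCode) .skip))

theorem cleanCode_tri {ψ : State ℕ} {n : ℕ} {g : Gate ℕ} (hE : (N + 1) * (N + 1) + 100 ≤ E.V)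
    (H : Holds N ψ h) (hg : ∀ q ∈ g.qubits, q < N) (hn : h.v .n = n)
    (hpg : h.p .pg = g.toTree (fun i => i)) :
    Tri E cleanCode h (5000 * ((N + 1) * (N + 1)))
      (fun h' => Holds N (g.qubits.foldl (resetQubit n) ψ) h' ∧ Frame gateVars [.pq] h h') := by
  have hN := le_sq (N := N)
  have hV := E.hV
  obtain ⟨q, l, hq⟩ : ∃ q l, g.qubits = q :: l := by cases g <;> exact ⟨_, _, rfl⟩
  have hc : (h.p .pg).child 0 = some (.leaf q) := by
    rw [hpg]; cases g <;> cases hq <;> rfl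
  have hqN : q < N := hg q (by simp [hq])
  have d1 := Den.link (E := E) (h := h) (p := .pq) (q := .pg) (e := 0) (i := 0) (t := .leaf q)
    (by decide) (fun _ => by simp) rfl hc
  obtain ⟨h2, d2, a2, f2⟩ := zeroCode_tri (E := E) (n := n) hE (H.setP (p := .pq) (t := .leaf q)) hqN
    (by simpa using hn) (by simp)
  have fr : Frame gateVars [.pq] h h2 := (Frame.setP _ _ h (by decide) _).trans f2
  have e2 : h2.p .pg = g.toTree (fun i => i) := by rw [fr.p _ (by decide), hpg]
  have n2 : h2.v .n = n := by rw [fr.v _ (by decide), hn]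
  by_cases hcx : (g.toTree (fun i => i)).word = 2
  · obtain ⟨q', rfl⟩ : ∃ q', l = [q'] := by
      cases g <;> simp [Gate.toTree, Tree.word] at hcx
      cases hq; exact ⟨_, rfl⟩
    have hc' : (h2.p .pg).child 1 = some (.leaf q') := by
      rw [e2]
      cases g <;> simp [Gate.toTree, Tree.word] at hcx
      cases hq; rfl
    have d3 := Den.link (E := E) (h := h2) (p := .pq) (q := .pg) (e := 1) (i := 1) (t := .leaf q')
      (by decide) (fun _ => by simp; omega) rfl hc'
    obtain ⟨h4, d4, a4, f4⟩ := zeroCode_tri (E := E) (n := n) hE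
      (a2.setP (p := .pq) (t := .leaf q')) (hg q' (by simp [hq])) (by simpa using n2) (by simp)
    refine ⟨h4, (d1.seq (d2.seq (Den.ifE_pos (by decide) (fun _ => by simp [e2, hcx]; omega)
      (by simp [e2, hcx]) (d3.seq d4)))).mono ?_, by rw [hq]; exact a4,
      (fr.trans (Frame.setP _ _ _ (by decide) _)).trans f4⟩
    simp only [show (0 : AExp).cost = 1 from rfl, show (1 : AExp).cost = 1 from rfl,
      show (eqE (word .pg) 2).cost = 3 from rfl]; omega
  · obtain rfl : l = [] := by
      cases g <;> simp [Gate.toTree, Tree.word] at hcx <;> cases hq <;> rfl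
    have w3 : (g.toTree (fun i => i)).word ≤ 3 := by cases g <;> simp [Gate.toTree, Tree.word]
    refine ⟨h2, (d1.seq (d2.seq (Den.ifE_neg (by decide) (fun _ => by simp [e2]; omega)
      (by simp [e2, hcx]) Den.skip))).mono ?_, by rw [hq]; exact a2, fr⟩
    simp only [show (0 : AExp).cost = 1 from rfl,
      show (eqE (word .pg) 2).cost = 3 from rfl]; omega

/-! ## Linked lists -/

/-- Runs `c` with `p` pointing to each of the records of the list that `l` points to. -/
def each (l p : Ptr) (c : Code arch) : Code arch :=
  whileE (word l) (.seq (link p l 0) (.seq c (link l l 1)))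

/-- `Inv` speaks of the part of the list still to be processed, and the body must leave the list
pointer in place. Per record, 6 steps go into the test and the two links; the final failing test
takes 2. -/
theorem each_tri {α : Type} (tr : α → Tree) {p l : Ptr} {c : Code arch} (cost : α → ℕ)
    (Inv : List α → Mem → Prop)
    (H : ∀ a as h, Inv (a :: as) h → h.p l = .ofList ((a :: as).map tr) →
      Tri E c (h.setP p (tr a)) (cost a) (fun h' => h'.p l = h.p l ∧
        Inv as (h'.setP l (.ofList (as.map tr))))) :
    ∀ as h, Inv as h → h.p l = .ofList (as.map tr) →
      Tri E (each l p c) h ((as.map (fun a => cost a + 6)).sum + 2) (Inv []) := by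
  have hV := E.hV
  intro as
  induction as with
  | nil =>
    intro h hi hl
    exact (Den.while_stop (Nat.le_of_ble_eq_true rfl) (fun _ => by simp [hl, Tree.ofList, Tree.leaf, Tree.word])
      (by simp [hl, Tree.ofList, Tree.leaf, Tree.word])).tri hi
  | cons a as ih =>
    intro h hi hl
    obtain ⟨h1, d1, e1, i1⟩ := H a as h hi hl
    have d0 := Den.link (E := E) (h := h) (p := p) (q := l) (e := 0) (i := 0) (t := tr a)
      (by decide) (fun _ => by simp) rfl (by rw [hl]; rfl)
    have d2 := Den.link (E := E) (h := h1) (p := l) (q := l) (e := 1) (i := 1)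
      (t := .ofList (as.map tr))
      (by decide) (fun _ => by simp; omega) rfl (by rw [e1, hl]; rfl)
    obtain ⟨h3, d3, i3⟩ := ih _ i1 (by simp)
    refine ((Den.while_step (Nat.le_of_ble_eq_true rfl) (fun _ => ?_) ?_ (d0.seq (d1.seq d2)) d3).mono ?_).tri i3
    · simp [hl, Tree.ofList, Tree.word]; omega
    · simp [hl, Tree.ofList, Tree.word]
    · simp only [List.map_cons, List.sum_cons, AExp.cost]
      omega

def runCode : Code arch := each .pl .pg gateCode

def resetCode : Code arch := each .pl .pg cleanCode

theorem sum_map_const_le {α : Type} (l : List α) (k m : ℕ) (S : ℕ) (hS : 1 ≤ S)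
    (hk : k + 8 ≤ m) :
    (l.map (fun _ => k * S + 6)).sum + 2 ≤ m * S * (l.length + 1) := by
  simp only [List.map_const', List.sum_replicate, smul_eq_mul]
  have : k * S + 8 ≤ m * S := by nlinarith
  nlinarith

theorem runCode_tri {Ψ : State ℕ} {C : List (Gate ℕ)} (hE : (N + 1) * (N + 1) + 100 ≤ E.V)
    (H : Holds N Ψ h) (hC : ∀ g ∈ C, ∀ q ∈ g.qubits, q < N)
    (hpl : h.p .pl = .ofList (C.map (Gate.toTree (fun i => i)))) :
    Tri E runCode h (17000 * ((N + 1) * (N + 1)) * (C.length + 1)) (fun h' =>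
      Holds N (StabCircuit.run C Ψ) h' ∧ Frame gateVars [.pl, .pg, .pq] h h') := by
  refine (each_tri (E := E) (Gate.toTree (fun i => i)) (p := .pg) (l := .pl) (c := gateCode)
    (fun _ => 16000 * ((N + 1) * (N + 1)))
    (fun as h' => (∀ g ∈ as, ∀ q ∈ g.qubits, q < N) ∧ (∃ Φ, Holds N Φ h' ∧
      StabCircuit.run as Φ = StabCircuit.run C Ψ) ∧ Frame gateVars [.pl, .pg, .pq] h h')
    ?_ C h ⟨hC, ⟨Ψ, H, rfl⟩, Frame.refl _ _ _⟩ hpl).mono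
      (sum_map_const_le _ _ _ _ (Nat.mul_pos (Nat.succ_pos _) (Nat.succ_pos _)) (by omega)) ?_
  · rintro g as h1 ⟨hlt, ⟨Φ, hΦ, hrun⟩, fr⟩ hl
    refine (gateCode_tri (E := E) hE (hΦ.setP (p := .pg) (t := g.toTree fun i => i))
      (hlt g List.mem_cons_self) (by simp)).mono le_rfl fun h' ⟨a1, a2⟩ => ⟨?_, ?_, ?_, ?_⟩
    · rw [a2.p _ (by decide)]; simp
    · exact fun g' hg' => hlt g' (List.mem_cons_of_mem _ hg')
    · exact ⟨_, a1.setP, hrun⟩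
    · exact ((fr.trans (Frame.setP _ _ _ (by decide) _)).trans (a2.mono (by decide) (by decide))).trans
        (Frame.setP _ _ _ (by decide) _)
  · rintro h' ⟨-, ⟨Φ, hΦ, hrun⟩, fr⟩
    exact ⟨by rw [← hrun]; exact hΦ, fr⟩

theorem resetCode_tri {Ψ : State ℕ} {n : ℕ} {C : List (Gate ℕ)}
    (hE : (N + 1) * (N + 1) + 100 ≤ E.V)
    (H : Holds N Ψ h) (hC : ∀ g ∈ C, ∀ q ∈ g.qubits, q < N) (hn : h.v .n = n)
    (hpl : h.p .pl = .ofList (C.map (Gate.toTree (fun i => i)))) :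
    Tri E resetCode h (6000 * ((N + 1) * (N + 1)) * (C.length + 1)) (fun h' =>
      Holds N (reset n C Ψ) h' ∧ Frame gateVars [.pl, .pg, .pq] h h') := by
  refine (each_tri (E := E) (Gate.toTree (fun i => i)) (p := .pg) (l := .pl) (c := cleanCode)
    (fun _ => 5000 * ((N + 1) * (N + 1)))
    (fun as h' => (∀ g ∈ as, ∀ q ∈ g.qubits, q < N) ∧ (∃ Φ, Holds N Φ h' ∧
      reset n as Φ = reset n C Ψ) ∧ Frame gateVars [.pl, .pg, .pq] h h')
    ?_ C h ⟨hC, ⟨Ψ, H, rfl⟩, Frame.refl _ _ _⟩ hpl).mono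
      (sum_map_const_le _ _ _ _ (Nat.mul_pos (Nat.succ_pos _) (Nat.succ_pos _)) (by omega)) ?_
  · rintro g as h1 ⟨hlt, ⟨Φ, hΦ, hrun⟩, fr⟩ hl
    refine (cleanCode_tri (E := E) (n := n) hE (hΦ.setP (p := .pg) (t := g.toTree fun i => i))
      (hlt g List.mem_cons_self) (by simpa using (fr.v .n (by decide)).trans hn)
      (by simp)).mono le_rfl fun h' ⟨a1, a2⟩ => ⟨?_, ?_, ?_, ?_⟩
    · rw [a2.p _ (by decide)]; simp
    · exact fun g' hg' => hlt g' (List.mem_cons_of_mem _ hg')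
    · exact ⟨_, a1.setP, hrun⟩
    · exact ((fr.trans (Frame.setP _ _ _ (by decide) _)).trans (a2.mono (by decide) (by decide))).trans
        (Frame.setP _ _ _ (by decide) _)
  · rintro h' ⟨-, ⟨Φ, hΦ, hrun⟩, fr⟩
    exact ⟨by rw [← hrun]; exact hΦ, fr⟩

end QSim

namespace QSim

open AExp (var get ltE eqE word arity)

variable {E : Env} {h h' h₁ h₂ : Mem} {N : ℕ}

/-! ## The initial state -/

/-- The state `0` of the first `N` qubits. -/
noncomputable def zeroState (N : ℕ) : State ℕ := fun x => if ∀ i < N, x i = false then 1 else 0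

theorem emb_ket0 {n : ℕ} (hn : n ≤ N) : emb n N (ket0 (Fin n)) = zeroState N := by
  funext x
  simp only [emb, ket0, zeroState, funext_iff]
  by_cases hx : ∀ i < N, x i = false
  · rw [if_pos hx, if_pos fun i hi _ => hx i hi, if_pos fun i : Fin n => hx i (by omega)]
  · rw [if_neg hx]
    by_cases h1 : ∀ i < N, n ≤ i → x i = false
    · rw [if_pos h1, if_neg]
      intro h2
      apply hx
      intro i hi
      by_cases hin : i < n
      · exact h2 ⟨i, hin⟩
      · exact h1 i hi (by omega)
    · rw [if_neg h1]

/-- The tableau of the state `0`. -/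
noncomputable def zeroTab (N : ℕ) : Tab where
  M i j := unitRow N i * unitRow N j
  B _ _ := 0
  amp := 1

theorem zeroTab_valid : (zeroTab N).Valid N where
  M_le i _ j _ := by simp only [zeroTab, unitRow]; split <;> split <;> simp
  B_le _ _ _ _ := Nat.zero_le _
  symm _ _ _ _ := rfl
  free i _ j _ h k _ := by
    simp only [zeroTab, unitRow] at h ⊢
    by_cases hj : j = N
    · simp [hj]
    · simp [hj] at h
  last k _ := by simp [zeroTab, unitRow]

theorem zeroTab_den : (zeroTab N).den N = zeroState N := by
  classical
  funext x
  have key : Sat N (zeroTab N).M x ↔ ∀ i < N, x i = false := by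
    have e : ∀ i, lin N ((zeroTab N).M i) x = unitRow N i := fun i => by
      have := lin_smul (N := N) (x := x) (unitRow N i) (unitRow N)
      rw [lin_unit le_rfl, ext_last, mul_one] at this
      exact this
    constructor
    · intro H i hi
      have := H i hi.le
      rw [e, unitRow, if_neg hi.ne, ext_lt hi] at this
      cases hx : x i
      · rfl
      · rw [hx] at this; exact absurd this (by decide)
    · intro H i hi
      rw [e, unitRow]
      split
      · rename_i h; rw [h, ext_last]
      · rename_i h; rw [ext_lt (by omega), H i (by omega)]; rfl
  rw [Tab.den_apply, zeroState]
  by_cases hx : ∀ i < N, x i = false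
  · rw [if_pos (key.2 hx), if_pos hx]
    simp [zeroTab, qf]
  · rw [if_neg (fun h => hx (key.1 h)), if_neg hx]

def initCode : Code arch :=
  .seq (fill .M (var .LL) (eqE (var .i / var .L) (var .L - 1) * eqE (var .i % var .L) (var .L - 1)))
  (.seq (fill .B (var .LL) 0) (.instr (.cconst CReg.amp.idx .one)))

theorem initCode_tri (hE : (N + 1) * (N + 1) + 100 ≤ E.V) (hb : Base N h) :
    Tri E initCode h (700 * ((N + 1) * (N + 1)))
      (fun h' => Holds N (zeroState N) h' ∧ Frame [] [] h h') := by
  have hN := le_sq (N := N)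
  obtain ⟨lM, d1, l1, i1⟩ := fill_mat (E := E) (s := .M)
    (e := eqE (var .i / var .L) (var .L - 1) * eqE (var .i % var .L) (var .L - 1)) hb hE
    (zeroTab N).M (by decide) (by decide) (by decide) (by
      intro l k i j hl hi hj hk hd hm hkl hlk
      constructor
      · simp [hb.L, hd, hm]
        constructor
        · omega
        · split <;> (try split) <;> omega
      · simp [hb.L, hd, hm, zeroTab, unitRow])
    (fun i hi j hj => by have := zeroTab_valid.M_le i hi j hj; omega)
  have hb1 := hb.setA (s := .M) l1
  obtain ⟨lB, d2, l2, i2⟩ := fill_mat (E := E) (s := .B) (e := 0) hb1 hE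
    (zeroTab N).B (by decide) (by decide) (by decide) (fun _ _ _ _ _ _ _ _ _ _ _ _ => by simp [zeroTab])
    (fun i hi j hj => Nat.zero_le _)
  refine ((d1.seq (d2.seq (Den.cconst (z := .amp) (k := .one)))).mono (by omega)).tri
    ⟨⟨zeroTab N, ⟨(hb1.setA l2).setC, by simpa using i1, by simpa using i2, by simp [zeroTab, CConst.val],
      zeroTab_valid⟩, zeroTab_den⟩,
    ((Frame.setA _ _ h (by decide) _).trans (Frame.setA _ _ _ (by decide) _)).trans
      (Frame.setC _ _ _ (by decide) _)⟩

/-! ## Amplitudes -/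

/-- `amp := ψ x` for the outcome `x` in the array `X`. -/
def evalCode : Code arch :=
  .seq (fill .W (var .L) (get .X (var .i)))
  (.seq (asg .s1 (var .L)) (.seq (asg .s2 1) (.seq matvecCode
  (.seq (fold .i .r (var .L) (var .r + (1 - eqE (get .Z (var .i)) (get .X (var .i)))))
  (.seq (fold .i .e (var .LL)
    ((var .e + get .B (var .i) * (get .X (var .i / var .L) * get .X (var .i % var .L))) % 4))
  (.seq powCode
  (ifE (var .r) (.instr (.cconst CReg.amp.idx .zero))
    (.instr (.cmul CReg.amp.idx CReg.amp.idx CReg.tmp.idx)))))))))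

/-- The point `x` is in the support if the number `r` of violated equations is 0, and the exponent
is accumulated modulo 4. The tableau is given up here: `amp` is overwritten by the amplitude, and
only the layout of the memory remains. -/
theorem evalCode_tri {ψ : State ℕ} {x : ℕ → Bool} (hE : (N + 1) * (N + 1) + 100 ≤ E.V)
    (H : Holds N ψ h) (hX : VecIs N (h.a .X) (ext N x)) :
    Tri E evalCode h (1500 * ((N + 1) * (N + 1)))
      (fun h' => h'.c .amp = ψ x ∧ Base N h' ∧ Frame gateVars [] h h') := by
  classical
  obtain ⟨T, R, rfl⟩ := H
  have hb := R.base
  have hN := le_sq (N := N)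
  have hV := E.hV
  have x1 : ∀ k, ext N x k ≤ 1 := fun k => by
    simp only [ext]; split <;> [cases x k <;> simp; exact le_rfl]
  obtain ⟨lW, d1, l1, i1⟩ := fill_vec (E := E) (s := .W) (e := get .X (var .i)) hb hE (ext N x)
    (by decide) (by decide) (by decide)
    (fun l k _ hk _ => ⟨by simp [hb.len]; omega, by simp [hX k hk]⟩) (fun k _ => by have := x1 k; omega)
  have d2 := Den.asg (E := E) (h := h.setA .W lW) (x := .s1) (e := var .L) (v := N + 1)
    (by decide) (fun _ => trivial) (by simp [hb.L])
  have d3 := Den.asg (E := E) (h := (h.setA .W lW).setV .s1 (N + 1)) (x := .s2) (e := 1) (v := 1)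
    (by decide) (fun _ => by simp; omega) rfl
  set h3 := ((h.setA .W lW).setV .s1 (N + 1)).setV .s2 1 with hh3
  have hb3 : Base N h3 := ((hb.setA l1).setV (by decide)).setV (by decide)
  obtain ⟨lZ, k4, d4, l4, i4⟩ := matvecCode_den (E := E) hb3 hE (F := T.M) (w := ext N x)
    (s₁ := N + 1) (s₂ := 1) (by simp [hh3]) (by simp [hh3]) (by simpa [hh3] using i1)
    (fun i hi j hj => by
      rw [mul_one]; exact ⟨flat_lt hi hj, by simpa [hh3] using R.M i hi j hj⟩)
    R.valid.M_le (fun i _ => by have := x1 i; omega)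
  set h4 := (h3.setV .acc k4).setA .Z lZ with hh4
  have hb4 : Base N h4 := (hb3.setV (by decide)).setA l4
  set z : ℕ → ℕ := fun i => (∑ j ∈ Finset.range (N + 1), ext N x j * T.M i j) % 2 with hz
  have hz1 : ∀ i, z i ≤ 1 := fun i => Nat.lt_succ_iff.1 (Nat.mod_lt _ (by decide))
  set g : ℕ → ℕ := fun m => ∑ i ∈ Finset.range m, (if z i = ext N x i then 0 else 1) with hg
  have hgle : ∀ m, g m ≤ m := fun m => by
    have := Finset.sum_le_card_nsmul (Finset.range m) (fun i => if z i = ext N x i then 0 else 1) 1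
      (fun i _ => by split <;> omega)
    simpa using this
  have X4 : h4.a .X = h.a .X := by simp [hh4, hh3]
  have Z4 : h4.a .Z = lZ := by simp [hh4]
  have B4 : h4.a .B = h.a .B := by simp [hh4, hh3]
  have d5 := Den.fold (E := E) (h := h4) (x := .r) (y := .i) (len := var .L)
    (e := var .r + (1 - eqE (get .Z (var .i)) (get .X (var .i)))) (m := N + 1)
    (S := (N + 1) * (N + 1)) g (by decide) (by decide) (by decide) (by decide) (by decide)
    (by omega) (by omega) hb4.i (by omega)
    (fun k _ => trivial)
    (fun k _ => by simp [hb4.L])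
    (fun k hk _ => by
      have e1 := i4 k (by omega)
      have e2 := hX k (by omega)
      have := hgle k
      simp [hb.len, X4, Z4, e1, e2, l4]
      omega)
    rfl
    (fun k hk => by
      have e1 := i4 k (by omega)
      have e2 := hX k (by omega)
      have e3 : g (k + 1) = g k + if z k = ext N x k then 0 else 1 := Finset.sum_range_succ _ _
      rw [e3]
      simp only [AExp.eval_add, AExp.eval_sub, AExp.eval_var, AExp.eval_get,
        AExp.eval_eq, AExp.eval_one, Mem.setV_v, Mem.setV_a, reduceCtorEq, if_false, if_true,
        X4, Z4, e1, e2, Option.getD_some]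
      change g k + (1 - if z k = ext N x k then 1 else 0) = _
      split <;> rfl)
  set h5 := h4.setV .r (g (N + 1)) with hh5
  have hb5 : Base N h5 := hb4.setV (by decide)
  set t : ℕ → ℕ → ℕ := fun i j => T.B i j * (ext N x i * ext N x j) with ht
  set q : ℕ → ℕ := fun m => (∑ k ∈ Finset.range m, t (k / (N + 1)) (k % (N + 1))) % 4 with hq
  have d6 := Den.fold (E := E) (h := h5) (x := .e) (y := .i) (len := var .LL)
    (e := (var .e + get .B (var .i) * (get .X (var .i / var .L) * get .X (var .i % var .L))) % 4)
    (m := (N + 1) * (N + 1)) (S := (N + 1) * (N + 1)) q (by decide) (by decide) (by decide)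
    (by decide) (by decide) le_rfl (by omega) hb5.i (by omega)
    (fun k _ => trivial)
    (fun k _ => by simp [hb5.LL])
    (fun k hk _ => by
      have a1 : k / (N + 1) ≤ N := Nat.lt_succ_iff.1 (Nat.div_lt_of_lt_mul hk)
      have a2 : k % (N + 1) ≤ N := Nat.lt_succ_iff.1 (Nat.mod_lt _ (Nat.succ_pos _))
      have e1 := hX _ a1
      have e2 := hX _ a2
      have e3 := R.B _ a1 _ a2
      rw [Nat.mul_comm (k / (N + 1)), Nat.div_add_mod] at e3
      have b1 := R.valid.B_le _ a1 _ a2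
      have b2 : ext N x (k / (N + 1)) * ext N x (k % (N + 1)) ≤ 1 * 1 :=
        Nat.mul_le_mul (x1 _) (x1 _)
      have b3 : T.B (k / (N + 1)) (k % (N + 1)) *
        (ext N x (k / (N + 1)) * ext N x (k % (N + 1))) ≤ 3 * 1 := Nat.mul_le_mul b1 b2
      have b4 : q k < 4 := Nat.mod_lt _ (by decide)
      simp [hb.len, hh5, X4, B4, hb4.L, e1, e2, e3]
      omega)
    rfl
    (fun k hk => by
      have a1 : k / (N + 1) ≤ N := Nat.lt_succ_iff.1 (Nat.div_lt_of_lt_mul hk)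
      have a2 : k % (N + 1) ≤ N := Nat.lt_succ_iff.1 (Nat.mod_lt _ (Nat.succ_pos _))
      have e1 := hX _ a1
      have e2 := hX _ a2
      have e3 := R.B _ a1 _ a2
      rw [Nat.mul_comm (k / (N + 1)), Nat.div_add_mod] at e3
      simp [hh5, X4, B4, hb4.L, e1, e2, e3, hq, Finset.sum_range_succ, ht])
  set h6 := h5.setV .e (q ((N + 1) * (N + 1))) with hh6
  have hb6 : Base N h6 := hb5.setV (by decide)
  have d7 := powCode_den (E := E) hb6 (e := q ((N + 1) * (N + 1))) (by simp [hh6])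
    (Nat.lt_succ_iff.1 (Nat.mod_lt _ (by decide)))
  set h7 := (h6.setC .aux Complex.I).setC .tmp (Complex.I ^ q ((N + 1) * (N + 1))) with hh7
  have amp7 : h7.c .amp = T.amp := by simp [hh7, hh6, hh5, hh4, hh3, R.amp]
  have hr7 : h7.v .r = g (N + 1) := by simp [hh7, hh6, hh5]
  have fr : Frame gateVars [] h h7 :=
    ((((((((Frame.setA _ _ h (by decide) _).trans (Frame.setV _ _ _ (by decide) _)).trans
      (Frame.setV _ _ _ (by decide) _)).trans (Frame.setV _ _ _ (by decide) _)).trans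
      (Frame.setA _ _ _ (by decide) _)).trans (Frame.setV _ _ _ (by decide) _)).trans
      (Frame.setV _ _ _ (by decide) _)).trans (Frame.setC _ _ _ (by decide) _)).trans
      (Frame.setC _ _ _ (by decide) _)
  have hsat : Sat N T.M x ↔ g (N + 1) = 0 := by
    rw [hg, Finset.sum_eq_zero_iff]
    refine ⟨fun hs i hi => ?_, fun hs i hi => ?_⟩
    · have hi : i ≤ N := by simpa [Nat.lt_succ_iff] using hi
      have := hs i hi
      rw [if_pos]
      unfold lin Nat.ModEq at this
      have hx := x1 i
      simp only [hz]
      rw [Nat.mod_eq_of_lt (show ext N x i < 2 by omega)] at this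
      rw [← this]
      simp only [mul_comm]
    · have := hs i (by simpa [Nat.lt_succ_iff] using hi)
      have h1 : z i = ext N x i := by
        by_contra hne; simp [hne] at this
      unfold lin Nat.ModEq
      rw [← h1]
      simp only [hz, Nat.mod_mod, mul_comm]
  have hqf : Complex.I ^ q ((N + 1) * (N + 1)) = Complex.I ^ qf N T.B x := by
    refine I_pow_congr ((Nat.mod_modEq _ _).trans ?_)
    rw [sum_range_mul_div_mod]
    simp only [qf, ht, mul_assoc]
    rfl
  have dlast : Tri E (ifE (var .r) (.instr (.cconst CReg.amp.idx .zero))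
    (.instr (.cmul CReg.amp.idx CReg.amp.idx CReg.tmp.idx))) h7 4
      (fun h' => h'.c .amp = T.den N x ∧ Base N h' ∧ Frame gateVars [] h h') := by
    refine Tri.ifE (T := 1) (by decide) (fun _ => trivial) (fun he => ?_) (fun he => ?_)
    · rw [AExp.eval_var, hr7] at he
      refine (Den.cconst).tri ⟨?_, hb6.setC.setC.setC, fr.trans (Frame.setC _ _ _ (by decide) _)⟩
      rw [Tab.den_apply, if_neg (fun hs => he (hsat.1 hs))]
      simp [CConst.val]
    · rw [AExp.eval_var, hr7] at he
      refine (Den.cmul).tri ⟨?_, hb6.setC.setC.setC, fr.trans (Frame.setC _ _ _ (by decide) _)⟩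
      rw [Tab.den_apply, if_pos (hsat.2 he), ← hqf, Mem.setC_c, if_pos rfl, amp7]
      simp [hh7]
  refine (d1.seq_tri (d2.seq_tri (d3.seq_tri (d4.seq_tri (d5.seq_tri (d6.seq_tri (d7.seq_tri
    dlast))))))).mono ?_ (fun _ a => a)
  simp only [AExp.cost]
  omega

/-! ## Gates given by implementations -/

theorem Holds.smul {ψ : State ℕ} (H : Holds N ψ h) {c : ℂ} {h' : Mem}
    (hh : h' = (h.setC .tmp c).setC .amp (h.c .amp * c)) : Holds N (c • ψ) h' := by
  classical
  obtain ⟨T, R, rfl⟩ := H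
  subst hh
  refine ⟨{ T with amp := T.amp * c }, ⟨R.base.setC.setC, R.M, R.B, by simp [R.amp], ⟨R.valid.M_le,
    R.valid.B_le, R.valid.symm, R.valid.free, R.valid.last⟩⟩, ?_⟩
  funext x
  simp only [Pi.smul_apply, Tab.den_apply, smul_eq_mul]
  by_cases hs : Sat N T.M x
  · rw [if_pos hs, if_pos hs]; ring
  · rw [if_neg hs, if_neg hs, mul_zero]

/-- The term number `dig` of the gate that `it` points to. -/
def highCode : Code arch :=
  .seq (link .pf .it 0) (.seq (link .pe .pf 1) (.seq (link .pe .pe (var .dig))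
  (.seq (link .pl .pe 0) (.seq runCode (.seq (link .pl .pf 0) (.seq runCode
  (.seq (link .pl .pe 0) (.seq resetCode (.seq (link .pl .pf 0) (.seq resetCode
  (.seq (.instr (.coeff CReg.tmp.idx Ptr.pe.idx))
    (.instr (.cmul CReg.amp.idx CReg.amp.idx CReg.tmp.idx)))))))))))))

theorem circN_toTree {n : ℕ} (F : Impl n) :
    Tree.ofList (F.circN.map (Gate.toTree (fun i => i))) = StabCircuit.toTree (numC n F.anc) F.circ := by
  simp only [Impl.circN, StabCircuit.toTree, List.map_map]
  congr 2
  funext g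
  simp [Gate.toTree_map]

theorem prepN_toTree {n : ℕ} (F : Impl n) (j : Fin F.rank) :
    Tree.ofList ((F.prepN j).map (Gate.toTree (fun i => i))) =
      StabCircuit.toTree (numA n F.anc) (F.prep j) := by
  simp only [Impl.prepN, StabCircuit.toTree, List.map_map]
  congr 2
  funext g
  simp [Gate.toTree_map]

/-- Both circuits are traversed twice, to be run and to have their operands reset. Therefore the
time is proportional to the number of gates, whatever the number of ancillas. -/
theorem highCode_tri {n : ℕ} {F : Impl n} {Ψ : State ℕ} {j : ℕ}
    (hE : (N + 1) * (N + 1) + 100 ≤ E.V) (H : Holds N Ψ h) (hF : n + F.anc ≤ N)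
    (hn : h.v .n = n) (hit : (h.p .it).child 0 = some F.toTree) (hd : h.v .dig = j)
    (hj : j < F.rank) :
    Tri E highCode h (50000 * ((N + 1) * (N + 1)) * (F.gates + 1)) (fun h' =>
      Holds N (F.step j Ψ) h' ∧ Frame gateVars [.pf, .pe, .pl, .pg, .pq] h h') := by
  have hV := E.hV
  have hN := le_sq (N := N)
  set j' : Fin F.rank := ⟨j, hj⟩ with hj'
  set tp : Tree := .node 0 (F.coeff j') 1 ![StabCircuit.toTree (numA n F.anc) (F.prep j')] with htp
  set tr : Tree := .node 0 0 F.rank (fun j =>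
        .node 0 (F.coeff j) 1 ![StabCircuit.toTree (numA n F.anc) (F.prep j)]) with htr
  have d1 := Den.link (E := E) (h := h) (p := .pf) (q := .it) (e := 0) (i := 0) (t := F.toTree)
    (by decide) (fun _ => by simp) rfl hit
  have d2 := Den.link (E := E) (h := h.setP .pf F.toTree) (p := .pe) (q := .pf) (e := 1) (i := 1)
    (t := tr) (by decide) (fun _ => by simp; omega) rfl (by simp; rfl)
  have d3 := Den.link (E := E) (h := (h.setP .pf F.toTree).setP .pe tr) (p := .pe) (q := .pe)
    (e := var .dig) (i := j) (t := tp) (by decide) (fun _ => trivial) (by simp [hd])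
    (by simp [htr, Tree.child, hj, htp, hj'])
  set h3 := ((h.setP .pf F.toTree).setP .pe tr).setP .pe tp with hh3
  have fr3 : Frame gateVars [.pf, .pe, .pl, .pg, .pq] h h3 :=
    ((Frame.setP _ _ h (by decide) _).trans (Frame.setP _ _ _ (by decide) _)).trans
      (Frame.setP _ _ _ (by decide) _)
  have pe3 : h3.p .pe = tp := by simp [hh3]
  have pf3 : h3.p .pf = F.toTree := by simp [hh3]
  have cf : F.toTree.child 0 = some (StabCircuit.toTree (numC n F.anc) F.circ) := rfl
  have ce : tp.child 0 = some (StabCircuit.toTree (numA n F.anc) (F.prep j')) := rfl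
  have H3 : Holds N Ψ h3 := H.setP.setP.setP
  have step : ∀ {h : Mem} {q : Ptr} {t t' : Tree}, h.p q = t → t.child 0 = some t' →
      Den E (link .pl q 0) h 2 (h.setP .pl t') := fun hq hc =>
    Den.link (Nat.le_of_ble_eq_true rfl) (fun _ => by simp) rfl (by rw [hq]; exact hc)
  obtain ⟨h4, d4, H4, f4⟩ := runCode_tri (E := E) hE (H3.setP (p := .pl)
    (t := StabCircuit.toTree (numA n F.anc) (F.prep j'))) (C := F.prepN j') (prepN_lt hF j')
    (by rw [prepN_toTree]; simp)
  have pe4 : h4.p .pe = tp := by rw [f4.p _ (by decide)]; simp [pe3]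
  have pf4 : h4.p .pf = F.toTree := by rw [f4.p _ (by decide)]; simp [pf3]
  obtain ⟨h5, d5, H5, f5⟩ := runCode_tri (E := E) hE (H4.setP (p := .pl)
    (t := StabCircuit.toTree (numC n F.anc) F.circ)) (C := F.circN) (circN_lt hF)
    (by rw [circN_toTree]; simp)
  have pe5 : h5.p .pe = tp := by rw [f5.p _ (by decide)]; simp [pe4]
  have pf5 : h5.p .pf = F.toTree := by rw [f5.p _ (by decide)]; simp [pf4]
  have n5 : h5.v .n = n := by
    rw [f5.v _ (by decide), Mem.setP_v, f4.v _ (by decide), Mem.setP_v, fr3.v _ (by decide), hn]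
  obtain ⟨h6, d6, H6, f6⟩ := resetCode_tri (E := E) (n := n) hE (H5.setP (p := .pl)
    (t := StabCircuit.toTree (numA n F.anc) (F.prep j'))) (C := F.prepN j') (prepN_lt hF j')
    n5 (by rw [prepN_toTree]; simp)
  have pe6 : h6.p .pe = tp := by rw [f6.p _ (by decide)]; simp [pe5]
  have pf6 : h6.p .pf = F.toTree := by rw [f6.p _ (by decide)]; simp [pf5]
  have n6 : h6.v .n = n := by rw [f6.v _ (by decide), Mem.setP_v, n5]
  obtain ⟨h7, d7, H7, f7⟩ := resetCode_tri (E := E) (n := n) hE (H6.setP (p := .pl)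
    (t := StabCircuit.toTree (numC n F.anc) F.circ)) (C := F.circN) (circN_lt hF)
    n6 (by rw [circN_toTree]; simp)
  have pe7 : h7.p .pe = tp := by rw [f7.p _ (by decide)]; simp [pe6]
  have d8 := Den.coeff (E := E) (h := h7) (z := .tmp) (p := .pe)
  have d9 := Den.cmul (E := E) (h := h7.setC .tmp (h7.p .pe).coeff) (z := .amp) (u := .amp)
    (v := .tmp)
  have lk : ∀ (h : Mem) (t : Tree), Frame gateVars [.pf, .pe, .pl, .pg, .pq] h (h.setP .pl t) :=
    fun h t => Frame.setP _ _ _ (by decide) _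
  have up : ∀ {h h' : Mem}, Frame gateVars [.pl, .pg, .pq] h h' →
      Frame gateVars [.pf, .pe, .pl, .pg, .pq] h h' := fun f => f.mono (by decide) (by decide)
  refine ((d1.seq (d2.seq (d3.seq ((step pe3 ce).seq (d4.seq ((step pf4 cf).seq (d5.seq
    ((step pe5 ce).seq (d6.seq ((step pf6 cf).seq (d7.seq (d8.seq d9)))))))))))).mono ?_).tri
    ⟨?_, ?_⟩
  · have hp : (F.prepN j').length ≤ Finset.univ.sup (fun j => (F.prep j).length) := by
      simp only [Impl.prepN, List.length_map]
      exact Finset.le_sup (f := fun j => (F.prep j).length) (Finset.mem_univ j')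
    have hg : (F.prepN j').length + F.circN.length ≤ F.gates := by
      simp only [Impl.gates, Impl.circN, List.length_map] at hp ⊢; omega
    simp only [AExp.cost]
    generalize (F.prepN j').length = a at *
    generalize F.circN.length = b at *
    generalize F.gates = c at *
    generalize hS : (N + 1) * (N + 1) = S at *
    have h1 : S * (a + b) ≤ S * c := Nat.mul_le_mul_left _ hg
    nlinarith
  · rw [Impl.step, dif_pos hj]
    exact H7.smul (by simp [pe7, htp, Tree.coeff, hj'])
  · exact (((((((((fr3.trans (lk _ _)).trans (up f4)).trans (lk _ _)).trans (up f5)).trans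
      (lk _ _)).trans (up f6)).trans (lk _ _)).trans (up f7)).trans
      (Frame.setC _ _ _ (by decide) _)).trans (Frame.setC _ _ _ (by decide) _)

end QSim

namespace QSim

open AExp (var get ltE eqE word arity)

variable {E : Env} {h h' h₁ h₂ : Mem} {n N : ℕ}

/-! ## Mixed radix numbers of terms -/

/-- The radices: the ranks other than `1`. -/
def radices (f : Unitary n → Impl n) : Circuit n → List ℕ
  | [] => []
  | .stab _ :: l => radices f l
  | .high U :: l => if 1 < (f U).rank then (f U).rank :: radices f l else radices f l

/-- The digits of the number of a term. -/
def digits (f : Unitary n → Impl n) : Circuit n → ℕ → List ℕ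
  | [], _ => []
  | .stab _ :: l, u => digits f l u
  | .high U :: l, u =>
    if 1 < (f U).rank then u % (f U).rank :: digits f l (u / (f U).rank)
    else digits f l (u / (f U).rank)

/-- The program has enough memory for the circuit. -/
structure Fits (E : Env) (f : Unitary n → Impl n) (N : ℕ) (C : Circuit n) : Prop where
  size : (N + 1) * (N + 1) + 100 ≤ E.V
  gate : ∀ U ∈ C.highGates, 0 < (f U).rank ∧ (f U).rank ≤ E.V ∧ n + (f U).anc ≤ N

theorem Fits.tail {f : Unitary n → Impl n} {a : Item n} {C : Circuit n}
    (H : Fits E f N (a :: C)) : Fits E f N C := by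
  refine ⟨H.size, fun U hU => H.gate U ?_⟩
  cases a
  · exact hU
  · exact List.mem_cons_of_mem _ hU

theorem cells_append (l l' : List ℕ) : cells (l ++ l') = cells l + cells l' := by
  simp [cells]

theorem cells_cons (a : ℕ) (l : List ℕ) : cells (a :: l) = 1 + a.size + cells l := by
  simp [cells]

theorem digits_le {f : Unitary n → Impl n} {C : Circuit n} (H : Fits E f N C) (u : ℕ) :
    cells (digits f C u) ≤ cells (radices f C) ∧ ∀ v ∈ digits f C u, v ≤ E.V := by
  induction C generalizing u with
  | nil => simp [digits, radices]
  | cons a C ih =>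
    cases a with
    | stab g => exact ih H.tail u
    | high U =>
      obtain ⟨h1, h2, -⟩ := H.gate U List.mem_cons_self
      obtain ⟨i1, i2⟩ := ih H.tail (u / (f U).rank)
      have hm := Nat.mod_lt u h1
      simp only [digits, radices]
      split
      · have := Nat.size_le_size hm.le
        simp only [cells_cons, List.forall_mem_cons]
        exact ⟨by omega, by omega, i2⟩
      · exact ⟨i1, i2⟩

theorem chi_stab (f : Unitary n → Impl n) (g : Gate (Fin n)) (C : Circuit n) :
    Circuit.chi (.stab g :: C) f = Circuit.chi C f := rfl

theorem chi_high (f : Unitary n → Impl n) (U : Unitary n) (C : Circuit n) :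
    Circuit.chi (.high U :: C) f = (f U).rank * Circuit.chi C f := by
  simp [Circuit.chi, Circuit.highGates, Item.high?]

/-- What does not change, when the registers `xs`, the pointers `ps`, and `D` may change. -/
structure FrameD (xs : List Var) (ps : List Ptr) (h h' : Mem) : Prop where
  v : ∀ x, x ∉ xs → h'.v x = h.v x
  p : ∀ p, p ∉ ps → h'.p p = h.p p
  X : h'.a .X = h.a .X
  acc : h'.c .acc = h.c .acc

theorem Frame.forget {xs xs' : List Var} {ps ps' : List Ptr} (a : Frame xs ps h h') (hx : xs ⊆ xs')
    (hp : ps ⊆ ps') : FrameD xs' ps' h h' :=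
  ⟨fun x h => a.v x (fun h' => h (hx h')), fun x h => a.p x (fun h' => h (hp h')), a.X, a.acc⟩

theorem FrameD.refl (xs : List Var) (ps : List Ptr) (h : Mem) : FrameD xs ps h h :=
  ⟨fun _ _ => rfl, fun _ _ => rfl, rfl, rfl⟩

theorem FrameD.trans {xs : List Var} {ps : List Ptr} (a : FrameD xs ps h h₁)
    (b : FrameD xs ps h₁ h₂) : FrameD xs ps h h₂ :=
  ⟨fun x hx => (b.v x hx).trans (a.v x hx), fun x hx => (b.p x hx).trans (a.p x hx),
    b.X.trans a.X, b.acc.trans a.acc⟩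

theorem FrameD.mono {xs xs' : List Var} {ps ps' : List Ptr} (a : FrameD xs ps h h')
    (hx : xs ⊆ xs') (hp : ps ⊆ ps') : FrameD xs' ps' h h' :=
  ⟨fun x h => a.v x (fun h' => h (hx h')), fun x h => a.p x (fun h' => h (hp h')), a.X, a.acc⟩

theorem FrameD.setV (xs : List Var) (ps : List Ptr) (h : Mem) {x : Var} (hx : x ∈ xs) (k : ℕ) :
    FrameD xs ps h (h.setV x k) :=
  (Frame.setV xs ps h hx k).forget (List.Subset.refl _) (List.Subset.refl _)

theorem FrameD.setP (xs : List Var) (ps : List Ptr) (h : Mem) {p : Ptr} (hp : p ∈ ps) (t : Tree) :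
    FrameD xs ps h (h.setP p t) :=
  (Frame.setP xs ps h hp t).forget (List.Subset.refl _) (List.Subset.refl _)

theorem FrameD.setD (xs : List Var) (ps : List Ptr) (h : Mem) (l : List ℕ) :
    FrameD xs ps h (h.setA .D l) :=
  ⟨fun _ _ => rfl, fun _ _ => rfl, by simp, rfl⟩

def termVars : List Var := .dig :: .rank :: .k :: .carry :: gateVars

def termPtrs : List Ptr := [.pc, .it, .pf, .pe, .pl, .pg, .pq]

/-- Reads a digit into `dig`, and replaces it by the one of the number of the next term. -/
def digitCode : Code arch :=
  .seq (link .pf .it 0) (.seq (link .pe .pf 1) (.seq (asg .rank (arity .pe))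
  (ifE (ltE 1 (var .rank))
    (.seq (asg .dig (get .D (var .k)))
    (.seq (put .D (var .k) ((var .dig + var .carry) % var .rank))
    (.seq (asg .carry ((var .dig + var .carry) / var .rank)) (asg .k (var .k + 1)))))
    (asg .dig 0))))

/-- The array `D` consists of the digits `pre` already replaced by new ones, the current digit, and
the old digits `post`. A gate of rank 1 has no digit; its digit counts as 0 and the carry passes
through unchanged. -/
theorem digitCode_tri {F : Impl n} {Ψ : State ℕ} {u c : ℕ} {pre post : List ℕ}
    (H : Holds N Ψ h) (hr : 0 < F.rank) (hrV : F.rank ≤ E.V)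
    (hit : (h.p .it).child 0 = some F.toTree)
    (hD : h.a .D = pre ++ ((if 1 < F.rank then [u % F.rank] else []) ++ post))
    (hk : h.v .k = pre.length) (hkV : pre.length + 1 ≤ E.V) (hc : h.v .carry = c) (hc1 : c ≤ 1)
    (hpre : ∀ v ∈ pre, v ≤ E.V) (hpost : ∀ v ∈ post, v ≤ E.V)
    (hsp : 1 < F.rank → cells pre + (1 + F.rank.size + cells post) ≤ E.spD) :
    Tri E digitCode h 200 (fun h' =>
      h'.v .dig = u % F.rank ∧ h'.v .carry = (u % F.rank + c) / F.rank ∧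
      h'.a .D = pre ++ ((if 1 < F.rank then [(u + c) % F.rank] else []) ++ post) ∧
      h'.v .k = (pre ++ if 1 < F.rank then [(u + c) % F.rank] else []).length ∧ Holds N Ψ h' ∧
      FrameD [.dig, .rank, .k, .carry] [.pf, .pe] h h') := by
  have hV := E.hV
  set tr : Tree := .node 0 0 F.rank (fun j =>
        .node 0 (F.coeff j) 1 ![StabCircuit.toTree (fun i : Fin F.anc => n + (i : ℕ)) (F.prep j)])
    with htr
  have d1 := Den.link (E := E) (h := h) (p := .pf) (q := .it) (e := 0) (i := 0) (t := F.toTree)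
    (by decide) (fun _ => by simp) rfl hit
  have d2 := Den.link (E := E) (h := h.setP .pf F.toTree) (p := .pe) (q := .pf) (e := 1) (i := 1)
    (t := tr) (by decide) (fun _ => by simp; omega) rfl (by simp; rfl)
  have d3 := Den.asg (E := E) (h := (h.setP .pf F.toTree).setP .pe tr) (x := .rank)
    (e := arity .pe) (v := F.rank) (by decide) (fun _ => by simpa [htr, Tree.arity] using hrV)
    (by simp [htr, Tree.arity])
  set h3 := ((h.setP .pf F.toTree).setP .pe tr).setV .rank F.rank with hh3
  have fr3 : FrameD [.dig, .rank, .k, .carry] [.pf, .pe] h h3 :=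
    ((FrameD.setP _ _ h (by decide) _).trans (FrameD.setP _ _ _ (by decide) _)).trans
      (FrameD.setV _ _ _ (by decide) _)
  have H3 : Holds N Ψ h3 := H.setP.setP.setV (by decide)
  refine (d1.seq_tri (d2.seq_tri (d3.seq_tri (Tri.ifE (T := 100) (by decide)
    (fun _ => by simp; omega) (fun he => ?_) (fun he => ?_))))).mono ?_ (fun _ a => a)
  · have h1 : 1 < F.rank := by simpa [hh3] using he
    simp only [if_pos h1] at hD ⊢
    have hD3 : h3.a .D = pre ++ ([u % F.rank] ++ post) := by simpa [hh3] using hD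
    have hk3 : h3.v .k = pre.length := by simp [hh3, hk]
    have hm := Nat.mod_lt u hr
    have d4 := Den.asg (E := E) (h := h3) (x := .dig) (e := get .D (var .k)) (v := u % F.rank)
      (by decide) (fun _ => by simp [hk3, hD3]) (by simp [hk3, hD3])
    have em : (u % F.rank + c) % F.rank = (u + c) % F.rank := Nat.mod_add_mod _ _ _
    have hm2 := Nat.mod_lt (u + c) hr
    have d5 := Den.put_of (E := E) (h := h3.setV .dig (u % F.rank)) (s := .D) (e₁ := var .k)
      (e₂ := (var .dig + var .carry) % var .rank) (i := pre.length) (v := (u + c) % F.rank)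
      (by decide) (by decide) (fun _ => trivial) (fun _ => by simp [hh3, hc]; omega)
      (by simp [hk3]) (by simp [hh3, hc]) (by simp [hD3]) (fun hg => by
        refine hg.setD ?_ ?_
        · have := Nat.size_le_size hm2.le
          have := hsp h1
          simp [hD3, cells_append, cells_cons]
          omega
        · simp [hD3]
          intro v hv
          rcases hv with hv | hv | hv
          · exact hpre v hv
          · omega
          · exact hpost v hv)
    have eset : ((h3.setV .dig (u % F.rank)).a .D).set pre.length ((u + c) % F.rank) =
        pre ++ ([(u + c) % F.rank] ++ post) := by simp [hD3]
    rw [eset] at d5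
    set h5 := (h3.setV .dig (u % F.rank)).setA .D (pre ++ ([(u + c) % F.rank] ++ post)) with hh5
    have d6 := Den.asg (E := E) (h := h5) (x := .carry) (e := (var .dig + var .carry) / var .rank)
      (v := (u % F.rank + c) / F.rank) (by decide) (fun _ => by simp [hh5, hh3, hc]; omega)
      (by simp [hh5, hh3, hc])
    have d7 := Den.asg (E := E) (h := h5.setV .carry ((u % F.rank + c) / F.rank)) (x := .k)
      (e := var .k + 1)
      (v := pre.length + 1) (by decide) (fun _ => by simp [hh5, hh3, hk]; omega)
      (by simp [hh5, hh3, hk])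
    refine ((d4.seq (d5.seq (d6.seq d7))).mono (by decide)).tri ⟨?_, ?_, ?_, ?_, ?_, ?_⟩
    · simp [hh5]
    · simp
    · simp [hh5]
    · simp
    · exact (((H3.setV (by decide)).setD).setV (by decide)).setV (by decide)
    · exact (((fr3.trans (FrameD.setV _ _ _ (by decide) _)).trans (FrameD.setD _ _ _ _)).trans
        (FrameD.setV _ _ _ (by decide) _)).trans (FrameD.setV _ _ _ (by decide) _)
  · have h1 : ¬ 1 < F.rank := by simpa [hh3] using he
    have hr1 : F.rank = 1 := by omega
    simp only [hr1, lt_irrefl, if_false, Nat.mod_one, Nat.div_one] at hD ⊢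
    have d4 := Den.asg (E := E) (h := h3) (x := .dig) (e := 0) (v := 0)
      (by decide) (fun _ => by simp) rfl
    refine (d4.mono (by decide)).tri ⟨?_, ?_, ?_, ?_, ?_, ?_⟩
    · simp
    · simp [hh3, hc]
    · simpa [hh3] using hD
    · simp [hh3, hk]
    · exact H3.setV (by decide)
    · exact fr3.trans (FrameD.setV _ _ _ (by decide) _)
  · decide

/-! ## Terms -/

def itemCode : Code arch :=
  ifE (eqE (word .it) 4) (.seq digitCode highCode) (.seq (.instr (.move Ptr.pg.idx Ptr.it.idx)) gateCode)

/-- The state of the computation of term number `id`, when the gates `as` are still to be done. -/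
structure TermInv (E : Env) (f : Unitary n → Impl n) (C : Circuit n) (N id : ℕ) (h₀ : Mem)
    (as : Circuit n) (h : Mem) : Prop where
  fits : Fits E f N as
  frame : FrameD termVars termPtrs h₀ h
  ex : ∃ pre u c Φ, h.a .D = pre ++ digits f as u ∧ h.v .k = pre.length ∧ h.v .carry = c ∧ c ≤ 1 ∧
    u < Circuit.chi as f ∧ pre ++ digits f as (u + c) = digits f C (id + 1) ∧
    (u + c = Circuit.chi as f ↔ id + 1 = C.chi f) ∧
    cells pre + cells (radices f as) ≤ E.spD ∧ (∀ v ∈ pre, v ≤ E.V) ∧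
    pre.length + (radices f as).length + 1 ≤ E.V ∧ Holds N Φ h ∧
    term f as u Φ = term f C id (zeroState N)

theorem stab_eq_map_toTree (g : Gate (Fin n)) :
    g.toTree (fun i : Fin n => (i : ℕ)) =
      (g.map (fun i : Fin n => (i : ℕ)) Fin.val_injective).toTree (fun i => i) :=
  (Gate.toTree_map _ Fin.val_injective (fun i => i) g).symm

def itemCost (f : Unitary n → Impl n) (N : ℕ) : Item n → ℕ
  | .stab _ => 17000 * ((N + 1) * (N + 1))
  | .high U => 51000 * ((N + 1) * (N + 1)) * ((f U).gates + 1)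

/-- The invariant has `u`, the quotient of `id` after the digits read so far, `pre`, the new digits,
and the carry `c`. The digits of `u + c` would complete `pre` to those of `id + 1`, and `u + c`
overflows the remaining radices exactly if `id + 1 = χ`. Applying the remaining gates to the current
state, with the number `u`, gives the whole term. -/
theorem itemCode_tri {f : Unitary n → Impl n} {C as : Circuit n} {a : Item n} {id : ℕ} {h₀ : Mem}
    (hnN : n ≤ N) (hn : h₀.v .n = n) (H : TermInv E f C N id h₀ (a :: as) h) :
    Tri E itemCode (h.setP .it (a.toTree f)) (itemCost f N a) (fun h' => h'.p .pc = h.p .pc ∧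
      TermInv E f C N id h₀ as (h'.setP .pc (.ofList (as.map (Item.toTree f))))) := by
  obtain ⟨fits, frame, pre, u, c, Φ, hD, hk, hc, hc1, hu, htarget, hcarry, hcells, hpre, hlen, HΦ,
    hterm⟩ := H
  have hN := le_sq (N := N)
  have hV := E.hV
  have pcframe : ∀ (h : Mem) (t : Tree), FrameD termVars termPtrs h (h.setP .pc t) := fun h t =>
    FrameD.setP _ _ _ (by decide) _
  have itframe := FrameD.setP termVars termPtrs h (p := .it) (by decide) (a.toTree f)
  cases a with
  | stab g =>
    have e1 : (Item.toTree f (Item.stab g)).word ≤ 3 := by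
      cases g <;> simp [Item.toTree, Gate.toTree, Tree.word]
    set hm := (h.setP .it (Item.toTree f (Item.stab g))).setP .pg (Item.toTree f (Item.stab g)) with hhm
    have d1 := Den.move (E := E) (h := h.setP .it (Item.toTree f (Item.stab g))) (p := .pg) (q := .it)
    have e2 : (h.setP .it (Item.toTree f (Item.stab g))).p .it = Item.toTree f (Item.stab g) := by simp
    rw [e2] at d1
    obtain ⟨h2, d2, a2, f2⟩ := gateCode_tri (E := E) fits.size
      (g := g.map (fun i : Fin n => (i : ℕ)) Fin.val_injective)
      (h := hm) (HΦ.setP.setP) (by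
        intro q hq
        rw [Gate.qubits_map, List.mem_map] at hq
        obtain ⟨i, -, rfl⟩ := hq
        omega) (by simp only [hhm, Mem.setP_p, if_true]; exact stab_eq_map_toTree g)
    have fr2 : FrameD termVars termPtrs h h2 := (itframe.trans
      (FrameD.setP _ _ _ (by decide) _)).trans (f2.forget (by decide) (by decide))
    refine ⟨h2, (Den.ifE_neg (by decide) (fun _ => by simp; omega) ?_ (d1.seq d2)).mono ?_, ?_,
      fits.tail, (frame.trans fr2).trans (pcframe _ _), pre, u, c, _, ?_, ?_, ?_, hc1, hu,
      htarget, hcarry, hcells, hpre, hlen, a2.setP, hterm⟩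
    · simp; omega
    · simp only [show (eqE (word .it) 4).cost = 3 from rfl, itemCost]; omega
    · rw [f2.p _ (by decide)]; simp [hhm]
    · simp only [Mem.setP_a, f2.D, hhm]; exact hD
    · simp only [Mem.setP_v, f2.v .k (by decide), hhm]; exact hk
    · simp only [Mem.setP_v, f2.v .carry (by decide), hhm]; exact hc
  | high U =>
    obtain ⟨r0, rV, ranc⟩ := fits.gate U List.mem_cons_self
    set F := f U with hF
    rw [chi_high, ← hF] at hu hcarry
    have cL : ∀ u, digits f (Item.high U :: as) u =
        (if 1 < F.rank then [u % F.rank] else []) ++ digits f as (u / F.rank) := fun u => by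
      simp only [digits]; split <;> rfl
    have cR : cells (radices f (Item.high U :: as)) =
        (if 1 < F.rank then 1 + F.rank.size else 0) + cells (radices f as) := by
      simp only [radices]; split <;> simp [cells_cons, hF]
    have cR2 : (radices f (Item.high U :: as)).length =
        (if 1 < F.rank then 1 else 0) + (radices f as).length := by
      simp only [radices]; split <;> simp; omega
    rw [cL] at hD htarget
    rw [cR] at hcells
    rw [cR2] at hlen
    obtain ⟨dl, dV⟩ := digits_le fits.tail (u / F.rank)
    obtain ⟨h1, d1, b1, b2, b3, b4, b5, b6⟩ := digitCode_tri (E := E) (n := n) (F := F) (u := u) (c := c)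
      (pre := pre)
      (post := digits f as (u / F.rank)) (h := h.setP .it (Item.toTree f (Item.high U)))
      HΦ.setP r0 rV (by simp [Item.toTree, Tree.child, hF]) (by simpa using hD) (by simpa using hk)
      (by omega) (by simpa using hc) hc1 hpre dV (fun h1 => by rw [if_pos h1] at hcells; omega)
    have fr1 := itframe.trans (b6.mono (by decide) (by decide))
    have it1 : (h1.p .it).child 0 = some F.toTree := by
      rw [b6.p _ (by decide)]; simp [Item.toTree, Tree.child, hF]
    have n1 : h1.v .n = n := by rw [(frame.trans fr1).v _ (by decide), hn]
    have hmod := Nat.mod_lt u r0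
    -- Schoolbook addition: adding the carry and then splitting off a digit is the same as adding to
    -- the digit and passing the new carry on to the quotient.
    have ediv : (u + c) / F.rank = u / F.rank + (u % F.rank + c) / F.rank := by
      conv_lhs => rw [← Nat.div_add_mod u F.rank, add_assoc, Nat.mul_add_div r0]
    have emod : (u + c) % F.rank = (u % F.rank + c) % F.rank := (Nat.mod_add_mod _ _ _).symm
    set c' := (u % F.rank + c) / F.rank with hc'
    have hc1' : c' ≤ 1 := by
      rw [hc', ← Nat.lt_succ_iff, Nat.div_lt_iff_lt_mul r0]; omega
    obtain ⟨h2, d2, a2, f2⟩ := highCode_tri (E := E) fits.size b5 ranc n1 it1 b1 hmod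
    have fr2 := fr1.trans (f2.forget (by decide) (by decide))
    refine ⟨h2, (Den.ifE_pos (by decide) (fun _ => by simp [Item.toTree, Tree.word]; omega)
      (by simp [Item.toTree, Tree.word]) (d1.seq d2)).mono ?_, ?_,
      fits.tail, (frame.trans fr2).trans (pcframe _ _),
      pre ++ (if 1 < F.rank then [(u + c) % F.rank] else []), u / F.rank, c', _, ?_, ?_, ?_, hc1',
      Nat.div_lt_of_lt_mul hu, ?_, ?_, ?_, ?_, ?_, a2.setP, hterm⟩
    · simp only [show (eqE (word .it) 4).cost = 3 from rfl, itemCost, ← hF]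
      have : (N + 1) * (N + 1) ≤ (N + 1) * (N + 1) * (F.gates + 1) := Nat.le_mul_of_pos_right _ (by omega)
      generalize (N + 1) * (N + 1) = S at *
      rw [mul_assoc 50000, mul_assoc 51000]
      omega
    · rw [f2.p _ (by decide), b6.p _ (by decide)]; simp
    · simp only [Mem.setP_a, f2.D, b3, List.append_assoc]
    · simp only [Mem.setP_v, f2.v .k (by decide), b4]
    · simp only [Mem.setP_v, f2.v .carry (by decide), b2]
    · rw [← ediv, List.append_assoc]; exact htarget
    · rw [← hcarry, ← ediv]
      -- Rounding down is harmless: from `u < r χ'` and `c ≤ 1`, the sum `u + c` is at most `r χ'`,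
      -- so its quotient by `r` is `χ'` only if it equals `r χ'`.
      refine ⟨fun e => le_antisymm (by omega) ?_, fun e => ?_⟩
      · rw [← e]; exact Nat.mul_div_le _ _
      · rw [e, Nat.mul_div_cancel_left _ r0]
    · have hs := Nat.size_le_size (Nat.mod_lt (u + c) r0).le
      simp only [cells_append]
      split
      · rename_i h1
        rw [if_pos h1] at hcells
        simp only [cells_cons, show cells [] = 0 from rfl]; omega
      · rename_i h1
        rw [if_neg h1] at hcells
        simp only [show cells [] = 0 from rfl]; omega
    · intro v hv
      rcases List.mem_append.1 hv with hv | hv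
      · exact hpre v hv
      · split at hv
        · rw [List.mem_singleton] at hv
          have := Nat.mod_lt (u + c) r0
          omega
        · simp at hv
    · simp only [List.length_append]
      split
      · rename_i h1
        rw [if_pos h1] at hlen
        simp only [List.length_cons, List.length_nil]; omega
      · rename_i h1
        rw [if_neg h1] at hlen
        simp only [List.length_nil]; omega

/-- The carry starts at 1, so that one traversal of the circuit computes term `id` and also advances
the stored number to `id + 1`. -/
def termCode : Code arch :=
  .seq (link .pc .px 1) (.seq initCode (.seq (asg .k 0) (.seq (asg .carry 1)
  (.seq (each .pc .it itemCode) (.seq evalCode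
    (.instr (.cadd CReg.acc.idx CReg.acc.idx CReg.amp.idx)))))))

theorem itemCost_sum_le {f : Unitary n → Impl n} (C : Circuit n) {μ : ℕ}
    (hμ : ∀ U ∈ C.highGates, (f U).gates ≤ μ) :
    (C.map (fun a => itemCost f N a + 6)).sum ≤
      52000 * ((N + 1) * (N + 1)) * (C.length + C.highGates.length * μ) := by
  have hN := le_sq (N := N)
  generalize hS : (N + 1) * (N + 1) = S at *
  induction C with
  | nil => simp
  | cons a C ih =>
    cases a with
    | stab g =>
      have h1 := ih hμ
      rw [List.map_cons, List.sum_cons, List.length_cons]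
      generalize (C.map (fun a => itemCost f N a + 6)).sum = t at *
      simp only [itemCost, hS]
      have e : Circuit.highGates (.stab g :: C) = Circuit.highGates C := rfl
      rw [e]
      nlinarith
    | high U =>
      have h1 := ih (fun V hV => hμ V (List.mem_cons_of_mem _ hV))
      have h2 := hμ U List.mem_cons_self
      rw [List.map_cons, List.sum_cons, List.length_cons]
      generalize (C.map (fun a => itemCost f N a + 6)).sum = t at *
      simp only [itemCost, hS]
      have e : Circuit.highGates (.high U :: C) = U :: Circuit.highGates C := rfl
      rw [e, List.length_cons]
      have h3 : S * (f U).gates ≤ S * μ := Nat.mul_le_mul_left _ h2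
      nlinarith

/-- The memory is ready for the computation of term number `id`. -/
structure Ready (E : Env) (f : Unitary n → Impl n) (C : Circuit n) (x : ℕ → Bool) (N id : ℕ)
    (h : Mem) : Prop where
  base : Base N h
  n : h.v .n = n
  X : VecIs N (h.a .X) (ext N x)
  D : h.a .D = digits f C id
  px : (h.p .px).child 1 = some (.ofList (C.map (Item.toTree f)))

theorem termCode_tri {f : Unitary n → Impl n} {C : Circuit n} {x : ℕ → Bool} {id μ : ℕ}
    (hnN : n ≤ N) (fits : Fits E f N C) (hD : cells (radices f C) ≤ E.spD)
    (hDl : (radices f C).length + 1 ≤ E.V) (hμ : ∀ U ∈ C.highGates, (f U).gates ≤ μ)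
    (hid : id < C.chi f) (R : Ready E f C x N id h) :
    Tri E termCode h (55000 * ((N + 1) * (N + 1)) * (1 + (C.length + C.highGates.length * μ)))
      (fun h' => Ready E f C x N (id + 1) h' ∧ (h'.v .carry ≠ 0 ↔ id + 1 = C.chi f) ∧
        h'.v .carry ≤ 1 ∧
        h'.c .acc = h.c .acc + term f C id (zeroState N) x ∧
        ∀ x, x ∉ termVars → h'.v x = h.v x) := by
  have hN := le_sq (N := N)
  have hV := E.hV
  have d1 := Den.link (E := E) (h := h) (p := .pc) (q := .px) (e := 1) (i := 1)
    (t := .ofList (C.map (Item.toTree f))) (by decide) (fun _ => by simp; omega) rfl R.px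
  obtain ⟨h2, d2, a2, f2⟩ := initCode_tri (E := E) (N := N) fits.size (R.base.setP (p := .pc)
    (t := .ofList (C.map (Item.toTree f))))
  have d3 := Den.asg (E := E) (h := h2) (x := .k) (e := 0) (v := 0)
    (by decide) (fun _ => by simp) rfl
  have d4 := Den.asg (E := E) (h := h2.setV .k 0) (x := .carry) (e := 1) (v := 1)
    (by decide) (fun _ => by simp; omega) rfl
  set h4 := (h2.setV .k 0).setV .carry 1 with hh4
  have fr4 : FrameD termVars termPtrs h h4 := (((FrameD.setP _ _ _ (by decide) _).trans
    (f2.forget (by decide) (by decide))).trans (FrameD.setV _ _ _ (by decide) _)).trans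
    (FrameD.setV _ _ _ (by decide) _)
  have inv : TermInv E f C N id h4 C h4 := by
    refine ⟨fits, FrameD.refl _ _ _, [], id, 1, zeroState N, ?_, by simp [hh4], by simp [hh4], le_rfl,
      hid, rfl, Iff.rfl, by simpa [cells] using hD, by simp, by simpa using hDl,
      (a2.setV (by decide)).setV (by decide), rfl⟩
    simp only [hh4, Mem.setV_a, f2.D, Mem.setP_a, R.D, List.nil_append]
  have n4 : h4.v .n = n := by rw [fr4.v _ (by decide), R.n]
  obtain ⟨h5, d5, i5⟩ := each_tri (E := E) (Item.toTree f) (p := .it) (l := .pc) (c := itemCode)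
    (itemCost f N) (TermInv E f C N id h4)
    (fun a as h1 hi hl => (itemCode_tri hnN n4 hi).mono le_rfl fun h' a => a) C h4 inv
    (by simp only [hh4, Mem.setV_p, f2.p .pc (by decide)]; simp)
  obtain ⟨-, fr5, pre, u, c, Φ, hD5, -, hc5, hc1, hu, htarget, hcarry, -, -, -, HΦ, hterm⟩ := i5
  have fr5' := fr4.trans fr5
  obtain ⟨h6, d6, amp6, base6, f6⟩ := evalCode_tri (E := E) (x := x) fits.size HΦ
    (by rw [fr5'.X]; exact R.X)
  have fr6 := fr5'.trans (f6.forget (xs' := termVars) (ps' := termPtrs) (by decide) (by decide))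
  have d7 := Den.cadd (E := E) (h := h6) (z := .acc) (u := .acc) (v := .amp)
  -- For the empty rest of the circuit the product of the ranks is 1, so `u < 1`; the remaining
  -- carry is then 1 exactly after the last term.
  have hu0 : u = 0 := by
    have : Circuit.chi ([] : Circuit n) f = 1 := rfl
    omega
  have e1 : Circuit.chi ([] : Circuit n) f = 1 := rfl
  have c6 : h6.v .carry = c := by rw [f6.v _ (by decide), hc5]
  refine ((d1.seq (d2.seq (d3.seq (d4.seq (d5.seq (d6.seq d7)))))).mono ?_).tri
    ⟨⟨base6.setC, ?_, ?_, ?_, ?_⟩, ?_, ?_, ?_, ?_⟩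
  · have := itemCost_sum_le (N := N) C hμ
    simp only [show (0 : AExp).cost = 1 from rfl, show (1 : AExp).cost = 1 from rfl]
    generalize (N + 1) * (N + 1) = S at *
    generalize C.length + C.highGates.length * μ = m at *
    nlinarith
  · rw [Mem.setC_v, fr6.v _ (by decide), R.n]
  · rw [Mem.setC_a, fr6.X]; exact R.X
  · rw [Mem.setC_a, f6.D, hD5, ← htarget]; rfl
  · rw [Mem.setC_p, fr6.p _ (by decide)]; exact R.px
  · rw [Mem.setC_v, c6, ← hcarry, e1, hu0]; omega
  · rw [Mem.setC_v, c6]; exact hc1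
  · rw [Mem.setC_c, if_pos rfl, amp6, fr6.acc, ← hterm]; rfl
  · intro x hx
    rw [Mem.setC_v, fr6.v x hx]

end QSim

namespace QSim

open AExp (var get ltE eqE word arity)

variable {E : Env} {h h' h₁ h₂ : Mem} {n N : ℕ}

/-! ## Reading the input -/

/-- What does not change, when registers, pointers and arrays as listed may change. -/
structure FrameA (xs : List Var) (ps : List Ptr) (ss : List Arr) (h h' : Mem) : Prop where
  v : ∀ x, x ∉ xs → h'.v x = h.v x
  p : ∀ p, p ∉ ps → h'.p p = h.p p
  a : ∀ s, s ∉ ss → h'.a s = h.a s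
  c : h'.c = h.c

theorem FrameA.refl (xs : List Var) (ps : List Ptr) (ss : List Arr) (h : Mem) :
    FrameA xs ps ss h h :=
  ⟨fun _ _ => rfl, fun _ _ => rfl, fun _ _ => rfl, rfl⟩

theorem FrameA.trans {xs : List Var} {ps : List Ptr} {ss : List Arr} (a : FrameA xs ps ss h h₁)
    (b : FrameA xs ps ss h₁ h₂) : FrameA xs ps ss h h₂ :=
  ⟨fun x hx => (b.v x hx).trans (a.v x hx), fun x hx => (b.p x hx).trans (a.p x hx),
    fun x hx => (b.a x hx).trans (a.a x hx), b.c.trans a.c⟩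

theorem FrameA.mono {xs xs' : List Var} {ps ps' : List Ptr} {ss ss' : List Arr}
    (a : FrameA xs ps ss h h') (hx : xs ⊆ xs') (hp : ps ⊆ ps') (hs : ss ⊆ ss') :
    FrameA xs' ps' ss' h h' :=
  ⟨fun x h => a.v x (fun h' => h (hx h')), fun x h => a.p x (fun h' => h (hp h')),
    fun x h => a.a x (fun h' => h (hs h')), a.c⟩

variable (xs : List Var) (ps : List Ptr) (ss : List Arr) in
theorem FrameA.setV (h : Mem) {x : Var} (hx : x ∈ xs) (k : ℕ) : FrameA xs ps ss h (h.setV x k) :=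
  ⟨fun y hy => by simp [show y ≠ x from fun e => hy (e ▸ hx)], fun _ _ => rfl, fun _ _ => rfl, rfl⟩

variable (xs : List Var) (ps : List Ptr) (ss : List Arr) in
theorem FrameA.setP (h : Mem) {x : Ptr} (hx : x ∈ ps) (k : Tree) :
    FrameA xs ps ss h (h.setP x k) :=
  ⟨fun _ _ => rfl, fun y hy => by simp [show y ≠ x from fun e => hy (e ▸ hx)], fun _ _ => rfl, rfl⟩

variable (xs : List Var) (ps : List Ptr) (ss : List Arr) in
theorem FrameA.setA (h : Mem) {x : Arr} (hx : x ∈ ss) (k : List ℕ) :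
    FrameA xs ps ss h (h.setA x k) :=
  ⟨fun _ _ => rfl, fun _ _ => rfl, fun y hy => by simp [show y ≠ x from fun e => hy (e ▸ hx)], rfl⟩

/-- The number of qubits in use, if there are at least that many for each gate. -/
def maxWidth (f : Unitary n → Impl n) : Circuit n → ℕ
  | [] => 0
  | .stab _ :: l => maxWidth f l
  | .high U :: l => max (n + (f U).anc) (maxWidth f l)

theorem maxWidth_le {f : Unitary n → Impl n} {C : Circuit n} {m : ℕ}
    (hC : ∀ U ∈ C.highGates, n + (f U).anc ≤ m) : maxWidth f C ≤ m := by
  induction C with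
  | nil => exact Nat.zero_le _
  | cons a C ih =>
    cases a with
    | stab g => exact ih hC
    | high U => exact max_le (hC U List.mem_cons_self) (ih fun V hV => hC V (List.mem_cons_of_mem _ hV))

theorem le_maxWidth {f : Unitary n → Impl n} {C : Circuit n} :
    ∀ U ∈ C.highGates, n + (f U).anc ≤ maxWidth f C := by
  induction C with
  | nil => intro U hU; simp [Circuit.highGates] at hU
  | cons a C ih =>
    cases a with
    | stab g => exact ih
    | high U =>
      intro V hV
      rcases List.mem_cons.1 (show V ∈ U :: Circuit.highGates C from hV) with rfl | hV
      · exact le_max_left _ _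
      · exact (ih V hV).trans (le_max_right _ _)

def scanVars : List Var := [.L, .u, .rank]

/-- Updates the number of qubits, and splits off a digit of `u`, for the gate that `it` points to. -/
def scanCode : Code arch :=
  ifE (eqE (word .it) 4)
    (.seq (link .pf .it 0) (.seq (link .pe .pf 1) (.seq (asg .rank (arity .pe))
    (.seq (ifE (ltE (var .L) (var .n + word .pf + 1)) (asg .L (var .n + word .pf + 1)) .skip)
    (ifE (ltE 1 (var .rank)) (.seq (pushE .D (var .u % var .rank)) (asg .u (var .u / var .rank)))
      .skip)))))
    .skip

/-- The digits already stored, together with those of the current quotient `u`, always spell `id`.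
The register `L` is one more than the largest width met so far, starting from `n`. -/
structure ScanInv (E : Env) (f : Unitary n → Impl n) (C : Circuit n) (N id : ℕ) (h₀ : Mem)
    (as : Circuit n) (h : Mem) : Prop where
  fits : Fits E f N as
  frame : FrameA scanVars [.pc, .it, .pf, .pe] [.D] h₀ h
  cellD : ∀ v ∈ h.a .D, v ≤ E.V
  space : cells (h.a .D) + cells (radices f as) ≤ E.spD
  digits : h.a .D ++ digits f as (h.v .u) = digits f C id
  width : ∃ l, h.v .L = l + 1 ∧ max l (maxWidth f as) = N

theorem scanCode_tri {f : Unitary n → Impl n} {C as : Circuit n} {a : Item n} {id : ℕ} {h₀ : Mem}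
    (hn : h₀.v .n = n) (H : ScanInv E f C N id h₀ (a :: as) h) :
    Tri E scanCode (h.setP .it (a.toTree f)) 150 (fun h' => h'.p .pc = h.p .pc ∧
      ScanInv E f C N id h₀ as (h'.setP .pc (.ofList (as.map (Item.toTree f))))) := by
  obtain ⟨fits, frame, cellD, space, dig, l, hl, hN⟩ := H
  have hS := fits.size
  have hN2 := le_sq (N := N)
  have hV := E.hV
  have pcf : ∀ (h : Mem) (t : Tree), FrameA scanVars [.pc, .it, .pf, .pe] [.D] h (h.setP .pc t) :=
    fun h t => FrameA.setP _ _ _ _ (by decide) _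
  have itf := FrameA.setP scanVars [.pc, .it, .pf, .pe] [.D] h (x := .it) (by decide) (a.toTree f)
  cases a with
  | stab g =>
    have e1 : (Item.toTree f (Item.stab g)).word ≤ 3 := by
      cases g <;> simp [Item.toTree, Gate.toTree, Tree.word]
    refine ⟨_, (Den.ifE_neg (by decide) (fun _ => by simp; omega) (by simp; omega)
      Den.skip).mono (by decide), by simp, fits.tail, (frame.trans itf).trans (pcf _ _), cellD,
      space, dig, l, hl, hN⟩
  | high U =>
    obtain ⟨r0, rV, ranc⟩ := fits.gate U List.mem_cons_self
    set F := f U with hF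
    have hnl : h.v .n = n := (frame.v _ (by decide)).trans hn
    set tr : Tree := .node 0 0 F.rank (fun j =>
        .node 0 (F.coeff j) 1 ![StabCircuit.toTree (fun i : Fin F.anc => n + (i : ℕ)) (F.prep j)])
      with htr
    set h0 := h.setP .it (Item.toTree f (Item.high U)) with hh0
    have d1 := Den.link (E := E) (h := h0) (p := .pf) (q := .it) (e := 0) (i := 0) (t := F.toTree)
      (by decide) (fun _ => by simp) rfl (by simp [hh0, Item.toTree, Tree.child, hF])
    have d2 := Den.link (E := E) (h := h0.setP .pf F.toTree) (p := .pe) (q := .pf) (e := 1) (i := 1)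
      (t := tr) (by decide) (fun _ => by simp; omega) rfl (by simp; rfl)
    have d3 := Den.asg (E := E) (h := (h0.setP .pf F.toTree).setP .pe tr) (x := .rank)
      (e := arity .pe) (v := F.rank) (by decide) (fun _ => by simpa [htr, Tree.arity] using rV)
      (by simp [htr, Tree.arity])
    set h3 := ((h0.setP .pf F.toTree).setP .pe tr).setV .rank F.rank with hh3
    have fr3 : FrameA scanVars [.pc, .it, .pf, .pe] [.D] h h3 :=
      ((itf.trans (FrameA.setP _ _ _ _ (by decide) _)).trans (FrameA.setP _ _ _ _ (by decide) _)).trans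
        (FrameA.setV _ _ _ _ (by decide) _)
    have hw : (F.toTree).word = F.anc := rfl
    have eL : h3.v .L = l + 1 := by simp [hh3, hh0, hl]
    have en : h3.v .n = n := by simp [hh3, hh0, hnl]
    have ew : (h3.p .pf).word = F.anc := by simp [hh3, hw]
    have d4 : Den E (ifE (ltE (var .L) (var .n + word .pf + 1)) (asg .L (var .n + word .pf + 1)) .skip)
        h3 20 (h3.setV .L (max l (n + F.anc) + 1)) := by
      have ok : (var .n + word .pf + 1).Ok E.V h3 := by
        simp [en, ew]; omega
      by_cases hlt : l < n + F.anc
      · rw [max_eq_right hlt.le]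
        refine (Den.ifE_pos (by decide) (fun _ => by simp [en, ew]; omega)
          (by simp [en, ew, eL]; omega) (Den.asg (v := n + F.anc + 1) (by decide) (fun _ => ok)
          (by simp [en, ew]))).mono (by decide)
      · rw [max_eq_left (by omega), Mem.setV_self eL]
        exact (Den.ifE_neg (by decide) (fun _ => by simp [en, ew]; omega)
          (by simp [en, ew, eL]; omega) Den.skip).mono (by decide)
    set h4 := h3.setV .L (max l (n + F.anc) + 1) with hh4
    have fr4 := fr3.trans (FrameA.setV scanVars [.pc, .it, .pf, .pe] [.D] h3 (x := .L) (by decide)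
      (max l (n + F.anc) + 1))
    have er4 : h4.v .rank = F.rank := by simp [hh4, hh3]
    have eu4 : h4.v .u = h.v .u := by simp [hh4, hh3, hh0]
    have eD4 : h4.a .D = h.a .D := by simp [hh4, hh3, hh0]
    have ewd : max (max l (n + F.anc)) (maxWidth f as) = N := by
      rw [max_assoc]; exact hN
    have hm := Nat.mod_lt (h.v .u) r0
    have pre : ∀ {T : ℕ} {h5 : Mem}, Den E (ifE (ltE 1 (var .rank))
        (.seq (pushE .D (var .u % var .rank)) (asg .u (var .u / var .rank))) .skip) h4 T h5 →
        T ≤ 100 → Den E scanCode h0 150 h5 := fun d5 hT =>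
      (Den.ifE_pos (by decide) (fun _ => by simp [hh0, Item.toTree, Tree.word]; omega)
        (by simp [hh0, Item.toTree, Tree.word]) (d1.seq (d2.seq (d3.seq (d4.seq d5))))).mono (by
          simp only [AExp.cost, show (eqE (word .it) 4).cost = 3 from rfl]; omega)
    simp only [digits, radices, ← hF] at dig space
    by_cases h1 : 1 < F.rank
    · rw [if_pos h1] at dig space
      rw [cells_cons] at space
      have hs := Nat.size_le_size hm.le
      have d5 := Den.pushE (E := E) (h := h4) (s := .D) (e := var .u % var .rank)
        (v := h.v .u % F.rank) (by decide) (fun _ => by simp) (by simp [er4, eu4])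
        (fun hg => hg.setD (by
          rw [cells_append, cells_cons, eD4, show cells [] = 0 from rfl]; omega) (by
          intro v hv
          rcases List.mem_append.1 hv with hv | hv
          · rw [eD4] at hv; exact cellD v hv
          · rw [List.mem_singleton] at hv; omega))
      have d6 := Den.asg (E := E) (h := h4.setA .D (h4.a .D ++ [h.v .u % F.rank])) (x := .u)
        (e := var .u / var .rank) (v := h.v .u / F.rank) (by decide) (fun _ => by simp)
        (by simp [er4, eu4])
      refine ⟨_, pre (Den.ifE_pos (by decide) (fun _ => by simp; omega)
        (by simp [er4, h1]) (d5.seq d6)) (by decide), by simp [hh4, hh3, hh0], fits.tail,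
        ((((frame.trans fr4).trans (FrameA.setA _ _ _ _ (by decide) _)).trans
          (FrameA.setV _ _ _ _ (by decide) _)).trans (pcf _ _)), ?_, ?_, ?_, max l (n + F.anc),
        by simp [hh4], ewd⟩
      · simp only [Mem.setP_a, Mem.setV_a, Mem.setA_a, if_true, eD4]
        intro v hv
        rcases List.mem_append.1 hv with hv | hv
        · exact cellD v hv
        · rw [List.mem_singleton] at hv; omega
      · simp only [Mem.setP_a, Mem.setV_a, Mem.setA_a, if_true, eD4]
        rw [cells_append, cells_cons, show cells [] = 0 from rfl]; omega
      · simp only [Mem.setP_a, Mem.setV_a, Mem.setA_a, if_true, eD4, Mem.setP_v, Mem.setV_v]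
        rw [List.append_assoc]; exact dig
    · rw [if_neg h1] at dig space
      have hr1 : F.rank = 1 := by omega
      rw [hr1, Nat.div_one] at dig
      refine ⟨_, pre (Den.ifE_neg (by decide) (fun _ => by simp; omega)
        (by simp [er4, h1]) Den.skip) (by decide), by simp [hh4, hh3, hh0], fits.tail,
        (frame.trans fr4).trans (pcf _ _), ?_, ?_, ?_, max l (n + F.anc), by simp [hh4], ewd⟩
      · simp only [Mem.setP_a, eD4]; exact cellD
      · simp only [Mem.setP_a, eD4]; exact space
      · simp only [Mem.setP_a, eD4, Mem.setP_v, eu4]; exact dig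

/-- Appends `LL` zeros to an array. -/
def extendCode (s : Arr) : Code arch := forE .i (var .LL) (pushE s 0)

theorem extendCode_den {s : Arr} {m : ℕ} (hs : s ≠ .D) (h0 : h.a s = []) (hi : h.v .i = 0)
    (hL : h.v .LL = m) (hV : m ≤ E.V) (hm : m ≤ E.len) :
    Den E (extendCode s) h (14 * m + 9) (h.setA s (List.replicate m 0)) := by
  have hz : h.setA s (List.replicate 0 0) = h := by
    rw [List.replicate_zero, ← h0, Mem.setA_self]
  have h1 := Den.forE (E := E) (x := .i) (e := var .LL) (c := pushE s 0) (T := 2)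
    (fun k => h.setA s (List.replicate k 0)) m (by decide) hV
    (fun _ _ _ => trivial) (fun i _ => by simp [hL]) (by simpa using hi) (by simpa using hi)
    (fun k hk => by
      have := Den.pushE (E := E) (h := (h.setA s (List.replicate k 0)).setV .i k) (s := s) (e := 0)
        (v := 0) (by decide) (fun _ => by simp) rfl (fun hg => hg.setA hs (by simp; omega) (by
          intro v hv
          rcases List.mem_append.1 hv with hv | hv
          · simp only [Mem.setV_a, Mem.setA_a, if_true] at hv
            rw [List.eq_of_mem_replicate hv]; omega
          · rw [List.mem_singleton] at hv; omega))
      rw [Mem.setV_setA, Mem.setA_setA] at this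
      simp only [Mem.setV_a, Mem.setA_a, if_true, ← List.replicate_succ'] at this
      exact this)
  rw [hz] at h1
  exact h1.mono (by rw [show (var .LL).cost = 2 from rfl]; omega)

/-- The bits of `x`, followed by zeros. -/
def padded (x : Fin n → Bool) (i : ℕ) : Bool := if hi : i < n then x ⟨i, hi⟩ else false

structure OutcomeInv (x : Fin n → Bool) (N : ℕ) (h₀ : Mem) (as : List Bool) (h : Mem) : Prop where
  frame : FrameA [.k] [.pl, .pg] [.X] h₀ h
  base : Base N h
  ex : ∃ k, h.v .k = k ∧ as = (List.ofFn x).drop k ∧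
    ∀ j ≤ N, (h.a .X)[j]? = some (if j < k then (padded x j).toNat else 0)

def outcomeCode : Code arch := .seq (put .X (var .k) (word .pg)) (asg .k (var .k + 1))

theorem outcomeCode_tri {x : Fin n → Bool} {h₀ : Mem} {b : Bool} {as : List Bool} (hnN : n ≤ N)
    (hE : (N + 1) * (N + 1) + 100 ≤ E.V) (H : OutcomeInv x N h₀ (b :: as) h) :
    Tri E outcomeCode (h.setP .pg (.leaf b.toNat)) 10 (fun h' => h'.p .pl = h.p .pl ∧
      OutcomeInv x N h₀ as (h'.setP .pl (.ofList (as.map fun b => .leaf b.toNat)))) := by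
  obtain ⟨fr, base, k, hk, has, hX⟩ := H
  have hN := le_sq (N := N)
  have hkn : k < n := by
    have := congrArg List.length has
    simp at this; omega
  have hb : b = padded x k := by
    have := congrArg List.head? has
    simp [List.head?_drop, hkn] at this
    rw [this, padded, dif_pos hkn]
  have has' : as = (List.ofFn x).drop (k + 1) := by
    have := congrArg List.tail has
    simpa using this
  have hb1 : b.toNat ≤ 1 := by cases b <;> simp
  set h0 := h.setP .pg (.leaf b.toNat) with hh0
  have hlen : (h.a .X).length = (N + 1) * (N + 1) := base.len .X (by decide)
  have d1 := Den.put (E := E) (h := h0) (s := .X) (e₁ := var .k) (e₂ := word .pg) (i := k)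
    (v := b.toNat) (by decide) (by decide) (fun _ => trivial)
    (fun _ => by simp [hh0, Tree.leaf, Tree.word]; omega) (by simp [hh0, hk])
    (by simp [hh0, Tree.leaf, Tree.word]) (by decide) (by omega) (by simp [hh0, hlen]; omega)
  have d2 := Den.asg (E := E) (h := h0.setA .X ((h0.a .X).set k b.toNat)) (x := .k)
    (e := var .k + 1) (v := k + 1) (by decide) (fun _ => by simp [hh0, hk]; omega)
    (by simp [hh0, hk])
  refine ((d1.seq d2).mono (by decide)).tri ⟨by simp [hh0], ⟨?_, ?_, k + 1, by simp, has', ?_⟩⟩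
  · exact (((fr.trans (FrameA.setP _ _ _ _ (by decide) _)).trans
      (FrameA.setA _ _ _ _ (by decide) _)).trans (FrameA.setV _ _ _ _ (by decide) _)).trans
      (FrameA.setP _ _ _ _ (by decide) _)
  · exact ((base.setP.setA (by simp [hh0, hlen])).setV (by decide)).setP
  · intro j hj
    simp only [Mem.setP_a, Mem.setV_a, Mem.setA_a, if_true, hh0]
    rw [List.getElem?_set]
    by_cases hkj : k = j
    · subst hkj
      simp [hlen, hb]; omega
    · rw [if_neg hkj, hX j hj]
      congr 1
      by_cases h1 : j < k
      · rw [if_pos h1, if_pos (by omega)]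
      · rw [if_neg h1, if_neg (by omega)]

/-- The circuit is scanned before the arrays are allocated, because the size of the matrices is
known only then. The last statement writes the constant coordinate 1 of the outcome vector. -/
def preludeCode : Code arch :=
  .seq (asg .n (word .px)) (.seq (asg .L (var .n + 1)) (.seq (asg .u (var .id))
  (.seq (link .pc .px 1) (.seq (each .pc .it scanCode) (.seq (asg .LL (var .L * var .L))
  (.seq (extendCode .M) (.seq (extendCode .B) (.seq (extendCode .Z) (.seq (extendCode .W)
  (.seq (extendCode .X) (.seq (link .pl .px 0) (.seq (asg .k 0) (.seq (each .pl .pg outcomeCode)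
  (put .X (var .L - 1) 1))))))))))))))

def preludeVars : List Var := [.n, .L, .LL, .u, .rank, .k]

theorem preludeTime_le {S c n : ℕ} (hn : n + 1 ≤ S) :
    1 + 2 + (2 + (1 + 1) + 2 + (2 + 2 + (1 + 1 + (c * (150 + 6) + 2 + (2 + (2 + 1) + 2 +
      (14 * S + 9 + (14 * S + 9 + (14 * S + 9 + (14 * S + 9 + (14 * S + 9 +
      (1 + 1 + (1 + 2 + (n * (10 + 6) + 2 + (4 + (1 + 1))))))))))))))) ≤
    500 * S * (1 + c) := by
  have h1 : c ≤ S * c := Nat.le_mul_of_pos_left _ (by omega)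
  rw [show 500 * S * (1 + c) = 500 * S + 500 * (S * c) by ring]
  omega

theorem preludeCode_tri {f : Unitary n → Impl n} {C : Circuit n} {x : Fin n → Bool} {id : ℕ}
    (hN : N = max n (maxWidth f C)) (fits : Fits E f N C)
    (hD : cells (radices f C) ≤ E.spD) (hlen : (N + 1) * (N + 1) ≤ E.len)
    (hid : h.v .id = id) (hi : h.v .i = 0) (hj : h.v .j = 0) (ha : ∀ s, h.a s = [])
    (hp : h.p .px = inputTree f C x) :
    Tri E preludeCode h (500 * ((N + 1) * (N + 1)) * (1 + C.length))
      (fun h' => Ready E f C (padded x) N id h' ∧ h'.c = h.c ∧ ∀ y, y ∉ preludeVars → h'.v y = h.v y) := by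
  have hS := fits.size
  have hV := E.hV
  have hN2 := le_sq (N := N)
  have hnN : n ≤ N := by omega
  have hnS : n + 1 ≤ (N + 1) * (N + 1) := by omega
  have wn : (inputTree f C x).word = n := rfl
  have d1 := Den.asg (E := E) (h := h) (x := .n) (e := word .px) (v := n) (by decide)
    (fun _ => by simp [hp, wn]; omega) (by simp [hp, wn])
  have d2 := Den.asg (E := E) (h := h.setV .n n) (x := .L) (e := var .n + 1) (v := n + 1) (by decide)
    (fun _ => by simp; omega) (by simp)
  have d3 := Den.asg (E := E) (h := (h.setV .n n).setV .L (n + 1)) (x := .u) (e := var .id)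
    (v := id) (by decide) (fun _ => trivial) (by simp [hid])
  have d4 := Den.link (E := E) (h := ((h.setV .n n).setV .L (n + 1)).setV .u id) (p := .pc)
    (q := .px) (e := 1) (i := 1) (t := .ofList (C.map (Item.toTree f))) (by decide)
    (fun _ => by simp; omega) rfl (by simp [hp]; rfl)
  set h4 := (((h.setV .n n).setV .L (n + 1)).setV .u id).setP .pc (.ofList (C.map (Item.toTree f)))
    with hh4
  let ps : List Ptr := [.pc, .it, .pf, .pe, .pl, .pg]
  let ss : List Arr := [.M, .B, .Z, .W, .X, .D]
  have f4 : FrameA preludeVars ps ss h h4 := (((FrameA.setV _ _ _ _ (by decide) _).trans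
    (FrameA.setV _ _ _ _ (by decide) _)).trans (FrameA.setV _ _ _ _ (by decide) _)).trans
    (FrameA.setP _ _ _ _ (by decide) _)
  have n4 : h4.v .n = n := by simp [hh4]
  obtain ⟨h5, d5, -, f5, -, -, dig5, l, L5, N5⟩ := each_tri (E := E) (Item.toTree f) (p := .it)
    (l := .pc) (c := scanCode) (fun _ => 150) (ScanInv E f C N id h4)
    (fun a as h1 hi _ => (scanCode_tri n4 hi).mono le_rfl fun h' a => a) C h4
    ⟨fits, FrameA.refl _ _ _ _, by simp [hh4, ha], by simpa [hh4, ha, cells] using hD,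
      by simp [hh4, ha], n, by simp [hh4], hN.symm⟩ (by simp [hh4])
  have lN : l = N := by simpa [maxWidth] using N5
  rw [lN] at L5
  have f5' : FrameA preludeVars ps ss h h5 := f4.trans (f5.mono (by decide) (by decide) (by decide))
  have d6 := Den.asg (E := E) (h := h5) (x := .LL) (e := var .L * var .L)
    (v := (N + 1) * (N + 1)) (by decide) (fun _ => by simp [L5]; omega) (by simp [L5])
  set h6 := h5.setV .LL ((N + 1) * (N + 1)) with hh6
  have a6 : ∀ s, s ≠ .D → h6.a s = [] := fun s hs => by
    rw [hh6, Mem.setV_a, f5.a s (by simpa using hs)]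
    exact ha s
  have i6 : h6.v .i = 0 := by simp [hh6, f5'.v .i (by decide), hi]
  have j6 : h6.v .j = 0 := by simp [hh6, f5'.v .j (by decide), hj]
  set z := List.replicate ((N + 1) * (N + 1)) 0 with hz
  have ext : ∀ {s : Arr} {h' : Mem}, s ≠ .D → h'.a s = [] → h'.v .i = 0 →
      h'.v .LL = (N + 1) * (N + 1) → Den E (extendCode s) h' (14 * ((N + 1) * (N + 1)) + 9)
        (h'.setA s z) := fun hs h1 h2 h3 => extendCode_den hs h1 h2 h3 (by omega) hlen
  have L6 : h6.v .LL = (N + 1) * (N + 1) := by simp [hh6]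
  have e1 := ext (s := .M) (h' := h6) (by decide) (a6 _ (by decide)) i6 L6
  have e2 := ext (s := .B) (h' := h6.setA .M z) (by decide) (by simpa using a6 .B (by decide)) i6 L6
  have e3 := ext (s := .Z) (h' := (h6.setA .M z).setA .B z) (by decide)
    (by simpa using a6 .Z (by decide)) i6 L6
  have e4 := ext (s := .W) (h' := ((h6.setA .M z).setA .B z).setA .Z z) (by decide)
    (by simpa using a6 .W (by decide)) i6 L6
  have e5 := ext (s := .X) (h' := (((h6.setA .M z).setA .B z).setA .Z z).setA .W z) (by decide)
    (by simpa using a6 .X (by decide)) i6 L6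
  set h7 := ((((h6.setA .M z).setA .B z).setA .Z z).setA .W z).setA .X z with hh7
  have f7 : FrameA preludeVars ps ss h h7 :=
    ((((((f5'.trans (FrameA.setV _ _ _ _ (by decide) _)).trans (FrameA.setA _ _ _ _ (by decide) _)).trans
      (FrameA.setA _ _ _ _ (by decide) _)).trans (FrameA.setA _ _ _ _ (by decide) _)).trans
      (FrameA.setA _ _ _ _ (by decide) _)).trans (FrameA.setA _ _ _ _ (by decide) _))
  have d8 := Den.link (E := E) (h := h7) (p := .pl) (q := .px) (e := 0) (i := 0)
    (t := .ofList (List.ofFn fun i => .leaf (x i).toNat)) (by decide)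
    (fun _ => by simp) rfl (by rw [f7.p _ (by decide), hp]; rfl)
  set h8 := h7.setP .pl (.ofList (List.ofFn fun i => .leaf (x i).toNat)) with hh8
  have d9 := Den.asg (E := E) (h := h8) (x := .k) (e := 0) (v := 0) (by decide)
    (fun _ => by simp) rfl
  set h9 := h8.setV .k 0 with hh9
  have b9 : Base N h9 := by
    refine ⟨?_, ?_, ?_, ?_, ?_⟩
    · simp [hh9, hh8, hh7, hh6, L5]
    · simp [hh9, hh8, hh7, hh6]
    · simpa [hh9, hh8, hh7] using i6
    · simpa [hh9, hh8, hh7] using j6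
    · intro s hs
      cases s <;> first | exact absurd rfl hs | simp [hh9, hh8, hh7, hz]
  have D9 : h9.a .D = digits f C id := by
    have : h9.a .D = h5.a .D := by simp [hh9, hh8, hh7, hh6]
    rw [this, ← dig5]
    simp [digits]
  have f9 : FrameA preludeVars ps ss h h9 :=
    (f7.trans (FrameA.setP _ _ _ _ (by decide) _)).trans (FrameA.setV _ _ _ _ (by decide) _)
  obtain ⟨h10, d10, f10, b10, k, hk, hdrop, hX⟩ := each_tri (E := E) (fun b : Bool => Tree.leaf b.toNat)
    (p := .pg) (l := .pl) (c := outcomeCode) (fun _ => 10) (OutcomeInv x N h9)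
    (fun a as h1 hi _ => (outcomeCode_tri hnN hS hi).mono le_rfl fun h' a => a) (List.ofFn x) h9
    ⟨FrameA.refl _ _ _ _, b9, 0, by simp [hh9], by simp, fun j hj => by
      have := flat_lt (N := N) (Nat.zero_le _) hj
      rw [zero_mul, zero_add] at this
      simp [hh9, hh8, hh7, hz, this]⟩
    (by simp [hh9, hh8, List.map_ofFn, Function.comp_def])
  have hkn : n ≤ k := by
    have := congrArg List.length hdrop
    simp at this; omega
  have f10' := f9.trans (f10.mono (xs' := preludeVars) (ps' := ps) (ss' := ss) (by decide) (by decide)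
    (by decide))
  have lX := b10.len .X (by decide)
  have d11 := Den.put (E := E) (h := h10) (s := .X) (e₁ := var .L - 1) (e₂ := 1) (i := N)
    (v := 1) (by decide) (by decide) (fun _ => by simp; omega)
    (fun _ => by simp; omega) (by simp [b10.L]) rfl (by decide) (by omega) (by omega)
  refine ((d1.seq (d2.seq (d3.seq (d4.seq (d5.seq (d6.seq (e1.seq (e2.seq (e3.seq (e4.seq (e5.seq
    (d8.seq (d9.seq (d10.seq d11)))))))))))))).mono ?_).tri ⟨⟨?_, ?_, ?_, ?_, ?_⟩, ?_, ?_⟩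
  · simp only [List.map_const', List.sum_replicate, smul_eq_mul, List.length_ofFn, AExp.cost,
      show (var .L - 1).cost = 4 from rfl]
    exact preludeTime_le hnS
  · exact b10.setA (by simpa using lX)
  · rw [Mem.setA_v, f10.v _ (by decide)]; simpa [hh9, hh8, hh7, hh6, f5.v .n (by decide)] using n4
  · intro j hj
    simp only [Mem.setA_a, if_true]
    rw [List.getElem?_set]
    by_cases hjN : N = j
    · subst hjN; rw [if_pos rfl, if_pos (by omega), ext_last]
    · rw [if_neg hjN, hX j hj, ext_lt (by omega)]
      congr 1
      by_cases h1 : j < k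
      · rw [if_pos h1]
      · rw [if_neg h1, padded, dif_neg (by omega)]; rfl
  · rw [Mem.setA_a, if_neg (by decide), f10.a _ (by decide), D9]
  · rw [Mem.setA_p, f10'.p _ (by decide), hp]; rfl
  · rw [Mem.setA_c, f10'.c]
  · intro y hy
    rw [Mem.setA_v, f10'.v y hy]

end QSim

namespace QSim

open AExp (var get ltE eqE word arity)

variable {E : Env} {h h' h₁ h₂ : Mem} {n N : ℕ}

/-! ## The programs -/

/-- The initial memory. -/
noncomputable def Mem.init (inp : Tree) (id P : ℕ) : Mem where
  v x := if x = .id then id else if x = .P then P else 0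
  a _ := []
  p _ := inp
  c _ := 0

theorem Rel.init {inp : Tree} {id P : ℕ} (hid : id ≤ E.V) (hP : P ≤ E.V) :
    Rel E (Mem.init inp id P) (Store.init arch inp id P) where
  reg x := by cases x <;> rfl
  le r := by simp only [Store.init]; split <;> [exact hid; (split <;> [exact hP; exact Nat.zero_le _])]
  arr _ := rfl
  ptr _ := rfl
  creg _ := rfl
  good :=
    { v := fun x => by
        simp only [Mem.init]; split <;> [exact hid; (split <;> [exact hP; exact Nat.zero_le _])]
      len := fun _ _ => Nat.zero_le _
      cell := fun _ _ v hv => by simp [Mem.init] at hv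
      spD := Nat.zero_le _
      cellD := fun v hv => by simp [Mem.init] at hv }

/-- `out := |acc|²` -/
def outCode : Code arch :=
  .seq (.instr (.cconj CReg.out.idx CReg.acc.idx))
    (.instr (.cmul CReg.out.idx CReg.acc.idx CReg.out.idx))

theorem outCode_tri : Tri E outCode h 2 (fun h' => h'.c .out = ((‖h.c .acc‖ ^ 2 : ℝ) : ℂ)) := by
  refine ((Den.cconj (z := .out) (u := .acc)).seq (Den.cmul (z := .out) (u := .acc) (v := .out))).tri ?_
  simp [Complex.mul_conj, Complex.normSq_eq_norm_sq]

/-- The requirements on the memory. -/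
structure Suits (E : Env) (f : Unitary n → Impl n) (N : ℕ) (C : Circuit n) : Prop
    extends Fits E f N C where
  width : N = max n (maxWidth f C)
  cells : cells (radices f C) ≤ E.spD
  num : (radices f C).length + 1 ≤ E.V
  len : (N + 1) * (N + 1) ≤ E.len

def loopCode : Code arch := whileE (var .go) (.seq termCode (asg .go (1 - var .carry)))

/-- The amplitude of the term number `id`. -/
noncomputable def amplitude (f : Unitary n → Impl n) (C : Circuit n) (N : ℕ) (x : ℕ → Bool) (id : ℕ) : ℂ :=
  term f C id (zeroState N) x

def termTime (f : Unitary n → Impl n) (C : Circuit n) (N : ℕ) : ℕ :=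
  55000 * ((N + 1) * (N + 1)) * (1 + (C.length + C.highGates.length * C.mu f))

theorem gates_le_mu {f : Unitary n → Impl n} {C : Circuit n} :
    ∀ U ∈ C.highGates, (f U).gates ≤ C.mu f := by
  unfold Circuit.mu
  generalize C.highGates = l
  induction l with
  | nil => simp
  | cons a l ih =>
    intro U hU
    rw [List.map_cons, List.foldr_cons]
    rcases List.mem_cons.1 hU with rfl | hU
    · exact le_max_left _ _
    · exact (ih U hU).trans (le_max_right _ _)

/-- Here `d` counts the terms after the current one. The number `id` may be too large for a word: it
exists only as digits in `D`, and the loop is ended by the carry instead of a comparison with `χ`.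
-/
theorem loopCode_tri {f : Unitary n → Impl n} {C : Circuit n} {x : ℕ → Bool} (H : Suits E f N C)
    (d : ℕ) : ∀ {id : ℕ} {h : Mem}, id + d + 1 = C.chi f → Ready E f C x N id h → h.v .go = 1 →
    h.c .acc = ∑ j ∈ Finset.range id, amplitude f C N x j →
    Tri E loopCode h ((d + 1) * (termTime f C N + 10) + 3)
      (fun h' => h'.c .acc = ∑ j ∈ Finset.range (C.chi f), amplitude f C N x j) := by
  have hV := E.hV
  have hnN : n ≤ N := by have := H.width; omega
  induction d with
  | zero =>
    intro id h hid R hgo hacc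
    obtain ⟨h1, d1, R1, hc, hc1, ha, -⟩ := termCode_tri hnN H.toFits H.cells H.num gates_le_mu
      (by omega) R
    have d2 := Den.asg (E := E) (h := h1) (x := .go) (e := 1 - var .carry) (v := 0)
      (by decide) (fun _ => by simp; omega) (by
        have := hc.2 hid
        simp; omega)
    refine ((Den.while_step (e := var .go) (by decide) (fun _ => trivial) (by simp [hgo]) (d1.seq d2)
      (Den.while_stop (e := var .go) (by decide) (fun _ => trivial) (by simp))).mono ?_).tri ?_
    · simp only [AExp.cost, show (1 - var .carry).cost = 4 from rfl, termTime]; omega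
    · rw [Mem.setV_c, ha, hacc, ← hid, Finset.sum_range_succ]; rfl
  | succ d ih =>
    intro id h hid R hgo hacc
    obtain ⟨h1, d1, R1, hc, hc1, ha, -⟩ := termCode_tri hnN H.toFits H.cells H.num gates_le_mu
      (by omega) R
    have hc0 : h1.v .carry = 0 := by
      by_contra hne
      have := hc.1 hne
      omega
    have d2 := Den.asg (E := E) (h := h1) (x := .go) (e := 1 - var .carry) (v := 1)
      (by decide) (fun _ => by simp; omega) (by simp [hc0])
    obtain ⟨h3, d3, a3⟩ := ih (id := id + 1) (h := h1.setV .go 1) (by omega)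
      ⟨R1.base.setV (by decide), by simpa using R1.n, R1.X, R1.D, R1.px⟩ (by simp)
      (by rw [Mem.setV_c, ha, hacc, Finset.sum_range_succ]; rfl)
    refine ((Den.while_step (e := var .go) (by decide) (fun _ => trivial) (by simp [hgo]) (d1.seq d2) d3).mono
      ?_).tri a3
    rw [Nat.add_mul (d + 1) 1]
    simp only [AExp.cost, show (1 - var .carry).cost = 4 from rfl, termTime]; omega

def seqProg : Code arch :=
  .seq preludeCode (.seq (asg .go 1) (.seq loopCode outCode))

def preludeTime (C : Circuit n) (N : ℕ) : ℕ := 500 * ((N + 1) * (N + 1)) * (1 + C.length)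

theorem seqProg_tri {f : Unitary n → Impl n} {C : Circuit n} {x : Fin n → Bool} (H : Suits E f N C)
    (hchi : 0 < C.chi f) :
    Tri E seqProg (Mem.init (inputTree f C x) 0 1)
      (preludeTime C N + C.chi f * (termTime f C N + 10) + 10)
      (fun h' => h'.c .out =
        ((‖∑ j ∈ Finset.range (C.chi f), amplitude f C N (padded x) j‖ ^ 2 : ℝ) : ℂ)) := by
  have hV := E.hV
  obtain ⟨h1, d1, R1, c1, -⟩ := preludeCode_tri (E := E) (h := Mem.init (inputTree f C x) 0 1)
    (id := 0) H.width H.toFits H.cells H.len rfl rfl rfl (fun _ => rfl) rfl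
  have d2 := Den.asg (E := E) (h := h1) (x := .go) (e := 1) (v := 1)
      (by decide) (fun _ => by simp; omega) rfl
  obtain ⟨h3, d3, a3⟩ := loopCode_tri (E := E) (x := padded x) H (C.chi f - 1) (id := 0)
    (h := h1.setV .go 1) (by omega)
    ⟨R1.base.setV (by decide), by simpa using R1.n, R1.X, R1.D, R1.px⟩ (by simp)
    (by rw [Mem.setV_c, c1]; rfl)
  obtain ⟨h4, d4, a4⟩ := outCode_tri (E := E) (h := h3)
  refine ((d1.seq (d2.seq (d3.seq d4))).mono ?_).tri ?_
  · rw [Nat.sub_add_cancel hchi]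
    simp only [show (1 : AExp).cost = 1 from rfl, preludeTime]
    omega
  · rw [a4, a3]

/-! ## The parallel program -/

/-- Only the common time bound matters, as the slowest thread determines the time. -/
theorem par_compute {P T : ℕ} {c : Code arch} {σ : Fin P → Store arch} {hs : Fin P → Mem}
    {Q : Fin P → Mem → Prop} (hσ : ∀ i, Rel E (hs i) (σ i)) (H : ∀ i, Tri E c (hs i) T (Q i)) :
    ∃ (τ : Fin P → Store arch) (hs' : Fin P → Mem) (T' : ℕ), ParExec E.w E.inp (.compute c) σ τ T' ∧ T' ≤ T ∧ (∀ i, Rel E (hs' i) (τ i)) ∧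
      ∀ i, Q i (hs' i) := by
  choose hs' hd using H
  choose τ T' S e1 e2 e3 e4 using fun i => (hd i).1 (σ i) (hσ i)
  exact ⟨τ, hs', _, .compute c σ τ T' S e1, Finset.sup_le fun i _ => e2 i, e4, fun i => (hd i).2⟩

/-- The memory of thread `i`, when its sum covers `s` terms. -/
structure SumInv (P : ℕ) (g : ℕ → ℂ) (s i : ℕ) (h : Mem) : Prop where
  id : h.v .id = i
  num : h.v .P = P
  strd : h.v .strd = s
  go : h.v .go = if s < P then 1 else 0
  acc : h.c .acc = ∑ j ∈ Finset.range s, if i + j < P then g (i + j) else 0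

/-- `tmp` is set to 0 in advance: a thread without a partner receives nothing and then adds 0. -/
def sendCode : Code arch :=
  .seq (.instr (.cconst CReg.tmp.idx .zero)) (asg .src (var .id + var .strd))

def receiveCode : Code arch :=
  .seq (.instr (.cadd CReg.acc.idx CReg.acc.idx CReg.tmp.idx))
  (.seq (asg .strd (var .strd * 2)) (asg .go (ltE (var .strd) (var .P))))

def sumProg : Par arch :=
  .loop Var.go.reg (.seq (.compute sendCode)
    (.seq (.gather Var.src.reg CReg.tmp.idx CReg.acc.idx) (.compute receiveCode)))

/-- Thread `i` holds the sum of the values number `i` to `i + s - 1`, as far as they exist. Adding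
the sum of thread `i + s` doubles `s`, and thread 0 has everything once `s ≥ P`. All threads agree
on `s`, so control by thread 0 is enough. In a round that takes place, `i` and `s` are below `P`,
hence partner number and new stride are at most `2P`. -/
theorem sumProg_exec {P : ℕ} {g : ℕ → ℂ} (hP : 0 < P) (hPV : 2 * P ≤ E.V) (k : ℕ) :
    ∀ {s : ℕ} {σ : Fin P → Store arch} {hs : Fin P → Mem}, P ≤ s * 2 ^ k →
      (∀ i, Rel E (hs i) (σ i)) → (∀ i : Fin P, SumInv P g s i (hs i)) →
      ∃ (τ : Fin P → Store arch) (hs' : Fin P → Mem) (T' : ℕ), ParExec E.w E.inp sumProg σ τ T' ∧ T' ≤ 50 * k + 1 ∧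
        (∀ i, Rel E (hs' i) (τ i)) ∧ (hs' ⟨0, hP⟩).c .acc = ∑ j ∈ Finset.range P, g j := by
  have hV := E.hV
  have halted : ∀ {s : ℕ} {σ : Fin P → Store arch} {hs : Fin P → Mem}, P ≤ s →
      (∀ i, Rel E (hs i) (σ i)) → (∀ i : Fin P, SumInv P g s i (hs i)) →
      ∃ (τ : Fin P → Store arch) (hs' : Fin P → Mem) (T' : ℕ), ParExec E.w E.inp sumProg σ τ T' ∧ T' ≤ 1 ∧
        (∀ i, Rel E (hs' i) (τ i)) ∧ (hs' ⟨0, hP⟩).c .acc = ∑ j ∈ Finset.range P, g j := by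
    intro s σ hs hPs hσ hi
    refine ⟨σ, hs, 1, .loopStop _ _ _ hP ?_, le_rfl, hσ, ?_⟩
    · rw [(hσ _).reg, (hi _).go, if_neg (by omega)]
    · rw [(hi _).acc]
      simp only [zero_add]
      rw [← Finset.sum_filter]
      congr 1
      ext j
      simp only [Finset.mem_filter, Finset.mem_range]
      omega
  induction k with
  | zero =>
    intro s σ hs hPs hσ hi
    exact halted (by simpa using hPs) hσ hi
  | succ k ih =>
    intro s σ hs hPs hσ hi
    by_cases hsP : P ≤ s
    · obtain ⟨τ, hs', T', a, b, c⟩ := halted hsP hσ hi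
      exact ⟨τ, hs', T', a, by omega, c⟩
    obtain ⟨σ1, hs1, T1, e1, t1, r1, q1⟩ := par_compute (E := E) (c := sendCode) (T := 10) hσ
      (Q := fun i h' => h' = ((hs i).setC .tmp 0).setV .src (i + s)) (fun i => by
        have d1 := Den.cconst (E := E) (h := hs i) (z := .tmp) (k := .zero)
        have d2 := Den.asg (E := E) (h := (hs i).setC .tmp 0) (x := .src) (e := var .id + var .strd)
          (v := i + s) (by decide) (fun _ => by simp [(hi i).id, (hi i).strd]; omega)
          (by simp [(hi i).id, (hi i).strd])
        exact ((d1.seq d2).mono (by decide)).tri rfl)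
    have src1 : ∀ i, (σ1 i).reg Var.src.reg = i + s := fun i => by
      rw [(r1 i).reg, q1 i]; simp
    -- The accumulators are those from before the round, since sending does not change them; the
    -- default 0 is the value that `sendCode` has stored.
    set hs2 : Fin P → Mem := fun i => (hs1 i).setC .tmp
      (if hi : i + s < P then (hs ⟨i + s, hi⟩).c .acc else 0) with hhs2
    have r2 : ∀ i, Rel E (hs2 i) (gatherStore Var.src.reg CReg.tmp.idx CReg.acc.idx σ1 i) := by
      intro i
      simp only [gatherStore, src1, hhs2]
      by_cases his : i + s < P
      · rw [dif_pos his, dif_pos his]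
        have : (σ1 ⟨i + s, his⟩).creg CReg.acc.idx = (hs ⟨i + s, his⟩).c .acc := by
          rw [(r1 _).creg, q1]; simp
        rw [this]
        exact (r1 i).setC
      · rw [dif_neg his, dif_neg his]
        have : (hs1 i).setC .tmp 0 = hs1 i := by
          rw [q1 i]; simp [Mem.setC, Mem.setV]
        rw [this]
        exact r1 i
    obtain ⟨σ3, hs3, T3, e3, t3, r3, q3⟩ := par_compute (E := E) (c := receiveCode) (T := 30) r2
      (Q := fun i h' => SumInv P g (s * 2) i h') (fun i => by
        have d1 := Den.cadd (E := E) (h := hs2 i) (z := .acc) (u := .acc) (v := .tmp)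
        set m := (hs2 i).setC .acc ((hs2 i).c .acc + (hs2 i).c .tmp) with hm
        have vm : ∀ y, y ≠ .src → m.v y = (hs i).v y := fun y hy => by simp [hm, hhs2, q1 i, hy]
        have d2 := Den.asg (E := E) (h := m) (x := .strd) (e := var .strd * 2) (v := s * 2)
          (by decide) (fun _ => by simp [vm, (hi i).strd]; omega) (by simp [vm, (hi i).strd])
        have d3 := Den.asg (E := E) (h := m.setV .strd (s * 2)) (x := .go)
          (e := ltE (var .strd) (var .P)) (v := if s * 2 < P then 1 else 0) (by decide)
          (fun _ => by simp) (by simp [vm, (hi i).num])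
        refine ((d1.seq (d2.seq d3)).mono (by decide)).tri ⟨?_, ?_, ?_, ?_, ?_⟩
        · simp [vm, (hi i).id]
        · simp [vm, (hi i).num]
        · simp
        · simp
        · have e : m.c .acc = (hs i).c .acc +
              if hi : i + s < P then (hs ⟨i + s, hi⟩).c .acc else 0 := by
            simp [hm, hhs2, q1 i]
          rw [Mem.setV_c, Mem.setV_c, e, mul_two, Finset.sum_range_add, (hi i).acc]
          congr 1
          split
          · rename_i his
            rw [(hi _).acc]
            simp only [add_assoc]
          · symm
            refine Finset.sum_eq_zero fun j _ => if_neg (by omega))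
    obtain ⟨τ, hs', T', e4, t4, r4, q4⟩ := ih (s := s * 2) (by
      rw [pow_succ] at hPs
      calc P ≤ s * (2 ^ k * 2) := hPs
        _ = _ := by ring) r3 q3
    refine ⟨τ, hs', _, .loopStep _ _ _ _ _ _ _ hP ?_ (.seq _ _ _ _ _ _ _ e1
      (.seq _ _ _ _ _ _ _ (.gather _ _ _ _) e3)) e4, by omega, r4, q4⟩
    rw [(hσ _).reg, (hi _).go, if_pos (by omega)]
    exact one_ne_zero

def parProg : Par arch :=
  .seq (.compute (.seq preludeCode (.seq termCode
    (.seq (asg .strd 1) (asg .go (ltE 1 (var .P)))))))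
  (.seq sumProg (.compute outCode))

/-- The same code for one term is used as in the sequential program, once per thread; the successor
of its number that it leaves in `D` plays no role. Since `χ < 2 ^ (log χ + 1)`, the doubling needs
at most `log χ + 1` rounds. -/
theorem parProg_computes {f : Unitary n → Impl n} {C : Circuit n} {x : Fin n → Bool}
    (H : Suits E f N C) (hinp : E.inp = inputTree f C x) (hchi : 0 < C.chi f)
    (hPV : 2 * C.chi f ≤ E.V) :
    ParComputes parProg (C.chi f) E.w (inputTree f C x)
      ((‖∑ j ∈ Finset.range (C.chi f), amplitude f C N (padded x) j‖ ^ 2 : ℝ) : ℂ)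
      (preludeTime C N + termTime f C N + 50 * Nat.log 2 (C.chi f) + 100) := by
  have hV := E.hV
  have hnN : n ≤ N := by have := H.width; omega
  set P := C.chi f with hP
  have r0 : ∀ i : Fin P, Rel E (Mem.init (inputTree f C x) i P) (Store.init arch (inputTree f C x) i P) :=
    fun i => Rel.init (by omega) (by omega)
  obtain ⟨σ1, hs1, T1, e1, t1, r1, q1⟩ := par_compute (E := E) (T := preludeTime C N + termTime f C N + 10)
    (c := .seq preludeCode (.seq termCode (.seq (asg .strd 1) (asg .go (ltE 1 (var .P)))))) r0
    (Q := fun i h' => SumInv P (amplitude f C N (padded x)) 1 i h') (fun i => by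
      obtain ⟨h1, d1, R1, c1, v1⟩ := preludeCode_tri (E := E) (h := Mem.init (inputTree f C x) i P)
        (id := i) H.width H.toFits H.cells H.len rfl rfl rfl (fun _ => rfl) rfl
      obtain ⟨h2, d2, -, -, -, ha, v2⟩ := termCode_tri hnN H.toFits H.cells H.num gates_le_mu i.2 R1
      have d3 := Den.asg (E := E) (h := h2) (x := .strd) (e := 1) (v := 1)
        (by decide) (fun _ => by simp; omega) rfl
      have vP : h2.v .P = P := by rw [v2 _ (by decide), v1 _ (by decide)]; rfl
      have vid : h2.v .id = i := by rw [v2 _ (by decide), v1 _ (by decide)]; rfl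
      have d4 := Den.asg (E := E) (h := h2.setV .strd 1) (x := .go) (e := ltE 1 (var .P))
        (v := if 1 < P then 1 else 0)
        (by decide) (fun _ => by simp; omega) (by simp [vP])
      refine ((d1.seq (d2.seq (d3.seq d4))).mono ?_).tri ⟨?_, ?_, ?_, ?_, ?_⟩
      · simp only [show (1 : AExp).cost = 1 from rfl, show (ltE 1 (var .P)).cost = 4 from rfl,
          preludeTime, termTime]
        omega
      · simp [vid]
      · simp [vP]
      · simp
      · simp
      · simp only [Mem.setV_c, ha, c1, Finset.sum_range_one, add_zero, if_pos i.2]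
        exact zero_add _)
  obtain ⟨σ2, hs2, T2, e2, t2, r2, q2⟩ := sumProg_exec (E := E) hchi hPV (Nat.log 2 P + 1) (s := 1)
    (by rw [one_mul]; exact (Nat.lt_pow_succ_log_self (by decide) P).le) r1 q1
  obtain ⟨σ3, hs3, T3, e3, t3, r3, q3⟩ := par_compute (E := E) (T := 2) (c := outCode) r2
    (fun i => outCode_tri)
  rw [hinp] at e1 e2 e3
  refine ⟨hchi, σ3, _, .seq _ _ _ _ _ _ _ e1 (.seq _ _ _ _ _ _ _ e2 e3), ?_, by omega⟩
  have := (r3 ⟨0, hchi⟩).creg .out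
  rw [← q2, ← q3]
  exact this

end QSim

namespace QSim

/-! ## The size of the input -/

theorem Tree.size_pos (t : Tree) : 1 ≤ t.size := by
  cases t; simp only [Tree.size]; omega

theorem Tree.size_child {t t' : Tree} {i : ℕ} (h : t.child i = some t') : t'.size < t.size := by
  cases t with
  | node a c k kids =>
    simp only [Tree.child] at h
    split at h
    · rename_i hi
      rw [← Option.some.inj h, Tree.size]
      have := Finset.single_le_sum (f := fun i => (kids i).size) (fun _ _ => Nat.zero_le _)
        (Finset.mem_univ (⟨i, hi⟩ : Fin k))
      omega
    · exact absurd h (by simp)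

theorem Tree.size_ofList (l : List Tree) :
    l.length ≤ (Tree.ofList l).size ∧ ∀ t ∈ l, t.size ≤ (Tree.ofList l).size := by
  induction l with
  | nil => simp
  | cons a l ih =>
    have e : (Tree.ofList (a :: l)).size = 1 + (a.size + (Tree.ofList l).size) := by
      simp [Tree.ofList, Tree.size, Fin.sum_univ_two]
    rw [e]
    refine ⟨by rw [List.length_cons]; omega, fun t ht => ?_⟩
    rcases List.mem_cons.1 ht with rfl | ht
    · omega
    · have := ih.2 t ht; omega

theorem Impl.rank_le_size {n : ℕ} (F : Impl n) : F.rank ≤ F.toTree.size := by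
  set tr : Tree := .node 0 0 F.rank (fun j =>
    .node 0 (F.coeff j) 1 ![StabCircuit.toTree (fun i : Fin F.anc => n + (i : ℕ)) (F.prep j)])
    with htr
  have h1 : tr.size < F.toTree.size := Tree.size_child (i := 1) rfl
  have h2 : F.rank ≤ tr.size := by
    have := Finset.card_nsmul_le_sum (Finset.univ : Finset (Fin F.rank)) (fun j => (Tree.node 0
      (F.coeff j) 1 ![StabCircuit.toTree (fun i : Fin F.anc => n + (i : ℕ)) (F.prep j)]).size) 1
      (fun j _ => Tree.size_pos _)
    simp only [Finset.card_univ, Fintype.card_fin, smul_eq_mul, mul_one] at this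
    rw [htr, Tree.size]
    omega
  omega

variable {n : ℕ} {f : Unitary n → Impl n} {C : Circuit n} {x : Fin n → Bool}

/-- The number of qubits, of gates, and each rank are at most the number of records. Words that are
polynomial in these quantities thus have logarithmic length in the size of the input. -/
theorem le_size_inputTree :
    n ≤ (inputTree f C x).size ∧ C.length ≤ (inputTree f C x).size ∧
      ∀ U ∈ C.highGates, (f U).rank ≤ (inputTree f C x).size := by
  have h0 : (Tree.ofList (List.ofFn fun i => Tree.leaf (x i).toNat)).size < (inputTree f C x).size :=
    Tree.size_child (i := 0) rfl
  have h1 : (Tree.ofList (C.map (Item.toTree f))).size < (inputTree f C x).size :=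
    Tree.size_child (i := 1) rfl
  have h2 := Tree.size_ofList (List.ofFn fun i => Tree.leaf (x i).toNat)
  have h3 := Tree.size_ofList (C.map (Item.toTree f))
  simp only [List.length_ofFn, List.length_map] at h2 h3
  refine ⟨by omega, by omega, fun U hU => ?_⟩
  obtain ⟨a, ha, hU⟩ := List.mem_filterMap.1 hU
  cases a with
  | stab g => exact absurd hU (by simp [Item.high?])
  | high V =>
    obtain rfl : V = U := by simpa [Item.high?] using hU
    have h4 := h3.2 _ (List.mem_map_of_mem ha)
    have h5 : (f V).toTree.size < (Item.toTree f (.high V)).size := Tree.size_child (i := 0) rfl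
    have := (f V).rank_le_size
    omega

/-! ## Bounds -/

theorem chi_pos (h : ∀ U ∈ C.highGates, 0 < (f U).rank) : 0 < C.chi f := by
  refine List.prod_pos fun r hr => ?_
  obtain ⟨U, hU, rfl⟩ := List.mem_map.1 hr
  exact h U hU

theorem rank_le_chi (h : ∀ U ∈ C.highGates, 0 < (f U).rank) :
    ∀ U ∈ C.highGates, (f U).rank ≤ C.chi f := fun _ hU =>
  Nat.le_of_dvd (chi_pos h) (List.dvd_prod (List.mem_map_of_mem hU))

theorem length_highGates_le (C : Circuit n) : C.highGates.length ≤ C.length :=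
  List.length_filterMap_le _ _

/-- A digit with radix `r ≥ 2` takes at most `1 + (log r + 1) ≤ 3 log r` bits, and rounded
logarithms are superadditive on products. Digits of rank 1 would take cells without increasing `χ`,
which is why they are left out. -/
theorem radices_bounds (h : ∀ U ∈ C.highGates, 0 < (f U).rank) :
    (radices f C).length ≤ C.length ∧ (radices f C).length ≤ Nat.log 2 (C.chi f) ∧
      cells (radices f C) ≤ 3 * Nat.log 2 (C.chi f) := by
  induction C with
  | nil => simp [radices, cells]
  | cons a C ih =>
    cases a with
    | stab g =>
      obtain ⟨i1, i2, i3⟩ := ih h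
      rw [chi_stab, List.length_cons]
      exact ⟨by simp only [radices]; omega, i2, i3⟩
    | high U =>
      have hC : ∀ V ∈ Circuit.highGates C, 0 < (f V).rank := fun V hV => h V (List.mem_cons_of_mem _ hV)
      obtain ⟨i1, i2, i3⟩ := ih hC
      have hr := h U List.mem_cons_self
      have hc := chi_pos hC
      rw [chi_high, List.length_cons, radices]
      split
      · rename_i h1
        have h2 : Nat.log 2 (f U).rank + Nat.log 2 (Circuit.chi C f) ≤
            Nat.log 2 ((f U).rank * Circuit.chi C f) := by
          refine Nat.le_log_of_pow_le (by decide) ?_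
          rw [pow_add]
          exact Nat.mul_le_mul (Nat.pow_log_le_self 2 (by omega)) (Nat.pow_log_le_self 2 (by omega))
        have h3 : 1 ≤ Nat.log 2 (f U).rank := Nat.le_log_of_pow_le (by decide) (by omega)
        have h4 : (f U).rank.size ≤ Nat.log 2 (f U).rank + 1 :=
          Nat.size_le.2 (Nat.lt_pow_succ_log_self (by decide) _)
        rw [cells_cons, List.length_cons]
        exact ⟨by omega, by omega, by omega⟩
      · obtain h1 : (f U).rank = 1 := by omega
        rw [h1, one_mul]
        exact ⟨by omega, i2, i3⟩

theorem log_chi_le {k : ℕ} (h : ∀ U ∈ C.highGates, (f U).rank ≤ 2 ^ k) :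
    Nat.log 2 (C.chi f) ≤ k * C.highGates.length := by
  have h1 : C.chi f ≤ 2 ^ (k * C.highGates.length) := by
    unfold Circuit.chi
    revert h
    generalize C.highGates = l
    intro h
    induction l with
    | nil => simp
    | cons U l ih =>
      rw [List.map_cons, List.prod_cons, List.length_cons, Nat.mul_succ, pow_add, mul_comm]
      exact Nat.mul_le_mul (ih fun V hV => h V (List.mem_cons_of_mem _ hV)) (h U List.mem_cons_self)
  calc Nat.log 2 (C.chi f) ≤ Nat.log 2 (2 ^ (k * C.highGates.length)) := Nat.log_mono_right h1
    _ = _ := Nat.log_pow (by decide) _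

/-- A polynomially bounded number fits into a word of logarithmic length. -/
theorem lt_two_pow_of_le {c X v w : ℕ} (hv : v ≤ c * X ^ 2) (hw : (c + 2) * (1 + Nat.log 2 X) ≤ w) :
    v < 2 ^ w := by
  have h1 : X < 2 ^ (1 + Nat.log 2 X) := by
    rw [add_comm]; exact Nat.lt_pow_succ_log_self (by decide) X
  set l := 1 + Nat.log 2 X with hl
  have h2 : c < 2 ^ (c * l) :=
    lt_of_lt_of_le Nat.lt_two_pow_self (Nat.pow_le_pow_right (by decide) (Nat.le_mul_of_pos_right _ (by omega)))
  have h3 : X ^ 2 ≤ 2 ^ (2 * l) := by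
    rw [mul_comm, pow_mul]; exact Nat.pow_le_pow_left h1.le 2
  calc v ≤ c * X ^ 2 := hv
    _ ≤ c * 2 ^ (2 * l) := Nat.mul_le_mul_left _ h3
    _ < 2 ^ (c * l) * 2 ^ (2 * l) := Nat.mul_lt_mul_of_pos_right h2 (by positivity)
    _ = 2 ^ ((c + 2) * l) := by rw [← pow_add]; ring_nf
    _ ≤ 2 ^ w := Nat.pow_le_pow_right (by decide) hw

/-- The largest rank of a gate. -/
def maxRank (f : Unitary n → Impl n) (C : Circuit n) : ℕ :=
  (C.highGates.map fun U => (f U).rank).foldr max 0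

theorem le_foldr_max {l : List ℕ} : ∀ v ∈ l, v ≤ l.foldr max 0 := by
  induction l with
  | nil => simp
  | cons a l ih =>
    intro v hv
    rcases List.mem_cons.1 hv with rfl | hv
    · exact le_max_left _ _
    · exact (ih v hv).trans (le_max_right _ _)

theorem foldr_max_le {l : List ℕ} {m : ℕ} (h : ∀ v ∈ l, v ≤ m) : l.foldr max 0 ≤ m := by
  induction l with
  | nil => exact Nat.zero_le _
  | cons a l ih =>
    exact max_le (h a List.mem_cons_self) (ih fun v hv => h v (List.mem_cons_of_mem _ hv))

/-- The bound for words; `Q` is the room needed for the numbers of threads. -/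
def wordBound (f : Unitary n → Impl n) (C : Circuit n) (N Q : ℕ) : ℕ :=
  (N + 1) * (N + 1) + 100 + maxRank f C + (radices f C).length + 2 * Q

theorem suits {E : Env} {N Q : ℕ} (hC : ∀ U ∈ C.highGates, 0 < (f U).rank)
    (hN : N = max n (maxWidth f C)) (hV : E.V = wordBound f C N Q)
    (hsp : E.spD = 3 * Nat.log 2 (C.chi f)) (hlen : E.len = (N + 1) * (N + 1)) :
    Suits E f N C where
  size := by rw [hV, wordBound]; omega
  gate U hU := by
    refine ⟨hC U hU, ?_, ?_⟩
    · have : (f U).rank ≤ maxRank f C := le_foldr_max _ (List.mem_map_of_mem hU)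
      rw [hV, wordBound]; omega
    · have := le_maxWidth (f := f) U hU
      omega
  width := hN
  cells := by rw [hsp]; exact (radices_bounds hC).2.2
  num := by rw [hV, wordBound]; omega
  len := hlen.ge

theorem prob_eq_sum {N : ℕ} (hnN : n ≤ N)
    (hC : ∀ U ∈ C.highGates, (f U).Implements U ∧ n + (f U).anc ≤ N) :
    ‖∑ j ∈ Finset.range (C.chi f), amplitude f C N (padded x) j‖ ^ 2 = C.prob x := by
  obtain ⟨θ, hθ⟩ := sum_term f C hC
  have h1 := congrFun (hθ (ket0 (Fin n))) (padded x)
  rw [Finset.sum_apply, emb_ket0 hnN] at h1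
  have h2 : emb n N (C.run (ket0 (Fin n))) (padded x) = C.run (ket0 (Fin n)) x := by
    rw [emb, if_pos fun i _ hi => by rw [padded, dif_neg (by omega)]]
    congr 1
    funext i
    rw [padded, dif_pos i.2]
  have h3 : ∑ j ∈ Finset.range (C.chi f), amplitude f C N (padded x) j =
      Complex.exp (θ * Complex.I) * C.run (ket0 (Fin n)) x := by
    rw [← h2]; exact h1
  rw [h3, norm_mul, Complex.norm_exp_ofReal_mul_I, one_mul]
  rfl

theorem seqProg_computes {E : Env} {N : ℕ} (H : Suits E f N C) (hinp : E.inp = inputTree f C x)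
    (hchi : 0 < C.chi f) :
    Computes seqProg E.w (inputTree f C x)
      ((‖∑ j ∈ Finset.range (C.chi f), amplitude f C N (padded x) j‖ ^ 2 : ℝ) : ℂ)
      (preludeTime C N + C.chi f * (termTime f C N + 10) + 10) E.space := by
  obtain ⟨h', d, q⟩ := seqProg_tri (x := x) H hchi
  obtain ⟨τ, T', S, e, t, s, r⟩ := d _ (Rel.init (Nat.zero_le _) (by have := E.hV; omega))
  rw [hinp] at e
  exact ⟨τ, T', S, e, by rw [← q]; exact r.creg .out, t, s⟩

theorem sq_width_le {A N : ℕ} (hn : 1 ≤ n) (hN : N ≤ (A + 1) * n) :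
    (N + 1) * (N + 1) ≤ (A + 2) ^ 2 * n ^ 2 := by
  have : N + 1 ≤ (A + 2) * n := by nlinarith
  calc (N + 1) * (N + 1) ≤ ((A + 2) * n) * ((A + 2) * n) := Nat.mul_le_mul this this
    _ = _ := by ring

/-- A bound linear in the matrix size and in `log χ` is enough, since only a fixed number of
registers is charged with it. Ranks are at most `χ`, and the other summands are exponentially below
the bound anyway. -/
theorem wordBound_size_le {N : ℕ} (h : ∀ U ∈ C.highGates, 0 < (f U).rank) :
    (wordBound f C N 0).size ≤ (N + 1) * (N + 1) + Nat.log 2 (C.chi f) + 102 := by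
  obtain ⟨-, hr, -⟩ := radices_bounds (f := f) h
  have hR : maxRank f C ≤ C.chi f := foldr_max_le fun v hv => by
    obtain ⟨U, hU, rfl⟩ := List.mem_map.1 hv
    exact rank_le_chi h U hU
  rw [Nat.size_le, wordBound]
  set l := Nat.log 2 (C.chi f) with hl
  set S := (N + 1) * (N + 1)
  have h1 : C.chi f < 2 ^ (l + 1) := Nat.lt_pow_succ_log_self (by decide) _
  have h2 : S + 100 + l < 2 ^ (S + 100 + l) := Nat.lt_two_pow_self
  have h3 : 2 ^ (l + 1) ≤ 2 ^ (S + 101 + l) := Nat.pow_le_pow_right (by decide) (by omega)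
  have h4 : 2 ^ (S + 100 + l) ≤ 2 ^ (S + 101 + l) := Nat.pow_le_pow_right (by decide) (by omega)
  have h5 : 2 ^ (S + l + 102) = 2 * 2 ^ (S + 101 + l) := by
    rw [← pow_succ']; congr 1; omega
  omega

/-- The matrix size is controlled by `A` and `n`, not by the size of the input: ancillas are given
by their number alone, and those without gates have no records. The thread count `Q` is bounded
separately by `X`. -/
theorem wordBound_le {A N Q X : ℕ} (hn : 1 ≤ n) (hN : N ≤ (A + 1) * n)
    (hX : (inputTree f C x).size ≤ X) (hQ : Q ≤ X) (h : ∀ U ∈ C.highGates, 0 < (f U).rank) :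
    wordBound f C N Q ≤ ((A + 2) ^ 2 + 104) * X ^ 2 := by
  obtain ⟨h1, h2, h3⟩ := le_size_inputTree (f := f) (C := C) (x := x)
  obtain ⟨hr, -, -⟩ := radices_bounds (f := f) h
  have hR : maxRank f C ≤ X := foldr_max_le fun v hv => by
    obtain ⟨U, hU, rfl⟩ := List.mem_map.1 hv
    exact (h3 U hU).trans hX
  have h4 := sq_width_le hn hN
  have h5 : n ^ 2 ≤ X ^ 2 := Nat.pow_le_pow_left (h1.trans hX) 2
  have h6 : X ≤ X ^ 2 := Nat.le_self_pow (by decide) X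
  have h7 : (A + 2) ^ 2 * n ^ 2 ≤ (A + 2) ^ 2 * X ^ 2 := Nat.mul_le_mul_left _ h5
  have h8 : ((A + 2) ^ 2 + 104) * X ^ 2 = (A + 2) ^ 2 * X ^ 2 + 104 * X ^ 2 := Nat.add_mul ..
  rw [wordBound, h8]
  omega

/-- The prelude runs once, but as `χ ≥ 1` it can be charged to every term. -/
theorem loop_le {c : ℕ} (hc : 0 < c) (p t : ℕ) : p + c * (t + 10) + 10 ≤ c * (p + t + 110) := by
  have h1 : p ≤ c * p := Nat.le_mul_of_pos_left _ hc
  have h2 : c * (p + t + 110) = c * p + c * (t + 10) + c * 100 := by ring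
  omega

/-- With width at most `(A + 1) n`, a matrix has at most `(A + 2)² n²` entries. As the circuit is
not empty, constants and fixed overhead are absorbed by the number of gates. -/
theorem times_le {A N : ℕ} (hn : 1 ≤ n) (hm : 1 ≤ C.length) (hN : N ≤ (A + 1) * n) :
    preludeTime C N + termTime f C N + 110 ≤ 120000 * (A + 2) ^ 2 * C.cost f := by
  have h1 := sq_width_le hn hN
  unfold preludeTime termTime Circuit.cost
  have h2 : 1 ≤ (N + 1) * (N + 1) := Nat.mul_pos (Nat.succ_pos _) (Nat.succ_pos _)
  generalize (N + 1) * (N + 1) = S at *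
  generalize C.highGates.length * C.mu f = g at *
  generalize C.length = m at *
  have h3 : S * (m + g) ≤ (A + 2) ^ 2 * n ^ 2 * (m + g) := Nat.mul_le_mul_right _ h1
  have h4 : S ≤ S * (m + g) := Nat.le_mul_of_pos_right _ (by omega)
  have h5 : S * m ≤ S * (m + g) := Nat.mul_le_mul_left _ (by omega)
  calc 500 * S * (1 + m) + 55000 * S * (1 + (m + g)) + 110
      = 55500 * S + 500 * (S * m) + 55000 * (S * (m + g)) + 110 := by ring
    _ ≤ 120000 * (S * (m + g)) := by omega
    _ ≤ 120000 * ((A + 2) ^ 2 * n ^ 2 * (m + g)) := Nat.mul_le_mul_left _ h3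
    _ = _ := by ring

theorem space_le {A N : ℕ} {E : Env} (hn : 1 ≤ n) (hN : N ≤ (A + 1) * n)
    (h : ∀ U ∈ C.highGates, 0 < (f U).rank) (hV : E.V = wordBound f C N 0)
    (hsp : E.spD = 3 * Nat.log 2 (C.chi f)) (hlen : E.len = (N + 1) * (N + 1)) :
    E.space ≤ 5000 * (A + 2) ^ 2 * (Nat.log 2 (C.chi f) + n ^ 2) := by
  have h1 := sq_width_le hn hN
  have h2 := wordBound_size_le (N := N) h
  rw [Env.space, hV, hsp, hlen]
  have h3 : 1 ≤ (A + 2) ^ 2 := Nat.one_le_pow _ _ (by omega)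
  have h4 : 1 ≤ n ^ 2 := Nat.one_le_pow _ _ hn
  generalize Nat.log 2 (C.chi f) = l at *
  generalize (wordBound f C N 0).size = s at *
  have h5 : l ≤ (A + 2) ^ 2 * l := Nat.le_mul_of_pos_left _ h3
  have h6 : 1 ≤ (A + 2) ^ 2 * n ^ 2 := Nat.mul_pos h3 h4
  rw [mul_assoc, Nat.mul_add ((A + 2) ^ 2)]
  generalize (A + 2) ^ 2 * l = a at *
  generalize (A + 2) ^ 2 * n ^ 2 = b at *
  generalize (N + 1) * (N + 1) = S at *
  omega

theorem Computes.mono {a : Arch} {c : Code a} {w : ℕ} {inp : Tree} {y : ℂ} {T T' S S' : ℕ}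
    (H : Computes c w inp y T S) (hT : T ≤ T') (hS : S ≤ S') : Computes c w inp y T' S' := by
  obtain ⟨τ, t, s, h1, h2, h3, h4⟩ := H
  exact ⟨τ, t, s, h1, h2, h3.trans hT, h4.trans hS⟩

theorem ParComputes.mono {a : Arch} {p : Par a} {P w : ℕ} {inp : Tree} {y : ℂ} {T T' : ℕ}
    (H : ParComputes p P w inp y T) (hT : T ≤ T') : ParComputes p P w inp y T' := by
  obtain ⟨hP, τ, t, h1, h2, h3⟩ := H
  exact ⟨hP, τ, t, h1, h2, h3.trans hT⟩

end QSim

/-! ### Choice of the programs and the constant -/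

open QSim in
theorem theorem1 :
    ∃ (a : QSim.Arch) (seqProg : QSim.Code a) (parProg : QSim.Par a),
      ∀ A : ℕ, ∃ K : ℕ, ∀ (n : ℕ) (f : QSim.Unitary n → QSim.Impl n) (C : QSim.Circuit n)
        (x : Fin n → Bool),
        1 ≤ n → 1 ≤ C.length →
        (∀ U ∈ C.highGates, (f U).Implements U ∧ (f U).anc ≤ A * n) →
        -- one thread: time and work space
        (∀ w : ℕ, K * (1 + Nat.log 2 (QSim.inputTree f C x).size) ≤ w →
          QSim.Computes seqProg w (QSim.inputTree f C x) (C.prob x : ℂ)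
            (K * (C.chi f * C.cost f)) (K * (Nat.log 2 (C.chi f) + n ^ 2))) ∧
        -- `χ` threads: parallel time
        (∀ w : ℕ, K * (1 + Nat.log 2 ((QSim.inputTree f C x).size * C.chi f)) ≤ w →
          QSim.ParComputes parProg (C.chi f) w (QSim.inputTree f C x) (C.prob x : ℂ)
            (K * (Nat.log 2 (C.chi f) + C.cost f)) ∧
          ((∀ U ∈ C.highGates, (f U).rank ≤ 2 ^ (A * n)) →
            QSim.ParComputes parProg (C.chi f) w (QSim.inputTree f C x) (C.prob x : ℂ)
              (K * C.cost f))) := by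
  -- The factor `120000 * (A + 2) ^ 2` covers time, space and word length. The additional factor `A
  -- + 1` is for the last claim, where `log χ ≤ A * cost` is absorbed.
  refine ⟨arch, seqProg, parProg, fun A => ⟨120000 * (A + 2) ^ 2 * (A + 1), ?_⟩⟩
  intro n f C x hn hm hC
  set K₀ := 120000 * (A + 2) ^ 2 with hK₀
  have hpos : ∀ U ∈ C.highGates, 0 < (f U).rank := fun U hU => rank_pos (hC U hU).1
  have hchi := chi_pos hpos
  obtain ⟨N, hN⟩ : ∃ N, N = max n (maxWidth f C) := ⟨_, rfl⟩
  have hNA : N ≤ (A + 1) * n := by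
    rw [hN, Nat.add_mul, one_mul]
    exact max_le (by omega) (maxWidth_le fun U hU => by have := (hC U hU).2; omega)
  have hprob : ‖∑ j ∈ Finset.range (C.chi f), amplitude f C N (padded x) j‖ ^ 2 = C.prob x :=
    prob_eq_sum (by omega) fun U hU => ⟨(hC U hU).1, by have := le_maxWidth (f := f) U hU; omega⟩
  have hA : 1 ≤ (A + 2) ^ 2 := Nat.one_le_pow _ _ (by omega)
  have hK1 : K₀ ≤ K₀ * (A + 1) := Nat.le_mul_of_pos_right _ (by omega)
  have hK2 : (A + 2) ^ 2 + 104 + 2 ≤ K₀ * (A + 1) := by omega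
  have htime := times_le (f := f) hn hm hNA
  rw [← hK₀] at htime
  have hcost : ∀ {Q X w : ℕ}, (inputTree f C x).size ≤ X → Q ≤ X →
      K₀ * (A + 1) * (1 + Nat.log 2 X) ≤ w → wordBound f C N Q < 2 ^ w := fun hX hQ hw =>
    lt_two_pow_of_le (wordBound_le hn hNA hX hQ hpos) ((Nat.mul_le_mul_right _ hK2).trans hw)
  have h100 : ∀ Q, 100 ≤ wordBound f C N Q := fun Q => by unfold wordBound; omega
  refine ⟨fun w hw => ?_, fun w hw => ?_⟩
  -- No room for `χ` is reserved in the words here, as the sequential program stores the number of a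
  -- term only digit by digit.
  · set E : Env := ⟨w, inputTree f C x, wordBound f C N 0, (N + 1) * (N + 1),
      3 * Nat.log 2 (C.chi f), hcost le_rfl (Nat.zero_le _) hw, h100 0⟩ with hE
    have H := seqProg_computes (E := E) (x := x) (suits hpos hN rfl rfl rfl) rfl hchi
    rw [hprob] at H
    refine H.mono ?_ ((space_le hn hNA hpos rfl rfl rfl).trans ?_)
    · calc preludeTime C N + C.chi f * (termTime f C N + 10) + 10
          ≤ C.chi f * (preludeTime C N + termTime f C N + 110) :=
            loop_le hchi _ _
        _ ≤ C.chi f * (K₀ * C.cost f) := Nat.mul_le_mul_left _ htime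
        _ = K₀ * (C.chi f * C.cost f) := by ring
        _ ≤ _ := Nat.mul_le_mul_right _ hK1
    · exact Nat.mul_le_mul_right _ (by omega)
  -- Thread numbers and strides do have to fit into words, so the bound includes `2χ`; this is why
  -- the word length may depend on the number of threads.
  · set E : Env := ⟨w, inputTree f C x, wordBound f C N (C.chi f), (N + 1) * (N + 1),
      3 * Nat.log 2 (C.chi f), hcost (Nat.le_mul_of_pos_right _ hchi)
        (Nat.le_mul_of_pos_left _ (Tree.size_pos _)) hw, h100 _⟩ with hE
    have H := parProg_computes (E := E) (x := x) (suits hpos hN rfl rfl rfl) rfl hchi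
      (by simp only [hE, wordBound]; omega)
    rw [hprob] at H
    have hT : preludeTime C N + termTime f C N + 50 * Nat.log 2 (C.chi f) + 100 ≤
        K₀ * (Nat.log 2 (C.chi f) + C.cost f) := by
      have : 50 * Nat.log 2 (C.chi f) ≤ K₀ * Nat.log 2 (C.chi f) :=
        Nat.mul_le_mul_right _ (by omega)
      rw [Nat.mul_add]; omega
    refine ⟨H.mono (hT.trans (Nat.mul_le_mul_right _ hK1)), fun hr => H.mono (hT.trans ?_)⟩
    -- Each gate contributes at most `A n` to the logarithm, and `n t ≤ n² m` because the further
    -- gates are among the `m` gates.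
    have h1 : Nat.log 2 (C.chi f) ≤ A * C.cost f := by
      refine (log_chi_le hr).trans ?_
      unfold Circuit.cost
      have h2 := length_highGates_le C
      have h3 : n ≤ n ^ 2 := Nat.le_self_pow (by decide) n
      calc A * n * C.highGates.length ≤ A * n ^ 2 * (C.length + C.highGates.length * C.mu f) :=
            Nat.mul_le_mul (Nat.mul_le_mul_left _ h3) (by omega)
        _ = _ := by ring
    calc K₀ * (Nat.log 2 (C.chi f) + C.cost f) ≤ K₀ * (A * C.cost f + C.cost f) :=
          Nat.mul_le_mul_left _ (by omega)
      _ = _ := by ring
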